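/- Let $q,Q,T\in\mathbb C^{*}$ with $q^{m}\ne1$ and $Qq^{m}\neq 1$ for all integers $m\ge1$, and $Tq^{m}\ne 1$ for all integers $m\ge 0$. For $n\ge0$ consider the (Chen–Griffin) recurrence for the deformed $q$-Laguerre weight $$(x_ny_n-1)(x_{n-1}y_n-1)=q^{2n}Q\,T\,\frac{(y_n-1)(y_n-1/T)}{q^n-y_n},\qquad (x_ny_n-1)(x_ny_{n+1}-1)=-q^{2n+1}Q\,\frac{(x_n-1)(x_n-T)}{x_n}.$$ **Notation.** For a blowup of $\mathbb P^1\times\mathbb P^1$ (coordinates $z_0,z_1$) at eight points, possibly infinitely near, $\mathrm{Pic}$ has the basis $\mathcal H_0,\mathcal H_1,\mathcal E_1,\dots,\mathcal E_8$ (classes of the fibres of the two coordinates, and total transforms of the exceptional lines), with $\mathcal H_0\bullet\mathcal H_1=1$, $\mathcal E_i\bullet\mathcal E_i=-1$ and all other products $0$; $\delta=-\mathcal K=2\mathcal H_0+2\mathcal H_1-\sum\mathcal E_i$, and $\mathcal E_{i\cdots j}=\mathcal E_i+\cdots+\mathcal E_j$. A Sakai surface of type $A_5^{(1)}$ is such a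 blowup with exactly one effective anticanonical divisor, which is a sum of six irreducible $(-2)$-curves intersecting according to the affine Dynkin diagram $A_5^{(1)}$. Root variables are $a=(a_0,\dots,a_4)\in(\mathbb C^*)^5$ with $a_0a_1a_2=a_3a_4=:q$. The *(b)-model* $\mathcal X^b_a$ is the blowup in coordinates $(f,g)$ at $p_1(\infty,1)$, $p_2(\infty,\infty)\leftarrow p_3(f/g=-a_4/a_0)$, $p_4(1,\infty)$, $p_5(0,1/a_2)$, $p_6(0,0)\leftarrow p_7(g/f=-1/a_4)$, $p_8(a_1,0)$. Its symmetry roots $\alpha_0=\mathcal H_f+\mathcal H_g-\mathcal E_{2367}$, $\alpha_1=\mathcal H_f-\mathcal E_{48}$, $\alpha_2=\mathcal H_g-\mathcal E_{15}$, $\alpha_3=\mathcal H_f+\mathcal H_g-\mathcal E_{2358}$, $\alpha_4=\mathcal H_f+\mathcal H_g-\mathcal E_{1467}$ form a root basis of type $E_3^{(1)}=(A_2+A_1)^{(1)}$, orthogonal to the surface roots $\mathcal H_f-\mathcal E_{12}$, $\mathcal E_2-\mathcal E_3$, $\mathcal H_g-\mathcal E_{24}$, $\mathcal H_f-\mathcal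 E_{56}$, $\mathcal E_6-\mathcal E_7$, $\mathcal H_g-\mathcal E_{68}$. $\widetilde W(E_3^{(1)})$ is the extended affine Weyl group generated by the reflections $w_i$ in the $\alpha_i$ and the Dynkin diagram automorphisms $\sigma_0=(\alpha_0\alpha_2)(\alpha_3\alpha_4)$, $\sigma_1=(\alpha_1\alpha_2)$; it acts on $\mathrm{Pic}$ and, by the standard birational representation, on the family $\mathcal X_a^b$. The *(a)-model* is the blowup at $p_1(\infty,0)\leftarrow p_8(fg=-a_1a_4/a_0)$, $p_2(\infty,\infty)\leftarrow p_3(f/g=-1)$, $p_4(1,\infty)$, $p_5(0,\frac{a_4}{a_0a_2})$, $p_6(0,\frac{a_4}{a_0})$, $p_7(a_4,0)$; it is isomorphic to the (b)-model (for $a_2\ne1$) by $(f,g)\mapsto\big(\frac{f(g-1)}{g},\frac{a_4}{a_0}g\big)$, with matching symmetry and surface roots. **Standard mappings.** Let $\sigma_2=\sigma_1\circ\sigma_0$, $\phi=\sigma_2^4\circ w_0\circ w_2$ and $\psi=w_4\circ\sigma_2^3$. On $\alpha=\langle\alpha_0,\alpha_1,\alpha_2;\alpha_3,\alpha_4\rangle$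 they act as translations, $\phi_*(\alpha)=\alpha+\langle0,1,-1;0,0\rangle\delta$ and $\psi_*(\alpha)=\alpha+\langle0,0,0;-1,1\rangle\delta$. The birational map $\phi$ is the standard $q$-$\mathrm P_{\mathrm{III}}$ mapping in the (b)-model: $\bar a=(a_0,a_1/q,qa_2,a_3,a_4)$, $$f\bar f=-\frac{a_4}{a_0}\frac{g(g-1/a_2)}{g-1},\qquad \bar g g=-\frac{\bar a_0}{\bar a_4}\frac{\bar f(\bar f-\bar a_1)}{\bar f-1};$$ $\psi$ is, in the coordinates of the (a)-model, the standard $q$-$\mathrm P_{\mathrm{IV}}$ mapping: $\bar a=(a_0,a_1,a_2,qa_3,a_4/q)$, $$f\bar f=-\frac{\big(g-\frac{a_4}{a_0a_2}\big)\big(g-\frac{a_4}{a_0}\big)}{g},\qquad \bar g g=\frac{\bar a_1\bar a_4}{\bar a_0}\,\frac{\bar f-\bar a_4}{\bar f-1}.$$ If $a_2,a_0a_2,a_3\neq1$, both are isomorphisms between (b)-model surfaces $\mathcal X^b_a\to\mathcal X^b_{\bar a}$ that induce $\phi_*$, $\psi_*$ on $\mathrm{Pic}$. The (b)-model surfaces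 with $q\ne1$, and the (a)-model surfaces with $q\neq 1$, $a_2\ne1$, are Sakai surfaces of type $A_5^{(1)}$. **Theorem.** 1. The recurrence determines a unique birational map $\varphi^{(n)}:(x_n,y_n)\mapsto(x_{n+1},y_{n+1})$ for each $n\geq 0$. Let $\mathcal X_n$ be the blowup of $\mathbb P^1\times\mathbb P^1$ at $q_1(1,1)$, $q_2(T,1/T)$, $q_3(0,\infty)\leftarrow q_4(\frac1{xy}=0)\leftarrow q_5\big(\frac1{x^2y}=\frac{q^{-2n-1}}{QT}\big)$, $q_6(\infty,0)\leftarrow q_7(xy=1-q^nQ)$, $q_8(\infty,q^n)$. Then $\mathcal X_n$ is a Sakai surface of type $A_5^{(1)}$ and $\varphi^{(n)}$ is an isomorphism $\mathcal X_n\to\mathcal X_{n+1}$. 2. The change of coordinates $$f=\frac{x_n-T}{T(x_ny_n-1)},\qquad g=-q^nQ\,\frac{x_n-T}{x_n(x_ny_n-1)}$$ is an isomorphism from $\mathcal X_n$ to the (b)-model surface with root variables $a_0=T$, $a_1=\frac1{q^nT}$, $a_2=q^{n+1}$, $a_3=q^{n+1}Q$, $a_4=\frac1{q^nQ}$. It sends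 the classes $\mathcal H_x,\mathcal H_y,\mathcal F_1,\dots,\mathcal F_8$ of $\mathcal X_n$ to $\mathcal H_f+\mathcal H_g-\mathcal E_{26}$, $2\mathcal H_f+\mathcal H_g-\mathcal E_{2467}$, $\mathcal E_3$, $\mathcal H_f+\mathcal H_g-\mathcal E_{267}$, $\mathcal H_f+\mathcal H_g-\mathcal E_{246}$, $\mathcal H_f-\mathcal E_6$, $\mathcal E_5$, $\mathcal H_f-\mathcal E_2$, $\mathcal E_1$, $\mathcal E_8$. 3. With respect to this identification, $\varphi^{(n)}_*$ is the element $\psi_*\phi_*=\phi_*\psi_*=(\sigma_1\sigma_0w_3w_0w_2)_*$ of $\widetilde W(E_3^{(1)})$, the translation $[01\bar1\bar11]$: $\varphi_*(\alpha)=\alpha+\langle0,1,-1;-1,1\rangle\delta$. 4. In the coordinates $(f,g)$ the recurrence is the composition $\psi\circ\phi=\phi\circ\psi$ (an equality of birational maps for all root variables) of the $q$-$\mathrm P_{\mathrm{IV}}$ and the $q$-$\mathrm P_{\mathrm{III}}$ mapping. 5. It is conjugate to neither factor: no invertible linear map of $\mathrm{Pic}\otimes\mathbb C$ conjugates $\psi_*\phi_*$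 to $\phi_*$ or to $\psi_*$. -/

import Mathlib

noncomputable section

namespace SakaiA5

/-! ## Rational surfaces as sets of local rings

Everything lives inside the field `KK` of rational functions in two variables.  A smooth projective
rational surface is given by the set of the local rings of its closed points, as subrings of `KK`. -/

/-- The field of rational functions `ℂ(z₀, z₁)`. -/
abbrev KK : Type := FractionRing (MvPolynomial (Fin 2) ℂ)

/-- The coordinate functions `z₀`, `z₁` (called `x, y` or `f, g`). -/
def coord (i : Fin 2) : KK := algebraMap (MvPolynomial (Fin 2) ℂ) KK (MvPolynomial.X i)

/-- Complex constants. -/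
def cst (c : ℂ) : KK := algebraMap ℂ KK c

/-- The local ring of the point `u = v = 0` in a chart with coordinates `u, v`:
all `P(u,v) / Q(u,v)` with polynomials `P, Q` and `Q(0,0) ≠ 0`. -/
def ptRing (u v : KK) : Subring KK where
  carrier := {h | ∃ P Q : MvPolynomial (Fin 2) ℂ, MvPolynomial.constantCoeff Q ≠ 0 ∧
    MvPolynomial.aeval ![u, v] Q ≠ 0 ∧
    h = MvPolynomial.aeval ![u, v] P / MvPolynomial.aeval ![u, v] Q}
  mul_mem' := by
    rintro a b ⟨P, Q, hQ, hQ', rfl⟩ ⟨P₂, Q₂, hQ₂, hQ₂', rfl⟩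
    refine ⟨P * P₂, Q * Q₂, ?_, ?_, ?_⟩
    · rw [map_mul]; exact mul_ne_zero hQ hQ₂
    · rw [map_mul]; exact mul_ne_zero hQ' hQ₂'
    · rw [map_mul, map_mul, div_mul_div_comm]
  one_mem' := ⟨1, 1, by simp, by simp, by simp⟩
  add_mem' := by
    rintro a b ⟨P, Q, hQ, hQ', rfl⟩ ⟨P₂, Q₂, hQ₂, hQ₂', rfl⟩
    refine ⟨P * Q₂ + Q * P₂, Q * Q₂, ?_, ?_, ?_⟩
    · rw [map_mul]; exact mul_ne_zero hQ hQ₂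
    · rw [map_mul]; exact mul_ne_zero hQ' hQ₂'
    · rw [map_add, map_mul, map_mul, map_mul, div_add_div _ _ hQ' hQ₂']
  zero_mem' := ⟨0, 1, by simp, by simp, by simp⟩
  neg_mem' := by
    rintro a ⟨P, Q, hQ, hQ', rfl⟩
    exact ⟨-P, Q, hQ, hQ', by rw [map_neg]; ring⟩

/-- The local ring of the generic point of the curve `u = 0` in a chart with coordinates `u, w`:
all `P(u,w) / Q(u,w)` with polynomials `P, Q` and `Q` not divisible by `u`. -/
def crvRing (u w : KK) : Set KK :=
  {h | ∃ P Q : MvPolynomial (Fin 2) ℂ, ¬ (MvPolynomial.X 0 ∣ Q) ∧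
    MvPolynomial.aeval ![u, w] Q ≠ 0 ∧
    h = MvPolynomial.aeval ![u, w] P / MvPolynomial.aeval ![u, w] Q}

/-- The local parameters `h - c` (`c ∈ ℂ`) and `1/h` at the points of the projective line with
affine coordinate `h`. -/
def lineParams (h : KK) : Set KK := {s | (∃ c : ℂ, s = h - cst c) ∨ s = h⁻¹}

/-- `ℙ¹ × ℙ¹` with the affine coordinates `z₀, z₁`. -/
def P1P1 : Set (Subring KK) :=
  {R | ∃ s ∈ lineParams (coord 0), ∃ t ∈ lineParams (coord 1), R = ptRing s t}

/-- Blowing up the closed point with local coordinates `u, v`: the point is replaced by the points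
of the exceptional line, i.e. `v/u = c` (`c ∈ ℂ`) in the chart `(u, v/u)` and `u/v = 0` in the
chart `(u/v, v)`. -/
def blowUp (S : Set (Subring KK)) (p : KK × KK) : Set (Subring KK) :=
  (S \ {ptRing p.1 p.2}) ∪ {R | ∃ c : ℂ, R = ptRing p.1 (p.2 / p.1 - cst c)}
    ∪ {ptRing (p.1 / p.2) p.2}

/-- Eight points, blown up one after another.  `loc i` are local coordinates vanishing at the
`i`-th point, on the surface obtained by blowing up the previous points.
`next i = some j` says that the `j`-th point is infinitely near to the `i`-th one
(it lies on the `i`-th exceptional line). -/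
structure PointConfig where
  loc : Fin 8 → KK × KK
  next : Fin 8 → Option (Fin 8)

/-- The blowup of `ℙ¹ × ℙ¹` at the eight points. -/
def PointConfig.surface (C : PointConfig) : Set (Subring KK) :=
  (List.ofFn C.loc).foldl blowUp P1P1

/-! ## Divisors and the Picard group -/

/-- Irreducible curves on the surface `S`, through their local rings: the localizations of the
(two-dimensional regular) local rings of closed points at primes of height one. -/
def IsPrimeDivisor (S : Set (Subring KK)) (V : Subring KK) : Prop :=
  ∃ R ∈ S, ∃ p : Ideal R, p.IsPrime ∧ p ≠ ⊥ ∧ ¬ p.IsMaximal ∧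
    ∀ h : KK, h ∈ V ↔ ∃ a b : R, b ∉ p ∧ h = (a : KK) / (b : KK)

/-- The irreducible curves on `S`. -/
abbrev PrimeDiv (S : Set (Subring KK)) : Type := {V : Subring KK // IsPrimeDivisor S V}

/-- The order of vanishing of `h` along the curve with local ring `V` is `k`. -/
def HasOrder (V : Subring KK) (h : KK) (k : ℤ) : Prop :=
  ∃ t w : V, Irreducible t ∧ IsUnit w ∧ h = (w : KK) * (t : KK) ^ k

/-- The group of principal divisors. -/
def principal (S : Set (Subring KK)) : AddSubgroup (PrimeDiv S →₀ ℤ) :=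
  AddSubgroup.closure {D | ∃ h : KK, h ≠ 0 ∧ ∀ V : PrimeDiv S, HasOrder V.1 h (D V)}

/-- The Picard group of the smooth surface `S`: divisors modulo linear equivalence. -/
abbrev PicS (S : Set (Subring KK)) : Type := (PrimeDiv S →₀ ℤ) ⧸ principal S

/-- The class of a divisor. -/
def cls {S : Set (Subring KK)} (D : PrimeDiv S →₀ ℤ) : PicS S := QuotientAddGroup.mk D

/-- `D` is the divisor of poles of `h`. -/
def IsPolarDivisor {S : Set (Subring KK)} (h : KK) (D : PrimeDiv S →₀ ℤ) : Prop :=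
  ∀ V : PrimeDiv S, ∃ k : ℤ, HasOrder V.1 h k ∧ D V = max (-k) 0

/-- The abstract Picard lattice `ℤ¹⁰`, with basis `H₀, H₁, E₁, …, E₈`. -/
abbrev PicLat : Type := Fin 10 → ℤ

/-- The class `a H₀ + b H₁ - ∑_{i ∈ l} E_i`. -/
def dv (a b : ℤ) (l : List ℕ) : PicLat :=
  Fin.cons a (Fin.cons b fun i : Fin 8 => -(l.count (i.val + 1) : ℤ))

/-- The class `E_i`, `1 ≤ i ≤ 8`. -/
def ex (i : ℕ) : PicLat := -dv 0 0 [i]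

/-- The intersection product on the lattice: `H₀·H₁ = 1`, `E_i·E_i = -1`, all other products of
basis vectors vanish. -/
def inter (c d : PicLat) : ℤ :=
  c 0 * d 1 + c 1 * d 0 - ∑ i : Fin 8, c i.succ.succ * d i.succ.succ

/-- The anticanonical class `-K = 2 H₀ + 2 H₁ - E₁ - ⋯ - E₈`. -/
def antiK : PicLat := dv 2 2 [1, 2, 3, 4, 5, 6, 7, 8]

/-- The class of the proper transform of the `i`-th exceptional line. -/
def PointConfig.exClass (C : PointConfig) (i : Fin 8) : PicLat :=
  match C.next i with
  | none => ex (i.val + 1)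
  | some j => ex (i.val + 1) - ex (j.val + 1)

/-- The identification of `ℤ¹⁰` with the Picard group of the blowup: `H₀`, `H₁` are the
classes of the fibres of the two coordinate projections to `ℙ¹`, `E_i` is the class of the total
transform of the `i`-th exceptional line. -/
structure Marking (C : PointConfig) where
  equiv : PicLat ≃+ PicS C.surface
  fibre₀ : ∃ D, IsPolarDivisor (coord 0) D ∧ equiv (dv 1 0 []) = cls D
  fibre₁ : ∃ D, IsPolarDivisor (coord 1) D ∧ equiv (dv 0 1 []) = cls D
  exceptional : ∀ i : Fin 8, ∃ V : PrimeDiv C.surface,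
    (V.1 : Set KK) = crvRing (C.loc i).1 ((C.loc i).2 / (C.loc i).1) ∧
    equiv (C.exClass i) = cls (Finsupp.single V 1)

/-- A Sakai surface of type `A₅⁽¹⁾` with surface roots `δ₀, …, δ₅`: there is exactly one effective
anticanonical divisor, it is the sum of six irreducible curves of classes `δ₀, …, δ₅`, and
these curves are `(-2)`-curves that intersect according to the affine Dynkin diagram `A₅⁽¹⁾`. -/
def IsSakaiSurfaceA5 (C : PointConfig) (δ : Fin 6 → PicLat) : Prop :=
  (∀ i j, inter (δ i) (δ j) = if i = j then -2 else if j = i + 1 ∨ i = j + 1 then 1 else 0) ∧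
  ∑ i, δ i = antiK ∧
  ∃ m : Marking C, ∃ d : Fin 6 → PrimeDiv C.surface,
    (∀ i, m.equiv (δ i) = cls (Finsupp.single (d i) 1)) ∧
    ∀ D : PrimeDiv C.surface →₀ ℤ, (∀ V, 0 ≤ D V) → cls D = m.equiv antiK →
      D = ∑ i, Finsupp.single (d i) 1

/-- The birational map with pullback `Φ` (`Φ h` is the composition of the rational function `h` on
the target with the map) is an isomorphism from the surface of `C` to the surface of `C'`, and its
push-forward of divisor classes is `L`: closed points correspond bijectively with the same local
rings, and `L` sends the class of every irreducible curve to the class of its image. -/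
def IsMarkedIso (Φ : KK ≃ₐ[ℂ] KK) (C C' : PointConfig) (L : PicLat →ₗ[ℤ] PicLat) : Prop :=
  (fun R : Subring KK => R.map (RingHomClass.toRingHom Φ)) '' C'.surface = C.surface ∧
  ∃ (m : Marking C) (m' : Marking C'), ∀ (V : PrimeDiv C.surface) (V' : PrimeDiv C'.surface),
    V'.1.map (RingHomClass.toRingHom Φ) = V.1 →
      m'.equiv (L (m.equiv.symm (cls (Finsupp.single V 1)))) = cls (Finsupp.single V' 1)

/-! ## The extended affine Weyl group and its two actions -/

theorem inter_add_left (c c' d : PicLat) : inter (c + c') d = inter c d + inter c' d := by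
  simp only [inter, Pi.add_apply, add_mul, Finset.sum_add_distrib]; ring

theorem inter_smul_left (k : ℤ) (c d : PicLat) : inter (k • c) d = k * inter c d := by
  simp only [inter, Pi.smul_apply, smul_eq_mul, mul_assoc, ← Finset.mul_sum]; ring

/-- The reflection `c ↦ c + (c·α) α` in a class `α` with `α·α = -2`. -/
def refl (α : PicLat) (h : inter α α = -2) : PicLat ≃ₗ[ℤ] PicLat :=
  LinearEquiv.ofInvolutive
    { toFun := fun c => c + inter c α • α
      map_add' := fun c d => by rw [inter_add_left, add_smul]; abel
      map_smul' := fun k c => by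
        rw [inter_smul_left, mul_smul, RingHom.id_apply, smul_add] }
    (fun c => by
      change c + inter c α • α + inter (c + inter c α • α) α • α = c
      rw [inter_add_left, inter_smul_left, h, add_assoc, ← add_smul]
      have : inter c α + (inter c α + inter c α * -2) = 0 := by ring
      rw [this, zero_smul, add_zero])

/-- Symmetry roots `α₀, …, α₄` of the (b)-model. -/
def alphaB : Fin 5 → PicLat :=
  ![dv 1 1 [2, 3, 6, 7], dv 1 0 [4, 8], dv 0 1 [1, 5], dv 1 1 [2, 3, 5, 8], dv 1 1 [1, 4, 6, 7]]

/-- Surface roots `δ₀, …, δ₅` of the (b)-model. -/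
def deltaB : Fin 6 → PicLat :=
  ![dv 1 0 [1, 2], ex 2 - ex 3, dv 0 1 [2, 4], dv 1 0 [5, 6], ex 6 - ex 7, dv 0 1 [6, 8]]

theorem alphaB_sq (i : Fin 5) : inter (alphaB i) (alphaB i) = -2 := by
  revert i; decide

/-- Names of the generators `w₀, …, w₄, σ₀, σ₁` of the extended affine Weyl group. -/
inductive Gen : Type
  | w (i : Fin 5)
  | σ₀
  | σ₁

/-- The generators as isometries of the Picard lattice (of the (b)-model). -/
def latGen : Gen → (PicLat ≃ₗ[ℤ] PicLat)
  | .w i => refl (alphaB i) (alphaB_sq i)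
  | .σ₀ => refl (ex 5 - ex 7) (by decide) * refl (ex 4 - ex 8) (by decide) *
      refl (ex 1 - ex 3) (by decide) * refl (ex 2 - ex 6) (by decide) *
      refl (dv 1 0 [2, 6]) (by decide)
  | .σ₁ => refl (ex 5 - ex 8) (by decide) * refl (ex 1 - ex 4) (by decide) *
      refl (dv 1 (-1) []) (by decide)

/-- The extended affine Weyl group of type `E₃⁽¹⁾ = (A₂ + A₁)⁽¹⁾`, acting on the Picard lattice. -/
def extWeyl : Subgroup (PicLat ≃ₗ[ℤ] PicLat) := Subgroup.closure (Set.range latGen)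

/-- The action on the Picard lattice of a word (composition, the last letter acts first). -/
def lat (l : List Gen) : PicLat ≃ₗ[ℤ] PicLat := (l.map latGen).prod

/-- The matrix over `ℂ` of the action of a word on the complexified Picard lattice. -/
def latMatrix (l : List Gen) : Matrix (Fin 10) (Fin 10) ℂ :=
  (LinearMap.toMatrix' (lat l).toLinearMap).map (fun k : ℤ => (k : ℂ))

/-- A parameter value `a = (a₀, …, a₄)` together with a pair `(f, g)` of rational functions,
considered as a `KK`-point of the (b)-model surface with root variables `a`. -/
@[ext] structure Pt where
  a : Fin 5 → ℂ
  f : KK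
  g : KK

/-- The birational representation of the generators on the (b)-model. -/
def birGen : Gen → Pt → Pt
  | .w 0, ⟨a, f, g⟩ => ⟨![1 / a 0, a 0 * a 1, a 0 * a 2, a 3, a 4],
      f * (cst (a 0) * f + cst (a 4) * g) / (f + cst (a 4) * g),
      g * (cst (a 0) * f + cst (a 4) * g) / (cst (a 0) * (f + cst (a 4) * g))⟩
  | .w 1, ⟨a, f, g⟩ => ⟨![a 0 * a 1, 1 / a 1, a 1 * a 2, a 3, a 4],
      f / cst (a 1), (f - 1) * g / (f - cst (a 1))⟩
  | .w 2, ⟨a, f, g⟩ => ⟨![a 0 * a 2, a 1 * a 2, 1 / a 2, a 3, a 4],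
      cst (a 2) * f * (g - 1) / (cst (a 2) * g - 1), cst (a 2) * g⟩
  | .w 3, ⟨a, f, g⟩ => ⟨![a 0, a 1, a 2, 1 / a 3, a 3 ^ 2 * a 4],
      cst (a 1) * cst (a 2) * f * (cst (a 0) * (f - cst (a 1)) + cst (a 4) * g) /
        (cst (a 4) * (f + cst (a 1) * (cst (a 2) * g - 1))),
      g * (cst (a 0) * cst (a 2) * f + cst (a 4) * (cst (a 2) * g - 1)) /
        (cst (a 0) * cst (a 2) * (f + cst (a 1) * (cst (a 2) * g - 1)))⟩
  | .w 4, ⟨a, f, g⟩ => ⟨![a 0, a 1, a 2, a 3 * a 4 ^ 2, 1 / a 4],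
      f * (f + g - f * g) / (f - cst (a 4) * (f - 1) * g),
      cst (a 4) * g * (f * g - f - g) / (f * (g - 1) - cst (a 4) * g)⟩
  | .σ₀, ⟨a, f, g⟩ => ⟨![1 / a 2, 1 / a 1, 1 / a 0, 1 / a 4, 1 / a 3],
      f / cst (a 1), -(cst (a 0) * f) / (cst (a 4) * g)⟩
  | .σ₁, ⟨a, f, g⟩ => ⟨![1 / a 0, 1 / a 2, 1 / a 1, 1 / a 3, 1 / a 4], g, f⟩

/-- The birational action of a word (composition, the last letter acts first). -/
def bir (l : List Gen) (p : Pt) : Pt := l.foldr birGen p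

/-- `σ₂ = σ₁ ∘ σ₀`. -/
def sigma₂ : List Gen := [.σ₁, .σ₀]

/-- `φ = σ₂⁴ ∘ w₀ ∘ w₂`. -/
def phiW : List Gen := sigma₂ ++ sigma₂ ++ sigma₂ ++ sigma₂ ++ [.w 0, .w 2]

/-- `ψ = w₄ ∘ σ₂³`. -/
def psiW : List Gen := [.w 4] ++ sigma₂ ++ sigma₂ ++ sigma₂

/-- `σ₁ ∘ σ₀ ∘ w₃ ∘ w₀ ∘ w₂`. -/
def lagW : List Gen := [.σ₁, .σ₀, .w 3, .w 0, .w 2]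

/-! ## The three families of point configurations -/

/-- Root variables: nonzero, with `a₀ a₁ a₂ = a₃ a₄`. -/
def IsRootVars (a : Fin 5 → ℂ) : Prop :=
  (∀ i, a i ≠ 0) ∧ a 0 * a 1 * a 2 = a 3 * a 4

/-- The generic point `(f, g) = (z₀, z₁)` of the surface with root variables `a`. -/
def genPt (a : Fin 5 → ℂ) : Pt := ⟨a, coord 0, coord 1⟩

/-- The (b)-model with root variables `a`. -/
def confB (a : Fin 5 → ℂ) : PointConfig :=
  let f := coord 0
  let g := coord 1
  { loc := ![(f⁻¹, g - 1), (f⁻¹, g⁻¹), (f⁻¹, f / g + cst (a 4 / a 0)), (g⁻¹, f - 1),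
      (f, g - cst (1 / a 2)), (f, g), (f, g / f + cst (1 / a 4)), (g, f - cst (a 1))]
    next := ![none, some 2, none, none, none, some 6, none, none] }

/-- The (a)-model with root variables `a`. -/
def confA (a : Fin 5 → ℂ) : PointConfig :=
  let f := coord 0
  let g := coord 1
  { loc := ![(f⁻¹, g), (f⁻¹, g⁻¹), (f⁻¹, f / g + 1), (g⁻¹, f - 1),
      (f, g - cst (a 4 / (a 0 * a 2))), (f, g - cst (a 4 / a 0)), (g, f - cst (a 4)),
      (f⁻¹, f * g + cst (a 1 * a 4 / a 0))]
    next := ![some 7, some 2, none, none, none, none, none, none] }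

/-- Symmetry roots of the (a)-model. -/
def alphaA : Fin 5 → PicLat :=
  ![dv 1 1 [2, 3, 6, 7], dv 1 1 [1, 4, 6, 8], ex 6 - ex 5, dv 1 2 [1, 2, 3, 5, 6, 8],
    dv 1 0 [4, 7]]

/-- Surface roots of the (a)-model. -/
def deltaA : Fin 6 → PicLat :=
  ![dv 1 0 [1, 2], ex 2 - ex 3, dv 0 1 [2, 4], dv 1 0 [5, 6], dv 0 1 [1, 7], ex 1 - ex 8]

/-- The points blown up for the `q`-Laguerre recurrence. -/
def confX (q Q T : ℂ) (n : ℕ) : PointConfig :=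
  let x := coord 0
  let y := coord 1
  { loc := ![(x - 1, y - 1), (x - cst T, y - cst (1 / T)), (x, y⁻¹), (x, 1 / (x * y)),
      (x, 1 / (x ^ 2 * y) - cst (1 / (q ^ (2 * n + 1) * Q * T))), (x⁻¹, y),
      (x⁻¹, x * y - cst (1 - q ^ n * Q)), (x⁻¹, y - cst (q ^ n))]
    next := ![none, none, some 3, some 4, none, some 6, none, none] }

/-- Symmetry roots of the `q`-Laguerre surface. -/
def alphaX : Fin 5 → PicLat :=
  ![ex 2 - ex 1, dv 0 1 [2, 8], dv 2 1 [2, 3, 4, 5, 6, 7], dv 2 1 [1, 2, 3, 4, 5, 8],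
    dv 0 1 [6, 7]]

/-- Surface roots of the `q`-Laguerre surface. -/
def deltaX : Fin 6 → PicLat :=
  ![ex 6 - ex 7, dv 1 1 [1, 2, 3, 6], ex 3 - ex 4, ex 4 - ex 5, dv 0 1 [3, 4], dv 1 0 [6, 8]]

/-- The linear map sending the basis `H₀, H₁, E₁, …, E₈` to the given ten vectors. -/
def ofImages (v : Fin 10 → PicLat) : PicLat →ₗ[ℤ] PicLat := Matrix.vecMulLinear (Matrix.of v)

/-- The change of basis from the `q`-Laguerre surface to the (b)-model. -/
def toB : PicLat →ₗ[ℤ] PicLat :=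
  ofImages ![dv 1 1 [2, 6], dv 2 1 [2, 4, 6, 7], ex 3, dv 1 1 [2, 6, 7], dv 1 1 [2, 4, 6],
    dv 1 0 [6], ex 5, dv 1 0 [2], ex 1, ex 8]

/-- The change of basis from the (b)-model to the (a)-model. -/
def BtoA : PicLat →ₗ[ℤ] PicLat :=
  ofImages ![dv 1 1 [1, 6], dv 0 1 [], dv 0 1 [6], ex 2, ex 3, ex 4, ex 5, dv 0 1 [1], ex 7, ex 8]

/-! ## The recurrence, the standard equations and the changes of coordinates -/

/-- `Φ` is the pullback of a birational map `(x_n, y_n) ↦ (x_{n+1}, y_{n+1})` that solves the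
`q`-Laguerre recurrence
`(x_n y_n - 1)(x_n y_{n+1} - 1) = - q^{2n+1} Q (x_n - 1)(x_n - T) / x_n`,
`(x_{n+1} y_{n+1} - 1)(x_n y_{n+1} - 1)
  = q^{2(n+1)} Q T (y_{n+1} - 1)(y_{n+1} - 1/T) / (q^{n+1} - y_{n+1})`. -/
def IsLaguerreStep (q Q T : ℂ) (n : ℕ) (Φ : KK ≃ₐ[ℂ] KK) : Prop :=
  let x := coord 0
  let y := coord 1
  let x' := Φ x
  let y' := Φ y
  (x * y - 1) * (x * y' - 1) = -cst (q ^ (2 * n + 1) * Q) * ((x - 1) * (x - cst T) / x) ∧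
  (x' * y' - 1) * (x * y' - 1) =
    cst (q ^ (2 * (n + 1)) * Q * T) * ((y' - 1) * (y' - cst (1 / T)) / (cst (q ^ (n + 1)) - y'))

/-- The root variables of the `q`-Laguerre surface. -/
def rootX (q Q T : ℂ) (n : ℕ) : Fin 5 → ℂ :=
  ![T, 1 / (q ^ n * T), q ^ (n + 1), q ^ (n + 1) * Q, 1 / (q ^ n * Q)]

/-- The coordinate `f` of the (b)-model as a function of `x, y`. -/
def fX (T : ℂ) : KK :=
  (coord 0 - cst T) / (cst T * (coord 0 * coord 1 - 1))

/-- The coordinate `g` of the (b)-model as a function of `x, y`. -/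
def gX (q Q T : ℂ) (n : ℕ) : KK :=
  -cst (q ^ n * Q) * ((coord 0 - cst T) / (coord 0 * (coord 0 * coord 1 - 1)))

/-- The `q`-P_III equation on the (b)-model, relating `p = (a; f, g)` to its image
`p' = (a'; f', g')`, with `q = a₀ a₁ a₂`. -/
def QPIII (p p' : Pt) : Prop :=
  p'.a = ![p.a 0, p.a 1 / (p.a 0 * p.a 1 * p.a 2), p.a 0 * p.a 1 * p.a 2 * p.a 2, p.a 3, p.a 4] ∧
  p.f * p'.f = -cst (p.a 4 / p.a 0) * (p.g * (p.g - cst (1 / p.a 2)) / (p.g - 1)) ∧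
  p'.g * p.g = -cst (p'.a 0 / p'.a 4) * (p'.f * (p'.f - cst (p'.a 1)) / (p'.f - 1))

/-- The `q`-P_IV equation on the (a)-model, relating `p = (a; f, g)` to its image
`p' = (a'; f', g')`, with `q = a₀ a₁ a₂`. -/
def QPIV (p p' : Pt) : Prop :=
  p'.a = ![p.a 0, p.a 1, p.a 2, p.a 0 * p.a 1 * p.a 2 * p.a 3, p.a 4 / (p.a 0 * p.a 1 * p.a 2)] ∧
  p.f * p'.f = -((p.g - cst (p.a 4 / (p.a 0 * p.a 2))) * (p.g - cst (p.a 4 / p.a 0)) / p.g) ∧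
  p'.g * p.g = cst (p'.a 1 * p'.a 4 / p'.a 0) * ((p'.f - cst (p'.a 4)) / (p'.f - 1))

/-- The birational change of coordinates from the (b)-model to the (a)-model. -/
def changeBA (p : Pt) : Pt := ⟨p.a, p.f * (p.g - 1) / p.g, cst (p.a 4 / p.a 0) * p.g⟩

end SakaiA5

end

open SakaiA5

noncomputable section

namespace SakaiA5

open MvPolynomial

/-- The polynomial ring `ℂ[z₀, z₁]`. -/
abbrev Poly : Type := MvPolynomial (Fin 2) ℂ

/-- `u, v` are the images of the coordinates under an automorphism of the function field. -/
def IsChart (u v : KK) : Prop := ∃ θ : KK ≃ₐ[ℂ] KK, θ (coord 0) = u ∧ θ (coord 1) = v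

theorem isChart_coord : IsChart (coord 0) (coord 1) := ⟨AlgEquiv.refl, rfl, rfl⟩

theorem IsChart.map {u v : KK} (h : IsChart u v) (θ : KK ≃ₐ[ℂ] KK) : IsChart (θ u) (θ v) := by
  obtain ⟨η, rfl, rfl⟩ := h
  exact ⟨η.trans θ, rfl, rfl⟩

theorem aeval_coord (P : Poly) : aeval ![coord 0, coord 1] P = algebraMap Poly KK P := by
  have : (aeval ![coord 0, coord 1] : Poly →ₐ[ℂ] KK) = IsScalarTower.toAlgHom ℂ Poly KK := by
    ext i
    fin_cases i <;> simp [coord]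
  rw [this]; rfl

theorem map_aeval (θ : KK ≃ₐ[ℂ] KK) (u v : KK) (P : Poly) :
    θ (aeval ![u, v] P) = aeval ![θ u, θ v] P := by
  have : ((θ : KK →ₐ[ℂ] KK).comp (aeval ![u, v]) : Poly →ₐ[ℂ] KK) = aeval ![θ u, θ v] := by
    ext i
    fin_cases i <;> simp
  rw [← this]; rfl

theorem map_cst (θ : KK ≃ₐ[ℂ] KK) (c : ℂ) : θ (cst c) = cst c := θ.commutes c

@[simp] theorem cst_zero : cst 0 = 0 := map_zero _
@[simp] theorem cst_one : cst 1 = 1 := map_one _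
theorem cst_add (a b : ℂ) : cst (a + b) = cst a + cst b := map_add _ _ _
theorem cst_sub (a b : ℂ) : cst (a - b) = cst a - cst b := map_sub _ _ _
theorem cst_mul (a b : ℂ) : cst (a * b) = cst a * cst b := map_mul _ _ _
theorem cst_neg (a : ℂ) : cst (-a) = -cst a := map_neg _ _
theorem cst_inv (a : ℂ) : cst a⁻¹ = (cst a)⁻¹ := map_inv₀ _ _
theorem cst_div (a b : ℂ) : cst (a / b) = cst a / cst b := map_div₀ _ _ _
theorem cst_pow (a : ℂ) (n : ℕ) : cst (a ^ n) = cst a ^ n := map_pow _ _ _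
theorem cst_inj {a b : ℂ} : cst a = cst b ↔ a = b := (algebraMap ℂ KK).injective.eq_iff
theorem cst_eq_zero {a : ℂ} : cst a = 0 ↔ a = 0 := by rw [← cst_zero, cst_inj]
theorem cst_ne_zero {a : ℂ} (h : a ≠ 0) : cst a ≠ 0 := fun h' => h (cst_eq_zero.1 h')

theorem cst_eq_algebraMap (c : ℂ) : cst c = algebraMap Poly KK (C c) :=
  IsScalarTower.algebraMap_apply ℂ Poly KK c

theorem IsChart.aeval_inj {u v : KK} (h : IsChart u v) {P Q : Poly} :
    aeval ![u, v] P = aeval ![u, v] Q ↔ P = Q := by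
  obtain ⟨θ, rfl, rfl⟩ := h
  rw [← map_aeval, ← map_aeval, θ.injective.eq_iff, aeval_coord, aeval_coord,
    (IsFractionRing.injective Poly KK).eq_iff]

theorem IsChart.aeval_ne_zero {u v : KK} (h : IsChart u v) {P : Poly} (hP : P ≠ 0) :
    aeval ![u, v] P ≠ 0 := by
  rw [← map_zero (aeval ![u, v] : Poly →ₐ[ℂ] KK), Ne, h.aeval_inj]; exact hP

theorem exists_div (h : KK) : ∃ a b : Poly, b ≠ 0 ∧ h = algebraMap Poly KK a / algebraMap Poly KK b := by
  obtain ⟨a, b, hb, rfl⟩ := IsFractionRing.div_surjective (A := Poly) h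
  exact ⟨a, b, nonZeroDivisors.ne_zero hb, rfl⟩

theorem adjoin_coord : IntermediateField.adjoin ℂ {coord 0, coord 1} = ⊤ := by
  refine eq_top_iff.2 fun h _ => ?_
  obtain ⟨a, b, -, rfl⟩ := exists_div h
  have key : ∀ P : Poly, algebraMap Poly KK P ∈ IntermediateField.adjoin ℂ {coord 0, coord 1} := by
    intro P
    rw [← aeval_coord]
    refine IntermediateField.algebra_adjoin_le_adjoin ℂ _ ?_
    have : ({coord 0, coord 1} : Set KK) = Set.range ![coord 0, coord 1] := by
      simp [Set.pair_comm]
    rw [this, Algebra.adjoin_range_eq_range_aeval]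
    exact ⟨P, rfl⟩
  exact div_mem (key a) (key b)

theorem trdeg_functionField : Algebra.trdeg ℂ KK = 2 := by
  have h := (IsTranscendenceBasis.mvPolynomial (Fin 2) ℂ)
  have : Algebra.IsAlgebraic Poly KK := IsLocalization.isAlgebraic KK (nonZeroDivisors Poly)
  have h2 : IsTranscendenceBasis ℂ (algebraMap Poly KK ∘ (X : Fin 2 → Poly)) :=
    h.algebraMap_comp (A := KK)
  have := h2.lift_cardinalMk_eq_trdeg
  simpa using this.symm

/-- Two functions from which the coordinates can be expressed rationally are a chart. -/
theorem isChart_of_mem_adjoin {u v : KK}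
    (h₀ : coord 0 ∈ IntermediateField.adjoin ℂ {u, v})
    (h₁ : coord 1 ∈ IntermediateField.adjoin ℂ {u, v}) : IsChart u v := by
  have hr : Set.range ![u, v] = {u, v} := by simp [Set.pair_comm]
  have htop : IntermediateField.adjoin ℂ (Set.range ![u, v]) = ⊤ := by
    rw [hr, eq_top_iff, ← adjoin_coord, IntermediateField.adjoin_le_iff]
    rintro x (rfl | rfl)
    · exact h₀
    · exact h₁
  have halg : Algebra.IsAlgebraic (Algebra.adjoin ℂ (Set.range ![u, v])) KK := by
    refine ⟨fun x => ?_⟩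
    have hx : x ∈ IntermediateField.adjoin ℂ (Set.range ![u, v]) := htop ▸ trivial
    rw [IntermediateField.mem_adjoin_iff_div] at hx
    obtain ⟨r, hr, s, hs, rfl⟩ := hx
    have h1 := isAlgebraic_algebraMap (R := Algebra.adjoin ℂ (Set.range ![u, v])) (A := KK) ⟨r, hr⟩
    have h2 := isAlgebraic_algebraMap (R := Algebra.adjoin ℂ (Set.range ![u, v])) (A := KK) ⟨s, hs⟩
    rw [div_eq_mul_inv]
    exact h1.mul h2.inv
  have hb : IsTranscendenceBasis ℂ ![u, v] :=
    Algebra.IsAlgebraic.isTranscendenceBasis_of_lift_le_trdeg_of_finite ℂ _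
      (by rw [trdeg_functionField]; simp)
  let e := hb.1.aevalEquivField.trans
    ((IntermediateField.equivOfEq htop).trans IntermediateField.topEquiv)
  have he : ∀ P : Poly, e (algebraMap Poly KK P) = aeval ![u, v] P := fun P =>
    hb.1.aevalEquivField_algebraMap_apply_coe P
  exact ⟨e, by rw [coord, he]; simp, by rw [coord, he]; simp⟩

theorem IsChart.of_mem_adjoin {u v u' v' : KK} (h : IsChart u v)
    (h₀ : u ∈ IntermediateField.adjoin ℂ {u', v'})
    (h₁ : v ∈ IntermediateField.adjoin ℂ {u', v'}) : IsChart u' v' := by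
  obtain ⟨θ, rfl, rfl⟩ := h
  have hmap : IntermediateField.adjoin ℂ {θ.symm u', θ.symm v'} =
      (IntermediateField.adjoin ℂ {u', v'}).map (θ.symm : KK →ₐ[ℂ] KK) := by
    rw [IntermediateField.adjoin_map, Set.image_pair]; rfl
  have : IsChart (θ.symm u') (θ.symm v') := by
    apply isChart_of_mem_adjoin
    · rw [hmap]; exact ⟨_, h₀, θ.symm_apply_apply _⟩
    · rw [hmap]; exact ⟨_, h₁, θ.symm_apply_apply _⟩
  simpa using this.map θ

/-- Criterion for charts by a rational inverse. -/
theorem IsChart.of_forall_mem {u v u' v' : KK} (h : IsChart u v)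
    (H : ∀ F : IntermediateField ℂ KK, u' ∈ F → v' ∈ F → u ∈ F ∧ v ∈ F) : IsChart u' v' :=
  have := H _ (IntermediateField.subset_adjoin ℂ {u', v'} (by simp))
    (IntermediateField.subset_adjoin ℂ {u', v'} (by simp))
  h.of_mem_adjoin this.1 this.2

theorem cst_mem (F : IntermediateField ℂ KK) (c : ℂ) : cst c ∈ F := F.algebraMap_mem c

theorem IsChart.swap {u v : KK} (h : IsChart u v) : IsChart v u :=
  h.of_forall_mem fun _ h1 h2 => ⟨h2, h1⟩

theorem IsChart.ne_zero {u v : KK} (h : IsChart u v) : u ≠ 0 := by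
  have := h.aeval_ne_zero (P := X 0) (X_ne_zero _)
  simpa using this

theorem IsChart.sub_cst {u v : KK} (h : IsChart u v) (c : ℂ) : IsChart u (v - cst c) :=
  h.of_forall_mem fun F h1 h2 => ⟨h1, by simpa using add_mem h2 (cst_mem F c)⟩

theorem IsChart.inv {u v : KK} (h : IsChart u v) : IsChart u v⁻¹ :=
  h.of_forall_mem fun F h1 h2 => ⟨h1, by simpa using inv_mem h2⟩

theorem IsChart.div {u v : KK} (h : IsChart u v) : IsChart u (v / u) :=
  h.of_forall_mem fun F h1 h2 => ⟨h1, by simpa [h.ne_zero] using mul_mem h2 h1⟩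

/-! ### Localizations of the polynomial ring -/

/-- The localization of `ℂ[z₀, z₁]` at a prime ideal, inside the function field. -/
def locAt (P : Ideal Poly) [hP : P.IsPrime] : Subring KK where
  carrier := {h | ∃ a b : Poly, b ∉ P ∧ h = algebraMap Poly KK a / algebraMap Poly KK b}
  mul_mem' := by
    rintro _ _ ⟨a, b, hb, rfl⟩ ⟨c, d, hd, rfl⟩
    exact ⟨a * c, b * d, hP.mul_notMem hb hd, by rw [map_mul, map_mul, div_mul_div_comm]⟩
  one_mem' := ⟨1, 1, (Ideal.ne_top_iff_one P).1 hP.ne_top, by simp⟩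
  add_mem' := by
    rintro _ _ ⟨a, b, hb, rfl⟩ ⟨c, d, hd, rfl⟩
    refine ⟨a * d + b * c, b * d, hP.mul_notMem hb hd, ?_⟩
    rw [map_add, map_mul, map_mul, map_mul, div_add_div]
    · rw [Ne, FaithfulSMul.algebraMap_eq_zero_iff]
      rintro rfl; exact hb P.zero_mem
    · rw [Ne, FaithfulSMul.algebraMap_eq_zero_iff]
      rintro rfl; exact hd P.zero_mem
  zero_mem' := ⟨0, 1, (Ideal.ne_top_iff_one P).1 hP.ne_top, by simp⟩
  neg_mem' := by
    rintro _ ⟨a, b, hb, rfl⟩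
    exact ⟨-a, b, hb, by rw [map_neg]; ring⟩

theorem mem_locAt {P : Ideal Poly} [P.IsPrime] {h : KK} :
    h ∈ locAt P ↔ ∃ a b : Poly, b ∉ P ∧ h = algebraMap Poly KK a / algebraMap Poly KK b := Iff.rfl

theorem algebraMap_mem_locAt (P : Ideal Poly) [hP : P.IsPrime] (a : Poly) :
    algebraMap Poly KK a ∈ locAt P :=
  ⟨a, 1, (Ideal.ne_top_iff_one P).1 hP.ne_top, by simp⟩

/-- The ideal of polynomials vanishing at a point. -/
def ptIdeal (c : Fin 2 → ℂ) : Ideal Poly := RingHom.ker (eval c)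

theorem mem_ptIdeal {c : Fin 2 → ℂ} {P : Poly} : P ∈ ptIdeal c ↔ eval c P = 0 := Iff.rfl

instance (c : Fin 2 → ℂ) : (ptIdeal c).IsPrime := RingHom.ker_isPrime _

instance (c : Fin 2 → ℂ) : (ptIdeal c).IsMaximal :=
  RingHom.ker_isMaximal_of_surjective _ fun y => ⟨C y, by simp⟩

theorem mem_ptIdeal_zero {P : Poly} : P ∈ ptIdeal 0 ↔ constantCoeff P = 0 := by
  rw [mem_ptIdeal, eval_zero]

/-- The ideal generated by an irreducible polynomial. -/
abbrev crvIdeal (π : Poly) : Ideal Poly := Ideal.span {π}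

theorem crvIdeal_isPrime {π : Poly} (h : Irreducible π) : (crvIdeal π).IsPrime :=
  (Ideal.span_singleton_prime h.ne_zero).2 h.prime

theorem ptRing_coord : ptRing (coord 0) (coord 1) = locAt (ptIdeal 0) := by
  ext h
  constructor
  · rintro ⟨P, Q, hQ, -, rfl⟩
    exact ⟨P, Q, fun h => hQ (mem_ptIdeal_zero.1 h), by rw [aeval_coord, aeval_coord]⟩
  · rintro ⟨P, Q, hQ, rfl⟩
    refine ⟨P, Q, fun h => hQ (mem_ptIdeal_zero.2 h), ?_, by rw [aeval_coord, aeval_coord]⟩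
    exact isChart_coord.aeval_ne_zero fun h => hQ (h ▸ Ideal.zero_mem _)

/-- The image of a subring of the function field under an automorphism. -/
abbrev mapRing (θ : KK ≃ₐ[ℂ] KK) (B : Subring KK) : Subring KK := B.map (RingHomClass.toRingHom θ)

theorem mem_mapRing {θ : KK ≃ₐ[ℂ] KK} {B : Subring KK} {h : KK} :
    h ∈ mapRing θ B ↔ θ.symm h ∈ B := by
  constructor
  · rintro ⟨x, hx, rfl⟩
    simpa using hx
  · intro hx
    exact ⟨_, hx, by simp⟩

theorem apply_mem_mapRing {θ : KK ≃ₐ[ℂ] KK} {B : Subring KK} {h : KK} :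
    θ h ∈ mapRing θ B ↔ h ∈ B := by rw [mem_mapRing, AlgEquiv.symm_apply_apply]

theorem mapRing_trans (θ η : KK ≃ₐ[ℂ] KK) (B : Subring KK) :
    mapRing (θ.trans η) B = mapRing η (mapRing θ B) := by
  ext h; simp only [mem_mapRing]; rfl

theorem mapRing_refl (B : Subring KK) : mapRing AlgEquiv.refl B = B := by
  ext h; simp only [mem_mapRing]; rfl

theorem mapRing_symm_mapRing (θ : KK ≃ₐ[ℂ] KK) (B : Subring KK) :
    mapRing θ.symm (mapRing θ B) = B := by
  rw [← mapRing_trans, AlgEquiv.self_trans_symm, mapRing_refl]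

theorem mapRing_mapRing_symm (θ : KK ≃ₐ[ℂ] KK) (B : Subring KK) :
    mapRing θ (mapRing θ.symm B) = B := by
  rw [← mapRing_trans, AlgEquiv.symm_trans_self, mapRing_refl]

theorem mapRing_injective (θ : KK ≃ₐ[ℂ] KK) : Function.Injective (mapRing θ) :=
  Function.LeftInverse.injective (mapRing_symm_mapRing θ)

theorem mapRing_ptRing (θ : KK ≃ₐ[ℂ] KK) (u v : KK) :
    mapRing θ (ptRing u v) = ptRing (θ u) (θ v) := by
  ext h
  constructor
  · rintro ⟨_, ⟨P, Q, hQ, hQ', rfl⟩, rfl⟩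
    refine ⟨P, Q, hQ, ?_, ?_⟩
    · rw [← map_aeval]; simpa using hQ'
    · rw [← map_aeval, ← map_aeval]; exact map_div₀ θ _ _
  · rintro ⟨P, Q, hQ, hQ', rfl⟩
    rw [← map_aeval] at hQ'
    refine ⟨_, ⟨P, Q, hQ, by simpa using hQ', rfl⟩, ?_⟩
    rw [← map_aeval, ← map_aeval]; exact map_div₀ θ _ _

/-- The local ring `crvRing u w` as a subring. -/
def crv (u w : KK) : Subring KK where
  carrier := crvRing u w
  mul_mem' := by
    rintro a b ⟨P, Q, hQ, hQ', rfl⟩ ⟨P₂, Q₂, hQ₂, hQ₂', rfl⟩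
    refine ⟨P * P₂, Q * Q₂, fun h => ?_, ?_, ?_⟩
    · exact (X_prime.dvd_or_dvd h).elim hQ hQ₂
    · rw [map_mul]; exact mul_ne_zero hQ' hQ₂'
    · rw [map_mul, map_mul, div_mul_div_comm]
  one_mem' := ⟨1, 1, X_prime.not_dvd_one, by simp, by simp⟩
  add_mem' := by
    rintro a b ⟨P, Q, hQ, hQ', rfl⟩ ⟨P₂, Q₂, hQ₂, hQ₂', rfl⟩
    refine ⟨P * Q₂ + Q * P₂, Q * Q₂, fun h => ?_, ?_, ?_⟩
    · exact (X_prime.dvd_or_dvd h).elim hQ hQ₂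
    · rw [map_mul]; exact mul_ne_zero hQ' hQ₂'
    · rw [map_add, map_mul, map_mul, map_mul, div_add_div _ _ hQ' hQ₂']
  zero_mem' := ⟨0, 1, X_prime.not_dvd_one, by simp, by simp⟩
  neg_mem' := by
    rintro a ⟨P, Q, hQ, hQ', rfl⟩
    exact ⟨-P, Q, hQ, hQ', by rw [map_neg]; ring⟩

theorem mapRing_crv (θ : KK ≃ₐ[ℂ] KK) (u v : KK) :
    mapRing θ (crv u v) = crv (θ u) (θ v) := by
  ext h
  constructor
  · rintro ⟨_, ⟨P, Q, hQ, hQ', rfl⟩, rfl⟩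
    refine ⟨P, Q, hQ, ?_, ?_⟩
    · rw [← map_aeval]; simpa using hQ'
    · rw [← map_aeval, ← map_aeval]; exact map_div₀ θ _ _
  · rintro ⟨P, Q, hQ, hQ', rfl⟩
    rw [← map_aeval] at hQ'
    refine ⟨_, ⟨P, Q, hQ, by simpa using hQ', rfl⟩, ?_⟩
    rw [← map_aeval, ← map_aeval]; exact map_div₀ θ _ _

/-! ### Primes of `ℂ[z₀, z₁]` -/

theorem prime_eq_crvIdeal_or_ptIdeal (P : Ideal Poly) [hP : P.IsPrime] (h0 : P ≠ ⊥) :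
    (∃ π, Irreducible π ∧ P = crvIdeal π) ∨ ∃ c, P = ptIdeal c := by
  obtain ⟨π, hπP, hπ⟩ := hP.exists_mem_prime_of_ne_bot h0
  by_cases hp : P = crvIdeal π
  · exact Or.inl ⟨π, hπ.irreducible, hp⟩
  right
  suffices hmax : P.IsMaximal by
    obtain ⟨x, hx⟩ := (isMaximal_iff_eq_vanishingIdeal_singleton (I := P)).1 hmax
    refine ⟨x, hx.trans ?_⟩
    ext f
    rw [mem_vanishingIdeal_singleton_iff, mem_ptIdeal, aeval_eq_eval]
  by_contra hmax
  obtain ⟨M, hM, hPM⟩ := P.exists_le_maximal hP.ne_top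
  have hlt : P < M := lt_of_le_of_ne hPM (fun h => hmax (h ▸ hM))
  have hπprime := crvIdeal_isPrime hπ.irreducible
  have h1 : (⟨⊥, Ideal.isPrime_bot⟩ : PrimeSpectrum Poly) < ⟨crvIdeal π, hπprime⟩ := by
    change (⊥ : Ideal Poly) < crvIdeal π
    rw [bot_lt_iff_ne_bot, Ne, Ideal.span_singleton_eq_bot]
    exact hπ.ne_zero
  have h2 : (⟨crvIdeal π, hπprime⟩ : PrimeSpectrum Poly) < ⟨P, hP⟩ := by
    change crvIdeal π < P
    exact lt_of_le_of_ne ((Ideal.span_singleton_le_iff_mem _).2 hπP) (Ne.symm hp)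
  have h3 : (⟨P, hP⟩ : PrimeSpectrum Poly) < ⟨M, hM.isPrime⟩ := hlt
  let s : LTSeries (PrimeSpectrum Poly) :=
    (((RelSeries.singleton _ ⟨⊥, Ideal.isPrime_bot⟩).snoc ⟨crvIdeal π, hπprime⟩
      (by simpa using h1)).snoc ⟨P, hP⟩ (by simpa using h2)).snoc ⟨M, hM.isPrime⟩ (by simpa using h3)
  have hs : s.length = 3 := rfl
  have hdim : ringKrullDim Poly = 2 := by
    rw [MvPolynomial.ringKrullDim_of_isNoetherianRing, ringKrullDim_eq_zero_of_field]; simp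
  have := Order.LTSeries.length_le_krullDim s
  rw [hs] at this
  change ((3 : ℕ) : WithBot ℕ∞) ≤ ringKrullDim Poly at this
  rw [hdim] at this
  exact absurd this (by decide)

theorem not_dvd_both {π P Q : Poly} (h : Irreducible π) (hP : P ≠ 0) (hQ : Q ≠ 0)
    (h1 : degreeOf 1 P = 0) (h0 : degreeOf 0 Q = 0) (hdP : π ∣ P) (hdQ : π ∣ Q) : False := by
  have aux : ∀ (R : Poly) (i : Fin 2), R ≠ 0 → degreeOf i R = 0 → π ∣ R → degreeOf i π = 0 := by
    rintro R i hR hi ⟨S, rfl⟩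
    rw [degreeOf_mul_eq h.ne_zero (right_ne_zero_of_mul hR)] at hi
    omega
  have hv : π.vars = ∅ := by
    ext i
    rw [mem_vars_iff_degreeOf_ne_zero]
    fin_cases i
    · simpa using aux Q 0 hQ h0 hdQ
    · simpa using aux P 1 hP h1 hdP
  rw [vars_eq_empty_iff_eq_C] at hv
  apply h.not_isUnit
  rw [hv]
  refine IsUnit.map C (isUnit_iff_ne_zero.2 fun h' => h.ne_zero ?_)
  rw [hv, h', C_0]

theorem degreeOf_X_sub_C (i j : Fin 2) (hij : i ≠ j) (c : ℂ) :
    degreeOf i (X j - C c : Poly) = 0 := by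
  have := degreeOf_sub_le i (X j : Poly) (C c)
  rw [degreeOf_C, degreeOf_X_of_ne hij] at this
  simpa using this

theorem X_sub_C_ne_zero (i : Fin 2) (c : ℂ) : (X i - C c : Poly) ≠ 0 := by
  intro h
  have := congrArg (eval fun _ => c + 1) h
  simp at this

theorem not_dvd_X_sub_C_both {π : Poly} (h : Irreducible π) (a b : ℂ)
    (hdP : π ∣ X 0 - C a) (hdQ : π ∣ X 1 - C b) : False :=
  not_dvd_both h (X_sub_C_ne_zero 0 a) (X_sub_C_ne_zero 1 b)
    (degreeOf_X_sub_C _ _ (by decide) _) (degreeOf_X_sub_C _ _ (by decide) _) hdP hdQ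

theorem irreducible_X_sub_C (i : Fin 2) (c : ℂ) : Irreducible (X i - C c : Poly) := by
  apply irreducible_of_totalDegree_eq_one
  · rw [sub_eq_add_neg, ← C_neg, totalDegree_add_eq_left_of_totalDegree_lt] <;> simp
  · intro x hx
    have hne : (Finsupp.single i 1 : Fin 2 →₀ ℕ) ≠ 0 := by simp
    have := hx (Finsupp.single i 1)
    simp [coeff_C, hne.symm] at this
    exact isUnit_iff_ne_zero.2 (fun h => by simp [h] at this)

theorem irreducible_X (i : Fin 2) : Irreducible (X i : Poly) := (X_prime).irreducible

theorem infinite_zeros {π : Poly} (h : Irreducible π) : {c : Fin 2 → ℂ | eval c π = 0}.Infinite := by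
  intro hfin
  have key : ∀ i : Fin 2, ∃ a, π ∣ X i - C a := by
    intro i
    have hmem : (∏ c ∈ hfin.toFinset, (X i - C (c i)) : Poly) ∈
        vanishingIdeal ℂ (zeroLocus ℂ (crvIdeal π)) := by
      rw [mem_vanishingIdeal_iff]
      intro x hx
      rw [mem_zeroLocus_iff] at hx
      have hx' := hx π (Ideal.mem_span_singleton_self π)
      rw [aeval_eq_eval] at hx' ⊢
      rw [map_prod]
      refine Finset.prod_eq_zero (i := x) (by simpa using hx') (by simp)
    have := crvIdeal_isPrime h
    rw [IsPrime.vanishingIdeal_zeroLocus, Ideal.mem_span_singleton, h.prime.dvd_finsetProd_iff]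
      at hmem
    obtain ⟨c, -, hc⟩ := hmem
    exact ⟨_, hc⟩
  obtain ⟨a, ha⟩ := key 0
  obtain ⟨b, hb⟩ := key 1
  exact not_dvd_X_sub_C_both h a b ha hb

/-! ### Vanishing in a local ring -/

/-- `h` is a non-unit of `B`. -/
def Vanishes (B : Subring KK) (h : KK) : Prop := h ∈ B ∧ (h = 0 ∨ h⁻¹ ∉ B)

/-- The local rings of the function field considered here. -/
def IsLoc (B : Subring KK) : Prop :=
  ∃ (θ : KK ≃ₐ[ℂ] KK) (P : Ideal Poly) (_ : P.IsPrime), B = mapRing θ (locAt P)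

theorem vanishes_mapRing {θ : KK ≃ₐ[ℂ] KK} {B : Subring KK} {h : KK} :
    Vanishes (mapRing θ B) (θ h) ↔ Vanishes B h := by
  simp only [Vanishes, apply_mem_mapRing, ← map_inv₀, map_eq_zero_iff θ θ.injective]

theorem vanishes_mapRing' {θ : KK ≃ₐ[ℂ] KK} {B : Subring KK} {h : KK} :
    Vanishes (mapRing θ B) h ↔ Vanishes B (θ.symm h) := by
  conv_lhs => rw [← θ.apply_symm_apply h]
  exact vanishes_mapRing

theorem toKK_ne_zero {a : Poly} (h : a ≠ 0) : algebraMap Poly KK a ≠ 0 := by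
  rwa [Ne, FaithfulSMul.algebraMap_eq_zero_iff]

theorem ne_zero_of_notMem {P : Ideal Poly} {b : Poly} (h : b ∉ P) : b ≠ 0 := fun h' =>
  h (h' ▸ P.zero_mem)

theorem div_mem_locAt_iff {P : Ideal Poly} [hP : P.IsPrime] {a b : Poly} (ha : a ∉ P) :
    algebraMap Poly KK a / algebraMap Poly KK b ∈ locAt P ↔ b = 0 ∨ b ∉ P := by
  constructor
  · rintro ⟨c, d, hd, h⟩
    by_cases hb : b = 0
    · exact Or.inl hb
    right
    rw [div_eq_div_iff (toKK_ne_zero hb) (toKK_ne_zero (ne_zero_of_notMem hd)), ← map_mul,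
      ← map_mul, (IsFractionRing.injective Poly KK).eq_iff] at h
    intro hbP
    exact hP.mul_notMem ha hd (h ▸ P.mul_mem_left _ hbP)
  · rintro (rfl | hb)
    · simp [zero_mem]
    · exact ⟨a, b, hb, rfl⟩

theorem vanishes_locAt_div {P : Ideal Poly} [hP : P.IsPrime] {a b : Poly} (hb : b ∉ P) :
    Vanishes (locAt P) (algebraMap Poly KK a / algebraMap Poly KK b) ↔ a ∈ P := by
  have hb0 := toKK_ne_zero (ne_zero_of_notMem hb)
  rw [Vanishes, inv_div, div_mem_locAt_iff hb, div_eq_zero_iff, or_iff_left hb0,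
    FaithfulSMul.algebraMap_eq_zero_iff]
  constructor
  · rintro ⟨-, rfl | h⟩
    · exact P.zero_mem
    · push Not at h; exact h.2
  · intro h
    refine ⟨⟨a, b, hb, rfl⟩, ?_⟩
    tauto

theorem vanishes_locAt {P : Ideal Poly} [hP : P.IsPrime] {a : Poly} :
    Vanishes (locAt P) (algebraMap Poly KK a) ↔ a ∈ P := by
  have := vanishes_locAt_div (P := P) (a := a) (b := 1) ((Ideal.ne_top_iff_one P).1 hP.ne_top)
  simpa using this

theorem IsLoc.add {B : Subring KK} (hB : IsLoc B) {x y : KK} (hx : Vanishes B x)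
    (hy : Vanishes B y) : Vanishes B (x + y) := by
  obtain ⟨θ, P, hP, rfl⟩ := hB
  rw [vanishes_mapRing'] at *
  rw [map_add]
  obtain ⟨a, b, hb, h1⟩ := hx.1
  obtain ⟨c, d, hd, h2⟩ := hy.1
  rw [h1, vanishes_locAt_div hb] at hx
  rw [h2, vanishes_locAt_div hd] at hy
  rw [h1, h2, div_add_div _ _ (toKK_ne_zero (ne_zero_of_notMem hb))
    (toKK_ne_zero (ne_zero_of_notMem hd)), ← map_mul, ← map_mul, ← map_add, ← map_mul,
    vanishes_locAt_div (hP.mul_notMem hb hd)]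
  exact P.add_mem (P.mul_mem_right _ hx) (P.mul_mem_left _ hy)

theorem IsLoc.mul {B : Subring KK} (hB : IsLoc B) {x y : KK} (hx : x ∈ B)
    (hy : Vanishes B y) : Vanishes B (x * y) := by
  obtain ⟨θ, P, hP, rfl⟩ := hB
  rw [vanishes_mapRing', mem_mapRing] at *
  rw [map_mul]
  obtain ⟨a, b, hb, h1⟩ := hx
  obtain ⟨c, d, hd, h2⟩ := hy.1
  rw [h2, vanishes_locAt_div hd] at hy
  rw [h1, h2, div_mul_div_comm, ← map_mul, ← map_mul, vanishes_locAt_div (hP.mul_notMem hb hd)]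
  exact P.mul_mem_left _ hy

theorem IsLoc.cst_mem {B : Subring KK} (hB : IsLoc B) (c : ℂ) : cst c ∈ B := by
  obtain ⟨θ, P, hP, rfl⟩ := hB
  rw [mem_mapRing, map_cst, cst_eq_algebraMap]
  exact algebraMap_mem_locAt P _

theorem IsLoc.vanishes_cst {B : Subring KK} (hB : IsLoc B) (c : ℂ) :
    Vanishes B (cst c) ↔ c = 0 := by
  constructor
  · rintro ⟨-, h | h⟩
    · exact cst_eq_zero.1 h
    · exact absurd (cst_inv c ▸ hB.cst_mem _) h
  · rintro rfl
    exact ⟨hB.cst_mem 0, Or.inl cst_zero⟩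

theorem IsLoc.neg {B : Subring KK} (hB : IsLoc B) {x : KK} (hx : Vanishes B x) :
    Vanishes B (-x) := by
  simpa using hB.mul (neg_mem (one_mem B)) hx

theorem IsLoc.sub {B : Subring KK} (hB : IsLoc B) {x y : KK} (hx : Vanishes B x)
    (hy : Vanishes B y) : Vanishes B (x - y) := by
  rw [sub_eq_add_neg]; exact hB.add hx (hB.neg hy)

theorem IsLoc.not_vanishes_one {B : Subring KK} (hB : IsLoc B) : ¬ Vanishes B 1 := by
  rw [← cst_one, hB.vanishes_cst]; exact one_ne_zero

/-- The value of a function at a point is unique. -/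
theorem IsLoc.value_unique {B : Subring KK} (hB : IsLoc B) {x : KK} {a b : ℂ}
    (ha : Vanishes B (x - cst a)) (hb : Vanishes B (x - cst b)) : a = b := by
  have := hB.sub hb ha
  rw [sub_sub_sub_cancel_left, ← cst_sub, hB.vanishes_cst] at this
  exact sub_eq_zero.1 this

theorem IsLoc.mem_of_vanishes_sub {B : Subring KK} (hB : IsLoc B) {x : KK} {a : ℂ}
    (ha : Vanishes B (x - cst a)) : x ∈ B := by
  simpa using add_mem ha.1 (hB.cst_mem a)

theorem not_vanishes_inv {B : Subring KK} {x : KK} (hx0 : x ≠ 0)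
    (hx : x ∈ B) : ¬ Vanishes B x⁻¹ := by
  rintro ⟨-, h | h⟩
  · exact hx0 (inv_eq_zero.1 h)
  · rw [inv_inv] at h; exact h hx

theorem IsLoc.map {B : Subring KK} (hB : IsLoc B) (η : KK ≃ₐ[ℂ] KK) : IsLoc (mapRing η B) := by
  obtain ⟨θ, P, hP, rfl⟩ := hB
  exact ⟨θ.trans η, P, hP, (mapRing_trans _ _ _).symm⟩

theorem isLoc_locAt (P : Ideal Poly) [hP : P.IsPrime] : IsLoc (locAt P) :=
  ⟨AlgEquiv.refl, P, hP, (mapRing_refl _).symm⟩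

/-! ### The local rings of points -/

theorem IsChart.ptRing_eq {u v : KK} {θ : KK ≃ₐ[ℂ] KK} (h0 : θ (coord 0) = u)
    (h1 : θ (coord 1) = v) : ptRing u v = mapRing θ (locAt (ptIdeal 0)) := by
  rw [← ptRing_coord, mapRing_ptRing, h0, h1]

theorem IsChart.isLoc {u v : KK} (h : IsChart u v) : IsLoc (ptRing u v) := by
  obtain ⟨θ, h0, h1⟩ := h
  exact ⟨θ, _, inferInstance, IsChart.ptRing_eq h0 h1⟩

theorem IsChart.vanishes_aeval_div {u v : KK} (h : IsChart u v) {P Q : Poly}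
    (hQ : constantCoeff Q ≠ 0) :
    Vanishes (ptRing u v) (aeval ![u, v] P / aeval ![u, v] Q) ↔ constantCoeff P = 0 := by
  obtain ⟨θ, rfl, rfl⟩ := h
  rw [IsChart.ptRing_eq rfl rfl, ← map_aeval, ← map_aeval, aeval_coord, aeval_coord, ← map_div₀,
    vanishes_mapRing, vanishes_locAt_div, mem_ptIdeal_zero]
  rwa [mem_ptIdeal_zero]

theorem IsChart.vanishes_aeval {u v : KK} (h : IsChart u v) {P : Poly} :
    Vanishes (ptRing u v) (aeval ![u, v] P) ↔ constantCoeff P = 0 := by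
  have := h.vanishes_aeval_div (P := P) (Q := 1) (by simp)
  simpa using this

theorem IsChart.vanishes_left {u v : KK} (h : IsChart u v) : Vanishes (ptRing u v) u := by
  have := (h.vanishes_aeval (P := X 0)).2 (by simp)
  simpa using this

theorem ptRing_swap (u v : KK) : ptRing u v = ptRing v u := by
  suffices H : ∀ u v : KK, ptRing u v ≤ ptRing v u from le_antisymm (H u v) (H v u)
  rintro u v _ ⟨P, Q, hQ, hQ', rfl⟩
  have key : ∀ P : Poly, aeval ![u, v] P = aeval ![v, u] (rename (Equiv.swap 0 1) P) := by
    intro P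
    rw [aeval_rename]
    congr 2
    funext i
    fin_cases i <;> simp
  rw [key] at hQ'
  refine ⟨rename (Equiv.swap 0 1) P, rename (Equiv.swap 0 1) Q, ?_, hQ', by rw [key, key]⟩
  rwa [constantCoeff_rename]

theorem IsChart.vanishes_right {u v : KK} (h : IsChart u v) : Vanishes (ptRing u v) v := by
  rw [ptRing_swap]; exact h.swap.vanishes_left

theorem IsLoc.vanishes_aeval_sub {B : Subring KK} (hB : IsLoc B) {u v : KK} (h0 : Vanishes B u)
    (h1 : Vanishes B v) (P : Poly) :
    Vanishes B (aeval ![u, v] P - cst (constantCoeff P)) := by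
  induction P using MvPolynomial.induction_on with
  | C a =>
    have : aeval ![u, v] (C a) - cst (constantCoeff (C a : Poly)) = cst 0 := by
      rw [algHom_C, constantCoeff_C, cst_zero]; exact sub_self _
    rw [this, hB.vanishes_cst]
  | add p q hp hq =>
    rw [map_add, map_add, cst_add, add_sub_add_comm]
    exact hB.add hp hq
  | mul_X p i hp =>
    rw [map_mul, map_mul, constantCoeff_X, mul_zero, cst_zero, sub_zero, aeval_X]
    have hmem := hB.mem_of_vanishes_sub hp
    refine hB.mul hmem ?_
    fin_cases i
    · exact h0
    · exact h1

theorem IsLoc.inv_aeval_mem {B : Subring KK} (hB : IsLoc B) {u v : KK} (h0 : Vanishes B u)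
    (h1 : Vanishes B v) {Q : Poly} (hQ : constantCoeff Q ≠ 0) : (aeval ![u, v] Q)⁻¹ ∈ B := by
  have hQ1 := hB.vanishes_aeval_sub h0 h1 Q
  by_contra hinv
  have hv : Vanishes B (aeval ![u, v] Q) := ⟨hB.mem_of_vanishes_sub hQ1, Or.inr hinv⟩
  have := hB.sub hv hQ1
  rw [sub_sub_cancel, hB.vanishes_cst] at this
  exact hQ this

/-- A local ring in which `u, v` vanish contains the local ring of the point `u = v = 0`. -/
theorem IsLoc.ptRing_le {B : Subring KK} (hB : IsLoc B) {u v : KK} (h0 : Vanishes B u)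
    (h1 : Vanishes B v) : ptRing u v ≤ B := by
  rintro _ ⟨P, Q, hQ, hQ', rfl⟩
  rw [div_eq_mul_inv]
  exact mul_mem (hB.mem_of_vanishes_sub (hB.vanishes_aeval_sub h0 h1 P)) (hB.inv_aeval_mem h0 h1 hQ)

/-- A local ring in which `u, v` vanish dominates the point `u = v = 0`. -/
theorem IsLoc.dominates {B : Subring KK} (hB : IsLoc B) {u v : KK} (h : IsChart u v)
    (h0 : Vanishes B u) (h1 : Vanishes B v) {x : KK} (hx : Vanishes (ptRing u v) x) :
    Vanishes B x := by
  obtain ⟨P, Q, hQ, hQ', rfl⟩ := hx.1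
  rw [h.vanishes_aeval_div hQ] at hx
  have hP := hB.vanishes_aeval_sub h0 h1 P
  rw [hx, cst_zero, sub_zero] at hP
  rw [div_eq_inv_mul]
  exact hB.mul (hB.inv_aeval_mem h0 h1 hQ) hP

/-- Irreducible polynomials. -/
abbrev IrrPoly : Type := {π : Poly // Irreducible π}

instance (π : IrrPoly) : (crvIdeal π.1).IsPrime := crvIdeal_isPrime π.2

/-- The local ring of the generic point of the plane curve `π = 0`. -/
def IrrPoly.ring (π : IrrPoly) : Subring KK := locAt (crvIdeal π.1)

theorem IrrPoly.mem_ring {π : IrrPoly} {h : KK} : h ∈ π.ring ↔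
    ∃ a b : Poly, ¬ π.1 ∣ b ∧ h = algebraMap Poly KK a / algebraMap Poly KK b := by
  simp only [IrrPoly.ring, mem_locAt, Ideal.mem_span_singleton]

theorem IrrPoly.vanishes_ring {π : IrrPoly} {a : Poly} :
    Vanishes π.ring (algebraMap Poly KK a) ↔ π.1 ∣ a := by
  rw [IrrPoly.ring, vanishes_locAt, Ideal.mem_span_singleton]

/-- The coordinate function `z_i` as an irreducible polynomial. -/
def irrX (i : Fin 2) : IrrPoly := ⟨X i, irreducible_X i⟩

/-- The linear form `z_i - c` as an irreducible polynomial. -/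
def irrXC (i : Fin 2) (c : ℂ) : IrrPoly := ⟨X i - C c, irreducible_X_sub_C i c⟩

theorem crv_coord : crv (coord 0) (coord 1) = (irrX 0).ring := by
  ext h
  rw [IrrPoly.mem_ring]
  constructor
  · rintro ⟨P, Q, hQ, -, rfl⟩
    exact ⟨P, Q, hQ, by rw [aeval_coord, aeval_coord]⟩
  · rintro ⟨P, Q, hQ, rfl⟩
    refine ⟨P, Q, hQ, ?_, by rw [aeval_coord, aeval_coord]⟩
    exact isChart_coord.aeval_ne_zero fun h => hQ (h ▸ dvd_zero _)

theorem crv_eq (θ : KK ≃ₐ[ℂ] KK) : crv (θ (coord 0)) (θ (coord 1)) = mapRing θ (irrX 0).ring := by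
  rw [← crv_coord, mapRing_crv]

/-- Local rings of generic points of curves. -/
def IsCurve (V : Subring KK) : Prop := ∃ (θ : KK ≃ₐ[ℂ] KK) (π : IrrPoly), V = mapRing θ π.ring

theorem IsCurve.isLoc {V : Subring KK} (h : IsCurve V) : IsLoc V := by
  obtain ⟨θ, π, rfl⟩ := h
  exact ⟨θ, _, inferInstance, rfl⟩

theorem IsCurve.map {V : Subring KK} (h : IsCurve V) (η : KK ≃ₐ[ℂ] KK) : IsCurve (mapRing η V) := by
  obtain ⟨θ, π, rfl⟩ := h
  exact ⟨θ.trans η, π, (mapRing_trans _ _ _).symm⟩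

theorem IrrPoly.isCurve (π : IrrPoly) : IsCurve π.ring := ⟨AlgEquiv.refl, π, (mapRing_refl _).symm⟩

theorem IsChart.isCurve {u v : KK} (h : IsChart u v) : IsCurve (crv u v) := by
  obtain ⟨θ, rfl, rfl⟩ := h
  exact ⟨θ, irrX 0, crv_eq θ⟩

/-- If the curve vanishes on an irreducible function of a chart, it is the zero curve. -/
theorem IrrPoly.eq_of_dvd {π ρ : IrrPoly} (h : π.1 ∣ ρ.1) : π.ring = ρ.ring := by
  have hass := π.2.associated_of_dvd ρ.2 h
  ext x
  simp only [IrrPoly.mem_ring, hass.dvd_iff_dvd_left]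

theorem algebraMap_mem_ring (π : IrrPoly) (a : Poly) : algebraMap Poly KK a ∈ π.ring :=
  algebraMap_mem_locAt _ a

theorem IrrPoly.ring_ne_top (π : IrrPoly) : ∃ h : KK, h ∉ π.ring := by
  refine ⟨(algebraMap Poly KK π.1)⁻¹, fun hmem => ?_⟩
  have := (IrrPoly.vanishes_ring (π := π)).2 dvd_rfl
  rcases this.2 with h | h
  · exact toKK_ne_zero π.2.ne_zero h
  · exact h hmem

theorem IsCurve.exists_notMem {V : Subring KK} (h : IsCurve V) : ∃ x : KK, x ∉ V := by
  obtain ⟨θ, π, rfl⟩ := h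
  obtain ⟨x, hx⟩ := π.ring_ne_top
  exact ⟨θ x, by rwa [apply_mem_mapRing]⟩

theorem IsLoc.aeval_mem {B : Subring KK} (hB : IsLoc B) {u v : KK} (hu : u ∈ B) (hv : v ∈ B)
    (P : Poly) : aeval ![u, v] P ∈ B := by
  induction P using MvPolynomial.induction_on with
  | C a => rw [algHom_C]; exact hB.cst_mem a
  | add p q hp hq => rw [map_add]; exact add_mem hp hq
  | mul_X p i hp =>
    rw [map_mul, aeval_X]
    refine mul_mem hp ?_
    fin_cases i
    · exact hu
    · exact hv

/-- A curve in the function field is a curve of the plane, or lies over a point, as soon as the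
coordinate functions are regular on it. -/
theorem IsCurve.center {V : Subring KK} (hV : IsCurve V) (h0 : coord 0 ∈ V) (h1 : coord 1 ∈ V) :
    (∃ π : IrrPoly, V = π.ring) ∨
      ∃ c : Fin 2 → ℂ, ∀ i, Vanishes V (coord i - cst (c i)) := by
  have hL := hV.isLoc
  have hmem : ∀ a : Poly, algebraMap Poly KK a ∈ V := fun a => by
    rw [← aeval_coord]; exact hL.aeval_mem h0 h1 a
  let P : Ideal Poly :=
    { carrier := {a | Vanishes V (algebraMap Poly KK a)}
      add_mem' := fun {a b} ha hb => by
        simp only [Set.mem_ofPred_eq, map_add] at *; exact hL.add ha hb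
      zero_mem' := ⟨by simp [zero_mem], Or.inl (map_zero _)⟩
      smul_mem' := fun c a ha => by
        simp only [Set.mem_ofPred_eq, smul_eq_mul, map_mul] at *; exact hL.mul (hmem c) ha }
  have hP : ∀ a, a ∈ P ↔ Vanishes V (algebraMap Poly KK a) := fun a => Iff.rfl
  have hnot : ∀ a, a ∉ P → (algebraMap Poly KK a)⁻¹ ∈ V := by
    intro a ha
    by_contra h
    exact ha ⟨hmem a, Or.inr h⟩
  have hprime : P.IsPrime := by
    refine ⟨?_, ?_⟩
    · rw [Ne, Ideal.eq_top_iff_one, hP, map_one]; exact hL.not_vanishes_one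
    · intro a b hab
      by_contra hc
      push Not at hc
      have h2 := mul_mem (hnot a hc.1) (hnot b hc.2)
      rw [← mul_inv, ← map_mul] at h2
      rcases hab.2 with h | h
      · have hab0 : a * b = 0 := by simpa using h
        rcases mul_eq_zero.1 hab0 with rfl | rfl
        · exact hc.1 P.zero_mem
        · exact hc.2 P.zero_mem
      · exact h h2
  have hbot : P ≠ ⊥ := by
    obtain ⟨x, hx⟩ := hV.exists_notMem
    obtain ⟨a, b, hb, rfl⟩ := exists_div x
    intro hbot
    have : b ∉ P := by rw [hbot]; exact hb
    exact hx (by rw [div_eq_mul_inv]; exact mul_mem (hmem a) (hnot b this))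
  rcases prime_eq_crvIdeal_or_ptIdeal P hbot with ⟨π, hπ, hPπ⟩ | ⟨c, hc⟩
  · left
    refine ⟨⟨π, hπ⟩, le_antisymm ?_ ?_⟩
    · intro h hh
      obtain ⟨a, b, hb, rfl⟩ := exists_div h
      by_cases ha0 : a = 0
      · rw [ha0, map_zero, zero_div]; exact zero_mem _
      obtain ⟨a', b', hrel⟩ : ∃ a' b' : Poly, IsRelPrime a' b' ∧ b' ≠ 0 ∧
          algebraMap Poly KK a / algebraMap Poly KK b =
            algebraMap Poly KK a' / algebraMap Poly KK b' := by
        obtain ⟨a', b', c, hrel, h1, h2⟩ := UniqueFactorizationMonoid.exists_reduced_factors' a b hb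
        refine ⟨a', b', hrel, ?_, ?_⟩
        · rintro rfl; exact hb (by rw [← h2, mul_zero])
        · have hc0 : c ≠ 0 := by rintro rfl; exact hb (by rw [← h2, zero_mul])
          rw [← h1, ← h2, map_mul, map_mul, mul_div_mul_left _ _ (toKK_ne_zero hc0)]
      obtain ⟨hrel, hb', heq⟩ := hrel
      rw [heq] at hh ⊢
      rw [IrrPoly.mem_ring]
      refine ⟨a', b', fun hdvd => ?_, rfl⟩
      have hna : ¬ π ∣ a' := fun h => hπ.not_isUnit (hrel h hdvd)
      have hbP : b' ∈ P := by rw [hPπ]; exact Ideal.mem_span_singleton.2 hdvd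
      have haP : a' ∉ P := by rw [hPπ]; exact fun h => hna (Ideal.mem_span_singleton.1 h)
      apply haP
      rw [hP]
      have := hL.mul hh ((hP b').1 hbP)
      rwa [div_mul_cancel₀ _ (toKK_ne_zero hb')] at this
    · intro h hh
      rw [IrrPoly.mem_ring] at hh
      obtain ⟨a, b, hb, rfl⟩ := hh
      rw [div_eq_mul_inv]
      refine mul_mem (hmem a) (hnot b fun h => hb ?_)
      rw [hPπ] at h
      exact Ideal.mem_span_singleton.1 h
  · right
    refine ⟨c, fun i => ?_⟩
    have : (X i - C (c i) : Poly) ∈ P := by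
      rw [hc, mem_ptIdeal]; simp
    rw [hP, map_sub, ← cst_eq_algebraMap] at this
    exact this

/-! ### Curves through a point -/

/-- `V` is the localization of `R` at a prime of height one. -/
def CurveOf (R V : Subring KK) : Prop :=
  ∃ p : Ideal R, p.IsPrime ∧ p ≠ ⊥ ∧ ¬ p.IsMaximal ∧
    ∀ h : KK, h ∈ V ↔ ∃ a b : R, b ∉ p ∧ h = (a : KK) / (b : KK)

theorem CurveOf.map {R V : Subring KK} (h : CurveOf R V) (θ : KK ≃ₐ[ℂ] KK) :
    CurveOf (mapRing θ R) (mapRing θ V) := by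
  obtain ⟨p, hp, hbot, hmax, hV⟩ := h
  let e : R ≃+* mapRing θ R := RingEquiv.subringMap (RingEquivClass.toRingEquiv θ)
  have he : ∀ x : R, ((e x : mapRing θ R) : KK) = θ x := fun _ => rfl
  have he' : ∀ x : mapRing θ R, ((e.symm x : R) : KK) = θ.symm x := fun x => by
    rw [AlgEquiv.eq_symm_apply, ← he, e.apply_symm_apply]
  refine ⟨p.comap e.symm, inferInstance, ?_, ?_, fun h => ?_⟩
  · obtain ⟨x, hx, hx0⟩ := Submodule.exists_mem_ne_zero_of_ne_bot hbot
    intro h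
    have hmem : e x ∈ p.comap e.symm := by simpa using hx
    rw [h, Ideal.mem_bot] at hmem
    exact hx0 (by simpa using hmem)
  · intro h
    apply hmax
    have hpe : (p.comap e.symm).comap e = p := by
      ext x; simp
    rw [← hpe]
    exact Ideal.comap_isMaximal_of_equiv e
  · rw [mem_mapRing, hV]
    constructor
    · rintro ⟨a, b, hb, hab⟩
      refine ⟨e a, e b, by simpa using hb, ?_⟩
      rw [he, he, ← map_div₀, ← hab, AlgEquiv.apply_symm_apply]
    · rintro ⟨a, b, hb, rfl⟩
      exact ⟨e.symm a, e.symm b, hb, by rw [he', he', map_div₀]⟩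

theorem curveOf_mapRing_iff {R V : Subring KK} (θ : KK ≃ₐ[ℂ] KK) :
    CurveOf (mapRing θ R) (mapRing θ V) ↔ CurveOf R V :=
  ⟨fun h => by simpa only [mapRing_symm_mapRing] using h.map θ.symm, fun h => h.map θ⟩

theorem curveOf_origin_iff {V : Subring KK} :
    CurveOf (locAt (ptIdeal 0)) V ↔ ∃ π : IrrPoly, constantCoeff π.1 = 0 ∧ V = π.ring := by
  constructor
  · rintro ⟨p, hp, hbot, hmax, hV⟩
    let ι : Poly →+* locAt (ptIdeal 0) :=
      (algebraMap Poly KK).codRestrict _ (algebraMap_mem_locAt (ptIdeal 0))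
    have hunit : ∀ a : Poly, a ∉ ptIdeal 0 → IsUnit (ι a) := by
      intro a ha
      have hinv : (algebraMap Poly KK a)⁻¹ ∈ locAt (ptIdeal 0) :=
        ⟨1, a, ha, by rw [map_one, one_div]⟩
      refine IsUnit.of_mul_eq_one ⟨_, hinv⟩ (Subtype.ext ?_)
      change algebraMap Poly KK a * (algebraMap Poly KK a)⁻¹ = 1
      exact mul_inv_cancel₀ (toKK_ne_zero (ne_zero_of_notMem ha))
    have hfrac : ∀ x : locAt (ptIdeal 0), ∃ a b : Poly, b ∉ ptIdeal 0 ∧ x * ι b = ι a ∧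
        (x : KK) = algebraMap Poly KK a / algebraMap Poly KK b := by
      rintro ⟨x, a, b, hb, rfl⟩
      refine ⟨a, b, hb, Subtype.ext ?_, rfl⟩
      exact div_mul_cancel₀ _ (toKK_ne_zero (ne_zero_of_notMem hb))
    let P : Ideal Poly := p.comap ι
    have hP : P.IsPrime := Ideal.comap_isPrime ι p
    have hnum : ∀ x : locAt (ptIdeal 0), ∀ a b : Poly, b ∉ ptIdeal 0 → x * ι b = ι a →
        (x ∈ p ↔ a ∈ P) := by
      intro x a b hb hx
      rw [Ideal.mem_comap, ← hx]
      exact ⟨fun h => p.mul_mem_right _ h, fun h => (hp.mem_or_mem h).resolve_right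
        fun h' => hp.ne_top (Ideal.eq_top_of_isUnit_mem _ h' (hunit b hb))⟩
    have hPle : P ≤ ptIdeal 0 := by
      intro a ha
      by_contra h
      exact hp.ne_top (Ideal.eq_top_of_isUnit_mem _ ha (hunit a h))
    have hPbot : P ≠ ⊥ := by
      obtain ⟨x, hx, hx0⟩ := Submodule.exists_mem_ne_zero_of_ne_bot hbot
      obtain ⟨a, b, hb, hab, heq⟩ := hfrac x
      intro h
      have ha := (hnum x a b hb hab).1 hx
      rw [h, Ideal.mem_bot] at ha
      apply hx0
      apply Subtype.ext
      rw [heq, ha, map_zero, zero_div]; rfl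
    rcases prime_eq_crvIdeal_or_ptIdeal P hPbot with ⟨π, hπ, hPπ⟩ | ⟨c, hc⟩
    · have hdvd : ∀ a, a ∈ P ↔ π ∣ a := fun a => by rw [hPπ, Ideal.mem_span_singleton]
      refine ⟨⟨π, hπ⟩, mem_ptIdeal_zero.1 (hPle ((hdvd π).2 dvd_rfl)), ?_⟩
      ext h
      rw [hV, IrrPoly.mem_ring]
      constructor
      · rintro ⟨x, y, hy, rfl⟩
        obtain ⟨a, b, hb, hab, heq⟩ := hfrac x
        obtain ⟨c, d, hd, hcd, heq'⟩ := hfrac y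
        refine ⟨a * d, b * c, ?_, by rw [heq, heq', div_div_div_eq, map_mul, map_mul]⟩
        rw [← hdvd]
        exact hP.mul_notMem (fun h => hb (hPle h)) (fun h => hy ((hnum y c d hd hcd).2 h))
      · rintro ⟨a, b, hb, rfl⟩
        exact ⟨ι a, ι b, fun h => hb ((hdvd b).1 h), rfl⟩
    · exfalso
      have hPm : P = ptIdeal 0 := by
        refine Ideal.IsMaximal.eq_of_le ?_ (Ideal.IsPrime.ne_top inferInstance) hPle
        rw [hc]; infer_instance
      apply hmax
      rw [Ideal.isMaximal_iff]
      refine ⟨(Ideal.ne_top_iff_one p).1 hp.ne_top, fun J x hJ hx hxJ => ?_⟩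
      obtain ⟨a, b, hb, hab, -⟩ := hfrac x
      rw [hnum x a b hb hab, hPm] at hx
      have h1 : ι a ∈ J := hab ▸ J.mul_mem_right _ hxJ
      exact (Ideal.eq_top_iff_one J).1 (Ideal.eq_top_of_isUnit_mem _ h1 (hunit a hx))
  · rintro ⟨π, hπ0, rfl⟩
    have hm : ∀ b, b ∉ ptIdeal 0 → ¬ π.1 ∣ b := by
      rintro b hb hdvd
      exact hb (Ideal.mem_of_dvd _ hdvd (mem_ptIdeal_zero.2 hπ0))
    have hle : ∀ x : locAt (ptIdeal 0), (x : KK) ∈ π.ring := by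
      rintro ⟨x, a, b, hb, rfl⟩
      exact IrrPoly.mem_ring.2 ⟨a, b, hm b hb, rfl⟩
    let p : Ideal (locAt (ptIdeal 0)) :=
      { carrier := {x | Vanishes π.ring x}
        add_mem' := fun {a b} ha hb => π.isCurve.isLoc.add ha hb
        zero_mem' := ⟨zero_mem _, Or.inl rfl⟩
        smul_mem' := fun c a ha => π.isCurve.isLoc.mul (hle c) ha }
    have hp : ∀ x : locAt (ptIdeal 0), x ∈ p ↔ Vanishes π.ring x := fun _ => Iff.rfl
    have hpoly : ∀ a : Poly, ∀ h : algebraMap Poly KK a ∈ locAt (ptIdeal 0),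
        (⟨_, h⟩ : locAt (ptIdeal 0)) ∈ p ↔ π.1 ∣ a := fun a h => by
      rw [hp]; exact IrrPoly.vanishes_ring
    have hunit : ∀ x : locAt (ptIdeal 0), x ∉ p → (x : KK)⁻¹ ∈ π.ring := by
      intro x hx
      by_contra h
      exact hx ⟨hle x, Or.inr h⟩
    refine ⟨p, ⟨?_, ?_⟩, ?_, ?_, fun h => ?_⟩
    · rw [Ne, Ideal.eq_top_iff_one, hp]; exact π.isCurve.isLoc.not_vanishes_one
    · intro a b hab
      by_contra hc
      push Not at hc
      have h2 := π.isCurve.isLoc.mul (mul_mem (hunit a hc.1) (hunit b hc.2)) hab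
      have ha0 : (a : KK) ≠ 0 := fun h => hc.1 ⟨hle a, Or.inl h⟩
      have hb0 : (b : KK) ≠ 0 := fun h => hc.2 ⟨hle b, Or.inl h⟩
      have : (a : KK)⁻¹ * (b : KK)⁻¹ * ((a * b : locAt (ptIdeal 0)) : KK) = 1 := by
        push_cast; field_simp
      rw [this] at h2
      exact π.isCurve.isLoc.not_vanishes_one h2
    · intro hbot
      have h1 := (hpoly π.1 (algebraMap_mem_locAt _ _)).2 dvd_rfl
      rw [hbot, Ideal.mem_bot] at h1
      exact toKK_ne_zero π.2.ne_zero (congrArg Subtype.val h1)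
    · intro hmax
      have hX : ∀ i : Fin 2, π.1 ∣ X i := by
        intro i
        rw [← hpoly (X i) (algebraMap_mem_locAt _ _)]
        by_contra hni
        obtain ⟨y, hy⟩ := hmax.exists_inv hni
        obtain ⟨j, hj, hy⟩ := hy
        have hL := isLoc_locAt (ptIdeal 0)
        have hXi : Vanishes (locAt (ptIdeal 0)) (algebraMap Poly KK (X i)) := by
          rw [vanishes_locAt, mem_ptIdeal]; simp
        have hv := hL.mul y.2 hXi
        rw [← eq_sub_iff_add_eq'] at hy
        rw [hy, ← neg_mem_iff, neg_sub, hp] at hj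
        push_cast at hj
        have hnv : ¬ Vanishes (locAt (ptIdeal 0)) ((y : KK) * algebraMap Poly KK (X i) - 1) :=
          fun h => hL.not_vanishes_one (by simpa using hL.sub hv h)
        rcases hj.2 with h0 | hinv
        · exact hnv ⟨sub_mem hv.1 (one_mem _), Or.inl h0⟩
        · exact hnv ⟨sub_mem hv.1 (one_mem _), Or.inr fun h => hinv (hle ⟨_, h⟩)⟩
      apply not_dvd_X_sub_C_both π.2 0 0
      · simpa using hX 0
      · simpa using hX 1
    · rw [IrrPoly.mem_ring]
      constructor
      · rintro ⟨a, b, hb, rfl⟩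
        exact ⟨⟨_, algebraMap_mem_locAt _ a⟩, ⟨_, algebraMap_mem_locAt _ b⟩,
          fun h => hb ((hpoly b _).1 h), rfl⟩
      · rintro ⟨a, b, hb, rfl⟩
        rw [← IrrPoly.mem_ring, div_eq_mul_inv]
        exact mul_mem (hle a) (hunit b hb)

theorem curveOf_ptRing_iff {θ : KK ≃ₐ[ℂ] KK} {V : Subring KK} :
    CurveOf (ptRing (θ (coord 0)) (θ (coord 1))) V ↔
      ∃ π : IrrPoly, constantCoeff π.1 = 0 ∧ V = mapRing θ π.ring := by
  rw [← mapRing_ptRing, ptRing_coord]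
  conv_lhs => rw [← mapRing_mapRing_symm θ V]
  rw [curveOf_mapRing_iff, curveOf_origin_iff]
  refine exists_congr fun π => and_congr_right fun _ => ?_
  rw [← (mapRing_injective θ).eq_iff, mapRing_mapRing_symm]

theorem CurveOf.isCurve {u v : KK} (huv : IsChart u v) {V : Subring KK}
    (h : CurveOf (ptRing u v) V) : IsCurve V := by
  obtain ⟨θ, rfl, rfl⟩ := huv
  obtain ⟨π, -, rfl⟩ := curveOf_ptRing_iff.1 h
  exact ⟨θ, π, rfl⟩

/-- A function regular at a point is regular along the curves through it, and if it vanishes along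
one of them, then it vanishes at the point. -/
theorem CurveOf.le {u v : KK} {V : Subring KK} (h : CurveOf (ptRing u v) V) :
    ptRing u v ≤ V := by
  obtain ⟨p, hp, -, -, hV⟩ := h
  intro x hx
  exact (hV x).2 ⟨⟨x, hx⟩, 1, (Ideal.ne_top_iff_one p).1 hp.ne_top, by simp⟩

theorem vanishes_of_le {R V : Subring KK} (hle : R ≤ V) {x : KK} (hx : x ∈ R)
    (hv : Vanishes V x) : Vanishes R x :=
  ⟨hx, hv.2.imp id fun h h' => h (hle h')⟩

/-- `IsCurve.center` in an arbitrary chart. -/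
theorem IsCurve.center_chart {V : Subring KK} (hV : IsCurve V) {θ : KK ≃ₐ[ℂ] KK}
    (h0 : θ (coord 0) ∈ V) (h1 : θ (coord 1) ∈ V) :
    (∃ π : IrrPoly, V = mapRing θ π.ring) ∨
      ∃ a b : ℂ, Vanishes V (θ (coord 0) - cst a) ∧ Vanishes V (θ (coord 1) - cst b) := by
  have := (hV.map θ.symm).center (by rwa [mem_mapRing, AlgEquiv.symm_symm])
    (by rwa [mem_mapRing, AlgEquiv.symm_symm])
  rcases this with ⟨π, hπ⟩ | ⟨c, hc⟩
  · exact Or.inl ⟨π, by rw [← hπ, mapRing_mapRing_symm]⟩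
  · refine Or.inr ⟨c 0, c 1, ?_, ?_⟩
    · simpa [vanishes_mapRing', map_cst] using hc 0
    · simpa [vanishes_mapRing', map_cst] using hc 1

/-- A curve of a chart does not lie over a point of the chart. -/
theorem not_vanishes_both {θ : KK ≃ₐ[ℂ] KK} {π : IrrPoly} {a b : ℂ}
    (h0 : Vanishes (mapRing θ π.ring) (θ (coord 0) - cst a))
    (h1 : Vanishes (mapRing θ π.ring) (θ (coord 1) - cst b)) : False := by
  rw [vanishes_mapRing', map_sub, map_cst, AlgEquiv.symm_apply_apply, cst_eq_algebraMap, coord,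
    ← map_sub, IrrPoly.vanishes_ring] at h0 h1
  exact not_dvd_X_sub_C_both π.2 a b h0 h1

theorem IsCurve.eq_crv {V : Subring KK} (hV : IsCurve V) {u w : KK} (h : IsChart u w)
    (hu : Vanishes V u) (hw : w ∈ V) (hn : ∀ c, ¬ Vanishes V (w - cst c)) : V = crv u w := by
  obtain ⟨θ, rfl, rfl⟩ := h
  rcases hV.center_chart hu.1 hw with ⟨π, rfl⟩ | ⟨a, b, -, hb⟩
  · rw [crv_eq]
    congr 1
    apply IrrPoly.eq_of_dvd
    rwa [vanishes_mapRing, coord, IrrPoly.vanishes_ring] at hu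
  · exact absurd hb (hn b)

theorem IsChart.crv_vanishes_left {u w : KK} (h : IsChart u w) : Vanishes (crv u w) u := by
  obtain ⟨θ, rfl, rfl⟩ := h
  rw [crv_eq, vanishes_mapRing, coord, IrrPoly.vanishes_ring]
  exact dvd_rfl

theorem IsChart.crv_mem_right {u w : KK} (h : IsChart u w) : w ∈ crv u w := by
  obtain ⟨θ, rfl, rfl⟩ := h
  rw [crv_eq, apply_mem_mapRing]
  exact algebraMap_mem_ring _ _

theorem IsChart.crv_not_vanishes {u w : KK} (h : IsChart u w) (c : ℂ) :
    ¬ Vanishes (crv u w) (w - cst c) := by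
  obtain ⟨θ, rfl, rfl⟩ := h
  intro hv
  refine not_vanishes_both (θ := θ) (π := irrX 0) (a := 0) (b := c) ?_ ?_
  · rw [← crv_eq, cst_zero, sub_zero]
    exact ((isChart_coord.map θ)).crv_vanishes_left
  · rwa [← crv_eq]

/-! ### Curves on a blowup -/

/-- The points of the exceptional line over the point `u = v = 0`. -/
def excSet (u v : KK) : Set (Subring KK) :=
  {R | ∃ c : ℂ, R = ptRing u (v / u - cst c)} ∪ {ptRing (u / v) v}

theorem IsChart.sub_cst_div {u v : KK} (h : IsChart u v) (c : ℂ) : IsChart u (v / u - cst c) :=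
  h.div.sub_cst c

theorem IsChart.div' {u v : KK} (h : IsChart u v) : IsChart (u / v) v := h.swap.div.swap

theorem IsChart.ptRing_le_div {u v : KK} (h : IsChart u v) (c : ℂ) :
    ptRing u v ≤ ptRing u (v / u - cst c) := by
  have h' := h.sub_cst_div c
  have hL := h'.isLoc
  refine hL.ptRing_le h'.vanishes_left ?_
  have : v = (v / u - cst c + cst c) * u := by have := h.ne_zero; field_simp; ring
  conv_rhs => rw [this]
  exact hL.mul (add_mem h'.vanishes_right.1 (hL.cst_mem c)) h'.vanishes_left

theorem IsChart.ptRing_le_div' {u v : KK} (h : IsChart u v) : ptRing u v ≤ ptRing (u / v) v := by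
  have h' := h.div'
  refine h'.isLoc.ptRing_le ?_ h'.vanishes_right
  have : u = u / v * v := by have := h.swap.ne_zero; field_simp
  conv_rhs => rw [this]
  exact h'.isLoc.mul h'.vanishes_left.1 h'.vanishes_right

theorem IsChart.crv_div_swap {u v : KK} (h : IsChart u v) : crv v (u / v) = crv u (v / u) := by
  have h1 := h.swap.div
  have hu := h.ne_zero
  have hv := h.swap.ne_zero
  have hC := h1.isCurve
  have hinv : v / u ∈ crv v (u / v) := by
    by_contra hc
    have : Vanishes (crv v (u / v)) (u / v - cst 0) := by
      rw [cst_zero, sub_zero]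
      exact ⟨h1.crv_mem_right, Or.inr (by rwa [inv_div])⟩
    exact h1.crv_not_vanishes 0 this
  refine hC.eq_crv h.div ?_ hinv fun c hc => ?_
  · have : u = u / v * v := by field_simp
    have hmul := hC.isLoc.mul h1.crv_mem_right h1.crv_vanishes_left
    rwa [← this] at hmul
  · have h2 := hC.isLoc.mul h1.crv_mem_right hc
    have h3 : u / v * (v / u - cst c) = 1 - cst c * (u / v) := by field_simp
    rw [h3] at h2
    by_cases hc0 : c = 0
    · subst hc0
      simp only [cst_zero, zero_mul, sub_zero] at h2
      exact hC.isLoc.not_vanishes_one h2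
    · have h4 := hC.isLoc.mul (hC.isLoc.cst_mem (-c⁻¹)) h2
      apply h1.crv_not_vanishes c⁻¹
      convert h4 using 1
      have := cst_ne_zero hc0
      rw [cst_neg, cst_inv]; field_simp; ring

/-- The curves through a point of the exceptional line: the line itself and the curves through
the center. -/
theorem curveOf_excSet {u v : KK} (h : IsChart u v) {R V : Subring KK} (hR : R ∈ excSet u v)
    (hV : CurveOf R V) : V = crv u (v / u) ∨ CurveOf (ptRing u v) V := by
  have key : IsCurve V → ptRing u v ≤ V → (∀ x ∈ ptRing u v, Vanishes V x → Vanishes (ptRing u v) x) →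
      (Vanishes V u → Vanishes V v → V = crv u (v / u)) →
      V = crv u (v / u) ∨ CurveOf (ptRing u v) V := by
    intro hC hle hvan hexc
    obtain ⟨θ, rfl, rfl⟩ := h
    have hch : IsChart (θ (coord 0)) (θ (coord 1)) := isChart_coord.map θ
    rcases hC.center_chart (hle hch.vanishes_left.1) (hle hch.vanishes_right.1) with
      ⟨π, rfl⟩ | ⟨a, b, ha, hb⟩
    · right
      rw [curveOf_ptRing_iff]
      refine ⟨π, ?_, rfl⟩
      have h1 := hvan (θ (algebraMap Poly KK π.1)) ?_ ?_
      · rwa [← aeval_coord, map_aeval, hch.vanishes_aeval] at h1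
      · rw [← aeval_coord, map_aeval]
        exact hch.isLoc.aeval_mem hch.vanishes_left.1 hch.vanishes_right.1 _
      · rw [vanishes_mapRing, IrrPoly.vanishes_ring]
    · left
      have ha' := hvan _ (sub_mem hch.vanishes_left.1 (hch.isLoc.cst_mem a)) ha
      have hb' := hvan _ (sub_mem hch.vanishes_right.1 (hch.isLoc.cst_mem b)) hb
      have ha0 := hch.isLoc.value_unique ha' (b := 0) (by simpa using hch.vanishes_left)
      have hb0 := hch.isLoc.value_unique hb' (b := 0) (by simpa using hch.vanishes_right)
      subst ha0 hb0
      rw [cst_zero, sub_zero] at ha hb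
      exact hexc ha hb
  rcases hR with ⟨c, rfl⟩ | rfl
  · have h' := h.sub_cst_div c
    have hC := hV.isCurve h'
    refine key hC ((h.ptRing_le_div c).trans hV.le) (fun x hx hv => ?_) fun hu _ => ?_
    · exact vanishes_of_le ((h.ptRing_le_div c).trans hV.le) hx hv
    · have hw : v / u - cst c ∈ V := hV.le h'.vanishes_right.1
      refine hC.eq_crv h.div hu (by simpa using add_mem hw (hC.isLoc.cst_mem c)) fun d hd => ?_
      obtain ⟨θ, h0, h1⟩ := h'
      rw [← h1, ← h0] at hV
      obtain ⟨π, -, rfl⟩ := curveOf_ptRing_iff.1 hV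
      refine not_vanishes_both (θ := θ) (π := π) (a := 0) (b := d - c) ?_ ?_
      · rwa [h0, cst_zero, sub_zero]
      · rw [h1, cst_sub]
        convert hd using 1; ring
  · have h' := h.div'
    have hC := hV.isCurve h'
    refine key hC (h.ptRing_le_div'.trans hV.le) (fun x hx hv => ?_) fun _ hv => ?_
    · exact vanishes_of_le (h.ptRing_le_div'.trans hV.le) hx hv
    · rw [← h.crv_div_swap]
      refine hC.eq_crv h.swap.div hv (hV.le h'.vanishes_left.1) fun d hd => ?_
      obtain ⟨θ, h0, h1⟩ := h'
      rw [← h0, ← h1] at hV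
      obtain ⟨π, -, rfl⟩ := curveOf_ptRing_iff.1 hV
      refine not_vanishes_both (θ := θ) (π := π) (a := d) (b := 0) ?_ ?_
      · rwa [h0]
      · rwa [h1, cst_zero, sub_zero]

/-! ### Orders of vanishing -/

theorem IrrPoly.factor (π : IrrPoly) {h : KK} (hh : h ≠ 0) : ∃ (k : ℤ) (a b : Poly), ¬ π.1 ∣ a ∧
    ¬ π.1 ∣ b ∧ h = algebraMap Poly KK a / algebraMap Poly KK b * algebraMap Poly KK π.1 ^ k := by
  obtain ⟨a, b, hb, rfl⟩ := exists_div h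
  have ha : a ≠ 0 := by rintro rfl; simp at hh
  obtain ⟨m, a', ha', rfl⟩ := WfDvdMonoid.max_power_factor ha π.2
  obtain ⟨n, b', hb', rfl⟩ := WfDvdMonoid.max_power_factor hb π.2
  have hπ := toKK_ne_zero π.2.ne_zero
  refine ⟨m - n, a', b', ha', hb', ?_⟩
  have := toKK_ne_zero (right_ne_zero_of_mul hb)
  rw [map_mul, map_mul, map_pow, map_pow, zpow_sub₀ hπ, zpow_natCast, zpow_natCast]
  field_simp

theorem IrrPoly.isUnit_iff {π : IrrPoly} (w : π.ring) : IsUnit w ↔ ∃ a b : Poly, ¬ π.1 ∣ a ∧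
    ¬ π.1 ∣ b ∧ (w : KK) = algebraMap Poly KK a / algebraMap Poly KK b := by
  constructor
  · intro hw
    obtain ⟨v, hv⟩ := hw.exists_right_inv
    obtain ⟨a, b, hb, hab⟩ := IrrPoly.mem_ring.1 w.2
    obtain ⟨c, d, hd, hcd⟩ := IrrPoly.mem_ring.1 v.2
    refine ⟨a, b, fun ha => ?_, hb, hab⟩
    have h1 : (w : KK) * (v : KK) = 1 := congrArg Subtype.val hv
    have hb0 : b ≠ 0 := by rintro rfl; exact hb (dvd_zero _)
    have hd0 : d ≠ 0 := by rintro rfl; exact hd (dvd_zero _)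
    rw [hab, hcd, div_mul_div_comm, div_eq_one_iff_eq (mul_ne_zero (toKK_ne_zero hb0)
      (toKK_ne_zero hd0)), ← map_mul, ← map_mul, (IsFractionRing.injective Poly KK).eq_iff] at h1
    exact (π.2.prime.dvd_or_dvd (h1 ▸ ha.mul_right c)).elim hb hd
  · rintro ⟨a, b, ha, hb, hab⟩
    have ha0 : a ≠ 0 := by rintro rfl; exact ha (dvd_zero _)
    have hb0 : b ≠ 0 := by rintro rfl; exact hb (dvd_zero _)
    refine IsUnit.of_mul_eq_one ⟨_, IrrPoly.mem_ring.2 ⟨b, a, ha, rfl⟩⟩ (Subtype.ext ?_)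
    change (w : KK) * (algebraMap Poly KK b / algebraMap Poly KK a) = 1
    rw [hab, div_mul_div_comm, mul_comm, div_self]
    exact mul_ne_zero (toKK_ne_zero hb0) (toKK_ne_zero ha0)

theorem IrrPoly.pow_unique {π : IrrPoly} {a b c d : Poly} {k l : ℤ} (ha : ¬ π.1 ∣ a)
    (hb : ¬ π.1 ∣ b) (hc : ¬ π.1 ∣ c) (hd : ¬ π.1 ∣ d)
    (h : algebraMap Poly KK a / algebraMap Poly KK b * algebraMap Poly KK π.1 ^ k =
      algebraMap Poly KK c / algebraMap Poly KK d * algebraMap Poly KK π.1 ^ l) : k = l := by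
  wlog hkl : k < l generalizing a b c d k l
  · rcases lt_trichotomy k l with h' | h' | h'
    · exact absurd h' hkl
    · exact h'
    · exact (this hc hd ha hb h.symm h').symm
  exfalso
  obtain ⟨n, rfl⟩ : ∃ n : ℕ, l = k + (n + 1 : ℕ) := ⟨(l - k - 1).toNat, by omega⟩
  have hπ := toKK_ne_zero π.2.ne_zero
  have hb0 : algebraMap Poly KK b ≠ 0 := toKK_ne_zero (by rintro rfl; exact hb (dvd_zero _))
  have hd0 : algebraMap Poly KK d ≠ 0 := toKK_ne_zero (by rintro rfl; exact hd (dvd_zero _))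
  rw [zpow_add₀ hπ, zpow_natCast, mul_comm (_ ^ k), ← mul_assoc] at h
  have h1 := mul_right_cancel₀ (zpow_ne_zero k hπ) h
  rw [div_mul_eq_mul_div, div_eq_div_iff hb0 hd0, ← map_pow, ← map_mul, ← map_mul, ← map_mul,
    (IsFractionRing.injective Poly KK).eq_iff] at h1
  have : π.1 ∣ a * d := by
    rw [h1, pow_succ]
    exact Dvd.intro_left (c * π.1 ^ n * b) (by ring)
  exact (π.2.prime.dvd_or_dvd this).elim ha hd

theorem IrrPoly.hasOrder_iff {π : IrrPoly} {h : KK} {k : ℤ} : HasOrder π.ring h k ↔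
    ∃ a b : Poly, ¬ π.1 ∣ a ∧ ¬ π.1 ∣ b ∧
      h = algebraMap Poly KK a / algebraMap Poly KK b * algebraMap Poly KK π.1 ^ k := by
  have hπ := toKK_ne_zero π.2.ne_zero
  have hmem : algebraMap Poly KK π.1 ∈ π.ring := algebraMap_mem_ring π _
  have hnu : ¬ IsUnit (⟨_, hmem⟩ : π.ring) := by
    rw [IrrPoly.isUnit_iff]
    rintro ⟨a, b, ha, hb, h⟩
    have h1 : ¬ π.1 ∣ 1 := π.2.prime.not_dvd_one
    have := IrrPoly.pow_unique (k := 0) (l := 1) ha hb h1 h1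
      (by rw [zpow_zero, mul_one, ← h]; simp)
    omega
  constructor
  · rintro ⟨t, w, ht, hw, rfl⟩
    have ht0 : (t : KK) ≠ 0 := fun h => ht.ne_zero (Subtype.ext h)
    obtain ⟨m, a, b, ha, hb, hab⟩ := π.factor ht0
    obtain ⟨c, d, hc, hd, hcd⟩ := (IrrPoly.isUnit_iff w).1 hw
    have hu : algebraMap Poly KK a / algebraMap Poly KK b ∈ π.ring :=
      IrrPoly.mem_ring.2 ⟨a, b, hb, rfl⟩
    have huu : IsUnit (⟨_, hu⟩ : π.ring) := (IrrPoly.isUnit_iff _).2 ⟨a, b, ha, hb, rfl⟩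
    have hm : m = 1 := by
      rcases lt_trichotomy m 0 with hm | hm | hm
      · exfalso
        obtain ⟨c', d', hd', h'⟩ := IrrPoly.mem_ring.1 t.2
        have hc0 : algebraMap Poly KK c' / algebraMap Poly KK d' ≠ 0 := h' ▸ ht0
        have hcc : c' ≠ 0 := by rintro rfl; simp at hc0
        obtain ⟨n, c'', hc'', rfl⟩ := WfDvdMonoid.max_power_factor hcc π.2
        have := IrrPoly.pow_unique (k := m) (l := n) ha hb hc'' hd' (by
          rw [← hab, h', map_mul, map_pow, zpow_natCast]; ring)
        omega
      · exfalso
        subst hm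
        apply ht.not_isUnit
        convert huu using 1
        exact Subtype.ext (by simpa using hab)
      · by_contra hm1
        obtain ⟨n, rfl⟩ : ∃ n : ℕ, m = ((n + 1 : ℕ) : ℤ) + 1 := ⟨(m - 2).toNat, by omega⟩
        have heq : t = (⟨_, hmem⟩ : π.ring) * ((⟨_, hu⟩ : π.ring) * (⟨_, hmem⟩ : π.ring) ^ (n + 1)) := by
          apply Subtype.ext
          rw [hab, zpow_add₀ hπ, zpow_natCast, zpow_one]
          push_cast; ring
        rcases ht.isUnit_or_isUnit heq with h1 | h1
        · exact hnu h1
        · rw [pow_succ, ← mul_assoc] at h1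
          exact hnu (isUnit_of_mul_isUnit_right h1)
    subst hm
    rw [zpow_one] at hab
    refine ⟨c * (if 0 ≤ k then a ^ k.toNat else b ^ (-k).toNat),
      d * (if 0 ≤ k then b ^ k.toNat else a ^ (-k).toNat), ?_, ?_, ?_⟩
    · refine π.2.prime.not_dvd_mul hc ?_
      split_ifs
      · exact fun h => ha (π.2.prime.dvd_of_dvd_pow h)
      · exact fun h => hb (π.2.prime.dvd_of_dvd_pow h)
    · refine π.2.prime.not_dvd_mul hd ?_
      split_ifs
      · exact fun h => hb (π.2.prime.dvd_of_dvd_pow h)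
      · exact fun h => ha (π.2.prime.dvd_of_dvd_pow h)
    · rw [hcd, hab, mul_zpow, div_zpow, map_mul, map_mul]
      split_ifs with hk
      · have : k = (k.toNat : ℤ) := by omega
        rw [this, zpow_natCast, zpow_natCast, map_pow, map_pow]
        simp only [Int.toNat_natCast]
        rw [mul_div_mul_comm]; ring
      · have : k = -((-k).toNat : ℤ) := by omega
        rw [this, zpow_neg, zpow_neg, zpow_natCast, zpow_natCast, map_pow, map_pow]
        simp only [neg_neg, Int.toNat_natCast]
        rw [mul_div_mul_comm, inv_div_inv]; ring
  · rintro ⟨a, b, ha, hb, rfl⟩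
    have hu : algebraMap Poly KK a / algebraMap Poly KK b ∈ π.ring :=
      IrrPoly.mem_ring.2 ⟨a, b, hb, rfl⟩
    refine ⟨⟨_, hmem⟩, ⟨_, hu⟩, ⟨hnu, ?_⟩, (IrrPoly.isUnit_iff _).2 ⟨a, b, ha, hb, rfl⟩, rfl⟩
    rintro ⟨x, hx⟩ ⟨y, hy⟩ hxy
    obtain ⟨a, b, hb, rfl⟩ := IrrPoly.mem_ring.1 hx
    obtain ⟨c, d, hd, rfl⟩ := IrrPoly.mem_ring.1 hy
    have h1 : algebraMap Poly KK π.1 = algebraMap Poly KK a / algebraMap Poly KK b *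
        (algebraMap Poly KK c / algebraMap Poly KK d) := congrArg Subtype.val hxy
    have hb0 : algebraMap Poly KK b ≠ 0 := toKK_ne_zero (by rintro rfl; exact hb (dvd_zero _))
    have hd0 : algebraMap Poly KK d ≠ 0 := toKK_ne_zero (by rintro rfl; exact hd (dvd_zero _))
    rw [div_mul_div_comm, eq_div_iff (mul_ne_zero hb0 hd0), ← map_mul, ← map_mul, ← map_mul,
      (IsFractionRing.injective Poly KK).eq_iff] at h1
    by_cases ha : π.1 ∣ a
    · right
      rw [IrrPoly.isUnit_iff]
      refine ⟨c, d, fun hc => ?_, hd, rfl⟩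
      obtain ⟨a', rfl⟩ := ha
      obtain ⟨c', rfl⟩ := hc
      have h2 : b * d = π.1 * (a' * c') := by
        apply mul_left_cancel₀ π.2.ne_zero; rw [h1]; ring
      exact (π.2.prime.dvd_or_dvd ⟨_, h2⟩).elim hb hd
    · exact Or.inl ((IrrPoly.isUnit_iff _).2 ⟨a, b, ha, hb, rfl⟩)

theorem HasOrder.map {V : Subring KK} {h : KK} {k : ℤ} (H : HasOrder V h k) (θ : KK ≃ₐ[ℂ] KK) :
    HasOrder (mapRing θ V) (θ h) k := by
  obtain ⟨t, w, ht, hw, rfl⟩ := H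
  let e : V ≃+* mapRing θ V := RingEquiv.subringMap (RingEquivClass.toRingEquiv θ)
  refine ⟨e t, e w, (MulEquiv.irreducible_iff e).2 ht, hw.map e, ?_⟩
  rw [map_mul, map_zpow₀]; rfl

theorem hasOrder_mapRing {V : Subring KK} {h : KK} {k : ℤ} {θ : KK ≃ₐ[ℂ] KK} :
    HasOrder (mapRing θ V) (θ h) k ↔ HasOrder V h k :=
  ⟨fun H => by simpa only [mapRing_symm_mapRing, AlgEquiv.symm_apply_apply] using H.map θ.symm,
    fun H => H.map θ⟩

theorem hasOrder_mapRing' {V : Subring KK} {h : KK} {k : ℤ} {θ : KK ≃ₐ[ℂ] KK} :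
    HasOrder (mapRing θ V) h k ↔ HasOrder V (θ.symm h) k := by
  conv_lhs => rw [← θ.apply_symm_apply h]
  exact hasOrder_mapRing

theorem HasOrder.ne_zero {V : Subring KK} {h : KK} {k : ℤ} (H : HasOrder V h k) : h ≠ 0 := by
  obtain ⟨t, w, ht, hw, rfl⟩ := H
  have ht0 : (t : KK) ≠ 0 := fun h => ht.ne_zero (Subtype.ext h)
  have hw0 : (w : KK) ≠ 0 := fun h => hw.ne_zero (Subtype.ext h)
  exact mul_ne_zero hw0 (zpow_ne_zero _ ht0)

section Curve

variable {V : Subring KK}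

theorem IsCurve.exists_hasOrder (hV : IsCurve V) {h : KK} (hh : h ≠ 0) : ∃ k, HasOrder V h k := by
  obtain ⟨θ, π, rfl⟩ := hV
  obtain ⟨k, a, b, ha, hb, hab⟩ := π.factor (h := θ.symm h) (by simpa using hh)
  exact ⟨k, hasOrder_mapRing'.2 (IrrPoly.hasOrder_iff.2 ⟨a, b, ha, hb, hab⟩)⟩

theorem IsCurve.hasOrder_unique (hV : IsCurve V) {h : KK} {k l : ℤ} (hk : HasOrder V h k)
    (hl : HasOrder V h l) : k = l := by
  obtain ⟨θ, π, rfl⟩ := hV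
  obtain ⟨a, b, ha, hb, h1⟩ := IrrPoly.hasOrder_iff.1 (hasOrder_mapRing'.1 hk)
  obtain ⟨c, d, hc, hd, h2⟩ := IrrPoly.hasOrder_iff.1 (hasOrder_mapRing'.1 hl)
  exact IrrPoly.pow_unique ha hb hc hd (h1.symm.trans h2)

theorem IsCurve.hasOrder_mul (hV : IsCurve V) {h h' : KK} {k l : ℤ} (hk : HasOrder V h k)
    (hl : HasOrder V h' l) : HasOrder V (h * h') (k + l) := by
  obtain ⟨θ, π, rfl⟩ := hV
  rw [hasOrder_mapRing', IrrPoly.hasOrder_iff] at *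
  obtain ⟨a, b, ha, hb, h1⟩ := hk
  obtain ⟨c, d, hc, hd, h2⟩ := hl
  refine ⟨a * c, b * d, π.2.prime.not_dvd_mul ha hc, π.2.prime.not_dvd_mul hb hd, ?_⟩
  rw [map_mul θ.symm, h1, h2, map_mul, map_mul, zpow_add₀ (toKK_ne_zero π.2.ne_zero),
    mul_div_mul_comm]
  ring

theorem IsCurve.hasOrder_inv (hV : IsCurve V) {h : KK} {k : ℤ} (hk : HasOrder V h k) :
    HasOrder V h⁻¹ (-k) := by
  obtain ⟨θ, π, rfl⟩ := hV
  rw [hasOrder_mapRing', IrrPoly.hasOrder_iff] at *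
  obtain ⟨a, b, ha, hb, h1⟩ := hk
  exact ⟨b, a, hb, ha, by rw [map_inv₀, h1, mul_inv, inv_div, zpow_neg]⟩

theorem IsCurve.hasOrder_div (hV : IsCurve V) {h h' : KK} {k l : ℤ} (hk : HasOrder V h k)
    (hl : HasOrder V h' l) : HasOrder V (h / h') (k - l) := by
  rw [div_eq_mul_inv, sub_eq_add_neg]
  exact hV.hasOrder_mul hk (hV.hasOrder_inv hl)

theorem IsCurve.hasOrder_one (hV : IsCurve V) : HasOrder V 1 0 := by
  obtain ⟨k, hk⟩ := hV.exists_hasOrder one_ne_zero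
  have := hV.hasOrder_mul hk (hV.hasOrder_inv hk)
  simpa using this

theorem IsCurve.mem_iff (hV : IsCurve V) {h : KK} {k : ℤ} (hk : HasOrder V h k) :
    h ∈ V ↔ 0 ≤ k := by
  obtain ⟨θ, π, rfl⟩ := hV
  rw [hasOrder_mapRing', IrrPoly.hasOrder_iff] at *
  rw [mem_mapRing]
  obtain ⟨a, b, ha, hb, h1⟩ := hk
  constructor
  · intro hm
    obtain ⟨c, d, hd, h2⟩ := IrrPoly.mem_ring.1 hm
    have hc : c ≠ 0 := by
      rintro rfl
      rw [h2] at h1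
      have ha0 := toKK_ne_zero (show a ≠ 0 by rintro rfl; exact ha (dvd_zero _))
      have hb0 := toKK_ne_zero (show b ≠ 0 by rintro rfl; exact hb (dvd_zero _))
      have hπ := zpow_ne_zero k (toKK_ne_zero π.2.ne_zero)
      rw [map_zero, zero_div, eq_comm, mul_eq_zero, div_eq_zero_iff] at h1
      tauto
    obtain ⟨n, c', hc', rfl⟩ := WfDvdMonoid.max_power_factor hc π.2
    have := IrrPoly.pow_unique (k := k) (l := n) ha hb hc' hd (by
      rw [← h1, h2, map_mul, map_pow, zpow_natCast]; ring)
    omega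
  · intro hk
    obtain ⟨n, rfl⟩ := Int.eq_ofNat_of_zero_le hk
    rw [h1, zpow_natCast, IrrPoly.mem_ring]
    exact ⟨a * π.1 ^ n, b, hb, by rw [map_mul, map_pow]; ring⟩

theorem IsCurve.vanishes_iff (hV : IsCurve V) {h : KK} {k : ℤ} (hk : HasOrder V h k) :
    Vanishes V h ↔ 0 < k := by
  rw [Vanishes, hV.mem_iff hk, hV.mem_iff (hV.hasOrder_inv hk), or_iff_right hk.ne_zero]
  omega

theorem IsCurve.hasOrder_zero_iff (hV : IsCurve V) {h : KK} :
    HasOrder V h 0 ↔ h ∈ V ∧ ¬ Vanishes V h := by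
  constructor
  · intro h0
    rw [hV.vanishes_iff h0, hV.mem_iff h0]; simp
  · rintro ⟨h1, h2⟩
    have hne : h ≠ 0 := fun h0 => h2 ⟨h1, Or.inl h0⟩
    obtain ⟨k, hk⟩ := hV.exists_hasOrder hne
    rw [hV.vanishes_iff hk] at h2
    rw [hV.mem_iff hk] at h1
    have : k = 0 := by omega
    exact this ▸ hk

theorem IsCurve.hasOrder_cst (hV : IsCurve V) {c : ℂ} (hc : c ≠ 0) : HasOrder V (cst c) 0 :=
  hV.hasOrder_zero_iff.2 ⟨hV.isLoc.cst_mem c, fun h => hc ((hV.isLoc.vanishes_cst c).1 h)⟩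

end Curve

theorem IrrPoly.hasOrder_self (π : IrrPoly) : HasOrder π.ring (algebraMap Poly KK π.1) 1 :=
  IrrPoly.hasOrder_iff.2 ⟨1, 1, π.2.prime.not_dvd_one, π.2.prime.not_dvd_one, by simp⟩

theorem IrrPoly.hasOrder_zero {π : IrrPoly} {a : Poly} (h : ¬ π.1 ∣ a) :
    HasOrder π.ring (algebraMap Poly KK a) 0 :=
  IrrPoly.hasOrder_iff.2 ⟨a, 1, h, π.2.prime.not_dvd_one, by simp⟩

theorem IsChart.hasOrder_left {u w : KK} (h : IsChart u w) : HasOrder (crv u w) u 1 := by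
  obtain ⟨θ, rfl, rfl⟩ := h
  rw [crv_eq, hasOrder_mapRing]
  exact (irrX 0).hasOrder_self

theorem not_X_dvd {P : Poly} (b : ℂ) (h : eval ![0, b] P ≠ 0) : ¬ X 0 ∣ P := by
  rintro ⟨Q, rfl⟩
  simp at h

theorem IsChart.hasOrder_aeval {u w : KK} (h : IsChart u w) {P : Poly} (b : ℂ)
    (hP : eval ![0, b] P ≠ 0) : HasOrder (crv u w) (aeval ![u, w] P) 0 := by
  obtain ⟨θ, rfl, rfl⟩ := h
  rw [crv_eq, ← map_aeval, aeval_coord, hasOrder_mapRing]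
  exact IrrPoly.hasOrder_zero (not_X_dvd b hP)

theorem IsChart.hasOrder_right {u w : KK} (h : IsChart u w) : HasOrder (crv u w) w 0 := by
  have := h.hasOrder_aeval (P := X 1) 1 (by simp)
  simpa using this

theorem IsChart.hasOrder_right_sub {u w : KK} (h : IsChart u w) (c : ℂ) :
    HasOrder (crv u w) (w - cst c) 0 := by
  have := h.hasOrder_aeval (P := X 1 - C c) (c + 1) (by simp)
  simpa [cst] using this

open Classical in
/-- The order of vanishing along a curve, as a function. -/
def ord (V : Subring KK) (h : KK) : ℤ := if H : ∃ k, HasOrder V h k then H.choose else 0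

theorem IsCurve.hasOrder_ord {V : Subring KK} (hV : IsCurve V) {h : KK} (hh : h ≠ 0) :
    HasOrder V h (ord V h) := by
  have H := hV.exists_hasOrder hh
  rw [ord, dif_pos H]; exact H.choose_spec

theorem IsLoc.value_inv {B : Subring KK} (hB : IsLoc B) {x : KK} {a : ℂ} (hx : x ≠ 0)
    (h : Vanishes B (x - cst a)) (hinv : x⁻¹ ∈ B) : ∃ b, Vanishes B (x⁻¹ - cst b) := by
  have ha : a ≠ 0 := by
    rintro rfl
    rw [cst_zero, sub_zero] at h
    rcases h.2 with h' | h'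
    · exact hx h'
    · exact h' hinv
  refine ⟨a⁻¹, ?_⟩
  have := hB.mul (mul_mem (hB.cst_mem (-a⁻¹)) hinv) h
  convert this using 1
  have := cst_ne_zero ha
  rw [cst_neg, cst_inv]; field_simp; ring

theorem IsChart.crv_inv {u w : KK} (h : IsChart u w) : crv u w⁻¹ = crv u w := by
  have hC := h.isCurve
  symm
  refine hC.eq_crv h.inv h.crv_vanishes_left ?_ fun c hc => ?_
  · by_contra hn
    exact h.crv_not_vanishes 0 (by rw [cst_zero, sub_zero]; exact ⟨h.crv_mem_right, Or.inr hn⟩)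
  · obtain ⟨b, hb⟩ := hC.isLoc.value_inv (inv_ne_zero h.swap.ne_zero) hc
      (by rw [inv_inv]; exact h.crv_mem_right)
    rw [inv_inv] at hb
    exact h.crv_not_vanishes b hb

theorem IsChart.crv_sub {u w : KK} (h : IsChart u w) (c : ℂ) : crv u (w - cst c) = crv u w := by
  have hC := h.isCurve
  symm
  refine hC.eq_crv (h.sub_cst c) h.crv_vanishes_left
    (sub_mem h.crv_mem_right (hC.isLoc.cst_mem c)) fun d hd => ?_
  apply h.crv_not_vanishes (c + d)
  rwa [cst_add, ← sub_sub]

/-! ### Curves on the product of two lines -/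

theorem isChart_of_lineParams {u v s t : KK} (h : IsChart u v) (hs : s ∈ lineParams u)
    (ht : t ∈ lineParams v) : IsChart s t := by
  have h1 : IsChart u t := by
    rcases ht with ⟨c, rfl⟩ | rfl
    · exact h.sub_cst c
    · exact h.inv
  rcases hs with ⟨c, rfl⟩ | rfl
  · exact (h1.swap.sub_cst c).swap
  · exact h1.swap.inv.swap

theorem IsChart.crv_lineParams {u w t : KK} (h : IsChart u w) (ht : t ∈ lineParams w) :
    crv u t = crv u w := by
  rcases ht with ⟨c, rfl⟩ | rfl
  · exact h.crv_sub c
  · exact h.crv_inv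

/-- The line at infinity `z_i = ∞`. -/
def lineInf (i : Fin 2) : Subring KK := crv (coord i)⁻¹ (coord (1 - i))

theorem isChart_lineInf (i : Fin 2) : IsChart (coord i)⁻¹ (coord (1 - i)) := by
  fin_cases i
  · exact isChart_coord.swap.inv.swap
  · exact isChart_coord.inv.swap

theorem lineInf_zero : lineInf 0 = crv (coord 0)⁻¹ (coord 1) := rfl
theorem lineInf_one : lineInf 1 = crv (coord 1)⁻¹ (coord 0) := rfl

theorem isCurve_lineInf (i : Fin 2) : IsCurve (lineInf i) := (isChart_lineInf i).isCurve

theorem coord_ne_zero (i : Fin 2) : coord i ≠ 0 := by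
  fin_cases i
  · exact isChart_coord.ne_zero
  · exact isChart_coord.swap.ne_zero

theorem coord_mem_of_param {V : Subring KK} (hV : IsLoc V) {i : Fin 2} {s : KK}
    (hs : s ∈ lineParams (coord i)) (hsV : s ∈ V) (hinf : ¬ Vanishes V (coord i)⁻¹) :
    coord i ∈ V := by
  rcases hs with ⟨c, rfl⟩ | rfl
  · simpa using add_mem hsV (hV.cst_mem c)
  · by_contra h
    exact hinf ⟨hsV, Or.inr (by rwa [inv_inv])⟩

theorem value_param {V : Subring KK} (hV : IsLoc V) {x s : KK} {a : ℂ} (hx : x ≠ 0)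
    (hs : s ∈ lineParams x) (hsV : s ∈ V) (h : Vanishes V (x - cst a)) :
    ∃ b, Vanishes V (s - cst b) := by
  rcases hs with ⟨c, rfl⟩ | rfl
  · exact ⟨a - c, by rwa [cst_sub, sub_sub_sub_cancel_right]⟩
  · exact hV.value_inv hx h hsV

theorem curveOf_P1P1 {R V : Subring KK} (hR : R ∈ P1P1) (hV : CurveOf R V) :
    (∃ π : IrrPoly, V = π.ring) ∨ ∃ i, V = lineInf i := by
  obtain ⟨s, hs, t, ht, rfl⟩ := hR
  have hst := isChart_of_lineParams isChart_coord hs ht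
  have hC := hV.isCurve hst
  have hsV := hV.le hst.vanishes_left.1
  have htV := hV.le hst.vanishes_right.1
  have hnot : ∀ a b, Vanishes V (s - cst a) → Vanishes V (t - cst b) → False := by
    intro a b ha hb
    obtain ⟨θ, rfl, rfl⟩ := hst
    obtain ⟨π, -, rfl⟩ := curveOf_ptRing_iff.1 hV
    exact not_vanishes_both ha hb
  by_cases h0 : Vanishes V (coord 0)⁻¹
  · right
    refine ⟨0, ?_⟩
    have hs' : s = (coord 0)⁻¹ := by
      rcases hs with ⟨c, rfl⟩ | rfl
      · exact absurd h0 (not_vanishes_inv (coord_ne_zero 0)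
          (by simpa using add_mem hsV (hC.isLoc.cst_mem c)))
      · rfl
    subst hs'
    rw [lineInf_zero, ← isChart_coord.swap.inv.swap.crv_lineParams ht]
    exact hC.eq_crv hst h0 htV fun c hc => hnot 0 c (by rwa [cst_zero, sub_zero]) hc
  by_cases h1 : Vanishes V (coord 1)⁻¹
  · right
    refine ⟨1, ?_⟩
    have ht' : t = (coord 1)⁻¹ := by
      rcases ht with ⟨c, rfl⟩ | rfl
      · exact absurd h1 (not_vanishes_inv (coord_ne_zero 1)
          (by simpa using add_mem htV (hC.isLoc.cst_mem c)))
      · rfl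
    subst ht'
    rw [lineInf_one, ← isChart_coord.inv.swap.crv_lineParams hs]
    exact hC.eq_crv hst.swap h1 hsV fun c hc => hnot c 0 hc (by rwa [cst_zero, sub_zero])
  · rcases hC.center (coord_mem_of_param hC.isLoc hs hsV h0)
      (coord_mem_of_param hC.isLoc ht htV h1) with h | ⟨c, hc⟩
    · exact Or.inl h
    · exfalso
      obtain ⟨a, ha⟩ := value_param hC.isLoc (coord_ne_zero 0) hs hsV (hc 0)
      obtain ⟨b, hb⟩ := value_param hC.isLoc (coord_ne_zero 1) ht htV (hc 1)
      exact hnot a b ha hb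

/-! ### Points on curves -/

theorem IsChart.curveOf_crv {u w : KK} (h : IsChart u w) (c : ℂ) :
    CurveOf (ptRing u (w - cst c)) (crv u w) := by
  rw [← h.crv_sub c]
  obtain ⟨θ, h0, h1⟩ := h.sub_cst c
  rw [← h1, ← h0, curveOf_ptRing_iff, crv_eq]
  exact ⟨irrX 0, by simp [irrX], rfl⟩

theorem IrrPoly.curveOf {π : IrrPoly} {c : Fin 2 → ℂ} (hc : eval c π.1 = 0) :
    CurveOf (ptRing (coord 0 - cst (c 0)) (coord 1 - cst (c 1))) π.ring := by
  have hch : IsChart (coord 0 - cst (c 0)) (coord 1 - cst (c 1)) :=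
    isChart_of_lineParams isChart_coord (Or.inl ⟨_, rfl⟩) (Or.inl ⟨_, rfl⟩)
  have hle : ptRing (coord 0 - cst (c 0)) (coord 1 - cst (c 1)) ≤ π.ring := by
    rintro _ ⟨P, Q, hQ, hQ', rfl⟩
    let τ : Poly →ₐ[ℂ] Poly := aeval ![X 0 - C (c 0), X 1 - C (c 1)]
    have hτ : ∀ P : Poly, aeval ![coord 0 - cst (c 0), coord 1 - cst (c 1)] P =
        algebraMap Poly KK (τ P) := by
      intro P
      have : (aeval ![coord 0 - cst (c 0), coord 1 - cst (c 1)] : Poly →ₐ[ℂ] KK) =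
          (IsScalarTower.toAlgHom ℂ Poly KK).comp τ := by
        ext i
        fin_cases i <;> simp [τ, coord, cst_eq_algebraMap]
      rw [this]; rfl
    have hev : ∀ P : Poly, eval c (τ P) = constantCoeff P := by
      intro P
      have : (aeval c : Poly →ₐ[ℂ] ℂ).comp τ = aeval 0 := by
        ext i
        fin_cases i <;> simp [τ]
      have h2 := congrArg (fun f => f P) this
      simp only [AlgHom.comp_apply, aeval_eq_eval] at h2
      rw [← eval_zero, ← h2]
    rw [hτ, hτ, IrrPoly.mem_ring]
    refine ⟨τ P, τ Q, fun h => hQ ?_, rfl⟩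
    obtain ⟨S, hS⟩ := h
    rw [← hev, hS, map_mul, hc, zero_mul]
  obtain ⟨θ, h0, h1⟩ := hch
  rw [← h0, ← h1] at hle ⊢
  have hch : IsChart (θ (coord 0)) (θ (coord 1)) := ⟨θ, rfl, rfl⟩
  rcases π.isCurve.center_chart (hle hch.vanishes_left.1) (hle hch.vanishes_right.1) with
    ⟨ρ, hρ⟩ | ⟨a, b, ha, hb⟩
  · rw [curveOf_ptRing_iff]
    refine ⟨ρ, ?_, hρ⟩
    have hmem : θ (algebraMap Poly KK ρ.1) ∈ ptRing (θ (coord 0)) (θ (coord 1)) := by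
      rw [← aeval_coord, map_aeval]
      exact hch.isLoc.aeval_mem hch.vanishes_left.1 hch.vanishes_right.1 _
    have h3 := vanishes_of_le hle hmem (by rw [hρ, vanishes_mapRing, IrrPoly.vanishes_ring])
    rwa [← aeval_coord, map_aeval, hch.vanishes_aeval] at h3
  · exfalso
    rw [h0, sub_sub, ← cst_add] at ha
    rw [h1, sub_sub, ← cst_add] at hb
    refine not_vanishes_both (θ := AlgEquiv.refl) (π := π) (a := c 0 + a) (b := c 1 + b) ?_ ?_
    · rwa [mapRing_refl]
    · rwa [mapRing_refl]

theorem exists_ptRing_notMem {u w : KK} (h : IsChart u w) {F : Set (Subring KK)} (hF : F.Finite) :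
    ∃ c : ℂ, ptRing u (w - cst c) ∉ F := by
  have hinj : Function.Injective fun c : ℂ => ptRing u (w - cst c) := by
    intro a b hab
    have hab' : ptRing u (w - cst a) = ptRing u (w - cst b) := hab
    have h1 := (h.sub_cst a).vanishes_right
    have h2 := (h.sub_cst b).vanishes_right
    rw [← hab'] at h2
    exact (h.sub_cst a).isLoc.value_unique h1 h2
  obtain ⟨R, ⟨c, rfl⟩, hR⟩ := (Set.infinite_range_of_injective hinj).exists_notMem_finite hF
  exact ⟨c, hR⟩

theorem IrrPoly.exists_point (π : IrrPoly) {F : Set (Subring KK)} (hF : F.Finite) :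
    ∃ c : Fin 2 → ℂ, eval c π.1 = 0 ∧
      ptRing (coord 0 - cst (c 0)) (coord 1 - cst (c 1)) ∉ F := by
  have hch : ∀ c : Fin 2 → ℂ, IsChart (coord 0 - cst (c 0)) (coord 1 - cst (c 1)) := fun c =>
    isChart_of_lineParams isChart_coord (Or.inl ⟨_, rfl⟩) (Or.inl ⟨_, rfl⟩)
  have hinj : Function.Injective fun c : Fin 2 → ℂ =>
      ptRing (coord 0 - cst (c 0)) (coord 1 - cst (c 1)) := by
    intro a b hab
    have hab' : ptRing (coord 0 - cst (a 0)) (coord 1 - cst (a 1)) =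
      ptRing (coord 0 - cst (b 0)) (coord 1 - cst (b 1)) := hab
    have h0 := (hch b).vanishes_left
    have h1 := (hch b).vanishes_right
    rw [← hab'] at h0 h1
    funext i
    fin_cases i
    · exact (hch a).isLoc.value_unique (hch a).vanishes_left h0
    · exact (hch a).isLoc.value_unique (hch a).vanishes_right h1
  obtain ⟨R, ⟨c, hc, rfl⟩, hR⟩ :=
    ((infinite_zeros π.2).image hinj.injOn).exists_notMem_finite hF
  exact ⟨c, hc, hR⟩

/-! ### Iterated blowups -/

theorem blowUp_eq (S : Set (Subring KK)) (p : KK × KK) :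
    blowUp S p = (S \ {ptRing p.1 p.2}) ∪ excSet p.1 p.2 := Set.union_assoc _ _ _

theorem mem_foldl_blowUp (l : List (KK × KK)) (S : Set (Subring KK)) {R : Subring KK}
    (h : R ∈ l.foldl blowUp S) : R ∈ S ∨ ∃ p ∈ l, R ∈ excSet p.1 p.2 := by
  induction l generalizing S with
  | nil => exact Or.inl h
  | cons p l ih =>
    rcases ih _ h with h | ⟨p', hp', h⟩
    · rw [blowUp_eq] at h
      rcases h with h | h
      · exact Or.inl h.1
      · exact Or.inr ⟨p, by simp, h⟩
    · exact Or.inr ⟨p', by simp [hp'], h⟩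

theorem mem_foldl_blowUp_of (l : List (KK × KK)) (S : Set (Subring KK)) {R : Subring KK}
    (h : R ∈ S ∨ ∃ p ∈ l, R ∈ excSet p.1 p.2) (hne : ∀ p ∈ l, R ≠ ptRing p.1 p.2) :
    R ∈ l.foldl blowUp S := by
  induction l generalizing S with
  | nil => simpa using h
  | cons p l ih =>
    refine ih _ ?_ fun p' hp' => hne p' (by simp [hp'])
    rw [blowUp_eq]
    rcases h with h | ⟨p', hp', h⟩
    · exact Or.inl (Or.inl ⟨h, hne p (by simp)⟩)
    · rcases List.mem_cons.1 hp' with rfl | hp'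
      · exact Or.inl (Or.inr h)
      · exact Or.inr ⟨p', hp', h⟩

namespace PointConfig

variable (C : PointConfig)

/-- The local ring of the `i`-th point. -/
def ctr (i : Fin 8) : Subring KK := ptRing (C.loc i).1 (C.loc i).2

/-- The local ring of the `i`-th exceptional line. -/
def exc (i : Fin 8) : Subring KK := crv (C.loc i).1 ((C.loc i).2 / (C.loc i).1)

/-- The points of the `i`-th exceptional line before the later points are blown up. -/
def excPts (i : Fin 8) : Set (Subring KK) := excSet (C.loc i).1 (C.loc i).2

theorem mem_surface {R : Subring KK} (h : R ∈ C.surface) : R ∈ P1P1 ∨ ∃ i, R ∈ C.excPts i := by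
  rcases mem_foldl_blowUp _ _ h with h | ⟨p, hp, h⟩
  · exact Or.inl h
  · obtain ⟨i, rfl⟩ := (List.mem_ofFn' _ _).1 hp
    exact Or.inr ⟨i, h⟩

theorem mem_surface_of {R : Subring KK} (h : R ∈ P1P1 ∨ ∃ i, R ∈ C.excPts i)
    (hne : ∀ i, R ≠ C.ctr i) : R ∈ C.surface := by
  refine mem_foldl_blowUp_of _ _ (h.imp id fun ⟨i, hi⟩ => ⟨_, (List.mem_ofFn' _ _).2 ⟨i, rfl⟩, hi⟩) ?_
  intro p hp
  obtain ⟨i, rfl⟩ := (List.mem_ofFn' _ _).1 hp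
  exact hne i

/-- Every center is a point of the surface on which it is blown up, given by a chart, and the
points and the exceptional lines are distinct. -/
structure Valid : Prop where
  chart : ∀ i, IsChart (C.loc i).1 (C.loc i).2
  center : ∀ i, C.ctr i ∈ P1P1 ∨ ∃ j < i, C.ctr i ∈ C.excPts j
  injective : Function.Injective C.exc
  ctr_injective : Function.Injective C.ctr

variable {C} (hC : C.Valid)

include hC

theorem Valid.isCurve_exc (i : Fin 8) : IsCurve (C.exc i) := (hC.chart i).div.isCurve

theorem Valid.isPrimeDivisor_iff {V : Subring KK} : IsPrimeDivisor C.surface V ↔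
    (∃ π : IrrPoly, V = π.ring) ∨ (∃ i, V = lineInf i) ∨ ∃ i, V = C.exc i := by
  have hfin : (Set.range C.ctr).Finite := Set.finite_range _
  constructor
  · rintro ⟨R, hR, hRV⟩
    have key : ∀ i, CurveOf (C.ctr i) V →
        (∃ π : IrrPoly, V = π.ring) ∨ (∃ i, V = lineInf i) ∨ ∃ i, V = C.exc i := by
      intro i
      induction i using WellFoundedLT.induction with
      | ind i ih =>
        intro hV
        rcases hC.center i with h | ⟨j, hj, h⟩
        · exact (curveOf_P1P1 h hV).imp id Or.inl
        · rcases curveOf_excSet (hC.chart j) h hV with h | h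
          · exact Or.inr (Or.inr ⟨j, h⟩)
          · exact ih j hj h
    rcases C.mem_surface hR with h | ⟨i, h⟩
    · exact (curveOf_P1P1 h hRV).imp id Or.inl
    · rcases curveOf_excSet (hC.chart i) h hRV with h | h
      · exact Or.inr (Or.inr ⟨i, h⟩)
      · exact key i h
  · rintro (⟨π, rfl⟩ | ⟨i, rfl⟩ | ⟨i, rfl⟩)
    · obtain ⟨c, hc, hR⟩ := π.exists_point hfin
      refine ⟨_, C.mem_surface_of (Or.inl ?_) fun i h => hR ⟨i, h.symm⟩, IrrPoly.curveOf hc⟩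
      exact ⟨_, Or.inl ⟨_, rfl⟩, _, Or.inl ⟨_, rfl⟩, rfl⟩
    · obtain ⟨c, hR⟩ := exists_ptRing_notMem (isChart_lineInf i) hfin
      refine ⟨_, C.mem_surface_of (Or.inl ?_) fun i h => hR ⟨i, h.symm⟩,
        (isChart_lineInf i).curveOf_crv c⟩
      fin_cases i
      · exact ⟨_, Or.inr rfl, _, Or.inl ⟨c, rfl⟩, rfl⟩
      · exact ⟨_, Or.inl ⟨c, rfl⟩, _, Or.inr rfl, ptRing_swap _ _⟩
    · obtain ⟨c, hR⟩ := exists_ptRing_notMem (hC.chart i).div hfin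
      exact ⟨_, C.mem_surface_of (Or.inr ⟨i, Or.inl ⟨c, rfl⟩⟩) fun i h => hR ⟨i, h.symm⟩,
        (hC.chart i).div.curveOf_crv c⟩

end PointConfig

/-! ### Divisors of functions -/

theorem IrrPoly.hasOrder_zero_of_ne {π ρ : IrrPoly} (h : π.ring ≠ ρ.ring) :
    HasOrder π.ring (algebraMap Poly KK ρ.1) 0 :=
  IrrPoly.hasOrder_zero fun hd => h (IrrPoly.eq_of_dvd hd)

theorem exists_poly_of_forall_mem {h : KK} (H : ∀ π : IrrPoly, h ∈ π.ring) :
    ∃ P : Poly, h = algebraMap Poly KK P := by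
  obtain ⟨a, b, hb, rfl⟩ := exists_div h
  obtain ⟨a', b', c, hrel, h1, h2⟩ := UniqueFactorizationMonoid.exists_reduced_factors' a b hb
  have hc0 : c ≠ 0 := by rintro rfl; exact hb (by rw [← h2, zero_mul])
  have hb' : b' ≠ 0 := by rintro rfl; exact hb (by rw [← h2, mul_zero])
  have heq : algebraMap Poly KK a / algebraMap Poly KK b =
      algebraMap Poly KK a' / algebraMap Poly KK b' := by
    rw [← h1, ← h2, map_mul, map_mul, mul_div_mul_left _ _ (toKK_ne_zero hc0)]
  rw [heq] at H ⊢
  have hu : IsUnit b' := by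
    by_contra hnu
    obtain ⟨π, hπ, hdvd⟩ := WfDvdMonoid.exists_irreducible_factor hnu hb'
    obtain ⟨x, y, hy, hxy⟩ := IrrPoly.mem_ring.1 (H ⟨π, hπ⟩)
    have hy0 : y ≠ 0 := by rintro rfl; exact hy (dvd_zero _)
    rw [div_eq_div_iff (toKK_ne_zero hb') (toKK_ne_zero hy0), ← map_mul, ← map_mul,
      (IsFractionRing.injective Poly KK).eq_iff] at hxy
    have h3 : π ∣ a' * y := hxy ▸ hdvd.mul_left x
    exact (hπ.prime.dvd_or_dvd h3).elim (fun h => hπ.not_isUnit (hrel h hdvd)) hy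
  obtain ⟨v, hv⟩ := hu.exists_right_inv
  refine ⟨a' * v, ?_⟩
  rw [map_mul, div_eq_iff (toKK_ne_zero hb'), mul_assoc, ← map_mul, mul_comm v, hv]; simp

theorem eq_cst_of_hasOrder_zero {h : KK} (H : ∀ π : IrrPoly, HasOrder π.ring h 0) :
    ∃ c : ℂ, c ≠ 0 ∧ h = cst c := by
  have hne : h ≠ 0 := (H (irrX 0)).ne_zero
  obtain ⟨P, rfl⟩ := exists_poly_of_forall_mem fun π => (π.isCurve.mem_iff (H π)).2 le_rfl
  have hP : P ≠ 0 := by rintro rfl; simp at hne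
  have hu : IsUnit P := by
    by_contra hnu
    obtain ⟨π, hπ, hdvd⟩ := WfDvdMonoid.exists_irreducible_factor hnu hP
    have h1 := H ⟨π, hπ⟩
    rw [IsCurve.hasOrder_zero_iff (IrrPoly.isCurve _)] at h1
    exact h1.2 (IrrPoly.vanishes_ring.2 hdvd)
  rw [isUnit_iff_eq_C_of_isReduced] at hu
  obtain ⟨c, hc, rfl⟩ := hu
  exact ⟨c, hc.ne_zero, (cst_eq_algebraMap c).symm⟩

theorem mem_principal {S : Set (Subring KK)} (hS : ∀ V : PrimeDiv S, IsCurve V.1)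
    {D : PrimeDiv S →₀ ℤ} :
    D ∈ principal S ↔ ∃ h : KK, h ≠ 0 ∧ ∀ V : PrimeDiv S, HasOrder V.1 h (D V) := by
  constructor
  · intro hD
    refine AddSubgroup.closure_induction (p := fun D _ => ∃ h : KK, h ≠ 0 ∧ ∀ V : PrimeDiv S,
      HasOrder V.1 h (D V)) (fun D hD => hD) ?_ ?_ ?_ hD
    · exact ⟨1, one_ne_zero, fun V => (hS V).hasOrder_one⟩
    · rintro D D' - - ⟨h, hh, H⟩ ⟨h', hh', H'⟩
      exact ⟨h * h', mul_ne_zero hh hh', fun V => (hS V).hasOrder_mul (H V) (H' V)⟩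
    · rintro D - ⟨h, hh, H⟩
      exact ⟨h⁻¹, inv_ne_zero hh, fun V => (hS V).hasOrder_inv (H V)⟩
  · exact fun h => AddSubgroup.subset_closure h

theorem cls_eq_cls {S : Set (Subring KK)} (hS : ∀ V : PrimeDiv S, IsCurve V.1)
    {D D' : PrimeDiv S →₀ ℤ} : cls D = cls D' ↔
      ∃ h : KK, h ≠ 0 ∧ ∀ V : PrimeDiv S, HasOrder V.1 h (D' V - D V) := by
  rw [cls, cls, QuotientAddGroup.eq, mem_principal hS]
  rw [neg_add_eq_sub]; rfl

namespace PointConfig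

variable (C : PointConfig)

/-- The point of `ℙ¹ × ℙ¹` under a local ring. -/
def _root_.SakaiA5.Over (B : Subring KK) (s t : KK) : Prop :=
  (s ∈ lineParams (coord 0) ∧ t ∈ lineParams (coord 1)) ∧ Vanishes B s ∧ Vanishes B t

theorem _root_.SakaiA5.param_unique {B : Subring KK} (hB : IsLoc B) {x s s' : KK} (hx : x ≠ 0)
    (hs : s ∈ lineParams x) (hs' : s' ∈ lineParams x) (h : Vanishes B s) (h' : Vanishes B s') :
    s = s' := by
  rcases hs with ⟨c, rfl⟩ | rfl <;> rcases hs' with ⟨c', rfl⟩ | rfl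
  · rw [hB.value_unique h h']
  · exact absurd h' (not_vanishes_inv hx (hB.mem_of_vanishes_sub h))
  · exact absurd h (not_vanishes_inv hx (hB.mem_of_vanishes_sub h'))
  · rfl

theorem _root_.SakaiA5.IrrPoly.not_over (π : IrrPoly) (s t : KK) : ¬ Over π.ring s t := by
  rintro ⟨⟨hs, ht⟩, h0, h1⟩
  have hmem : ∀ i, coord i ∈ π.ring := fun i => algebraMap_mem_ring π _
  rcases hs with ⟨a, rfl⟩ | rfl
  · rcases ht with ⟨b, rfl⟩ | rfl
    · exact not_vanishes_both (θ := AlgEquiv.refl) (π := π) (by rwa [mapRing_refl])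
        (by rwa [mapRing_refl])
    · exact not_vanishes_inv (coord_ne_zero 1) (hmem 1) h1
  · exact not_vanishes_inv (coord_ne_zero 0) (hmem 0) h0

theorem _root_.SakaiA5.lineInf_not_over (i : Fin 2) (s t : KK) : ¬ Over (lineInf i) s t := by
  have hC := isCurve_lineInf i
  have key : ∀ s ∈ lineParams (coord (1 - i)), ¬ Vanishes (lineInf i) s := by
    rintro s (⟨a, rfl⟩ | rfl)
    · exact (isChart_lineInf i).crv_not_vanishes a
    · exact not_vanishes_inv (coord_ne_zero _) (isChart_lineInf i).crv_mem_right
  rintro ⟨⟨hs, ht⟩, h0, h1⟩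
  fin_cases i
  · exact key _ ht h1
  · exact key _ hs h0

theorem _root_.SakaiA5.lineInf_ne_ring (i : Fin 2) (π : IrrPoly) : lineInf i ≠ π.ring := by
  intro h
  have h1 : Vanishes (lineInf i) (coord i)⁻¹ := (isChart_lineInf i).crv_vanishes_left
  rw [h] at h1
  exact not_vanishes_inv (coord_ne_zero i) (algebraMap_mem_ring π _) h1

theorem _root_.SakaiA5.lineInf_injective : Function.Injective lineInf := by
  have : lineInf 0 ≠ lineInf 1 := by
    intro h
    have h1 : Vanishes (lineInf 0) (coord 0)⁻¹ := (isChart_lineInf 0).crv_vanishes_left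
    rw [h] at h1
    exact not_vanishes_inv (coord_ne_zero 0) (isChart_lineInf 1).crv_mem_right h1
  intro i j hij
  fin_cases i <;> fin_cases j
  · rfl
  · exact absurd hij this
  · exact absurd hij.symm this
  · rfl

theorem _root_.SakaiA5.IsChart.exc_dominates {u v x : KK} (h : IsChart u v)
    (hx : Vanishes (ptRing u v) x) : Vanishes (crv u (v / u)) x := by
  have hL := h.div.isCurve.isLoc
  refine hL.dominates h h.div.crv_vanishes_left ?_ hx
  have := hL.mul h.div.crv_mem_right h.div.crv_vanishes_left
  rwa [div_mul_cancel₀ _ h.ne_zero] at this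

theorem _root_.SakaiA5.IsChart.excSet_dominates {u v x : KK} (h : IsChart u v) {R : Subring KK}
    (hR : R ∈ excSet u v) (hx : Vanishes (ptRing u v) x) : Vanishes R x := by
  have hu := h.ne_zero
  have hv := h.swap.ne_zero
  rcases hR with ⟨c, rfl⟩ | rfl
  · have h' := h.sub_cst_div c
    refine h'.isLoc.dominates h h'.vanishes_left ?_ hx
    have := h'.isLoc.mul (h'.isLoc.mem_of_vanishes_sub h'.vanishes_right) h'.vanishes_left
    rwa [div_mul_cancel₀ _ hu] at this
  · have h' := h.div'
    refine h'.isLoc.dominates h ?_ h'.vanishes_right hx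
    have := h'.isLoc.mul h'.vanishes_left.1 h'.vanishes_right
    rwa [div_mul_cancel₀ _ hv] at this

/-- The ten curves whose classes form a basis of the Picard group. -/
def basic : Fin 10 → Subring KK := Fin.cons (lineInf 0) (Fin.cons (lineInf 1) C.exc)

variable {C}

theorem Valid.over_ctr (hC : C.Valid) (i : Fin 8) : ∃ s t, Over (C.ctr i) s t := by
  induction i using WellFoundedLT.induction with
  | ind i ih =>
    rcases hC.center i with h | ⟨j, hj, h⟩
    · obtain ⟨s, hs, t, ht, heq⟩ := h
      have := isChart_of_lineParams isChart_coord hs ht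
      exact ⟨s, t, ⟨hs, ht⟩, by rw [heq]; exact this.vanishes_left,
        by rw [heq]; exact this.vanishes_right⟩
    · obtain ⟨s, t, hst, h0, h1⟩ := ih j hj
      exact ⟨s, t, hst, (hC.chart j).excSet_dominates h h0, (hC.chart j).excSet_dominates h h1⟩

theorem Valid.over_exc (hC : C.Valid) (i : Fin 8) : ∃ s t, Over (C.exc i) s t := by
  obtain ⟨s, t, hst, h0, h1⟩ := hC.over_ctr i
  exact ⟨s, t, hst, (hC.chart i).exc_dominates h0, (hC.chart i).exc_dominates h1⟩

theorem Valid.basic_ne_ring (hC : C.Valid) (k : Fin 10) (π : IrrPoly) : C.basic k ≠ π.ring := by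
  refine Fin.cases ?_ (fun k => Fin.cases ?_ (fun i => ?_) k) k
  · exact lineInf_ne_ring 0 π
  · exact lineInf_ne_ring 1 π
  · intro h
    obtain ⟨s, t, hst⟩ := hC.over_exc i
    exact π.not_over s t ((show C.exc i = π.ring from h) ▸ hst)

theorem Valid.exc_ne_lineInf (hC : C.Valid) (i : Fin 8) (j : Fin 2) : C.exc i ≠ lineInf j := by
  intro h
  obtain ⟨s, t, hst⟩ := hC.over_exc i
  exact lineInf_not_over j s t (h ▸ hst)

theorem Valid.basic_injective (hC : C.Valid) : Function.Injective C.basic := by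
  rw [basic, Fin.cons_injective_iff, Fin.cons_injective_iff]
  refine ⟨?_, ?_, hC.injective⟩
  · rintro ⟨k, hk⟩
    revert hk
    refine Fin.cases (fun h => ?_) (fun i h => ?_) k
    · exact absurd (lineInf_injective h) (by decide)
    · exact hC.exc_ne_lineInf i 0 h
  · rintro ⟨i, hi⟩
    exact hC.exc_ne_lineInf i 1 hi

theorem Valid.isCurve_basic (hC : C.Valid) (k : Fin 10) : IsCurve (C.basic k) := by
  refine Fin.cases ?_ (fun k => Fin.cases ?_ (fun i => ?_) k) k
  · exact isCurve_lineInf 0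
  · exact isCurve_lineInf 1
  · exact hC.isCurve_exc i

theorem Valid.prime_iff (hC : C.Valid) {V : Subring KK} : IsPrimeDivisor C.surface V ↔
    (∃ π : IrrPoly, V = π.ring) ∨ ∃ k, V = C.basic k := by
  rw [hC.isPrimeDivisor_iff]
  refine or_congr_right ⟨?_, ?_⟩
  · rintro (⟨i, rfl⟩ | ⟨i, rfl⟩)
    · fin_cases i
      · exact ⟨0, rfl⟩
      · exact ⟨1, rfl⟩
    · exact ⟨i.succ.succ, rfl⟩
  · rintro ⟨k, rfl⟩
    refine Fin.cases ?_ (fun k => Fin.cases ?_ (fun i => ?_) k) k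
    · exact Or.inl ⟨0, rfl⟩
    · exact Or.inl ⟨1, rfl⟩
    · exact Or.inr ⟨i, rfl⟩

theorem Valid.isCurve (hC : C.Valid) (V : PrimeDiv C.surface) : IsCurve V.1 := by
  rcases hC.prime_iff.1 V.2 with ⟨π, h⟩ | ⟨k, h⟩
  · rw [h]; exact π.isCurve
  · rw [h]; exact hC.isCurve_basic k

/-- The basic curves as prime divisors. -/
def Valid.basicDiv (hC : C.Valid) (k : Fin 10) : PrimeDiv C.surface :=
  ⟨C.basic k, hC.prime_iff.2 (Or.inr ⟨k, rfl⟩)⟩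

/-- The plane curves as prime divisors. -/
def Valid.planeDiv (hC : C.Valid) (π : IrrPoly) : PrimeDiv C.surface :=
  ⟨π.ring, hC.prime_iff.2 (Or.inl ⟨π, rfl⟩)⟩

theorem Valid.cases (hC : C.Valid) (V : PrimeDiv C.surface) :
    (∃ π, V = hC.planeDiv π) ∨ ∃ k, V = hC.basicDiv k :=
  (hC.prime_iff.1 V.2).imp (fun ⟨π, h⟩ => ⟨π, Subtype.ext h⟩) fun ⟨k, h⟩ => ⟨k, Subtype.ext h⟩

theorem Valid.basicDiv_injective (hC : C.Valid) : Function.Injective hC.basicDiv := fun _ _ h =>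
  hC.basic_injective (congrArg Subtype.val h)

/-- The combinations of the basic curves. -/
def Valid.comb (hC : C.Valid) : (Fin 10 → ℤ) →+ (PrimeDiv C.surface →₀ ℤ) where
  toFun x := ∑ k, Finsupp.single (hC.basicDiv k) (x k)
  map_zero' := by simp
  map_add' x y := by simp [Finset.sum_add_distrib]

theorem Valid.comb_basicDiv (hC : C.Valid) (x : Fin 10 → ℤ) (k : Fin 10) :
    hC.comb x (hC.basicDiv k) = x k := by
  classical
  change (∑ k, Finsupp.single (hC.basicDiv k) (x k)) (hC.basicDiv k) = x k
  rw [Finsupp.finsetSum_apply, Finset.sum_eq_single k]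
  · simp
  · intro l _ hl
    rw [Finsupp.single_apply, if_neg (fun h => hl (hC.basicDiv_injective h))]
  · simp

theorem Valid.comb_planeDiv (hC : C.Valid) (x : Fin 10 → ℤ) (π : IrrPoly) :
    hC.comb x (hC.planeDiv π) = 0 := by
  classical
  change (∑ k, Finsupp.single (hC.basicDiv k) (x k)) (hC.planeDiv π) = 0
  rw [Finsupp.finsetSum_apply, Finset.sum_eq_zero]
  intro l _
  rw [Finsupp.single_apply, if_neg (fun h => hC.basic_ne_ring l π (congrArg Subtype.val h))]

theorem Valid.cls_planeDiv (hC : C.Valid) (π : IrrPoly) (o : Fin 10 → ℤ)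
    (ho : ∀ k, HasOrder (C.basic k) (algebraMap Poly KK π.1) (o k)) :
    cls (Finsupp.single (hC.planeDiv π) 1) = cls (hC.comb (-o)) := by
  classical
  rw [cls_eq_cls hC.isCurve]
  refine ⟨(algebraMap Poly KK π.1)⁻¹, inv_ne_zero (toKK_ne_zero π.2.ne_zero), fun V => ?_⟩
  rw [show (hC.comb (-o)) V - (Finsupp.single (hC.planeDiv π) 1 : PrimeDiv C.surface →₀ ℤ) V =
    -((Finsupp.single (hC.planeDiv π) 1 : PrimeDiv C.surface →₀ ℤ) V - hC.comb (-o) V) by ring]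
  refine (hC.isCurve V).hasOrder_inv ?_
  rcases hC.cases V with ⟨ρ, rfl⟩ | ⟨k, rfl⟩
  · rw [hC.comb_planeDiv, Finsupp.single_apply]
    by_cases h : π.ring = ρ.ring
    · rw [if_pos (Subtype.ext h)]
      change HasOrder ρ.ring _ _
      rw [← h]
      exact π.hasOrder_self
    · rw [if_neg fun h' => h (congrArg Subtype.val h')]
      exact IrrPoly.hasOrder_zero_of_ne fun h' => h h'.symm
  · rw [hC.comb_basicDiv, Finsupp.single_apply,
      if_neg fun h => hC.basic_ne_ring k π (congrArg Subtype.val h).symm]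
    simpa [basicDiv] using ho k

/-- The ten basic curves freely generate the Picard group. -/
def Valid.combCls (hC : C.Valid) : (Fin 10 → ℤ) →+ PicS C.surface :=
  (QuotientAddGroup.mk' (principal C.surface)).comp hC.comb

theorem Valid.combCls_apply (hC : C.Valid) (x : Fin 10 → ℤ) :
    hC.combCls x = cls (hC.comb x) := rfl

theorem Valid.combCls_single (hC : C.Valid) (k : Fin 10) :
    hC.combCls (Pi.single k 1) = cls (Finsupp.single (hC.basicDiv k) 1) := by
  rw [hC.combCls_apply]
  congr 1
  change ∑ l, Finsupp.single (hC.basicDiv l) ((Pi.single k 1 : Fin 10 → ℤ) l) = _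
  rw [Finset.sum_eq_single k]
  · simp
  · intro l _ hl
    simp [Pi.single_eq_of_ne hl]
  · simp

theorem Valid.combCls_injective (hC : C.Valid) : Function.Injective hC.combCls := by
  rw [injective_iff_map_eq_zero]
  intro x hx
  rw [hC.combCls_apply, show (0 : PicS C.surface) = cls 0 from rfl, eq_comm,
    cls_eq_cls hC.isCurve] at hx
  obtain ⟨h, hh, H⟩ := hx
  simp only [Finsupp.coe_zero, Pi.zero_apply, sub_zero] at H
  obtain ⟨c, hc, rfl⟩ := eq_cst_of_hasOrder_zero fun π => by
    have := H (hC.planeDiv π)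
    rwa [hC.comb_planeDiv] at this
  funext k
  have h1 := H (hC.basicDiv k)
  rw [hC.comb_basicDiv] at h1
  exact (hC.isCurve_basic k).hasOrder_unique h1 ((hC.isCurve_basic k).hasOrder_cst hc)

theorem _root_.SakaiA5.addHom_ext_cls {S : Set (Subring KK)} {G : Type*} [AddCommGroup G]
    {f g : PicS S →+ G}
    (H : ∀ V : PrimeDiv S, f (cls (Finsupp.single V 1)) = g (cls (Finsupp.single V 1))) :
    f = g := by
  refine QuotientAddGroup.addMonoidHom_ext _ (Finsupp.addHom_ext' fun V => ?_)
  exact AddMonoidHom.ext_int (H V)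

theorem Valid.combCls_surjective (hC : C.Valid) : Function.Surjective hC.combCls := by
  have key : ∀ V : PrimeDiv C.surface, cls (Finsupp.single V 1) ∈ hC.combCls.range := by
    intro V
    rcases hC.cases V with ⟨π, rfl⟩ | ⟨k, rfl⟩
    · exact ⟨_, (hC.cls_planeDiv π (fun k => ord (C.basic k) (algebraMap Poly KK π.1)) fun k =>
        (hC.isCurve_basic k).hasOrder_ord (toKK_ne_zero π.2.ne_zero)).symm⟩
    · exact ⟨_, hC.combCls_single k⟩
  have h2 : QuotientAddGroup.mk' hC.combCls.range = 0 := by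
    refine addHom_ext_cls (G := PicS C.surface ⧸ hC.combCls.range) fun V => ?_
    exact (QuotientAddGroup.eq_zero_iff _).2 (key V)
  intro x
  exact (QuotientAddGroup.eq_zero_iff x).1 (DFunLike.congr_fun h2 x)

/-- The Picard group of a blowup of `ℙ¹ × ℙ¹` at eight points. -/
def Valid.picEquiv (hC : C.Valid) : (Fin 10 → ℤ) ≃+ PicS C.surface :=
  AddEquiv.ofBijective hC.combCls ⟨hC.combCls_injective, hC.combCls_surjective⟩

theorem Valid.picEquiv_apply (hC : C.Valid) (x : Fin 10 → ℤ) :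
    hC.picEquiv x = cls (hC.comb x) := rfl

end PointConfig

theorem hasOrder_lineInf_self (j : Fin 2) (c : ℂ) : HasOrder (lineInf j) (coord j - cst c) (-1) := by
  have h := isChart_lineInf j
  have hC := h.isCurve
  have hne := coord_ne_zero j
  have h1 : HasOrder (lineInf j) (1 - cst c * (coord j)⁻¹) 0 := by
    have := h.hasOrder_aeval (P := 1 - C c * X 0) 0 (by simp)
    simpa [cst, lineInf] using this
  have h2 := hC.hasOrder_div h1 h.hasOrder_left
  have h3 : (1 - cst c * (coord j)⁻¹) / (coord j)⁻¹ = coord j - cst c := by field_simp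
  rw [h3] at h2
  exact h2

theorem hasOrder_lineInf_other (j : Fin 2) (c : ℂ) :
    HasOrder (lineInf (1 - j)) (coord j - cst c) 0 := by
  have h := isChart_lineInf (1 - j)
  rw [sub_sub_cancel] at h
  have := h.hasOrder_right_sub c
  rwa [lineInf, sub_sub_cancel]

theorem ofImages_apply (v : Fin 10 → PicLat) (x : PicLat) :
    ofImages v x = ∑ k, x k • v k := by
  exact Matrix.vecMul_eq_sum x (Matrix.of v)

theorem ofImages_single (v : Fin 10 → PicLat) (k : Fin 10) :
    ofImages v (Pi.single k 1) = v k := by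
  rw [ofImages_apply, Finset.sum_eq_single k]
  · simp
  · intro l _ hl
    simp [Pi.single_eq_of_ne hl]
  · simp

theorem ofImages_ofImages {v w : Fin 10 → PicLat} (h : Matrix.of v * Matrix.of w = 1)
    (x : PicLat) : ofImages w (ofImages v x) = x := by
  change Matrix.vecMul (Matrix.vecMul x (Matrix.of v)) (Matrix.of w) = x
  rw [Matrix.vecMul_vecMul, h, Matrix.vecMul_one]

/-- The first two basis vectors. -/
def fst (j : Fin 2) : Fin 10 := Fin.castLE (by decide) j

/-- The class of the fibres of the `j`-th coordinate. -/
def fibreClass : Fin 2 → PicLat := ![dv 1 0 [], dv 0 1 []]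

namespace PointConfig

variable (C : PointConfig)

/-- The classes of the ten basic curves, when `p k i` is the order of the pole of `z_k` along the `i`-th
exceptional line. -/
def basicClass (p : Fin 2 → Fin 8 → ℤ) : Fin 10 → PicLat :=
  Fin.cons (fibreClass 0 - ∑ i, p 0 i • C.exClass i)
    (Fin.cons (fibreClass 1 - ∑ i, p 1 i • C.exClass i) C.exClass)

theorem basicClass_fst (p : Fin 2 → Fin 8 → ℤ) (j : Fin 2) :
    C.basicClass p (fst j) = fibreClass j - ∑ i, p j i • C.exClass i := by
  fin_cases j <;> rfl

theorem basic_fst (j : Fin 2) : C.basic (fst j) = lineInf j := by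
  fin_cases j <;> rfl

/-- The data that determine the marking of a blowup. -/
structure MarkData where
  valid : C.Valid
  p : Fin 2 → Fin 8 → ℤ
  hasPole : ∀ k i, ∃ o, HasOrder (C.exc i) (coord k) o ∧ p k i = max (-o) 0
  inv : Fin 10 → PicLat
  left_inv : Matrix.of (C.basicClass p) * Matrix.of inv = 1

variable {C} (M : C.MarkData)

/-- The vector with entry `a` at the `j`-th line at infinity and `x` at the exceptional lines. -/
def vec (j : Fin 2) (a : ℤ) (x : Fin 8 → ℤ) : Fin 10 → ℤ :=
  Pi.single (fst j) a + Fin.cons 0 (Fin.cons 0 x)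

theorem vec_fst_self (j : Fin 2) (a : ℤ) (x : Fin 8 → ℤ) : vec j a x (fst j) = a := by
  fin_cases j <;> simp [vec, fst]

theorem vec_fst_other (j : Fin 2) (a : ℤ) (x : Fin 8 → ℤ) : vec j a x (fst (1 - j)) = 0 := by
  fin_cases j <;> simp [vec, fst]

theorem vec_succ (j : Fin 2) (a : ℤ) (x : Fin 8 → ℤ) (i : Fin 8) :
    vec j a x i.succ.succ = x i := by
  have : fst j ≠ i.succ.succ := by
    intro h
    have := congrArg Fin.val h
    simp [fst] at this
    omega
  simp [vec, this.symm]

theorem _root_.SakaiA5.forall_fin_ten {p : Fin 10 → Prop} (j : Fin 2) (h0 : p (fst j))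
    (h1 : p (fst (1 - j))) (h2 : ∀ i : Fin 8, p i.succ.succ) (k : Fin 10) : p k := by
  refine Fin.cases ?_ (fun k => Fin.cases ?_ (fun i => h2 i) k) k
  · fin_cases j
    · exact h0
    · exact h1
  · fin_cases j
    · exact h1
    · exact h0

theorem ofImages_vec (p : Fin 2 → Fin 8 → ℤ) (j : Fin 2) (a : ℤ) (x : Fin 8 → ℤ) :
    ofImages (C.basicClass p) (vec j a x) =
      a • C.basicClass p (fst j) + ∑ i, x i • C.exClass i := by
  rw [vec, map_add]
  congr 1
  · rw [← ofImages_single (C.basicClass p), ← map_smul, ← Pi.single_smul, smul_eq_mul, mul_one]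
  · rw [ofImages_apply, Fin.sum_univ_succ, Fin.sum_univ_succ]
    simp [basicClass]

/-- The lattice isomorphism between combinations of basic curves and `ℤ¹⁰`. -/
def MarkData.latEquiv : (Fin 10 → ℤ) ≃+ PicLat where
  toFun := ofImages (C.basicClass M.p)
  invFun := ofImages M.inv
  left_inv := ofImages_ofImages M.left_inv
  right_inv := ofImages_ofImages (mul_eq_one_comm.1 M.left_inv)
  map_add' := map_add _

theorem MarkData.latEquiv_apply (x : Fin 10 → ℤ) :
    M.latEquiv x = ofImages (C.basicClass M.p) x := rfl

theorem MarkData.latEquiv_polar (j : Fin 2) :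
    M.latEquiv (vec j 1 (M.p j)) = fibreClass j := by
  rw [M.latEquiv_apply, ofImages_vec, basicClass_fst]; simp

theorem MarkData.isPolarDivisor (j : Fin 2) :
    IsPolarDivisor (coord j) (M.valid.comb (vec j 1 (M.p j))) := by
  intro V
  rcases M.valid.cases V with ⟨π, rfl⟩ | ⟨k, rfl⟩
  · obtain ⟨k, hk⟩ := π.isCurve.exists_hasOrder (coord_ne_zero j)
    refine ⟨k, hk, ?_⟩
    have := (π.isCurve.mem_iff hk).1 (algebraMap_mem_ring π _)
    rw [M.valid.comb_planeDiv]; omega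
  · rw [M.valid.comb_basicDiv]
    change ∃ o, HasOrder (C.basic k) _ o ∧ _
    revert k
    refine forall_fin_ten j ?_ ?_ fun i => ?_
    · refine ⟨-1, ?_, by rw [vec_fst_self]; rfl⟩
      rw [basic_fst]
      simpa using hasOrder_lineInf_self j 0
    · refine ⟨0, ?_, by rw [vec_fst_other]; rfl⟩
      rw [basic_fst]
      simpa using hasOrder_lineInf_other j 0
    · obtain ⟨o, ho, h⟩ := M.hasPole j i
      exact ⟨o, ho, (vec_succ _ _ _ _).trans h⟩

/-- The marking. -/
def MarkData.marking : Marking C where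
  equiv := M.latEquiv.symm.trans M.valid.picEquiv
  fibre₀ := ⟨_, M.isPolarDivisor 0, by
    rw [AddEquiv.trans_apply, show dv 1 0 [] = fibreClass 0 from rfl, ← M.latEquiv_polar 0,
      AddEquiv.symm_apply_apply, M.valid.picEquiv_apply]⟩
  fibre₁ := ⟨_, M.isPolarDivisor 1, by
    rw [AddEquiv.trans_apply, show dv 0 1 [] = fibreClass 1 from rfl, ← M.latEquiv_polar 1,
      AddEquiv.symm_apply_apply, M.valid.picEquiv_apply]⟩
  exceptional i := ⟨M.valid.basicDiv i.succ.succ, rfl, by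
    have : C.exClass i = M.latEquiv (Pi.single i.succ.succ 1) := by
      rw [M.latEquiv_apply, ofImages_single]; rfl
    rw [AddEquiv.trans_apply, this, AddEquiv.symm_apply_apply]
    exact M.valid.combCls_single _⟩

theorem _root_.SakaiA5.IsPolarDivisor.unique {S : Set (Subring KK)}
    (hS : ∀ V : PrimeDiv S, IsCurve V.1) {h : KK} {D D' : PrimeDiv S →₀ ℤ}
    (hD : IsPolarDivisor h D) (hD' : IsPolarDivisor h D') : D = D' := by
  ext V
  obtain ⟨k, hk, h1⟩ := hD V
  obtain ⟨k', hk', h2⟩ := hD' V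
  rw [h1, h2, (hS V).hasOrder_unique hk hk']

theorem MarkData.equiv_eq (m : Marking C) : m.equiv = M.marking.equiv := by
  have hexc : ∀ i, m.equiv (C.exClass i) = M.marking.equiv (C.exClass i) := by
    intro i
    obtain ⟨V, hV, h1⟩ := m.exceptional i
    obtain ⟨V', hV', h2⟩ := M.marking.exceptional i
    rw [h1, h2, show V = V' from Subtype.ext (SetLike.coe_injective (hV.trans hV'.symm))]
  have hfib : ∀ j, m.equiv (fibreClass j) = M.marking.equiv (fibreClass j) := by
    intro j
    fin_cases j
    · obtain ⟨D, hD, h1⟩ := m.fibre₀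
      obtain ⟨D', hD', h2⟩ := M.marking.fibre₀
      exact h1.trans ((congrArg cls (hD.unique M.valid.isCurve hD')).trans h2.symm)
    · obtain ⟨D, hD, h1⟩ := m.fibre₁
      obtain ⟨D', hD', h2⟩ := M.marking.fibre₁
      exact h1.trans ((congrArg cls (hD.unique M.valid.isCurve hD')).trans h2.symm)
  have hbasic : ∀ k, m.equiv (C.basicClass M.p k) = M.marking.equiv (C.basicClass M.p k) := by
    have hf : ∀ j, m.equiv (C.basicClass M.p (fst j)) =
        M.marking.equiv (C.basicClass M.p (fst j)) := by
      intro j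
      rw [basicClass_fst, map_sub, map_sub, hfib, map_sum, map_sum]
      congr 1
      refine Finset.sum_congr rfl fun i _ => ?_
      rw [map_zsmul, map_zsmul, hexc]
    exact forall_fin_ten 0 (hf 0) (hf 1) hexc
  ext x
  obtain ⟨y, rfl⟩ := M.latEquiv.surjective x
  rw [M.latEquiv_apply, ofImages_apply, map_sum, map_sum]
  refine Finset.sum_congr rfl fun k _ => ?_
  rw [map_zsmul, map_zsmul, hbasic]

theorem MarkData.equiv_basicClass (m : Marking C) (k : Fin 10) :
    m.equiv (C.basicClass M.p k) = cls (Finsupp.single (M.valid.basicDiv k) 1) := by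
  rw [M.equiv_eq m, ← ofImages_single (C.basicClass M.p) k, ← M.latEquiv_apply]
  change M.valid.picEquiv (M.latEquiv.symm _) = _
  rw [AddEquiv.symm_apply_apply]
  exact M.valid.combCls_single k

/-- The class of the curve `z_j = c`. -/
theorem MarkData.equiv_linear (m : Marking C) {j : Fin 2} {c : ℂ} {o : Fin 8 → ℤ}
    (ho : ∀ i, HasOrder (C.exc i) (coord j - cst c) (o i)) :
    m.equiv (C.basicClass M.p (fst j) - ∑ i, o i • C.exClass i) =
      cls (Finsupp.single (M.valid.planeDiv (irrXC j c)) 1) := by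
  rw [M.valid.cls_planeDiv (irrXC j c) (vec j (-1) o)]
  · have : C.basicClass M.p (fst j) - ∑ i, o i • C.exClass i = M.latEquiv (-vec j (-1) o) := by
      rw [map_neg, M.latEquiv_apply, ofImages_vec, neg_add, neg_smul, one_smul, neg_neg,
        sub_eq_add_neg]
    rw [M.equiv_eq m, this]
    change M.valid.picEquiv (M.latEquiv.symm _) = _
    rw [AddEquiv.symm_apply_apply]; rfl
  · have hf : algebraMap Poly KK (irrXC j c).1 = coord j - cst c := by
      rw [irrXC, map_sub, ← cst_eq_algebraMap]; rfl
    rw [hf]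
    refine forall_fin_ten j ?_ ?_ fun i => ?_
    · rw [vec_fst_self, basic_fst]; exact hasOrder_lineInf_self j c
    · rw [vec_fst_other, basic_fst]; exact hasOrder_lineInf_other j c
    · rw [vec_succ]; exact ho i

end PointConfig

/-! ### Isomorphisms -/

theorem IsPrimeDivisor.map {S : Set (Subring KK)} {V : Subring KK} (h : IsPrimeDivisor S V)
    (Φ : KK ≃ₐ[ℂ] KK) : IsPrimeDivisor (mapRing Φ '' S) (mapRing Φ V) := by
  obtain ⟨R, hR, hV⟩ := h
  exact ⟨_, ⟨R, hR, rfl⟩, CurveOf.map hV Φ⟩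

theorem isPrimeDivisor_map_iff {S S' : Set (Subring KK)} {Φ : KK ≃ₐ[ℂ] KK}
    (hS : mapRing Φ '' S' = S) (V : Subring KK) :
    IsPrimeDivisor S (mapRing Φ V) ↔ IsPrimeDivisor S' V := by
  subst hS
  refine ⟨fun h => ?_, fun h => h.map Φ⟩
  have := h.map Φ.symm
  rwa [← Set.image_comp, show mapRing Φ.symm ∘ mapRing Φ = id from
    funext (mapRing_symm_mapRing Φ), Set.image_id, mapRing_symm_mapRing] at this

/-- The bijection of curves induced by an isomorphism. -/
def primeDivEquiv {S S' : Set (Subring KK)} {Φ : KK ≃ₐ[ℂ] KK} (hS : mapRing Φ '' S' = S) :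
    PrimeDiv S ≃ PrimeDiv S' where
  toFun V := ⟨mapRing Φ.symm V.1, by
    rw [← isPrimeDivisor_map_iff hS, mapRing_mapRing_symm]; exact V.2⟩
  invFun V := ⟨mapRing Φ V.1, (isPrimeDivisor_map_iff hS _).2 V.2⟩
  left_inv V := Subtype.ext (mapRing_mapRing_symm Φ _)
  right_inv V := Subtype.ext (mapRing_symm_mapRing Φ _)

theorem primeDivEquiv_eq_iff {S S' : Set (Subring KK)} {Φ : KK ≃ₐ[ℂ] KK}
    (hS : mapRing Φ '' S' = S) {V : PrimeDiv S} {V' : PrimeDiv S'} :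
    primeDivEquiv hS V = V' ↔ mapRing Φ V'.1 = V.1 := by
  rw [← Equiv.eq_symm_apply, Subtype.ext_iff, eq_comm]; rfl

/-- The push-forward of divisor classes. -/
def pushCls {S S' : Set (Subring KK)} {Φ : KK ≃ₐ[ℂ] KK} (hS : mapRing Φ '' S' = S) :
    PicS S →+ PicS S' :=
  QuotientAddGroup.map _ _ (Finsupp.domCongr (primeDivEquiv hS)).toAddMonoidHom (by
    rw [principal, AddSubgroup.closure_le]
    rintro D ⟨h, hh, H⟩
    refine AddSubgroup.subset_closure ⟨Φ.symm h, by simpa using hh, fun V => ?_⟩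
    have := (H ((primeDivEquiv hS).symm V)).map Φ.symm
    change HasOrder (mapRing Φ.symm (mapRing Φ V.1)) _ _ at this
    rwa [mapRing_symm_mapRing] at this)

theorem pushCls_cls {S S' : Set (Subring KK)} {Φ : KK ≃ₐ[ℂ] KK} (hS : mapRing Φ '' S' = S)
    (D : PrimeDiv S →₀ ℤ) :
    pushCls hS (cls D) = cls (Finsupp.domCongr (primeDivEquiv hS) D) := rfl

theorem pushCls_single {S S' : Set (Subring KK)} {Φ : KK ≃ₐ[ℂ] KK} (hS : mapRing Φ '' S' = S)
    (V : PrimeDiv S) :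
    pushCls hS (cls (Finsupp.single V 1)) = cls (Finsupp.single (primeDivEquiv hS V) 1) := by
  rw [pushCls_cls, Finsupp.domCongr_apply, Finsupp.equivMapDomain_single]

section Iso

variable {C C' C'' : PointConfig} {Φ Ψ : KK ≃ₐ[ℂ] KK} {L L' : PicLat →ₗ[ℤ] PicLat}

theorem isMarkedIso_of_push (hS : mapRing Φ '' C'.surface = C.surface) (m : Marking C)
    (m' : Marking C') (H : ∀ V : PrimeDiv C.surface, m'.equiv (L (m.equiv.symm
      (cls (Finsupp.single V 1)))) = pushCls hS (cls (Finsupp.single V 1))) :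
    IsMarkedIso Φ C C' L := by
  refine ⟨hS, m, m', fun V V' hV => ?_⟩
  rw [H, pushCls_single, (primeDivEquiv_eq_iff hS).2 hV]

theorem push_eq_of_isMarked (hS : mapRing Φ '' C'.surface = C.surface) {m : Marking C}
    {m' : Marking C'} (H : ∀ (V : PrimeDiv C.surface) (V' : PrimeDiv C'.surface),
    mapRing Φ V'.1 = V.1 →
      m'.equiv (L (m.equiv.symm (cls (Finsupp.single V 1)))) = cls (Finsupp.single V' 1))
    (x : PicLat) : pushCls hS (m.equiv x) = m'.equiv (L x) := by
  have : pushCls hS = (m'.equiv.toAddMonoidHom.comp L.toAddMonoidHom).comp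
      m.equiv.symm.toAddMonoidHom := by
    refine addHom_ext_cls fun V => ?_
    rw [pushCls_single, ← H V _ ((primeDivEquiv_eq_iff hS).1 rfl)]; rfl
  rw [this]
  change m'.equiv (L (m.equiv.symm (m.equiv x))) = _
  rw [AddEquiv.symm_apply_apply]

/-- It suffices to know the images of the basic curves. -/
theorem IsMarkedIso.of_basic (M : C.MarkData) (M' : C'.MarkData)
    (hS : mapRing Φ '' C'.surface = C.surface)
    (H : ∀ k, ∃ V' : PrimeDiv C'.surface, mapRing Φ V'.1 = C.basic k ∧
      M'.marking.equiv (L (C.basicClass M.p k)) = cls (Finsupp.single V' 1)) :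
    IsMarkedIso Φ C C' L := by
  refine isMarkedIso_of_push hS M.marking M'.marking ?_
  have key : ((M'.marking.equiv.toAddMonoidHom.comp L.toAddMonoidHom).comp
      M.marking.equiv.symm.toAddMonoidHom).comp M.valid.picEquiv.toAddMonoidHom =
      (pushCls hS).comp M.valid.picEquiv.toAddMonoidHom := by
    refine AddMonoidHom.functions_ext' _ _ _ fun k => AddMonoidHom.ext_int ?_
    change M'.marking.equiv (L (M.marking.equiv.symm (M.valid.picEquiv (Pi.single k 1)))) =
      pushCls hS (M.valid.picEquiv (Pi.single k 1))
    have h1 : M.valid.picEquiv (Pi.single k 1) = cls (Finsupp.single (M.valid.basicDiv k) 1) :=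
      M.valid.combCls_single k
    obtain ⟨V', hV', h2⟩ := H k
    rw [h1, ← M.equiv_basicClass M.marking, AddEquiv.symm_apply_apply, h2,
      M.equiv_basicClass M.marking, pushCls_single,
      (primeDivEquiv_eq_iff hS (V := M.valid.basicDiv k)).2 hV']
  intro V
  obtain ⟨y, hy⟩ := M.valid.picEquiv.surjective (cls (Finsupp.single V 1))
  rw [← hy]
  exact DFunLike.congr_fun key y

theorem IsMarkedIso.trans (M' : C'.MarkData) (h : IsMarkedIso Φ C C' L)
    (h' : IsMarkedIso Ψ C' C'' L') : IsMarkedIso (Ψ.trans Φ) C C'' (L' ∘ₗ L) := by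
  obtain ⟨hS, m, m₁, H⟩ := h
  obtain ⟨hS', m₂, m', H'⟩ := h'
  have himg : mapRing (Ψ.trans Φ) '' C''.surface = C.surface := by
    rw [← hS, ← hS', ← Set.image_comp]
    exact Set.image_congr fun R _ => mapRing_trans _ _ _
  refine ⟨himg, m, m', fun V V'' hV => ?_⟩
  let V' : PrimeDiv C'.surface := ⟨mapRing Ψ V''.1, (isPrimeDivisor_map_iff hS' _).2 V''.2⟩
  have h1 := H V V' ((mapRing_trans _ _ _).symm.trans hV)
  have h2 := H' V' V'' rfl
  rw [← h1, M'.equiv_eq m₁, M'.equiv_eq m₂, AddEquiv.symm_apply_apply] at h2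
  exact h2

theorem IsMarkedIso.symm (h : IsMarkedIso Φ C C' L)
    (hL' : L' ∘ₗ L = LinearMap.id) : IsMarkedIso Φ.symm C' C L' := by
  obtain ⟨hS, m, m', H⟩ := h
  refine ⟨?_, m', m, fun V V' hV => ?_⟩
  · rw [← hS, ← Set.image_comp]
    have : mapRing Φ.symm ∘ mapRing Φ = id := funext (mapRing_symm_mapRing Φ)
    change mapRing Φ.symm ∘ mapRing Φ '' _ = _
    rw [this, Set.image_id]
  · have h1 := H V' V (by
      change mapRing Φ V.1 = V'.1
      have h2 : mapRing Φ.symm V'.1 = V.1 := hV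
      rw [← h2, mapRing_mapRing_symm])
    rw [← h1, AddEquiv.symm_apply_apply]
    have h3 : L' (L (m.equiv.symm (cls (Finsupp.single V' 1)))) = m.equiv.symm (cls (Finsupp.single V' 1)) :=
      LinearMap.congr_fun hL' _
    rw [h3, AddEquiv.apply_symm_apply]

theorem IsSakaiSurfaceA5.of_iso (M' : C'.MarkData) (h : IsMarkedIso Φ C C' L)
    {δ δ' : Fin 6 → PicLat} (hδ : ∀ i, L (δ i) = δ' i)
    (hL : Function.Injective L)
    (hinter : ∀ i j, inter (δ i) (δ j) = if i = j then -2 else if j = i + 1 ∨ i = j + 1 then 1 else 0)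
    (hsum : ∑ i, δ i = antiK) (h' : IsSakaiSurfaceA5 C' δ') : IsSakaiSurfaceA5 C δ := by
  obtain ⟨hS, m, m₁, H⟩ := h
  obtain ⟨-, hsum', m₂, d', hd', huniq⟩ := h'
  have hm : m₁.equiv = m₂.equiv := by rw [M'.equiv_eq m₁, M'.equiv_eq m₂]
  have hpush := push_eq_of_isMarked hS H
  refine ⟨hinter, hsum, m, fun i => (primeDivEquiv hS).symm (d' i), fun i => ?_, fun D hD hcls => ?_⟩
  · have h1 := H ((primeDivEquiv hS).symm (d' i)) (d' i) rfl
    rw [← hd' i, ← hδ i, ← hm] at h1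
    have h2 := hL (m₁.equiv.injective h1)
    rw [← h2, AddEquiv.apply_symm_apply]
  · have hK : L antiK = antiK := by
      rw [← hsum, map_sum, Finset.sum_congr rfl fun i _ => hδ i, hsum', hsum]
    have h1 : Finsupp.domCongr (primeDivEquiv hS) D = ∑ i, Finsupp.single (d' i) 1 := by
      apply huniq
      · intro V; exact hD _
      · rw [← pushCls_cls, hcls, hpush, hK, hm]
    have h2 := congrArg (Finsupp.domCongr (primeDivEquiv hS)).symm h1
    rw [AddEquiv.symm_apply_apply, map_sum] at h2
    rw [h2]
    refine Finset.sum_congr rfl fun i _ => ?_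
    rw [Finsupp.domCongr_symm, Finsupp.domCongr_apply, Finsupp.equivMapDomain_single]

end Iso

/-! ### Local rings with residue field `ℂ` -/

/-- The local ring of a closed point: the residue field is `ℂ`. -/
def IsPoint (B : Subring KK) : Prop := IsLoc B ∧ ∀ x ∈ B, ∃ c, Vanishes B (x - cst c)

/-- `x` has a value in `ℙ¹` at the point. -/
def HasValue (B : Subring KK) (x : KK) : Prop := x ∈ B ∨ x⁻¹ ∈ B

/-- `B` dominates `R`. -/
def Dom (R B : Subring KK) : Prop := R ≤ B ∧ ∀ x, Vanishes R x → Vanishes B x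

theorem Dom.refl (R : Subring KK) : Dom R R := ⟨le_rfl, fun _ h => h⟩

theorem Dom.trans {R B D : Subring KK} (h : Dom R B) (h' : Dom B D) : Dom R D :=
  ⟨h.1.trans h'.1, fun x hx => h'.2 x (h.2 x hx)⟩

theorem IsChart.dom_iff {u v : KK} (h : IsChart u v) {B : Subring KK} (hB : IsLoc B) :
    Dom (ptRing u v) B ↔ Vanishes B u ∧ Vanishes B v :=
  ⟨fun H => ⟨H.2 _ h.vanishes_left, H.2 _ h.vanishes_right⟩,
    fun H => ⟨hB.ptRing_le H.1 H.2, fun _ hx => hB.dominates h H.1 H.2 hx⟩⟩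

theorem IsChart.isPoint {u v : KK} (h : IsChart u v) : IsPoint (ptRing u v) := by
  refine ⟨h.isLoc, ?_⟩
  rintro x ⟨P, Q, hQ, hQ', rfl⟩
  refine ⟨constantCoeff P / constantCoeff Q, ?_⟩
  have : aeval ![u, v] P / aeval ![u, v] Q - cst (constantCoeff P / constantCoeff Q) =
      aeval ![u, v] (P - C (constantCoeff P / constantCoeff Q) * Q) / aeval ![u, v] Q := by
    rw [map_sub, map_mul, aeval_C, sub_div, mul_div_cancel_right₀ _ hQ']; rfl
  rw [this, h.vanishes_aeval_div hQ]
  simp [div_mul_cancel₀ _ hQ]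

theorem IsLoc.isUnit_of_not_vanishes {B : Subring KK} {x : KK} (hx : x ∈ B)
    (h : ¬ Vanishes B x) : x ≠ 0 ∧ x⁻¹ ∈ B := by
  rw [Vanishes] at h
  push Not at h
  exact ⟨(h hx).1, (h hx).2⟩

theorem IsLoc.vanishes_zero {B : Subring KK} : Vanishes B 0 := ⟨B.zero_mem, Or.inl rfl⟩

theorem IsLoc.vanishes_inv_of_notMem {B : Subring KK} {x : KK}
    (hx : x ∉ B) (h : x⁻¹ ∈ B) : Vanishes B x⁻¹ := ⟨h, Or.inr (by rwa [inv_inv])⟩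

/-- A set of local rings that is described by a predicate: `pred B` says that the point `B` has a
center in `S`. -/
structure Represents (S : Set (Subring KK)) (pred : Subring KK → Prop) : Prop where
  point : ∀ R ∈ S, IsPoint R
  iff : ∀ B, IsPoint B → (pred B ↔ ∃ R ∈ S, Dom R B)
  unique : ∀ B, IsPoint B → ∀ R ∈ S, ∀ R' ∈ S, Dom R B → Dom R' B → R = R'

theorem Represents.subset {S S' : Set (Subring KK)} {p p' : Subring KK → Prop}
    (h : Represents S p) (h' : Represents S' p') (H : ∀ B, IsPoint B → (p B ↔ p' B)) : S ⊆ S' := by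
  intro R hR
  have hR' := h.point R hR
  obtain ⟨R₁, hR₁, h1⟩ := (h'.iff R hR').1 ((H R hR').1 ((h.iff R hR').2 ⟨R, hR, Dom.refl R⟩))
  have hR₁' := h'.point R₁ hR₁
  obtain ⟨R₂, hR₂, h2⟩ := (h.iff R₁ hR₁').1 ((H R₁ hR₁').2 ((h'.iff R₁ hR₁').2
    ⟨R₁, hR₁, Dom.refl _⟩))
  have := h.unique R hR' R₂ hR₂ R hR (h2.trans h1) (Dom.refl _)
  subst this
  rwa [le_antisymm h2.1 h1.1]

theorem Represents.eq {S S' : Set (Subring KK)} {p p' : Subring KK → Prop}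
    (h : Represents S p) (h' : Represents S' p') (H : ∀ B, IsPoint B → (p B ↔ p' B)) : S = S' :=
  (h.subset h' H).antisymm (h'.subset h fun B hB => (H B hB).symm)

theorem IsPoint.map {B : Subring KK} (hB : IsPoint B) (θ : KK ≃ₐ[ℂ] KK) :
    IsPoint (mapRing θ B) := by
  refine ⟨hB.1.map θ, fun x hx => ?_⟩
  obtain ⟨c, hc⟩ := hB.2 _ (mem_mapRing.1 hx)
  exact ⟨c, vanishes_mapRing'.2 (by rwa [map_sub, map_cst])⟩

theorem Dom.map {R B : Subring KK} (h : Dom R B) (θ : KK ≃ₐ[ℂ] KK) :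
    Dom (mapRing θ R) (mapRing θ B) :=
  ⟨fun _ hx => mem_mapRing.2 (h.1 (mem_mapRing.1 hx)), fun _ hx => vanishes_mapRing'.2 (h.2 _ (vanishes_mapRing'.1 hx))⟩

theorem Represents.map {S : Set (Subring KK)} {p : Subring KK → Prop} (h : Represents S p)
    (θ : KK ≃ₐ[ℂ] KK) : Represents (mapRing θ '' S) (fun B => p (mapRing θ.symm B)) := by
  refine ⟨?_, fun B hB => ?_, fun B hB => ?_⟩
  · rintro _ ⟨R, hR, rfl⟩
    exact (h.point R hR).map θ
  · rw [h.iff _ (hB.map _)]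
    constructor
    · rintro ⟨R, hR, h1⟩
      have := h1.map θ
      rw [mapRing_mapRing_symm] at this
      exact ⟨_, ⟨R, hR, rfl⟩, this⟩
    · rintro ⟨_, ⟨R, hR, rfl⟩, h1⟩
      have := h1.map θ.symm
      rw [mapRing_symm_mapRing] at this
      exact ⟨R, hR, this⟩
  · rintro _ ⟨R, hR, rfl⟩ _ ⟨R', hR', rfl⟩ h1 h2
    have h1 := h1.map θ.symm
    have h2 := h2.map θ.symm
    rw [mapRing_symm_mapRing] at h1 h2
    rw [h.unique _ (hB.map _) R hR R' hR' h1 h2]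

theorem hasValue_mapRing {θ : KK ≃ₐ[ℂ] KK} {B : Subring KK} {x : KK} :
    HasValue (mapRing θ.symm B) x ↔ HasValue B (θ x) := by
  rw [HasValue, HasValue, mem_mapRing, mem_mapRing, AlgEquiv.symm_symm, map_inv₀]

theorem IsPoint.exists_param {B : Subring KK} (hB : IsPoint B) {x : KK} (hx : HasValue B x) :
    ∃ s ∈ lineParams x, Vanishes B s := by
  by_cases h : x ∈ B
  · obtain ⟨c, hc⟩ := hB.2 x h
    exact ⟨_, Or.inl ⟨c, rfl⟩, hc⟩
  · exact ⟨_, Or.inr rfl, IsLoc.vanishes_inv_of_notMem h (hx.resolve_left h)⟩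

theorem IsLoc.hasValue_of_param {B : Subring KK} (hB : IsLoc B) {x s : KK}
    (hs : s ∈ lineParams x) (h : Vanishes B s) : HasValue B x := by
  rcases hs with ⟨c, rfl⟩ | rfl
  · exact Or.inl (hB.mem_of_vanishes_sub h)
  · exact Or.inr h.1

theorem represents_P1P1 :
    Represents P1P1 fun B => HasValue B (coord 0) ∧ HasValue B (coord 1) := by
  have hch : ∀ s ∈ lineParams (coord 0), ∀ t ∈ lineParams (coord 1), IsChart s t :=
    fun s hs t ht => isChart_of_lineParams isChart_coord hs ht
  refine ⟨?_, fun B hB => ?_, fun B hB => ?_⟩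
  · rintro _ ⟨s, hs, t, ht, rfl⟩
    exact (hch s hs t ht).isPoint
  · constructor
    · rintro ⟨h0, h1⟩
      obtain ⟨s, hs, hsB⟩ := hB.exists_param h0
      obtain ⟨t, ht, htB⟩ := hB.exists_param h1
      exact ⟨_, ⟨s, hs, t, ht, rfl⟩, ((hch s hs t ht).dom_iff hB.1).2 ⟨hsB, htB⟩⟩
    · rintro ⟨_, ⟨s, hs, t, ht, rfl⟩, h⟩
      rw [(hch s hs t ht).dom_iff hB.1] at h
      exact ⟨hB.1.hasValue_of_param hs h.1, hB.1.hasValue_of_param ht h.2⟩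
  · rintro _ ⟨s, hs, t, ht, rfl⟩ _ ⟨s', hs', t', ht', rfl⟩ h h'
    rw [(hch s hs t ht).dom_iff hB.1] at h
    rw [(hch s' hs' t' ht').dom_iff hB.1] at h'
    rw [param_unique hB.1 (coord_ne_zero 0) hs hs' h.1 h'.1,
      param_unique hB.1 (coord_ne_zero 1) ht ht' h.2 h'.2]

theorem represents_excSet {u v : KK} (h : IsChart u v) : Represents (excSet u v)
    fun B => Dom (ptRing u v) B ∧ HasValue B (v / u) := by
  have hu := h.ne_zero
  have hv := h.swap.ne_zero
  have hvu : (v / u)⁻¹ = u / v := inv_div _ _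
  have hdom : ∀ B, IsPoint B → ∀ c, Dom (ptRing u (v / u - cst c)) B →
      Dom (ptRing u v) B ∧ Vanishes B (v / u - cst c) := by
    intro B hB c H
    rw [(h.sub_cst_div c).dom_iff hB.1] at H
    refine ⟨(h.dom_iff hB.1).2 ⟨H.1, ?_⟩, H.2⟩
    have := hB.1.mul (hB.1.mem_of_vanishes_sub H.2) H.1
    rwa [div_mul_cancel₀ _ hu] at this
  have hdom' : ∀ B, IsPoint B → Dom (ptRing (u / v) v) B →
      Dom (ptRing u v) B ∧ Vanishes B (v / u)⁻¹ := by
    intro B hB H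
    rw [h.div'.dom_iff hB.1] at H
    refine ⟨(h.dom_iff hB.1).2 ⟨?_, H.2⟩, by rw [hvu]; exact H.1⟩
    have := hB.1.mul H.1.1 H.2
    rwa [div_mul_cancel₀ _ hv] at this
  refine ⟨?_, fun B hB => ⟨?_, ?_⟩, fun B hB => ?_⟩
  · rintro R (⟨c, rfl⟩ | hR)
    · exact (h.sub_cst_div c).isPoint
    · rw [Set.mem_singleton_iff.1 hR]; exact h.div'.isPoint
  · rintro ⟨H, hval⟩
    rw [h.dom_iff hB.1] at H
    by_cases hm : v / u ∈ B
    · obtain ⟨c, hc⟩ := hB.2 _ hm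
      exact ⟨_, Or.inl ⟨c, rfl⟩, ((h.sub_cst_div c).dom_iff hB.1).2 ⟨H.1, hc⟩⟩
    · have := IsLoc.vanishes_inv_of_notMem hm (hval.resolve_left hm)
      rw [hvu] at this
      exact ⟨_, Or.inr rfl, (h.div'.dom_iff hB.1).2 ⟨this, H.2⟩⟩
  · rintro ⟨R, ⟨c, rfl⟩ | hR, H⟩
    · obtain ⟨h1, h2⟩ := hdom B hB c H
      exact ⟨h1, Or.inl (hB.1.mem_of_vanishes_sub h2)⟩
    · rw [Set.mem_singleton_iff.1 hR] at H
      obtain ⟨h1, h2⟩ := hdom' B hB H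
      exact ⟨h1, Or.inr h2.1⟩
  · have hne : v / u ≠ 0 := div_ne_zero hv hu
    rintro R (⟨c, rfl⟩ | hR) R' (⟨c', rfl⟩ | hR') H H'
    · rw [hB.1.value_unique (hdom B hB c H).2 (hdom B hB c' H').2]
    · rw [Set.mem_singleton_iff.1 hR'] at H'
      exact absurd (hdom' B hB H').2 (not_vanishes_inv hne
        (hB.1.mem_of_vanishes_sub (hdom B hB c H).2))
    · rw [Set.mem_singleton_iff.1 hR] at H
      exact absurd (hdom' B hB H).2 (not_vanishes_inv hne
        (hB.1.mem_of_vanishes_sub (hdom B hB c' H').2))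
    · rw [Set.mem_singleton_iff.1 hR, Set.mem_singleton_iff.1 hR']

/-- The condition imposed on a point by the blowup of `u = v = 0`. -/
def BlowCond (u v : KK) (B : Subring KK) : Prop :=
  Vanishes B u → Vanishes B v → HasValue B (v / u)

theorem Represents.blowUp {S : Set (Subring KK)} {p : Subring KK → Prop} (hS : Represents S p)
    {c : KK × KK} (hc : IsChart c.1 c.2) (hcS : ptRing c.1 c.2 ∈ S) :
    Represents (blowUp S c) fun B => p B ∧ BlowCond c.1 c.2 B := by
  have hE := represents_excSet hc
  rw [blowUp_eq]
  refine ⟨?_, fun B hB => ⟨?_, ?_⟩, fun B hB => ?_⟩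
  · rintro R (hR | hR)
    · exact hS.point R hR.1
    · exact hE.point R hR
  · rintro ⟨hp, hcond⟩
    obtain ⟨R, hR, hRB⟩ := (hS.iff B hB).1 hp
    by_cases h : R = ptRing c.1 c.2
    · rw [h] at hRB
      have h2 := (hc.dom_iff hB.1).1 hRB
      obtain ⟨R', hR', h'⟩ := (hE.iff B hB).1 ⟨hRB, hcond h2.1 h2.2⟩
      exact ⟨R', Or.inr hR', h'⟩
    · exact ⟨R, Or.inl ⟨hR, h⟩, hRB⟩
  · rintro ⟨R, hR | hR, hRB⟩
    · refine ⟨(hS.iff B hB).2 ⟨R, hR.1, hRB⟩, fun h1 h2 => ?_⟩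
      exact absurd (hS.unique B hB R hR.1 _ hcS hRB ((hc.dom_iff hB.1).2 ⟨h1, h2⟩)) hR.2
    · have := (hE.iff B hB).2 ⟨R, hR, hRB⟩
      exact ⟨(hS.iff B hB).2 ⟨_, hcS, this.1⟩, fun _ _ => this.2⟩
  · have aux : ∀ R ∈ S \ {ptRing c.1 c.2}, ∀ R' ∈ excSet c.1 c.2, Dom R B → Dom R' B → False := by
      intro R hR R' hR' h h'
      exact hR.2 (hS.unique B hB R hR.1 _ hcS h ((hE.iff B hB).2 ⟨R', hR', h'⟩).1)
    rintro R (hR | hR) R' (hR' | hR') h h'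
    · exact hS.unique B hB R hR.1 R' hR'.1 h h'
    · exact (aux R hR R' hR' h h').elim
    · exact (aux R' hR' R hR h' h).elim
    · exact hE.unique B hB R hR R' hR' h h'

theorem Represents.foldl_blowUp (l : List (KK × KK)) {S : Set (Subring KK)}
    {p : Subring KK → Prop} (hS : Represents S p)
    (H : ∀ l₁ c l₂, l = l₁ ++ c :: l₂ → IsChart c.1 c.2 ∧
      ptRing c.1 c.2 ∈ l₁.foldl SakaiA5.blowUp S) :
    Represents (l.foldl SakaiA5.blowUp S) fun B => p B ∧ ∀ c ∈ l, BlowCond c.1 c.2 B := by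
  induction l generalizing S p with
  | nil => simpa using hS
  | cons c l ih =>
    obtain ⟨hc, hcS⟩ := H [] c l rfl
    have := ih (hS.blowUp hc hcS) fun l₁ c' l₂ h => by
      have := H (c :: l₁) c' l₂ (by rw [h]; rfl)
      exact this
    simpa [and_assoc] using this

namespace PointConfig

/-- The condition for a point to have a center on the blowup of the eight points with local
coordinates `loc i` on `ℙ¹ × ℙ¹` with coordinates `s, t`. -/
def Pred (s t : KK) (loc : Fin 8 → KK × KK) (B : Subring KK) : Prop :=
  HasValue B s ∧ HasValue B t ∧ ∀ i, BlowCond (loc i).1 (loc i).2 B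

theorem Valid.represents {C : PointConfig} (hC : C.Valid) :
    Represents C.surface (Pred (coord 0) (coord 1) C.loc) := by
  have := represents_P1P1.foldl_blowUp (List.ofFn C.loc) (by
    intro l₁ c l₂ h
    have hlen : l₁.length < 8 := by
      have := congrArg List.length h
      simp at this; omega
    set k : Fin 8 := ⟨l₁.length, hlen⟩ with hk
    have hck : c = C.loc k := by
      have h1 : (List.ofFn C.loc)[l₁.length]? = some c := by rw [h]; simp
      rw [List.getElem?_ofFn, dif_pos hlen, Option.some_inj] at h1
      exact h1.symm
    have hget : ∀ j < k, C.loc j ∈ l₁ := by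
      intro j hj
      have h1 : (List.ofFn C.loc)[j.val]? = some (C.loc j) := by
        rw [List.getElem?_ofFn, dif_pos j.2]
      have hj' : j.val < l₁.length := hj
      rw [h, List.getElem?_append_left hj'] at h1
      exact List.mem_of_getElem? h1
    have hmem : ∀ c' ∈ l₁, ∃ j < k, c' = C.loc j := by
      intro c' hc'
      obtain ⟨n, hn, h1⟩ := List.mem_iff_getElem.1 hc'
      have h2 : (List.ofFn C.loc)[n]? = some c' := by
        rw [h, List.getElem?_append_left hn, List.getElem?_eq_getElem hn, h1]
      rw [List.getElem?_ofFn, dif_pos (hn.trans hlen), Option.some_inj] at h2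
      exact ⟨⟨n, hn.trans hlen⟩, hn, h2.symm⟩
    rw [hck]
    refine ⟨hC.chart k, mem_foldl_blowUp_of _ _ ?_ ?_⟩
    · rcases hC.center k with h1 | ⟨j, hj, h1⟩
      · exact Or.inl h1
      · exact Or.inr ⟨_, hget j hj, h1⟩
    · intro c' hc' h1
      obtain ⟨j, hj, rfl⟩ := hmem c' hc'
      exact hj.ne (hC.ctr_injective h1).symm)
  refine ⟨this.point, fun B hB => ?_, this.unique⟩
  refine Iff.trans ?_ (this.iff B hB)
  rw [Pred, and_assoc]
  simp only [List.forall_mem_ofFn_iff]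

theorem pred_map {θ : KK ≃ₐ[ℂ] KK} {s t : KK} {loc : Fin 8 → KK × KK} {B : Subring KK} :
    Pred s t loc (mapRing θ.symm B) ↔ Pred (θ s) (θ t) (fun i => (θ (loc i).1, θ (loc i).2)) B := by
  simp only [Pred, BlowCond, hasValue_mapRing, vanishes_mapRing', AlgEquiv.symm_symm, map_div₀]

theorem Valid.image_surface {C C' : PointConfig} (hC : C.Valid) (hC' : C'.Valid)
    {Φ : KK ≃ₐ[ℂ] KK} (H : ∀ B, IsPoint B → (Pred (coord 0) (coord 1) C.loc B ↔
      Pred (Φ (coord 0)) (Φ (coord 1)) (fun i => (Φ (C'.loc i).1, Φ (C'.loc i).2)) B)) :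
    mapRing Φ '' C'.surface = C.surface :=
  ((hC'.represents.map Φ).eq hC.represents fun B hB => by rw [H B hB, pred_map])

end PointConfig

/-! ### Change of local coordinates -/

theorem ptRing_eq_of {u v u' v' : KK} (h : IsChart u v) (h' : IsChart u' v')
    (H : ∀ B, IsLoc B → Vanishes B u → Vanishes B v → Vanishes B u' ∧ Vanishes B v')
    (H' : ∀ B, IsLoc B → Vanishes B u' → Vanishes B v' → Vanishes B u ∧ Vanishes B v) :
    ptRing u v = ptRing u' v' := by
  have h1 := H _ h.isLoc h.vanishes_left h.vanishes_right
  have h2 := H' _ h'.isLoc h'.vanishes_left h'.vanishes_right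
  exact le_antisymm (h'.isLoc.ptRing_le h2.1 h2.2) (h.isLoc.ptRing_le h1.1 h1.2)

theorem constantCoeff_eq_zero_iff {P : Poly} : constantCoeff P = 0 ↔
    ∃ A B : Poly, P = A * X 0 + B * X 1 := by
  constructor
  · intro h
    have hP : P ∈ Ideal.span ((fun i => (X i : Poly)) '' Set.univ) := by
      rw [mem_ideal_span_X_image]
      intro m hm
      by_contra hne
      push Not at hne
      have : m = 0 := by ext i; simpa using hne i (Set.mem_univ i)
      subst this
      rw [mem_support_iff] at hm
      exact hm h
    have : ((fun i => (X i : Poly)) '' Set.univ) = {X 0, X 1} := by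
      ext x
      simp only [Set.image_univ, Set.mem_range, Fin.exists_fin_two, Set.mem_insert_iff,
        Set.mem_singleton_iff]
      exact ⟨by rintro (h | h) <;> simp [h], by rintro (h | h) <;> simp [h]⟩
    rw [this, Ideal.mem_span_pair] at hP
    obtain ⟨A, B, h1⟩ := hP
    exact ⟨A, B, h1.symm⟩
  · rintro ⟨A, B, rfl⟩; simp

theorem IsChart.exists_comb {u v : KK} (h : IsChart u v) {x : KK}
    (hx : Vanishes (ptRing u v) x) : ∃ α ∈ ptRing u v, ∃ β ∈ ptRing u v, x = α * u + β * v := by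
  obtain ⟨P, Q, hQ, hQ', rfl⟩ := hx.1
  rw [h.vanishes_aeval_div hQ] at hx
  obtain ⟨A, B, rfl⟩ := constantCoeff_eq_zero_iff.1 hx
  refine ⟨_, ⟨A, Q, hQ, hQ', rfl⟩, _, ⟨B, Q, hQ, hQ', rfl⟩, ?_⟩
  simp only [map_add, map_mul, aeval_X]
  simp
  ring

/-- The condition of the blowup depends only on the local ring of the point. -/
theorem blowCond_of_ptRing_eq {u v u' v' : KK} (h : IsChart u v) (h' : IsChart u' v')
    (H : ptRing u v = ptRing u' v') {B : Subring KK} (hB : IsLoc B) (hc : BlowCond u v B) :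
    BlowCond u' v' B := by
  intro hu' hv'
  have hdom := (h'.dom_iff hB).2 ⟨hu', hv'⟩
  rw [← H] at hdom
  have hle := hdom.1
  have hdom2 := (h.dom_iff hB).1 hdom
  have hval := hc hdom2.1 hdom2.2
  have hu0 := h.ne_zero
  have hv0 := h.swap.ne_zero
  obtain ⟨α, hα, β, hβ, h1⟩ := h.exists_comb (x := u') (by rw [H]; exact h'.vanishes_left)
  obtain ⟨γ, hγ, δ, hδ, h2⟩ := h.exists_comb (x := v') (by rw [H]; exact h'.vanishes_right)
  obtain ⟨α', hα', β', hβ', h3⟩ := h'.exists_comb (x := u) (by rw [← H]; exact h.vanishes_left)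
  obtain ⟨γ', hγ', δ', hδ', h4⟩ := h'.exists_comb (x := v) (by rw [← H]; exact h.vanishes_right)
  rw [← H] at hα' hβ' hγ' hδ'
  -- `t` generates the extended ideal
  obtain ⟨t, ht0, htu, htv, htcomb⟩ : ∃ t, t ≠ 0 ∧ u / t ∈ B ∧ v / t ∈ B ∧
      ∃ a ∈ B, ∃ b ∈ B, t = a * u' + b * v' := by
    rcases hval with hm | hm
    · exact ⟨u, hu0, by rw [div_self hu0]; exact B.one_mem, hm, α', hle hα', β', hle hβ', h3⟩
    · rw [inv_div] at hm
      exact ⟨v, hv0, hm, by rw [div_self hv0]; exact B.one_mem, γ', hle hγ', δ', hle hδ', h4⟩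
  obtain ⟨a, ha, b, hb, htc⟩ := htcomb
  have hu't : u' / t ∈ B := by
    rw [h1, add_div, mul_div_assoc, mul_div_assoc]
    exact B.add_mem (B.mul_mem (hle hα) htu) (B.mul_mem (hle hβ) htv)
  have hv't : v' / t ∈ B := by
    rw [h2, add_div, mul_div_assoc, mul_div_assoc]
    exact B.add_mem (B.mul_mem (hle hγ) htu) (B.mul_mem (hle hδ) htv)
  have hone : a * (u' / t) + b * (v' / t) = 1 := by
    rw [← mul_div_assoc, ← mul_div_assoc, ← add_div, ← htc, div_self ht0]
  by_cases hnu : Vanishes B (u' / t)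
  · have hnv : ¬ Vanishes B (v' / t) := fun hnv =>
      hB.not_vanishes_one (by rw [← hone]; exact hB.add (hB.mul ha hnu) (hB.mul hb hnv))
    have := (IsLoc.isUnit_of_not_vanishes hv't hnv).2
    right
    have h5 := B.mul_mem hu't this
    rwa [inv_div, div_mul_div_cancel₀ ht0, ← inv_div] at h5
  · have := (IsLoc.isUnit_of_not_vanishes hu't hnu).2
    left
    have h5 := B.mul_mem hv't this
    rwa [inv_div, div_mul_div_cancel₀ ht0] at h5

theorem excSet_eq_of_ptRing_eq {u v u' v' : KK} (h : IsChart u v) (h' : IsChart u' v')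
    (H : ptRing u v = ptRing u' v') : excSet u v = excSet u' v' := by
  refine (represents_excSet h).eq (represents_excSet h') fun B hB => ?_
  rw [← H]
  refine and_congr_right fun hdom => ?_
  have h1 := (h.dom_iff hB.1).1 hdom
  have h2 := (h'.dom_iff hB.1).1 (by rwa [← H])
  exact ⟨fun hv => blowCond_of_ptRing_eq h h' H hB.1 (fun _ _ => hv) h2.1 h2.2,
    fun hv => blowCond_of_ptRing_eq h' h H.symm hB.1 (fun _ _ => hv) h1.1 h1.2⟩

/-- The exceptional line depends only on the local ring of the point. -/
theorem crv_eq_of_ptRing_eq {u v u' v' : KK} (h : IsChart u v) (h' : IsChart u' v')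
    (H : ptRing u v = ptRing u' v') : crv u (v / u) = crv u' (v' / u') := by
  have h1 : CurveOf (ptRing u (v / u - cst 0)) (crv u (v / u)) := h.div.curveOf_crv 0
  have h2 : ptRing u (v / u - cst 0) ∈ excSet u' v' := by
    rw [← excSet_eq_of_ptRing_eq h h' H]; exact Or.inl ⟨0, rfl⟩
  refine (curveOf_excSet h' h2 h1).resolve_right fun h3 => ?_
  rw [← H] at h3
  obtain ⟨θ, rfl, rfl⟩ := h
  obtain ⟨π, -, h4⟩ := curveOf_ptRing_iff.1 h3
  have hch : IsChart (θ (coord 0)) (θ (coord 1)) := ⟨θ, rfl, rfl⟩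
  refine not_vanishes_both (θ := θ) (π := π) (a := 0) (b := 0) ?_ ?_ <;>
    rw [← h4, cst_zero, sub_zero]
  · exact hch.exc_dominates hch.vanishes_left
  · exact hch.exc_dominates hch.vanishes_right

/-! ### Values of functions -/

/-- `x` has the value `a` at the closed point of `B`. -/
def Tends (B : Subring KK) (x : KK) (a : ℂ) : Prop := Vanishes B (x - cst a)

section Tends

variable {B : Subring KK} {x y : KK} {a b : ℂ}

theorem tends_zero_iff : Tends B x 0 ↔ Vanishes B x := by rw [Tends, cst_zero, sub_zero]

theorem Vanishes.tends (h : Vanishes B x) : Tends B x 0 := tends_zero_iff.2 h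

theorem tends_sub_cst_iff : Vanishes B (x - cst a) ↔ Tends B x a := Iff.rfl

theorem Tends.mem (h : Tends B x a) (hB : IsLoc B) : x ∈ B := hB.mem_of_vanishes_sub h

theorem Tends.unique (h : Tends B x a) (h' : Tends B x b) (hB : IsLoc B) : a = b :=
  hB.value_unique h h'

theorem tends_cst (a : ℂ) : Tends B (cst a) a := by
  rw [Tends, sub_self]; exact IsLoc.vanishes_zero

theorem tends_one : Tends B 1 1 := by
  have := tends_cst (B := B) 1; rwa [cst_one] at this

theorem Tends.add (hx : Tends B x a) (hy : Tends B y b) (hB : IsLoc B) :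
    Tends B (x + y) (a + b) := by
  have := hB.add hx hy
  rwa [← add_sub_add_comm, ← cst_add] at this

theorem Tends.neg (hx : Tends B x a) (hB : IsLoc B) : Tends B (-x) (-a) := by
  have := hB.neg hx
  rwa [neg_sub', ← cst_neg] at this

theorem Tends.sub (hx : Tends B x a) (hy : Tends B y b) (hB : IsLoc B) :
    Tends B (x - y) (a - b) := by
  rw [sub_eq_add_neg, sub_eq_add_neg]; exact hx.add (hy.neg hB) hB

theorem Tends.mul (hx : Tends B x a) (hy : Tends B y b) (hB : IsLoc B) :
    Tends B (x * y) (a * b) := by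
  have := hB.add (hB.mul (hy.mem hB) hx) (hB.mul (hB.cst_mem a) hy)
  rw [Tends, cst_mul]
  convert this using 1
  ring

theorem Tends.inv (hx : Tends B x a) (ha : a ≠ 0) (hB : IsLoc B) : Tends B x⁻¹ a⁻¹ := by
  have hnv : ¬ Vanishes B x := fun h => ha (hx.unique h.tends hB)
  obtain ⟨h0, hinv⟩ := IsLoc.isUnit_of_not_vanishes (hx.mem hB) hnv
  have := hB.mul (B.mul_mem hinv (hB.cst_mem (-a⁻¹))) hx
  rw [Tends]
  convert this using 1
  have hc := cst_ne_zero ha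
  rw [cst_neg, cst_inv]
  field_simp
  ring

theorem Tends.div (hx : Tends B x a) (hy : Tends B y b) (hb : b ≠ 0) (hB : IsLoc B) :
    Tends B (x / y) (a / b) := by
  rw [div_eq_mul_inv, div_eq_mul_inv]; exact hx.mul (hy.inv hb hB) hB

theorem Tends.ne_zero (hx : Tends B x a) (ha : a ≠ 0) (hB : IsLoc B) : x ≠ 0 := by
  rintro rfl
  exact ha (hx.unique IsLoc.vanishes_zero.tends hB)

theorem Tends.not_vanishes (hx : Tends B x a) (ha : a ≠ 0) (hB : IsLoc B) : ¬ Vanishes B x :=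
  fun h => ha (hx.unique h.tends hB)

/-- To show that `x` vanishes, compute its value. -/
theorem Tends.vanishes (h : Tends B y b) (he : x = y) (hb : b = 0) : Vanishes B x := by
  rw [he, ← tends_zero_iff, ← hb]; exact h

theorem Tends.congr (h : Tends B y b) (he : x = y) (hb : a = b) : Tends B x a := by
  rw [he, hb]; exact h

theorem tends_of_vanishes_add (h : Vanishes B (x + cst a)) : Tends B x (-a) := by
  rw [Tends, cst_neg, sub_neg_eq_add]; exact h

theorem tends_of_vanishes_sub_one (h : Vanishes B (x - 1)) : Tends B x 1 := by
  rw [Tends, cst_one]; exact h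

theorem tends_of_vanishes_add_one (h : Vanishes B (x + 1)) : Tends B x (-1) := by
  rw [Tends, cst_neg, cst_one, sub_neg_eq_add]; exact h

theorem HasValue.inv (h : HasValue B x) : HasValue B x⁻¹ := by
  rw [HasValue, inv_inv]; exact h.symm

theorem hasValue_inv_iff : HasValue B x⁻¹ ↔ HasValue B x :=
  ⟨fun h => by simpa using h.inv, HasValue.inv⟩

theorem Tends.hasValue (hx : Tends B x a) (hB : IsLoc B) : HasValue B x := Or.inl (hx.mem hB)

theorem HasValue.mul (h : HasValue B x) (hy : Tends B y a) (ha : a ≠ 0) (hB : IsLoc B) :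
    HasValue B (x * y) := by
  rcases h with h | h
  · exact Or.inl (B.mul_mem h (hy.mem hB))
  · right
    rw [mul_inv]
    exact B.mul_mem h ((hy.inv ha hB).mem hB)

theorem HasValue.add (h : HasValue B x) (hy : y ∈ B) (hB : IsLoc B) : HasValue B (x + y) := by
  by_cases hx : x ∈ B
  · exact Or.inl (B.add_mem hx hy)
  · have hv := IsLoc.vanishes_inv_of_notMem hx (h.resolve_left hx)
    have hx0 : x ≠ 0 := by rintro rfl; exact hx B.zero_mem
    have h1 : Tends B (1 + y * x⁻¹) (1 + 0) := tends_one.add (hB.mul hy hv).tends hB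
    rw [add_zero] at h1
    have h2 := (hv.tends.mul (h1.inv one_ne_zero hB) hB).mem hB
    right
    have h4 : x⁻¹ * (1 + y * x⁻¹)⁻¹ = (x + y)⁻¹ := by
      rw [← mul_inv]; congr 1; field_simp
    rwa [h4] at h2

theorem HasValue.of_affine (h : HasValue B x) {α β : KK} (hα : Tends B α a) (ha : a ≠ 0)
    (hβ : β ∈ B) (hB : IsLoc B) (he : y = x * α + β) : HasValue B y := by
  rw [he]; exact (h.mul hα ha hB).add hβ hB

theorem HasValue.of_mul (h : HasValue B x) {α : KK} (hα : Tends B α a) (ha : a ≠ 0)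
    (hB : IsLoc B) (he : y = x * α) : HasValue B y := by
  rw [he]; exact h.mul hα ha hB

theorem IsPoint.tends_or (hB : IsPoint B) (h : HasValue B x) :
    (∃ c, Tends B x c) ∨ Vanishes B x⁻¹ := by
  by_cases hx : x ∈ B
  · exact Or.inl (hB.2 x hx)
  · exact Or.inr (IsLoc.vanishes_inv_of_notMem hx (h.resolve_left hx))

theorem IsPoint.unit_or (hB : IsPoint B) (h : HasValue B x) :
    (∃ c, c ≠ 0 ∧ Tends B x c) ∨ Vanishes B x ∨ Vanishes B x⁻¹ := by
  rcases hB.tends_or h with ⟨c, hc⟩ | h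
  · by_cases h0 : c = 0
    · subst h0; exact Or.inr (Or.inl (tends_zero_iff.1 hc))
    · exact Or.inl ⟨c, h0, hc⟩
  · exact Or.inr (Or.inr h)

theorem Vanishes.mul_mem (hx : Vanishes B x) (hy : y ∈ B) (hB : IsLoc B) : Vanishes B (x * y) := by
  rw [mul_comm]; exact hB.mul hy hx

theorem Vanishes.mul_tends (hx : Vanishes B x) (hy : Tends B y a) (hB : IsLoc B) :
    Vanishes B (x * y) := hx.mul_mem (hy.mem hB) hB

theorem Vanishes.of_mul (hx : Vanishes B x) {z : KK} (hy : Tends B y a) (hB : IsLoc B)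
    (he : z = x * y) : Vanishes B z := by rw [he]; exact hx.mul_tends hy hB

end Tends

/-- Two descriptions of the same curve. -/
theorem IsChart.crv_eq {u w u' w' : KK} (h : IsChart u w) (h' : IsChart u' w')
    (hu : Vanishes (crv u w) u') {α β : KK} {a b : ℂ} (hα : Tends (crv u w) α a) (ha : a ≠ 0)
    (hβ : Tends (crv u w) β b) (he : w' = w * α + β) : crv u w = crv u' w' := by
  have hB := h.isCurve.isLoc
  refine h.isCurve.eq_crv h' hu ?_ fun c hc => ?_
  · rw [he]
    exact add_mem (mul_mem h.crv_mem_right (hα.mem hB)) (hβ.mem hB)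
  · have hc : Tends (crv u w) w' c := hc
    rw [he] at hc
    have h1 := (hc.sub hβ hB).mul (hα.inv ha hB) hB
    rw [add_sub_cancel_right, mul_inv_cancel_right₀ (hα.ne_zero ha hB)] at h1
    exact h.crv_not_vanishes _ h1

theorem IsChart.div_notMem {u v : KK} (h : IsChart u v) : v / u ∉ ptRing u v := by
  intro hm
  obtain ⟨c, hc⟩ := h.isPoint.2 _ hm
  exact h.div.crv_not_vanishes c (h.exc_dominates hc)

theorem IsChart.hasOrder_right_exc {u v : KK} (h : IsChart u v) :
    HasOrder (crv u (v / u)) v 1 := by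
  have := h.div.isCurve.hasOrder_mul h.div.hasOrder_left h.div.hasOrder_right
  rwa [mul_div_cancel₀ _ h.ne_zero] at this

theorem Tends.hasOrder {V : Subring KK} {x : KK} {a : ℂ} (h : Tends V x a) (ha : a ≠ 0)
    (hV : IsCurve V) : HasOrder V x 0 :=
  hV.hasOrder_zero_iff.2 ⟨h.mem hV.isLoc, h.not_vanishes ha hV.isLoc⟩

/-! ### Eight points over given points of `ℙ¹ × ℙ¹` -/

/-- The local parameter at a point of `ℙ¹`; `none` is the point at infinity. -/
def param (x : KK) : Option ℂ → KK
  | none => x⁻¹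
  | some c => x - cst c

theorem param_mem (x : KK) (o : Option ℂ) : param x o ∈ lineParams x := by
  cases o
  · exact Or.inr rfl
  · exact Or.inl ⟨_, rfl⟩

theorem param_injective {B : Subring KK} (hB : IsLoc B) {x : KK} (hx : x ≠ 0) {o o' : Option ℂ}
    (h : Vanishes B (param x o)) (h' : Vanishes B (param x o')) : o = o' := by
  cases o <;> cases o'
  · rfl
  · exact absurd h (not_vanishes_inv hx (hB.mem_of_vanishes_sub h'))
  · exact absurd h' (not_vanishes_inv hx (hB.mem_of_vanishes_sub h))
  · rw [hB.value_unique h h']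

namespace PointConfig

variable {C : PointConfig}

/-- The `i`-th point lies over `b i ∈ ℙ¹ × ℙ¹`, and it is a point of `ℙ¹ × ℙ¹` or on one of the previous
exceptional lines; points over the same point are distinguished by their position on exceptional
lines. -/
structure Tree (C : PointConfig) (b : Fin 8 → Fin 2 → Option ℂ) : Prop where
  step : ∀ i, (C.loc i = (param (coord 0) (b i 0), param (coord 1) (b i 1)) ∨
      C.loc i = (param (coord 1) (b i 1), param (coord 0) (b i 0))) ∨
    ∃ j < i, b i = b j ∧ ∃ c, C.loc i = ((C.loc j).1, (C.loc j).2 / (C.loc j).1 - cst c)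
  sep : ∀ i j, i < j → b i ≠ b j ∨ ∃ c, Vanishes (C.ctr j) ((C.loc i).2 / (C.loc i).1 - cst c)

variable {b : Fin 8 → Fin 2 → Option ℂ}

theorem Tree.chart (h : C.Tree b) (i : Fin 8) : IsChart (C.loc i).1 (C.loc i).2 := by
  induction i using WellFoundedLT.induction with
  | ind i ih =>
    rcases h.step i with (h1 | h1) | ⟨j, hj, -, c, h1⟩
    · rw [h1]; exact isChart_of_lineParams isChart_coord (param_mem _ _) (param_mem _ _)
    · rw [h1]; exact (isChart_of_lineParams isChart_coord (param_mem _ _) (param_mem _ _)).swap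
    · rw [h1]; exact (ih j hj).sub_cst_div c

theorem Tree.vanishes (h : C.Tree b) (i : Fin 8) (k : Fin 2) :
    Vanishes (C.ctr i) (param (coord k) (b i k)) := by
  induction i using WellFoundedLT.induction with
  | ind i ih =>
    have hc := h.chart i
    have hl := hc.vanishes_left
    have hr := hc.vanishes_right
    rcases h.step i with (h1 | h1) | ⟨j, hj, hb, c, h1⟩
    · rw [h1] at hl hr
      rw [ctr, h1]
      fin_cases k
      · exact hl
      · exact hr
    · rw [h1] at hl hr
      rw [ctr, h1]
      fin_cases k
      · exact hr
      · exact hl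
    · rw [hb]
      refine (h.chart j).excSet_dominates ?_ (ih j hj)
      rw [ctr, h1]
      exact Or.inl ⟨c, rfl⟩

theorem Tree.vanishes_exc (h : C.Tree b) (i : Fin 8) (k : Fin 2) :
    Vanishes (C.exc i) (param (coord k) (b i k)) := (h.chart i).exc_dominates (h.vanishes i k)

theorem Tree.valid (h : C.Tree b) : C.Valid := by
  have key : ∀ i j, i < j → C.exc i ≠ C.exc j ∧ C.ctr i ≠ C.ctr j := by
    intro i j hij
    rcases h.sep i j hij with hb | ⟨c, hc⟩
    · obtain ⟨k, hk⟩ := Function.ne_iff.1 hb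
      refine ⟨fun he => hk ?_, fun he => hk ?_⟩
      · exact param_injective (h.chart i).div.isCurve.isLoc (coord_ne_zero k) (h.vanishes_exc i k)
          (by have := h.vanishes_exc j k; rwa [← he] at this)
      · exact param_injective (h.chart i).isLoc (coord_ne_zero k) (h.vanishes i k)
          (by have := h.vanishes j k; rwa [← he] at this)
    · refine ⟨fun he => ?_, fun he => ?_⟩
      · have := (h.chart j).exc_dominates hc
        change Vanishes (C.exc j) _ at this
        rw [← he] at this
        exact (h.chart i).div.crv_not_vanishes c this
      · rw [← he] at hc
        exact (h.chart i).div_notMem ((h.chart i).isLoc.mem_of_vanishes_sub hc)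
  refine ⟨h.chart, fun i => ?_, fun i j hij => ?_, fun i j hij => ?_⟩
  · rcases h.step i with (h1 | h1) | ⟨j, hj, -, c, h1⟩
    · left; rw [ctr, h1]; exact ⟨_, param_mem _ _, _, param_mem _ _, rfl⟩
    · left; rw [ctr, h1, ptRing_swap]; exact ⟨_, param_mem _ _, _, param_mem _ _, rfl⟩
    · right; refine ⟨j, hj, ?_⟩; rw [ctr, h1]; exact Or.inl ⟨c, rfl⟩
  · by_contra hne
    rcases lt_or_gt_of_ne hne with hl | hl
    · exact (key i j hl).1 hij
    · exact (key j i hl).1 hij.symm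
  · by_contra hne
    rcases lt_or_gt_of_ne hne with hl | hl
    · exact (key i j hl).2 hij
    · exact (key j i hl).2 hij.symm

theorem Tree.hasOrder_zero (h : C.Tree b) {i : Fin 8} {k : Fin 2} {c d : ℂ} (hb : b i k = some d)
    (hcd : c ≠ d) : HasOrder (C.exc i) (coord k - cst c) 0 := by
  have h1 := h.vanishes_exc i k
  rw [hb] at h1
  have h1 : Tends (C.exc i) (coord k) d := h1
  have hV := h.valid.isCurve_exc i
  exact (h1.sub (tends_cst c) hV.isLoc).hasOrder (sub_ne_zero.2 hcd.symm) hV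

theorem hasOrder_pole {V : Subring KK} (hV : IsCurve V) {x : KK} {m : ℤ} (hm : 0 < m)
    (h : HasOrder V x⁻¹ m) (c : ℂ) : HasOrder V (x - cst c) (-m) := by
  have hx0 : x ≠ 0 := fun h0 => h.ne_zero (by rw [h0, inv_zero])
  have h1 : HasOrder V (1 - cst c * x⁻¹) 0 := by
    have := tends_one.sub ((tends_cst c).mul ((hV.vanishes_iff h).2 hm).tends hV.isLoc) hV.isLoc
    rw [mul_zero, sub_zero] at this
    exact this.hasOrder one_ne_zero hV
  have h2 := hV.hasOrder_div h1 h
  have h3 : (1 - cst c * x⁻¹) / x⁻¹ = x - cst c := by field_simp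
  rwa [h3, zero_sub] at h2

theorem Tree.hasPole (h : C.Tree b) {i : Fin 8} {k : Fin 2} {m : ℤ}
    (hb : (b i k ≠ none ∧ m = 0) ∨ (b i k = none ∧ HasOrder (C.exc i) (param (coord k) (b i k)) m)) :
    ∃ o, HasOrder (C.exc i) (coord k) o ∧ m = max (-o) 0 := by
  have hV := h.valid.isCurve_exc i
  have hv := h.vanishes_exc i k
  rcases hb with ⟨hb, rfl⟩ | ⟨hb, hm⟩
  · obtain ⟨d, hd⟩ := Option.ne_none_iff_exists'.1 hb
    rw [hd] at hv
    obtain ⟨o, ho⟩ := hV.exists_hasOrder (coord_ne_zero k)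
    have := (hV.mem_iff ho).1 (hV.isLoc.mem_of_vanishes_sub hv)
    exact ⟨o, ho, by omega⟩
  · have h0 := (hV.vanishes_iff hm).1 hv
    rw [hb] at hm
    refine ⟨-m, ?_, by omega⟩
    have := hV.hasOrder_inv hm
    rwa [param, inv_inv] at this

end PointConfig

namespace PointConfig

variable {C : PointConfig} {b : Fin 8 → Fin 2 → Option ℂ}

/-- The `i`-th point is the point `b i` of `ℙ¹ × ℙ¹`. -/
def IsBase (C : PointConfig) (b : Fin 8 → Fin 2 → Option ℂ) (i : Fin 8) : Prop :=
  C.loc i = (param (coord 0) (b i 0), param (coord 1) (b i 1)) ∨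
    C.loc i = (param (coord 1) (b i 1), param (coord 0) (b i 0))

theorem Tree.order_one (h : C.Tree b) {i : Fin 8} (hi : C.IsBase b i ∨ ∃ j, C.IsBase b j ∧
    b i = b j ∧ ∃ c ≠ 0, C.loc i = ((C.loc j).1, (C.loc j).2 / (C.loc j).1 - cst c)) (k : Fin 2) :
    HasOrder (C.exc i) (param (coord k) (b i k)) 1 := by
  have key : ∀ j, C.IsBase b j → HasOrder (C.exc i) (C.loc j).1 1 →
      HasOrder (C.exc i) (C.loc j).2 1 → ∀ k, HasOrder (C.exc i) (param (coord k) (b j k)) 1 := by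
    intro j hj h1 h2 k
    rcases hj with hj | hj
    · rw [hj] at h1 h2
      fin_cases k
      · exact h1
      · exact h2
    · rw [hj] at h1 h2
      fin_cases k
      · exact h2
      · exact h1
  have hl : HasOrder (C.exc i) (C.loc i).1 1 := (h.chart i).div.hasOrder_left
  rcases hi with hi | ⟨j, hj, hb, c, hc, hij⟩
  · exact key i hi hl (h.chart i).hasOrder_right_exc k
  · rw [hb]
    have hu : (C.loc i).1 = (C.loc j).1 := by rw [hij]
    rw [hu] at hl
    refine key j hj hl ?_ k
    have hV := h.valid.isCurve_exc i
    have hv : Vanishes (C.exc i) (C.loc i).2 :=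
      (h.chart i).exc_dominates (h.chart i).vanishes_right
    have h3 : Tends (C.exc i) ((C.loc j).2 / (C.loc j).1) c := by rw [hij] at hv; exact hv
    have h4 := hV.hasOrder_mul (h3.hasOrder hc hV) hl
    rwa [div_mul_cancel₀ _ (h.chart j).ne_zero] at h4

theorem Tree.hasOrder_one (h : C.Tree b) {i : Fin 8} (hi : C.IsBase b i ∨ ∃ j, C.IsBase b j ∧
    b i = b j ∧ ∃ c ≠ 0, C.loc i = ((C.loc j).1, (C.loc j).2 / (C.loc j).1 - cst c)) {k : Fin 2}
    {c : ℂ} (hb : b i k = some c) : HasOrder (C.exc i) (coord k - cst c) 1 := by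
  have := h.order_one hi k
  rwa [hb] at this

theorem Tree.hasOrder_neg_one (h : C.Tree b) {i : Fin 8} (hi : C.IsBase b i ∨ ∃ j, C.IsBase b j ∧
    b i = b j ∧ ∃ c ≠ 0, C.loc i = ((C.loc j).1, (C.loc j).2 / (C.loc j).1 - cst c)) {k : Fin 2}
    (hb : b i k = none) (c : ℂ) : HasOrder (C.exc i) (coord k - cst c) (-1) := by
  have := h.order_one hi k
  rw [hb] at this
  exact hasOrder_pole (h.valid.isCurve_exc i) one_pos this c

end PointConfig

/-- The classes of the proper transforms of the exceptional lines. -/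
def excClasses (next : Fin 8 → Option (Fin 8)) (i : Fin 8) : PicLat :=
  match next i with
  | none => ex (i.val + 1)
  | some j => ex (i.val + 1) - ex (j.val + 1)

/-- The classes of the basic curves. -/
def basicClasses (next : Fin 8 → Option (Fin 8)) (p : Fin 2 → Fin 8 → ℤ) : Fin 10 → PicLat :=
  Fin.cons (fibreClass 0 - ∑ i, p 0 i • excClasses next i)
    (Fin.cons (fibreClass 1 - ∑ i, p 1 i • excClasses next i) (excClasses next))

open PointConfig

/-! ### The (b)-model -/

/-- Local coordinates of the eight points of the (b)-model in terms of `f` and `g`. -/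
def locB (a : Fin 5 → ℂ) (f g : KK) : Fin 8 → KK × KK :=
  ![(f⁻¹, g - 1), (f⁻¹, g⁻¹), (f⁻¹, f / g + cst (a 4 / a 0)), (g⁻¹, f - 1),
      (f, g - cst (1 / a 2)), (f, g), (f, g / f + cst (1 / a 4)), (g, f - cst (a 1))]

theorem confB_loc (a : Fin 5 → ℂ) : (confB a).loc = locB a (coord 0) (coord 1) := rfl

theorem map_locB (θ : KK ≃ₐ[ℂ] KK) (a : Fin 5 → ℂ) (f g : KK) (i : Fin 8) :
    (θ (locB a f g i).1, θ (locB a f g i).2) = locB a (θ f) (θ g) i := by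
  fin_cases i <;> simp [locB, map_cst]

/-- The points of `ℙ¹ × ℙ¹` under the eight points of the (b)-model. -/
def baseB (a : Fin 5 → ℂ) : Fin 8 → Fin 2 → Option ℂ :=
  ![![none, some 1], ![none, none], ![none, none], ![some 1, none], ![some 0, some (1 / a 2)],
    ![some 0, some 0], ![some 0, some 0], ![some (a 1), some 0]]

theorem stepB {a : Fin 5 → ℂ} (ha : ∀ i, a i ≠ 0) (i : Fin 8) : (confB a).IsBase (baseB a) i ∨
    ∃ j < i, (confB a).IsBase (baseB a) j ∧ baseB a i = baseB a j ∧ ∃ c ≠ 0,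
      (confB a).loc i = (((confB a).loc j).1, ((confB a).loc j).2 / ((confB a).loc j).1 - cst c) := by
  have h1 : (confB a).IsBase (baseB a) 1 := Or.inl (by simp [confB_loc, locB, baseB, param])
  have h5 : (confB a).IsBase (baseB a) 5 := Or.inl (by simp [confB_loc, locB, baseB, param])
  fin_cases i
  · exact Or.inl (Or.inl (by simp [confB_loc, locB, baseB, param]))
  · exact Or.inl h1
  · refine Or.inr ⟨1, by decide, h1, rfl, -(a 4 / a 0),
      neg_ne_zero.2 (div_ne_zero (ha _) (ha _)), ?_⟩
    simp only [confB_loc, locB, cst_neg, sub_neg_eq_add]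
    simp [div_eq_mul_inv, mul_comm]
  · exact Or.inl (Or.inr (by simp [confB_loc, locB, baseB, param]))
  · exact Or.inl (Or.inl (by simp [confB_loc, locB, baseB, param]))
  · exact Or.inl h5
  · refine Or.inr ⟨5, by decide, h5, rfl, -(1 / a 4),
      neg_ne_zero.2 (div_ne_zero one_ne_zero (ha _)), ?_⟩
    simp only [confB_loc, locB, cst_neg, sub_neg_eq_add]
    simp
  · exact Or.inl (Or.inr (by simp [confB_loc, locB, baseB, param]))

theorem treeB {a : Fin 5 → ℂ} (ha : ∀ i, a i ≠ 0) : (confB a).Tree (baseB a) := by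
  refine ⟨fun i => ?_, fun i j hij => ?_⟩
  · rcases stepB ha i with h | ⟨j, hj, -, h2, c, -, h3⟩
    · exact Or.inl h
    · exact Or.inr ⟨j, hj, h2, c, h3⟩
  · by_cases hc : (i = 1 ∧ j = 2) ∨ (i = 5 ∧ j = 6)
    · right
      have hch : IsChart ((confB a).loc j).1 ((confB a).loc j).2 := by
        rcases hc with ⟨rfl, rfl⟩ | ⟨rfl, rfl⟩
        · have := (isChart_of_lineParams isChart_coord (Or.inr rfl) (Or.inr rfl)).div.sub_cst
            (-(a 4 / a 0))
          simpa [confB_loc, locB, cst_neg, div_eq_mul_inv, mul_comm] using this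
        · have := isChart_coord.div.sub_cst (-(1 / a 4))
          simpa [confB_loc, locB, cst_neg] using this
      have := hch.vanishes_right
      rcases hc with ⟨rfl, rfl⟩ | ⟨rfl, rfl⟩
      · refine ⟨-(a 4 / a 0), ?_⟩
        simpa [confB_loc, locB, cst_neg, div_eq_mul_inv, mul_comm, ctr] using this
      · refine ⟨-(1 / a 4), ?_⟩
        simpa [confB_loc, locB, cst_neg, ctr] using this
    · left
      have h1 := ha 1
      have h2 := ha 2
      have h1' := h1.symm
      clear ha
      intro h
      have h3 := congrFun h 0
      have h4 := congrFun h 1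
      fin_cases i <;> fin_cases j <;> simp_all [baseB]

/-- Pole orders of `f` and `g` along the exceptional lines of the (b)-model. -/
def poleB : Fin 2 → Fin 8 → ℤ := ![![1, 1, 1, 0, 0, 0, 0, 0], ![0, 1, 1, 1, 0, 0, 0, 0]]

theorem simpleB {a : Fin 5 → ℂ} (ha : ∀ i, a i ≠ 0) (i : Fin 8) : (confB a).IsBase (baseB a) i ∨
    ∃ j, (confB a).IsBase (baseB a) j ∧ baseB a i = baseB a j ∧ ∃ c ≠ 0,
      (confB a).loc i = (((confB a).loc j).1, ((confB a).loc j).2 / ((confB a).loc j).1 - cst c) :=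
  (stepB ha i).imp_right fun ⟨j, _, h⟩ => ⟨j, h⟩

theorem hasPoleB (a : Fin 5 → ℂ) (k : Fin 2) (i : Fin 8) :
    (baseB a i k ≠ none ∧ poleB k i = 0) ∨ (baseB a i k = none ∧ poleB k i = 1) := by
  fin_cases i <;> fin_cases k <;> simp [baseB, poleB]

/-- Which points of the (b)-model have infinitely near points. -/
def nextB : Fin 8 → Option (Fin 8) := ![none, some 2, none, none, none, some 6, none, none]

/-- The inverse of the matrix of the classes of basic curves of the (b)-model. -/
def invB : Fin 10 → PicLat := ![![1, 0, 1, 1, 1, 0, 0, 0, 0, 0], ![0, 1, 0, 1, 1, 1, 0, 0, 0, 0],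
    ![0, 0, 1, 0, 0, 0, 0, 0, 0, 0], ![0, 0, 0, 1, 1, 0, 0, 0, 0, 0],
    ![0, 0, 0, 0, 1, 0, 0, 0, 0, 0], ![0, 0, 0, 0, 0, 1, 0, 0, 0, 0],
    ![0, 0, 0, 0, 0, 0, 1, 0, 0, 0], ![0, 0, 0, 0, 0, 0, 0, 1, 1, 0],
    ![0, 0, 0, 0, 0, 0, 0, 0, 1, 0], ![0, 0, 0, 0, 0, 0, 0, 0, 0, 1]]

theorem basicClasses_mul_invB : Matrix.of (basicClasses nextB poleB) * Matrix.of invB = 1 := by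
  decide +kernel

/-- The basis of the Picard group of the (b)-model. -/
def markB {a : Fin 5 → ℂ} (ha : ∀ i, a i ≠ 0) : (confB a).MarkData where
  valid := (treeB ha).valid
  p := poleB
  hasPole k i := (treeB ha).hasPole <| (hasPoleB a k i).imp_right fun h =>
    ⟨h.1, by rw [h.2]; exact (treeB ha).order_one (simpleB ha i) k⟩
  inv := invB
  left_inv := basicClasses_mul_invB

/-! ### The (a)-model -/

/-- Local coordinates of the eight points of the (a)-model in terms of `f` and `g`. -/
def locA (a : Fin 5 → ℂ) (f g : KK) : Fin 8 → KK × KK :=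
  ![(f⁻¹, g), (f⁻¹, g⁻¹), (f⁻¹, f / g + 1), (g⁻¹, f - 1),
      (f, g - cst (a 4 / (a 0 * a 2))), (f, g - cst (a 4 / a 0)), (g, f - cst (a 4)),
      (f⁻¹, f * g + cst (a 1 * a 4 / a 0))]

theorem confA_loc (a : Fin 5 → ℂ) : (confA a).loc = locA a (coord 0) (coord 1) := rfl

theorem map_locA (θ : KK ≃ₐ[ℂ] KK) (a : Fin 5 → ℂ) (f g : KK) (i : Fin 8) :
    (θ (locA a f g i).1, θ (locA a f g i).2) = locA a (θ f) (θ g) i := by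
  fin_cases i <;> simp [locA, map_cst]

/-- The points of `ℙ¹ × ℙ¹` under the eight points of the (a)-model. -/
def baseA (a : Fin 5 → ℂ) : Fin 8 → Fin 2 → Option ℂ :=
  ![![none, some 0], ![none, none], ![none, none], ![some 1, none],
    ![some 0, some (a 4 / (a 0 * a 2))], ![some 0, some (a 4 / a 0)], ![some (a 4), some 0],
    ![none, some 0]]

theorem stepA {a : Fin 5 → ℂ} (ha : ∀ i, a i ≠ 0) (i : Fin 8) : (confA a).IsBase (baseA a) i ∨
    ∃ j < i, (confA a).IsBase (baseA a) j ∧ baseA a i = baseA a j ∧ ∃ c ≠ 0,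
      (confA a).loc i = (((confA a).loc j).1, ((confA a).loc j).2 / ((confA a).loc j).1 - cst c) := by
  have h1 : (confA a).IsBase (baseA a) 1 := Or.inl (by simp [confA_loc, locA, baseA, param])
  have h0 : (confA a).IsBase (baseA a) 0 := Or.inl (by simp [confA_loc, locA, baseA, param])
  fin_cases i
  · exact Or.inl h0
  · exact Or.inl h1
  · refine Or.inr ⟨1, by decide, h1, rfl, -1, by norm_num, ?_⟩
    simp only [confA_loc, locA, cst_neg, sub_neg_eq_add]
    simp [div_eq_mul_inv, mul_comm]
  · exact Or.inl (Or.inr (by simp [confA_loc, locA, baseA, param]))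
  · exact Or.inl (Or.inl (by simp [confA_loc, locA, baseA, param]))
  · exact Or.inl (Or.inl (by simp [confA_loc, locA, baseA, param]))
  · exact Or.inl (Or.inr (by simp [confA_loc, locA, baseA, param]))
  · refine Or.inr ⟨0, by decide, h0, rfl, -(a 1 * a 4 / a 0),
      neg_ne_zero.2 (div_ne_zero (mul_ne_zero (ha _) (ha _)) (ha _)), ?_⟩
    simp only [confA_loc, locA, cst_neg, sub_neg_eq_add]
    simp [div_eq_mul_inv, mul_comm]

theorem simpleA {a : Fin 5 → ℂ} (ha : ∀ i, a i ≠ 0) (i : Fin 8) : (confA a).IsBase (baseA a) i ∨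
    ∃ j, (confA a).IsBase (baseA a) j ∧ baseA a i = baseA a j ∧ ∃ c ≠ 0,
      (confA a).loc i = (((confA a).loc j).1, ((confA a).loc j).2 / ((confA a).loc j).1 - cst c) :=
  (stepA ha i).imp_right fun ⟨j, _, h⟩ => ⟨j, h⟩

theorem treeA {a : Fin 5 → ℂ} (ha : ∀ i, a i ≠ 0) (ha2 : a 2 ≠ 1) :
    (confA a).Tree (baseA a) := by
  refine ⟨fun i => ?_, fun i j hij => ?_⟩
  · rcases stepA ha i with h | ⟨j, hj, -, h2, c, -, h3⟩
    · exact Or.inl h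
    · exact Or.inr ⟨j, hj, h2, c, h3⟩
  · by_cases hc : (i = 1 ∧ j = 2) ∨ (i = 0 ∧ j = 7)
    · right
      have hch : IsChart ((confA a).loc j).1 ((confA a).loc j).2 := by
        rcases hc with ⟨rfl, rfl⟩ | ⟨rfl, rfl⟩
        · have := (isChart_of_lineParams isChart_coord (Or.inr rfl) (Or.inr rfl)).div.sub_cst (-1)
          simpa [confA_loc, locA, cst_neg, div_eq_mul_inv, mul_comm] using this
        · have := isChart_coord.swap.inv.swap.div.sub_cst (-(a 1 * a 4 / a 0))
          simpa [confA_loc, locA, cst_neg, div_eq_mul_inv, mul_comm] using this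
      have := hch.vanishes_right
      rcases hc with ⟨rfl, rfl⟩ | ⟨rfl, rfl⟩
      · refine ⟨-1, ?_⟩
        simpa [confA_loc, locA, cst_neg, div_eq_mul_inv, mul_comm, ctr] using this
      · refine ⟨-(a 1 * a 4 / a 0), ?_⟩
        simpa [confA_loc, locA, cst_neg, ctr, div_eq_mul_inv, mul_comm] using this
    · left
      have h0 := ha 0
      have h2 := ha 2
      have h5 := ha 4
      have h6 : a 4 / (a 0 * a 2) ≠ a 4 / a 0 := by
        intro h; apply ha2; field_simp at h; exact h.symm
      have h7 : a 4 / (a 0 * a 2) ≠ 0 := div_ne_zero h5 (mul_ne_zero h0 h2)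
      have h8 : a 4 / a 0 ≠ 0 := div_ne_zero h5 h0
      have h5' := h5.symm
      unfold baseA
      generalize a 4 / (a 0 * a 2) = x, a 4 / a 0 = y at *
      clear ha
      intro h
      have h3 := congrFun h 0
      have h4 := congrFun h 1
      fin_cases i <;> fin_cases j <;> simp_all

/-- Pole orders of `f` and `g` along the exceptional lines of the (a)-model. -/
def poleA : Fin 2 → Fin 8 → ℤ := ![![1, 1, 1, 0, 0, 0, 0, 1], ![0, 1, 1, 1, 0, 0, 0, 0]]

theorem hasPoleA (a : Fin 5 → ℂ) (k : Fin 2) (i : Fin 8) :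
    (baseA a i k ≠ none ∧ poleA k i = 0) ∨ (baseA a i k = none ∧ poleA k i = 1) := by
  fin_cases i <;> fin_cases k <;> simp [baseA, poleA]

/-- Which points of the (a)-model have infinitely near points. -/
def nextA : Fin 8 → Option (Fin 8) := ![some 7, some 2, none, none, none, none, none, none]

/-- The inverse of the matrix of the classes of basic curves of the (a)-model. -/
def invA : Fin 10 → PicLat := ![![1, 0, 1, 1, 1, 0, 0, 0, 0, 1], ![0, 1, 0, 1, 1, 1, 0, 0, 0, 0],
    ![0, 0, 1, 0, 0, 0, 0, 0, 0, 1], ![0, 0, 0, 1, 1, 0, 0, 0, 0, 0],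
    ![0, 0, 0, 0, 1, 0, 0, 0, 0, 0], ![0, 0, 0, 0, 0, 1, 0, 0, 0, 0],
    ![0, 0, 0, 0, 0, 0, 1, 0, 0, 0], ![0, 0, 0, 0, 0, 0, 0, 1, 0, 0],
    ![0, 0, 0, 0, 0, 0, 0, 0, 1, 0], ![0, 0, 0, 0, 0, 0, 0, 0, 0, 1]]

theorem basicClasses_mul_invA : Matrix.of (basicClasses nextA poleA) * Matrix.of invA = 1 := by
  decide +kernel

/-- The basis of the Picard group of the (a)-model. -/
def markA {a : Fin 5 → ℂ} (ha : ∀ i, a i ≠ 0) (ha2 : a 2 ≠ 1) : (confA a).MarkData where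
  valid := (treeA ha ha2).valid
  p := poleA
  hasPole k i := (treeA ha ha2).hasPole <| (hasPoleA a k i).imp_right fun h =>
    ⟨h.1, by rw [h.2]; exact (treeA ha ha2).order_one (simpleA ha i) k⟩
  inv := invA
  left_inv := basicClasses_mul_invA

/-! ### The `q`-Laguerre surface -/

section Laguerre

variable {q Q T : ℂ} {n : ℕ}

/-- Local coordinates of the eight points of the `q`-Laguerre surface in terms of `x` and `y`. -/
def locX (q Q T : ℂ) (n : ℕ) (x y : KK) : Fin 8 → KK × KK :=
  ![(x - 1, y - 1), (x - cst T, y - cst (1 / T)), (x, y⁻¹), (x, 1 / (x * y)),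
      (x, 1 / (x ^ 2 * y) - cst (1 / (q ^ (2 * n + 1) * Q * T))), (x⁻¹, y),
      (x⁻¹, x * y - cst (1 - q ^ n * Q)), (x⁻¹, y - cst (q ^ n))]

theorem confX_loc : (confX q Q T n).loc = locX q Q T n (coord 0) (coord 1) := rfl

/-- The points of `ℙ¹ × ℙ¹` under the eight points of the `q`-Laguerre surface. -/
def baseX (q T : ℂ) (n : ℕ) : Fin 8 → Fin 2 → Option ℂ :=
  ![![some 1, some 1], ![some T, some (1 / T)], ![some 0, none], ![some 0, none], ![some 0, none],
    ![none, some 0], ![none, some 0], ![none, some (q ^ n)]]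

theorem stepX (i : Fin 8) : (confX q Q T n).IsBase (baseX q T n) i ∨
    ∃ j < i, baseX q T n i = baseX q T n j ∧ ∃ c, (confX q Q T n).loc i =
      (((confX q Q T n).loc j).1, ((confX q Q T n).loc j).2 / ((confX q Q T n).loc j).1 - cst c) := by
  have hx := coord_ne_zero 0
  have hy := coord_ne_zero 1
  fin_cases i
  · exact Or.inl (Or.inl (by simp [confX_loc, locX, baseX, param]))
  · exact Or.inl (Or.inl (by simp [confX_loc, locX, baseX, param]))
  · exact Or.inl (Or.inl (by simp [confX_loc, locX, baseX, param]))
  · refine Or.inr ⟨2, by decide, rfl, 0, ?_⟩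
    simp only [confX_loc, locX, cst_zero, sub_zero]
    refine Prod.ext rfl ?_
    simp
    field_simp
  · refine Or.inr ⟨3, by decide, rfl, 1 / (q ^ (2 * n + 1) * Q * T), ?_⟩
    simp only [confX_loc, locX]
    refine Prod.ext rfl ?_
    simp
    field_simp
  · exact Or.inl (Or.inl (by simp [confX_loc, locX, baseX, param]))
  · refine Or.inr ⟨5, by decide, rfl, 1 - q ^ n * Q, ?_⟩
    simp only [confX_loc, locX]
    refine Prod.ext rfl ?_
    simp
    field_simp
  · exact Or.inl (Or.inl (by simp [confX_loc, locX, baseX, param]))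

theorem chartX (i : Fin 8) : IsChart ((confX q Q T n).loc i).1 ((confX q Q T n).loc i).2 := by
  induction i using WellFoundedLT.induction with
  | ind i ih =>
    rcases stepX (q := q) (Q := Q) (T := T) (n := n) i with (h1 | h1) | ⟨j, hj, -, c, h1⟩
    · rw [h1]; exact isChart_of_lineParams isChart_coord (param_mem _ _) (param_mem _ _)
    · rw [h1]; exact (isChart_of_lineParams isChart_coord (param_mem _ _) (param_mem _ _)).swap
    · rw [h1]; exact (ih j hj).sub_cst_div c

theorem treeX (hq : q ≠ 0) (hT : T ≠ 0) (hT1 : T ≠ 1) :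
    (confX q Q T n).Tree (baseX q T n) := by
  have hx := coord_ne_zero 0
  have hy := coord_ne_zero 1
  refine ⟨fun i => ?_, fun i j hij => ?_⟩
  · exact stepX i
  · by_cases hc : (i = 2 ∧ j = 3) ∨ (i = 2 ∧ j = 4) ∨ (i = 3 ∧ j = 4) ∨ (i = 5 ∧ j = 6)
    · right
      have hch := chartX (q := q) (Q := Q) (T := T) (n := n) j
      have hr := hch.vanishes_right
      have hl := hch.vanishes_left
      rcases hc with ⟨rfl, rfl⟩ | ⟨rfl, rfl⟩ | ⟨rfl, rfl⟩ | ⟨rfl, rfl⟩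
      · refine ⟨0, ?_⟩
        have : ((confX q Q T n).loc 2).2 / ((confX q Q T n).loc 2).1 - cst 0 =
            ((confX q Q T n).loc 3).2 := by
          simp [confX_loc, locX]
          field_simp
        rw [this]
        exact hr
      · refine ⟨0, ?_⟩
        have : ((confX q Q T n).loc 2).2 / ((confX q Q T n).loc 2).1 - cst 0 =
            (((confX q Q T n).loc 4).2 + cst (1 / (q ^ (2 * n + 1) * Q * T))) *
              ((confX q Q T n).loc 4).1 := by
          simp [confX_loc, locX]
          field_simp
        rw [this]
        exact hch.isLoc.mul (add_mem hr.1 (hch.isLoc.cst_mem _)) hl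
      · refine ⟨1 / (q ^ (2 * n + 1) * Q * T), ?_⟩
        have : ((confX q Q T n).loc 3).2 / ((confX q Q T n).loc 3).1 -
            cst (1 / (q ^ (2 * n + 1) * Q * T)) = ((confX q Q T n).loc 4).2 := by
          simp [confX_loc, locX]
          field_simp
        rw [this]
        exact hr
      · refine ⟨1 - q ^ n * Q, ?_⟩
        have : ((confX q Q T n).loc 5).2 / ((confX q Q T n).loc 5).1 -
            cst (1 - q ^ n * Q) = ((confX q Q T n).loc 6).2 := by
          simp [confX_loc, locX]
          field_simp
        rw [this]
        exact hr
    · left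
      have h6 : q ^ n ≠ 0 := pow_ne_zero n hq
      have h6' := h6.symm
      have hT1' := hT1.symm
      intro h
      have h3 := congrFun h 0
      have h4 := congrFun h 1
      fin_cases i <;> fin_cases j <;> simp_all [baseX]

/-- Pole orders of `x` and `y` along the exceptional lines of the `q`-Laguerre surface. -/
def poleX : Fin 2 → Fin 8 → ℤ := ![![0, 0, 0, 0, 0, 1, 1, 1], ![0, 0, 1, 2, 2, 0, 0, 0]]

/-- Which points of the `q`-Laguerre surface have infinitely near points. -/
def nextX : Fin 8 → Option (Fin 8) := ![none, none, some 3, some 4, none, some 6, none, none]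

/-- The inverse of the matrix of the classes of basic curves of the `q`-Laguerre surface. -/
def invX : Fin 10 → PicLat := ![![1, 0, 0, 0, 0, 0, 0, 1, 1, 1], ![0, 1, 0, 0, 1, 2, 2, 0, 0, 0],
    ![0, 0, 1, 0, 0, 0, 0, 0, 0, 0], ![0, 0, 0, 1, 0, 0, 0, 0, 0, 0],
    ![0, 0, 0, 0, 1, 1, 1, 0, 0, 0], ![0, 0, 0, 0, 0, 1, 1, 0, 0, 0],
    ![0, 0, 0, 0, 0, 0, 1, 0, 0, 0], ![0, 0, 0, 0, 0, 0, 0, 1, 1, 0],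
    ![0, 0, 0, 0, 0, 0, 0, 0, 1, 0], ![0, 0, 0, 0, 0, 0, 0, 0, 0, 1]]

theorem basicClasses_mul_invX : Matrix.of (basicClasses nextX poleX) * Matrix.of invX = 1 := by
  decide +kernel

theorem hasPoleX (hq : q ≠ 0) (hQ : Q ≠ 0) (hT : T ≠ 0) (k : Fin 2) (i : Fin 8) :
    (baseX q T n i k ≠ none ∧ poleX k i = 0) ∨ (baseX q T n i k = none ∧
      HasOrder ((confX q Q T n).exc i) (param (coord k) (baseX q T n i k)) (poleX k i)) := by
  have hx := coord_ne_zero 0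
  have hy := coord_ne_zero 1
  have hch := chartX (q := q) (Q := Q) (T := T) (n := n) i
  have hV := hch.div.isCurve
  have hl := hch.div.hasOrder_left
  have hr := hch.hasOrder_right_exc
  have hw := hch.div.hasOrder_right
  fin_cases i <;> fin_cases k <;> try (left; refine ⟨?_, rfl⟩; simp [baseX])
  · exact Or.inr ⟨rfl, hr⟩
  · refine Or.inr ⟨rfl, ?_⟩
    have := hV.hasOrder_mul hl hr
    have he : (coord 1)⁻¹ = ((confX q Q T n).loc 3).1 * ((confX q Q T n).loc 3).2 := by
      simp [confX_loc, locX]; field_simp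
    change HasOrder _ (coord 1)⁻¹ 2
    rw [he]
    exact this
  · refine Or.inr ⟨rfl, ?_⟩
    have hc : 1 / (q ^ (2 * n + 1) * Q * T) ≠ 0 :=
      one_div_ne_zero (mul_ne_zero (mul_ne_zero (pow_ne_zero _ hq) hQ) hT)
    have h3 : Tends ((confX q Q T n).exc 4) (1 / (coord 0 ^ 2 * coord 1))
        (1 / (q ^ (2 * n + 1) * Q * T)) := hch.exc_dominates hch.vanishes_right
    have := hV.hasOrder_mul (hV.hasOrder_mul hl hl) (h3.hasOrder hc hV)
    have he : (coord 1)⁻¹ = ((confX q Q T n).loc 4).1 * ((confX q Q T n).loc 4).1 *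
        (1 / (coord 0 ^ 2 * coord 1)) := by
      simp [confX_loc, locX]; field_simp
    change HasOrder _ (coord 1)⁻¹ 2
    rw [he]
    exact this
  · exact Or.inr ⟨rfl, hl⟩
  · exact Or.inr ⟨rfl, hl⟩
  · exact Or.inr ⟨rfl, hl⟩

/-- The basis of the Picard group of the `q`-Laguerre surface. -/
def markX (hq : q ≠ 0) (hQ : Q ≠ 0) (hT : T ≠ 0) (hT1 : T ≠ 1) : (confX q Q T n).MarkData where
  valid := (treeX hq hT hT1).valid
  p := poleX
  hasPole k i := (treeX hq hT hT1).hasPole (hasPoleX hq hQ hT k i)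
  inv := invX
  left_inv := basicClasses_mul_invX

end Laguerre

open PointConfig

theorem irrXC_ring (j : Fin 2) (c : ℂ) :
    (irrXC j c).ring = crv (coord j - cst c) (coord (1 - j)) := by
  have hf : algebraMap Poly KK (X j - C c) = coord j - cst c := by
    rw [map_sub, ← cst_eq_algebraMap]; rfl
  have hch : IsChart (coord j) (coord (1 - j)) := by
    fin_cases j
    · exact isChart_coord
    · exact isChart_coord.swap
  refine (irrXC j c).isCurve.eq_crv (hch.swap.sub_cst c).swap ?_ (algebraMap_mem_ring _ _) ?_
  · rw [← hf, IrrPoly.vanishes_ring]; exact dvd_rfl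
  · intro d hd
    have hf' : algebraMap Poly KK (X (1 - j) - C d) = coord (1 - j) - cst d := by
      rw [map_sub, ← cst_eq_algebraMap]; rfl
    rw [← hf', IrrPoly.vanishes_ring] at hd
    have hd : (X j - C c : Poly) ∣ X (1 - j) - C d := hd
    have hirr := irreducible_X_sub_C j c
    fin_cases j
    · exact not_dvd_X_sub_C_both hirr c d dvd_rfl hd
    · exact not_dvd_X_sub_C_both hirr d c hd dvd_rfl

theorem IsChart.sub_cst_ne_zero {u v : KK} (h : IsChart u v) (c : ℂ) : u - cst c ≠ 0 :=
  (h.swap.sub_cst c).swap.ne_zero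

theorem IsChart.sub_one_ne_zero {u v : KK} (h : IsChart u v) : u - 1 ≠ 0 := by
  simpa [cst_one] using h.sub_cst_ne_zero 1

theorem algEquiv_ext {Φ Ψ : KK ≃ₐ[ℂ] KK} (h0 : Φ (coord 0) = Ψ (coord 0))
    (h1 : Φ (coord 1) = Ψ (coord 1)) : Φ = Ψ := by
  ext h
  obtain ⟨a, b, -, rfl⟩ := exists_div h
  have key : ∀ P : Poly, Φ (algebraMap Poly KK P) = Ψ (algebraMap Poly KK P) := fun P => by
    rw [← aeval_coord, map_aeval, map_aeval, h0, h1]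
  rw [map_div₀, map_div₀, key, key]

/-! ### Links between two descriptions of a surface -/

/-- The points of the second description that are not exceptional (`un`) are obtained from points of
the first one; the remaining conditions of the second description follow from the first. -/
structure Link (s t : KK) (loc : Fin 8 → KK × KK) (s' t' : KK) (loc' : Fin 8 → KK × KK)
    (π : Fin 8 → Fin 8) (un : Fin 8 → Prop) : Prop where
  van : ∀ i, ¬ un i → ∀ B, IsLoc B → Vanishes B (loc i).1 → Vanishes B (loc i).2 →
    Vanishes B (loc' (π i)).1 ∧ Vanishes B (loc' (π i)).2
  val : ∀ B, IsPoint B → Pred s t loc B → HasValue B s' ∧ HasValue B t' ∧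
    ∀ i, un i → BlowCond (loc' (π i)).1 (loc' (π i)).2 B

section Link

variable {s t s' t' : KK} {loc loc' : Fin 8 → KK × KK} {π ρ : Fin 8 → Fin 8} {un : Fin 8 → Prop}

theorem Link.ptRing_eq (h : Link s t loc s' t' loc' π un) (h' : Link s' t' loc' s t loc ρ (un ∘ ρ))
    (hπ : ∀ i, ρ (π i) = i) (hc : ∀ i, IsChart (loc i).1 (loc i).2)
    (hc' : ∀ i, IsChart (loc' i).1 (loc' i).2) {i : Fin 8} (hi : ¬ un i) :
    ptRing (loc i).1 (loc i).2 = ptRing (loc' (π i)).1 (loc' (π i)).2 := by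
  refine ptRing_eq_of (hc i) (hc' _) (h.van i hi) fun B hB h1 h2 => ?_
  have := h'.van (π i) (by rwa [Function.comp, hπ]) B hB h1 h2
  rwa [hπ] at this

theorem Link.crv_eq (h : Link s t loc s' t' loc' π un) (h' : Link s' t' loc' s t loc ρ (un ∘ ρ))
    (hπ : ∀ i, ρ (π i) = i) (hc : ∀ i, IsChart (loc i).1 (loc i).2)
    (hc' : ∀ i, IsChart (loc' i).1 (loc' i).2) {i : Fin 8} (hi : ¬ un i) :
    crv (loc' (π i)).1 ((loc' (π i)).2 / (loc' (π i)).1) = crv (loc i).1 ((loc i).2 / (loc i).1) :=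
  (crv_eq_of_ptRing_eq (hc i) (hc' _) (h.ptRing_eq h' hπ hc hc' hi)).symm

theorem Link.pred (h : Link s t loc s' t' loc' π un) (h' : Link s' t' loc' s t loc ρ (un ∘ ρ))
    (hπ : ∀ i, ρ (π i) = i) (hρ : ∀ i, π (ρ i) = i) (hc : ∀ i, IsChart (loc i).1 (loc i).2)
    (hc' : ∀ i, IsChart (loc' i).1 (loc' i).2) {B : Subring KK} (hB : IsPoint B)
    (H : Pred s t loc B) : Pred s' t' loc' B := by
  obtain ⟨h1, h2, h3⟩ := h.val B hB H
  refine ⟨h1, h2, fun i => ?_⟩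
  rw [← hρ i]
  by_cases hi : un (ρ i)
  · exact h3 _ hi
  · exact blowCond_of_ptRing_eq (hc _) (hc' _) (h.ptRing_eq h' hπ hc hc' hi) hB.1 (H.2.2 _)

theorem Link.pred_iff (h : Link s t loc s' t' loc' π un)
    (h' : Link s' t' loc' s t loc ρ (un ∘ ρ))
    (hπ : ∀ i, ρ (π i) = i) (hρ : ∀ i, π (ρ i) = i) (hc : ∀ i, IsChart (loc i).1 (loc i).2)
    (hc' : ∀ i, IsChart (loc' i).1 (loc' i).2) (B : Subring KK) (hB : IsPoint B) :
    Pred s t loc B ↔ Pred s' t' loc' B := by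
  refine ⟨h.pred h' hπ hρ hc hc' hB, h'.pred ?_ hρ hπ hc' hc hB⟩
  rwa [show (un ∘ ρ) ∘ π = un from funext fun i => congrArg un (hπ i)]

end Link

/-- The image of the `k`-th basic curve is a basic curve or a line, of the class prescribed by `L`. -/
def CurveImage {C C' : PointConfig} (M : C.MarkData) (M' : C'.MarkData) (Φ : KK ≃ₐ[ℂ] KK)
    (L : PicLat →ₗ[ℤ] PicLat) (k : Fin 10) : Prop :=
  (∃ j, mapRing Φ (C'.basic j) = C.basic k ∧ L (C.basicClass M.p k) = C'.basicClass M'.p j) ∨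
    ∃ (j : Fin 2) (c : ℂ) (o : Fin 8 → ℤ), (∀ i, HasOrder (C'.exc i) (coord j - cst c) (o i)) ∧
      crv (Φ (coord j) - cst c) (Φ (coord (1 - j))) = C.basic k ∧
      L (C.basicClass M.p k) = C'.basicClass M'.p (fst j) - ∑ i, o i • C'.exClass i

theorem IsMarkedIso.of_curves {C C' : PointConfig} {Φ : KK ≃ₐ[ℂ] KK} {L : PicLat →ₗ[ℤ] PicLat}
    (M : C.MarkData) (M' : C'.MarkData) (hS : mapRing Φ '' C'.surface = C.surface)
    (H : ∀ k, CurveImage M M' Φ L k) : IsMarkedIso Φ C C' L := by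
  refine IsMarkedIso.of_basic M M' hS fun k => ?_
  rcases H k with ⟨j, h1, h2⟩ | ⟨j, c, o, ho, h1, h2⟩
  · exact ⟨M'.valid.basicDiv j, h1, by rw [h2, M'.equiv_basicClass]⟩
  · refine ⟨M'.valid.planeDiv (irrXC j c), ?_, by rw [h2, M'.equiv_linear M'.marking ho]⟩
    rw [← h1]
    change mapRing Φ (irrXC j c).ring = _
    rw [irrXC_ring, mapRing_crv, map_sub, map_cst]

theorem mapRing_exc {C : PointConfig} {θ : KK ≃ₐ[ℂ] KK} {loc : Fin 8 → KK × KK} {i : Fin 8}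
    (h : (θ (C.loc i).1, θ (C.loc i).2) = loc i) :
    mapRing θ (C.exc i) = crv (loc i).1 ((loc i).2 / (loc i).1) := by
  rw [← h, exc, mapRing_crv, map_div₀]

theorem basic_succ (C : PointConfig) (i : Fin 8) : C.basic i.succ.succ = C.exc i := rfl

theorem mapRing_lineInf_zero (θ : KK ≃ₐ[ℂ] KK) :
    mapRing θ (lineInf 0) = crv (θ (coord 0))⁻¹ (θ (coord 1)) := by
  rw [lineInf_zero, mapRing_crv, map_inv₀]

theorem mapRing_lineInf_one (θ : KK ≃ₐ[ℂ] KK) :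
    mapRing θ (lineInf 1) = crv (θ (coord 1))⁻¹ (θ (coord 0)) := by
  rw [lineInf_one, mapRing_crv, map_inv₀]

theorem IsChart.linear_ne_zero {u v : KK} (h : IsChart u v) {a : ℂ} (ha : a ≠ 0) (b : ℂ) :
    cst a * u - cst b ≠ 0 := by
  have h1 := h.sub_cst_ne_zero (b / a)
  have h2 := cst_ne_zero ha
  intro h0
  apply h1
  rw [cst_div]
  field_simp
  linear_combination h0

theorem IsChart.linear_sub_one_ne_zero {u v : KK} (h : IsChart u v) {a : ℂ} (ha : a ≠ 0) :
    cst a * u - 1 ≠ 0 := by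
  simpa [cst_one] using h.linear_ne_zero ha 1

theorem IsMarkedIso.of_link {C C' : PointConfig} {Φ : KK ≃ₐ[ℂ] KK} {L : PicLat →ₗ[ℤ] PicLat}
    (M : C.MarkData) (M' : C'.MarkData) {f' g' : KK} (hf : Φ (coord 0) = f') (hg : Φ (coord 1) = g')
    {loc' : Fin 8 → KK × KK} (hloc : ∀ i, (Φ (C'.loc i).1, Φ (C'.loc i).2) = loc' i)
    {π ρ : Fin 8 → Fin 8} {un : Fin 8 → Prop}
    (h : Link (coord 0) (coord 1) C.loc f' g' loc' π un)
    (h' : Link f' g' loc' (coord 0) (coord 1) C.loc ρ (un ∘ ρ))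
    (hπ : ∀ i, ρ (π i) = i) (hρ : ∀ i, π (ρ i) = i)
    (hL : ∀ i, ¬ un i → L (C.exClass i) = C'.exClass (π i))
    (H0 : CurveImage M M' Φ L 0) (H1 : CurveImage M M' Φ L 1)
    (H : ∀ i : Fin 8, un i → CurveImage M M' Φ L i.succ.succ) : IsMarkedIso Φ C C' L := by
  subst hf hg
  have hc' : ∀ i, IsChart (loc' i).1 (loc' i).2 := fun i => by
    rw [← hloc]; exact (M'.valid.chart i).map Φ
  refine IsMarkedIso.of_curves M M' (M.valid.image_surface M'.valid fun B hB => ?_) ?_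
  · rw [show (fun i => (Φ (C'.loc i).1, Φ (C'.loc i).2)) = loc' from funext hloc]
    exact h.pred_iff h' hπ hρ M.valid.chart hc' B hB
  · refine forall_fin_ten 0 H0 H1 fun i => ?_
    by_cases hi : un i
    · exact H i hi
    · refine Or.inl ⟨(π i).succ.succ, ?_, hL i hi⟩
      rw [basic_succ, basic_succ, mapRing_exc (hloc _)]
      exact h.crv_eq h' hπ M.valid.chart hc' hi

theorem IsChart.crv_eq_mul {u w u' w' : KK} (h : IsChart u w) (h' : IsChart u' w')
    (hu : Vanishes (crv u w) u') {α : KK} {a : ℂ} (hα : Tends (crv u w) α a) (ha : a ≠ 0)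
    (he : w' = w * α) : crv u w = crv u' w' :=
  h.crv_eq h' hu hα ha (tends_cst 0) (by rw [he, cst_zero, add_zero])

theorem IsChart.crv_eq_of {u w u' w' : KK} (h : IsChart u w) (h' : IsChart u' w')
    (H : ∀ V, IsCurve V → Vanishes V u → (∀ c, HasOrder V (w - cst c) 0) →
      Vanishes V u' ∧ ∃ α a, a ≠ 0 ∧ Tends V α a ∧ w' = w * α) : crv u w = crv u' w' := by
  obtain ⟨h1, α, a, ha, hα, he⟩ := H _ h.isCurve h.crv_vanishes_left h.hasOrder_right_sub
  exact h.crv_eq_mul h' h1 hα ha he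

theorem IsChart.exc_eq_of {u v u' w' : KK} (h : IsChart u v) (h' : IsChart u' w')
    (H : ∀ V, IsLoc V → Vanishes V u → Vanishes V v →
      Vanishes V u' ∧ ∃ α a, a ≠ 0 ∧ Tends V α a ∧ w' = v / u * α) :
    crv u (v / u) = crv u' w' := by
  obtain ⟨h1, α, a, ha, hα, he⟩ := H _ h.div.isCurve.isLoc (h.exc_dominates h.vanishes_left)
    (h.exc_dominates h.vanishes_right)
  exact h.div.crv_eq_mul h' h1 hα ha he

theorem IsChart.exc_eq_of_inv {u v u' w' : KK} (h : IsChart u v) (h' : IsChart u' w')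
    (H : ∀ V, IsLoc V → Vanishes V u → Vanishes V v →
      Vanishes V u' ∧ ∃ α a, a ≠ 0 ∧ Tends V α a ∧ w' = u / v * α) :
    crv u (v / u) = crv u' w' := by
  rw [← h.crv_div_swap]
  exact h.swap.exc_eq_of h' fun V hV h1 h2 => H V hV h2 h1

theorem orderB {a : Fin 5 → ℂ} (ha : ∀ i, a i ≠ 0) {i : Fin 8} {j : Fin 2} {c : ℂ} {o : ℤ}
    (h : (baseB a i j = none ∧ o = -1) ∨ (baseB a i j = some c ∧ o = 1) ∨
      (∃ d, baseB a i j = some d ∧ c ≠ d ∧ o = 0)) :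
    HasOrder ((confB a).exc i) (coord j - cst c) o := by
  rcases h with ⟨h, rfl⟩ | ⟨h, rfl⟩ | ⟨d, h, hcd, rfl⟩
  · exact (treeB ha).hasOrder_neg_one (simpleB ha i) h c
  · exact (treeB ha).hasOrder_one (simpleB ha i) h
  · exact (treeB ha).hasOrder_zero h hcd

theorem orderA {a : Fin 5 → ℂ} (ha : ∀ i, a i ≠ 0) (ha2 : a 2 ≠ 1) {i : Fin 8} {j : Fin 2} {c : ℂ}
    {o : ℤ} (h : (baseA a i j = none ∧ o = -1) ∨ (baseA a i j = some c ∧ o = 1) ∨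
      (∃ d, baseA a i j = some d ∧ c ≠ d ∧ o = 0)) :
    HasOrder ((confA a).exc i) (coord j - cst c) o := by
  rcases h with ⟨h, rfl⟩ | ⟨h, rfl⟩ | ⟨d, h, hcd, rfl⟩
  · exact (treeA ha ha2).hasOrder_neg_one (simpleA ha i) h c
  · exact (treeA ha ha2).hasOrder_one (simpleA ha i) h
  · exact (treeA ha ha2).hasOrder_zero h hcd

theorem birGen_mem (s : Gen) (p : Pt) (F : IntermediateField ℂ KK) (hf : p.f ∈ F) (hg : p.g ∈ F) :
    (birGen s p).f ∈ F ∧ (birGen s p).g ∈ F := by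
  obtain ⟨a, f, g⟩ := p
  have hc := cst_mem F
  have h1 := F.one_mem
  rcases s with i | _ | _
  · fin_cases i <;> constructor <;> simp only [birGen] <;>
      repeat' first
        | assumption
        | exact hc _
        | apply F.div_mem
        | apply F.mul_mem
        | apply F.sub_mem
        | apply F.add_mem
  · exact ⟨F.div_mem hf (hc _), F.div_mem (F.neg_mem (F.mul_mem (hc _) hf)) (F.mul_mem (hc _) hg)⟩
  · exact ⟨hg, hf⟩

theorem isChart_of_birGen {s : Gen} {p p' : Pt} (h : IsChart p.f p.g) (hp : birGen s p' = p) :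
    IsChart p'.f p'.g := by
  subst hp
  exact h.of_forall_mem fun F h0 h1 => birGen_mem s p' F h0 h1

/-! ### The reflection `w₂` -/

theorem birGen_w2_birGen {a : Fin 5 → ℂ} (ha : ∀ i, a i ≠ 0) {f g : KK} (h : IsChart f g) :
    birGen (.w 2) (birGen (.w 2) ⟨a, f, g⟩) = ⟨a, f, g⟩ := by
  have hA := cst_ne_zero (ha 2)
  have hg1 : g - 1 ≠ 0 := h.swap.sub_one_ne_zero
  have hgA : cst (a 2) * g - 1 ≠ 0 := h.swap.linear_sub_one_ne_zero (ha 2)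
  have n2 := ha 2
  ext
  · rename_i i
    fin_cases i <;> simp [birGen] <;> field_simp
  · simp only [birGen]
    simp [cst_inv]
    field_simp
  · simp [birGen, cst_inv]
    field_simp

theorem link_w2 {a a' : Fin 5 → ℂ} (ha : ∀ i, a i ≠ 0) (ha2 : a 2 ≠ 1) {f g f' g' : KK}
    (h : IsChart f g) (hp : birGen (.w 2) ⟨a, f, g⟩ = ⟨a', f', g'⟩) :
    Link f g (locB a f g) f' g' (locB a' f' g') id (fun i => i = 0 ∨ i = 4) := by
  have hf := h.ne_zero
  have hg := h.swap.ne_zero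
  have hA := cst_ne_zero (ha 2)
  have hg1 : g - 1 ≠ 0 := h.swap.sub_one_ne_zero
  have hgA : cst (a 2) * g - 1 ≠ 0 := h.swap.linear_sub_one_ne_zero (ha 2)
  have ea : a' = _ := (congrArg Pt.a hp).symm
  have ef : f' = cst (a 2) * f * (g - 1) / (cst (a 2) * g - 1) := (congrArg Pt.f hp).symm
  have eg : g' = cst (a 2) * g := (congrArg Pt.g hp).symm
  have a0 : a' 0 = a 0 * a 2 := by rw [ea]; rfl
  have a1 : a' 1 = a 1 * a 2 := by rw [ea]; rfl
  have a2 : a' 2 = 1 / a 2 := by rw [ea]; rfl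
  have a4 : a' 4 = a 4 := by rw [ea]; rfl
  have n0 := ha 0
  have n2 := ha 2
  have n4 := ha 4
  obtain ⟨U, hU⟩ : ∃ U : KK, U = cst (a 2) * (g - 1) / (cst (a 2) * g - 1) := ⟨_, rfl⟩
  have hU0 : U ≠ 0 := by rw [hU]; exact div_ne_zero (mul_ne_zero hA hg1) hgA
  have hf' : f' = f * U := by rw [ef, hU]; ring
  have hfi' : f'⁻¹ = f⁻¹ * U⁻¹ := by rw [hf', mul_inv]
  have hg' : g' = g * cst (a 2) := by rw [eg, mul_comm]
  have hgi' : g'⁻¹ = g⁻¹ * (cst (a 2))⁻¹ := by rw [hg', mul_inv]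
  have hUinf : ∀ B, IsLoc B → Vanishes B g⁻¹ → Tends B U 1 := by
    intro B hB hv
    refine (((tends_cst (a 2)).mul (tends_one.sub hv.tends hB) hB).div
      ((tends_cst (a 2)).sub hv.tends hB) (by simpa using ha 2) hB).congr ?_ ?_
    · rw [hU]; field_simp
    · field_simp; ring
  have hUc : ∀ B, IsLoc B → ∀ c, a 2 * c - 1 ≠ 0 → Tends B g c →
      Tends B U (a 2 * (c - 1) / (a 2 * c - 1)) := by
    intro B hB c hc hv
    rw [hU]
    exact ((tends_cst (a 2)).mul (hv.sub tends_one hB) hB).div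
      (((tends_cst (a 2)).mul hv hB).sub tends_one hB) hc hB
  have hUzero : ∀ B, IsLoc B → Vanishes B g → Tends B U (a 2) := by
    intro B hB hv
    simpa using hUc B hB 0 (by simp) hv.tends
  constructor
  · intro i hi B hB h1 h2
    fin_cases i
    · exact absurd (Or.inl rfl) hi
    · replace h1 : Vanishes B f⁻¹ := h1
      replace h2 : Vanishes B g⁻¹ := h2
      have hT := hUinf B hB h2
      exact ⟨h1.of_mul (hT.inv one_ne_zero hB) hB hfi',
        h2.of_mul ((tends_cst (a 2)).inv n2 hB) hB hgi'⟩
    · replace h1 : Vanishes B f⁻¹ := h1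
      replace h2 : Vanishes B (f / g + cst (a 4 / a 0)) := h2
      have h3 := tends_of_vanishes_add h2
      have h4 : Vanishes B g⁻¹ := h1.of_mul h3 hB (by field_simp)
      have hT := hUinf B hB h4
      refine ⟨h1.of_mul (hT.inv one_ne_zero hB) hB hfi',
        ((h3.mul (hT.div (tends_cst (a 2)) n2 hB) hB).add (tends_cst (a' 4 / a' 0)) hB).vanishes
          ?_ ?_⟩
      · change f' / g' + _ = _
        rw [hf', eg]; field_simp
      · rw [a0, a4]; field_simp; ring
    · replace h1 : Vanishes B g⁻¹ := h1
      replace h2 : Vanishes B (f - 1) := h2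
      have hT := hUinf B hB h1
      refine ⟨h1.of_mul ((tends_cst (a 2)).inv n2 hB) hB hgi',
        (((tends_of_vanishes_sub_one h2).mul hT hB).sub tends_one hB).vanishes ?_ (by ring)⟩
      change f' - 1 = _
      rw [hf']
    · exact absurd (Or.inr rfl) hi
    · replace h1 : Vanishes B f := h1
      replace h2 : Vanishes B g := h2
      exact ⟨h1.of_mul (hUzero B hB h2) hB hf', h2.of_mul (tends_cst (a 2)) hB hg'⟩
    · replace h1 : Vanishes B f := h1
      replace h2 : Vanishes B (g / f + cst (1 / a 4)) := h2
      have h3 := tends_of_vanishes_add h2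
      have h4 : Vanishes B g := h1.of_mul h3 hB (by field_simp)
      have hT := hUzero B hB h4
      refine ⟨h1.of_mul hT hB hf', ((h3.mul ((tends_cst (a 2)).div hT n2 hB) hB).add
        (tends_cst (1 / a' 4)) hB).vanishes ?_ ?_⟩
      · change g' / f' + _ = _
        rw [hf', eg]; field_simp
      · rw [a4]; field_simp; ring
    · replace h1 : Vanishes B g := h1
      replace h2 : Vanishes B (f - cst (a 1)) := h2
      have h3 : Tends B f (a 1) := h2
      have hT := hUzero B hB h1
      refine ⟨h1.of_mul (tends_cst (a 2)) hB hg', ?_⟩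
      change Tends B f' (a' 1)
      rw [hf', a1]
      exact h3.mul hT hB
  · rintro B ⟨hB, hB'⟩ ⟨hvf, hvg, hc⟩
    have c0 : Vanishes B f⁻¹ → Vanishes B (g - 1) → HasValue B ((g - 1) / f⁻¹) := hc 0
    have c4 : Vanishes B f → Vanishes B (g - cst (1 / a 2)) → HasValue B ((g - cst (1 / a 2)) / f) :=
      hc 4
    have hP : IsPoint B := ⟨hB, hB'⟩
    refine ⟨?_, ?_, ?_⟩
    · rcases hP.tends_or hvg with ⟨c, hgc⟩ | hgi
      · by_cases hc2 : a 2 * c - 1 = 0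
        · have hc2 : c = 1 / a 2 := by field_simp; linear_combination hc2
          subst hc2
          have h3 : HasValue B (f / (g - cst (1 / a 2))) := by
            rw [← inv_div, hasValue_inv_iff]
            rcases hP.unit_or hvf with ⟨d, hd, hfd⟩ | hf0 | hfi
            · exact (hgc.tends.div hfd hd hB).hasValue hB
            · exact c4 hf0 hgc
            · rw [div_eq_mul_inv]
              exact Or.inl (mul_mem hgc.1 hfi.1)
          refine h3.of_mul (hgc.sub tends_one hB) ?_ hB ?_
          · rw [div_sub_one n2]; exact div_ne_zero (sub_ne_zero.2 ha2.symm) n2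
          · have : g - cst (1 / a 2) ≠ 0 := h.swap.sub_cst_ne_zero _
            rw [ef, cst_div, cst_one] at *
            field_simp
        · by_cases hc1 : c = 1
          · subst hc1
            have hg1v : Vanishes B (g - 1) := by simpa [Tends, cst_one] using hgc
            have h3 : HasValue B (f * (g - 1)) := by
              rcases hP.tends_or hvf with ⟨d, hfd⟩ | hfi
              · exact Or.inl (mul_mem (hfd.mem hB) hg1v.1)
              · have := c0 hfi hg1v
                rwa [div_inv_eq_mul, mul_comm] at this
            refine h3.of_mul ((tends_cst (a 2)).div (((tends_cst (a 2)).mul hgc hB).sub tends_one hB)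
              hc2 hB) (div_ne_zero n2 hc2) hB ?_
            rw [ef]; field_simp
          · exact hvf.of_mul (hUc B hB c hc2 hgc)
              (div_ne_zero (mul_ne_zero n2 (sub_ne_zero.2 hc1)) hc2) hB hf'
      · exact hvf.of_mul (hUinf B hB hgi) one_ne_zero hB hf'
    · exact hvg.of_mul (tends_cst (a 2)) n2 hB hg'
    · rintro i (rfl | rfl)
      · intro h1 h2
        replace h2 : Vanishes B (g' - 1) := h2
        have h3 : Tends B g (1 / a 2) := by
          refine ((tends_of_vanishes_sub_one h2).div (tends_cst (a 2)) n2 hB).congr ?_ rfl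
          rw [eg]; field_simp
        refine hvf.of_mul ((tends_cst (a 2)).mul (h3.sub tends_one hB) hB) ?_ hB ?_
        · field_simp; exact sub_ne_zero.2 ha2.symm
        · change (g' - 1) / f'⁻¹ = _
          rw [div_inv_eq_mul, ef, eg]; field_simp
      · intro h1 h2
        replace h2 : Vanishes B (g' - cst (1 / a' 2)) := h2
        rw [a2, one_div_one_div] at h2
        have h3 : Tends B g 1 := by
          refine ((tends_sub_cst_iff.1 h2).div (tends_cst (a 2)) n2 hB).congr ?_ (div_self n2).symm
          rw [eg]; field_simp
        refine hvf.inv.of_mul (((tends_cst (a 2)).mul h3 hB).sub tends_one hB) ?_ hB ?_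
        · rw [mul_one]; exact sub_ne_zero.2 ha2
        · change (g' - cst (1 / a' 2)) / f' = _
          rw [a2, one_div_one_div, ef, eg]; field_simp

theorem lat_w2 : (∀ i : Fin 8, ¬ (i = 0 ∨ i = 4) →
      latGen (.w 2) (excClasses nextB i) = excClasses nextB i) ∧
    latGen (.w 2) (basicClasses nextB poleB 0) = basicClasses nextB poleB 0 ∧
    latGen (.w 2) (basicClasses nextB poleB 1) = basicClasses nextB poleB 1 ∧
    latGen (.w 2) (excClasses nextB 0) = basicClasses nextB poleB 1 -
      ∑ i, (![0, -1, -1, -1, 1, 0, 0, 0] : Fin 8 → ℤ) i • excClasses nextB i ∧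
    latGen (.w 2) (excClasses nextB 4) = basicClasses nextB poleB 1 -
      ∑ i, (![1, -1, -1, -1, 0, 0, 0, 0] : Fin 8 → ℤ) i • excClasses nextB i := by
  decide +kernel

theorem curves_w2 {a a' : Fin 5 → ℂ} (ha : ∀ i, a i ≠ 0) (ha2 : a 2 ≠ 1) {f g f' g' : KK}
    (h : IsChart f g) (h' : IsChart f' g') (hp : birGen (.w 2) ⟨a, f, g⟩ = ⟨a', f', g'⟩) :
    crv f'⁻¹ g' = crv f⁻¹ g ∧ crv g'⁻¹ f' = crv g⁻¹ f ∧
    crv (g' - cst (1 / a' 2)) f' = crv f⁻¹ ((g - 1) / f⁻¹) ∧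
    crv (g' - cst 1) f' = crv f ((g - cst (1 / a 2)) / f) := by
  have hf := h.ne_zero
  have hg := h.swap.ne_zero
  have n2 := ha 2
  have hA := cst_ne_zero (ha 2)
  have hg1 : g - 1 ≠ 0 := h.swap.sub_one_ne_zero
  have hgA : cst (a 2) * g - 1 ≠ 0 := h.swap.linear_sub_one_ne_zero (ha 2)
  have ea : a' = _ := (congrArg Pt.a hp).symm
  have ef : f' = cst (a 2) * f * (g - 1) / (cst (a 2) * g - 1) := (congrArg Pt.f hp).symm
  have eg : g' = cst (a 2) * g := (congrArg Pt.g hp).symm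
  have e2 : 1 / a' 2 = a 2 := by rw [ea]; simp [birGen]
  have hgA' : g - cst (1 / a 2) ≠ 0 := h.swap.sub_cst_ne_zero _
  refine ⟨?_, ?_, ?_, ?_⟩
  · refine (h.swap.inv.swap.crv_eq_of h'.swap.inv.swap fun V hV hu hw => ⟨?_, ?_⟩).symm
    · have h1 := hV.hasOrder_zero_iff.1 (hV.hasOrder_div (hw (1 / a 2)) (hw 1))
      refine (hu.mul_mem h1.1 hV.isLoc).of_mul (tends_cst 1) hV.isLoc ?_
      rw [ef, cst_div, cst_one]
      field_simp
    · exact ⟨_, _, n2, tends_cst (a 2), by rw [eg, mul_comm]⟩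
  · refine (h.inv.swap.crv_eq_of h'.inv.swap fun V hV hu hw => ⟨?_, ?_⟩).symm
    · exact hu.of_mul ((tends_cst (a 2)).inv n2 hV.isLoc) hV.isLoc (by rw [eg, mul_inv, mul_comm])
    · have hB := hV.isLoc
      refine ⟨_, _, ?_, ((tends_cst (a 2)).mul (tends_one.sub hu.tends hB) hB).div
        ((tends_cst (a 2)).sub hu.tends hB) ?_ hB, ?_⟩
      · simpa using n2
      · simpa using n2
      · rw [ef]; field_simp
  · have hc : IsChart f⁻¹ (g - 1) := by simpa [cst_one] using (h.sub_cst 1).swap.inv.swap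
    refine (hc.exc_eq_of (h'.sub_cst _).swap fun V hB hu hv => ⟨?_, ?_⟩).symm
    · exact hv.of_mul (tends_cst (a 2)) hB (by rw [eg, e2]; ring)
    · have hv1 := tends_of_vanishes_sub_one hv
      refine ⟨_, _, ?_, (tends_cst (a 2)).div (((tends_cst (a 2)).mul hv1 hB).sub tends_one hB)
        ?_ hB, ?_⟩
      · simpa [sub_eq_zero, n2] using ha2
      · simpa [sub_eq_zero] using ha2
      · rw [ef]; field_simp
  · refine ((h.sub_cst _).exc_eq_of_inv (h'.sub_cst _).swap fun V hB hu hv => ⟨?_, ?_⟩).symm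
    · exact hv.of_mul (tends_cst (a 2)) hB (by rw [eg, cst_div, cst_one]; field_simp)
    · have hv1 : Tends V g (1 / a 2) := hv
      refine ⟨_, _, ?_, hv1.sub tends_one hB, ?_⟩
      · rw [div_sub_one n2]; exact div_ne_zero (sub_ne_zero.2 ha2.symm) n2
      · rw [ef]
        rw [cst_div, cst_one] at hgA' ⊢
        field_simp

theorem iso_w2 {a : Fin 5 → ℂ} (ha : ∀ i, a i ≠ 0) (ha2 : a 2 ≠ 1) : ∃ Φ : KK ≃ₐ[ℂ] KK,
    Φ (coord 0) = (birGen (.w 2) (genPt a)).f ∧ Φ (coord 1) = (birGen (.w 2) (genPt a)).g ∧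
    IsMarkedIso Φ (confB a) (confB (birGen (.w 2) (genPt a)).a) (latGen (.w 2)).toLinearMap := by
  obtain ⟨⟨a', f', g'⟩, hp⟩ : ∃ p, birGen (.w 2) (genPt a) = p := ⟨_, rfl⟩
  have hp' : birGen (.w 2) ⟨a', f', g'⟩ = genPt a := by
    rw [← hp]; exact birGen_w2_birGen ha isChart_coord
  have hch : IsChart f' g' := isChart_of_birGen (p' := ⟨a', f', g'⟩) isChart_coord hp'
  rw [hp]
  obtain ⟨Φ, hf, hg⟩ := hch
  have hch : IsChart f' g' := ⟨Φ, hf, hg⟩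
  refine ⟨Φ, hf, hg, ?_⟩
  have ea : a' = _ := (congrArg Pt.a hp).symm
  have ha' : ∀ i, a' i ≠ 0 := by
    intro i
    rw [ea]
    fin_cases i <;> simp [birGen, genPt, ha]
  have ha2' : a' 2 ≠ 1 := by
    rw [ea]
    change 1 / a 2 ≠ 1
    rw [one_div]; simpa using ha2
  have n2 := ha' 2
  obtain ⟨c0, c1, c2, c6⟩ := curves_w2 ha ha2 isChart_coord hch hp
  obtain ⟨l, l0, l1, l2, l6⟩ := lat_w2
  refine IsMarkedIso.of_link (markB ha) (markB ha') hf hg (loc' := locB a' f' g')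
    (fun i => by rw [confB_loc, map_locB, hf, hg]) (link_w2 ha ha2 isChart_coord hp)
    (link_w2 ha' ha2' hch hp') (fun _ => rfl) (fun _ => rfl) l ?_ ?_ ?_
  · refine Or.inl ⟨0, ?_, l0⟩
    change mapRing Φ (lineInf 0) = lineInf 0
    rw [mapRing_lineInf_zero, hf, hg, c0, lineInf_zero]
  · refine Or.inl ⟨1, ?_, l1⟩
    change mapRing Φ (lineInf 1) = lineInf 1
    rw [mapRing_lineInf_one, hf, hg, c1, lineInf_one]
  · rintro i (rfl | rfl)
    · refine Or.inr ⟨1, 1 / a' 2, ![0, -1, -1, -1, 1, 0, 0, 0], fun i => ?_, ?_, l2⟩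
      · refine orderB ha' ?_
        fin_cases i <;> simp [baseB, ha2', n2]
      · change crv (Φ (coord 1) - cst (1 / a' 2)) (Φ (coord 0)) = _
        rw [hf, hg, c2]; rfl
    · refine Or.inr ⟨1, 1, ![1, -1, -1, -1, 0, 0, 0, 0], fun i => ?_, ?_, l6⟩
      · refine orderB ha' ?_
        fin_cases i <;> simp [baseB, ha2']
      · change crv (Φ (coord 1) - cst 1) (Φ (coord 0)) = _
        rw [hf, hg, c6]; rfl

/-! ### The diagram automorphism `σ₁` -/

/-- The permutation of the points under `σ₁`. -/
def permσ₁ : Fin 8 → Fin 8 := ![3, 1, 2, 0, 7, 5, 6, 4]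

theorem permσ₁_permσ₁ (i : Fin 8) : permσ₁ (permσ₁ i) = i := by
  revert i; decide

theorem birGen_σ₁_birGen {a : Fin 5 → ℂ} {f g : KK} :
    birGen .σ₁ (birGen .σ₁ ⟨a, f, g⟩) = ⟨a, f, g⟩ := by
  ext
  · rename_i i
    fin_cases i <;> simp [birGen]
  · rfl
  · rfl

theorem link_σ₁ {a a' : Fin 5 → ℂ} (ha : ∀ i, a i ≠ 0) {f g f' g' : KK}
    (h : IsChart f g) (hp : birGen .σ₁ ⟨a, f, g⟩ = ⟨a', f', g'⟩) :
    Link f g (locB a f g) f' g' (locB a' f' g') permσ₁ (fun _ => False) := by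
  have hf := h.ne_zero
  have hg := h.swap.ne_zero
  have ea : a' = _ := (congrArg Pt.a hp).symm
  obtain rfl : f' = g := (congrArg Pt.f hp).symm
  obtain rfl : g' = f := (congrArg Pt.g hp).symm
  have a0 : a' 0 = 1 / a 0 := by rw [ea]; rfl
  have a1 : a' 1 = 1 / a 2 := by rw [ea]; rfl
  have a2 : a' 2 = 1 / a 1 := by rw [ea]; rfl
  have a4 : a' 4 = 1 / a 4 := by rw [ea]; rfl
  have n0 := ha 0
  have n4 := ha 4
  constructor
  · intro i _ B hB h1 h2
    fin_cases i
    · replace h1 : Vanishes B g'⁻¹ := h1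
      replace h2 : Vanishes B (f' - 1) := h2
      exact ⟨h1, h2⟩
    · replace h1 : Vanishes B g'⁻¹ := h1
      replace h2 : Vanishes B f'⁻¹ := h2
      exact ⟨h2, h1⟩
    · replace h1 : Vanishes B g'⁻¹ := h1
      replace h2 : Vanishes B (g' / f' + cst (a 4 / a 0)) := h2
      have h3 := tends_of_vanishes_add h2
      refine ⟨h1.of_mul h3 hB ?_, ((h3.inv (neg_ne_zero.2 (div_ne_zero n4 n0)) hB).add
        (tends_cst (a' 4 / a' 0)) hB).vanishes ?_ ?_⟩
      · change f'⁻¹ = _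
        field_simp
      · change f' / g' + _ = _
        rw [inv_div]
      · rw [a0, a4]; field_simp; ring
    · replace h1 : Vanishes B f'⁻¹ := h1
      replace h2 : Vanishes B (g' - 1) := h2
      exact ⟨h1, h2⟩
    · replace h1 : Vanishes B g' := h1
      replace h2 : Vanishes B (f' - cst (1 / a 2)) := h2
      refine ⟨h1, ?_⟩
      change Vanishes B (f' - cst (a' 1))
      rw [a1]; exact h2
    · replace h1 : Vanishes B g' := h1
      replace h2 : Vanishes B f' := h2
      exact ⟨h2, h1⟩
    · replace h1 : Vanishes B g' := h1
      replace h2 : Vanishes B (f' / g' + cst (1 / a 4)) := h2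
      have h3 := tends_of_vanishes_add h2
      refine ⟨h1.of_mul h3 hB ?_, ((h3.inv (neg_ne_zero.2 (div_ne_zero one_ne_zero n4)) hB).add
        (tends_cst (1 / a' 4)) hB).vanishes ?_ ?_⟩
      · change f' = _
        field_simp
      · change g' / f' + _ = _
        rw [inv_div]
      · rw [a4]; field_simp; ring
    · replace h1 : Vanishes B f' := h1
      replace h2 : Vanishes B (g' - cst (a 1)) := h2
      refine ⟨h1, ?_⟩
      change Vanishes B (g' - cst (1 / a' 2))
      rw [a2, one_div_one_div]; exact h2
  · rintro B - ⟨h1, h2, -⟩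
    exact ⟨h2, h1, fun i hi => hi.elim⟩

theorem lat_σ₁ : (∀ i : Fin 8, latGen .σ₁ (excClasses nextB i) = excClasses nextB (permσ₁ i)) ∧
    latGen .σ₁ (basicClasses nextB poleB 0) = basicClasses nextB poleB 1 ∧
    latGen .σ₁ (basicClasses nextB poleB 1) = basicClasses nextB poleB 0 := by
  decide +kernel

theorem iso_σ₁ {a : Fin 5 → ℂ} (ha : ∀ i, a i ≠ 0) : ∃ Φ : KK ≃ₐ[ℂ] KK,
    Φ (coord 0) = (birGen .σ₁ (genPt a)).f ∧ Φ (coord 1) = (birGen .σ₁ (genPt a)).g ∧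
    IsMarkedIso Φ (confB a) (confB (birGen .σ₁ (genPt a)).a) (latGen .σ₁).toLinearMap := by
  obtain ⟨⟨a', f', g'⟩, hp⟩ : ∃ p, birGen .σ₁ (genPt a) = p := ⟨_, rfl⟩
  have hp' : birGen .σ₁ ⟨a', f', g'⟩ = genPt a := by
    rw [← hp]; exact birGen_σ₁_birGen
  have hch : IsChart f' g' := isChart_of_birGen (p' := ⟨a', f', g'⟩) isChart_coord hp'
  rw [hp]
  obtain ⟨Φ, hf, hg⟩ := hch
  have hch : IsChart f' g' := ⟨Φ, hf, hg⟩
  refine ⟨Φ, hf, hg, ?_⟩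
  have ea : a' = _ := (congrArg Pt.a hp).symm
  have ef : f' = coord 1 := (congrArg Pt.f hp).symm
  have eg : g' = coord 0 := (congrArg Pt.g hp).symm
  have ha' : ∀ i, a' i ≠ 0 := by
    intro i
    rw [ea]
    fin_cases i <;> simp [birGen, genPt, ha]
  obtain ⟨l, l0, l1⟩ := lat_σ₁
  refine IsMarkedIso.of_link (markB ha) (markB ha') hf hg (loc' := locB a' f' g')
    (fun i => by rw [confB_loc, map_locB, hf, hg]) (link_σ₁ ha isChart_coord hp)
    (link_σ₁ ha' hch hp') permσ₁_permσ₁ permσ₁_permσ₁ (fun i _ => l i) ?_ ?_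
    (fun i hi => hi.elim)
  · refine Or.inl ⟨1, ?_, l0⟩
    change mapRing Φ (lineInf 1) = lineInf 0
    rw [mapRing_lineInf_one, hf, hg, ef, eg, lineInf_zero]
  · refine Or.inl ⟨0, ?_, l1⟩
    change mapRing Φ (lineInf 0) = lineInf 1
    rw [mapRing_lineInf_zero, hf, hg, ef, eg, lineInf_one]

/-! ### The diagram automorphism `σ₀` -/

/-- The permutation of the points under `σ₀`. -/
def permσ₀ : Fin 8 → Fin 8 := ![2, 1, 0, 7, 6, 5, 4, 3]

theorem permσ₀_permσ₀ (i : Fin 8) : permσ₀ (permσ₀ i) = i := by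
  revert i; decide

theorem birGen_σ₀_birGen {a : Fin 5 → ℂ} (ha : IsRootVars a) {f g : KK} (h : IsChart f g) :
    birGen .σ₀ (birGen .σ₀ ⟨a, f, g⟩) = ⟨a, f, g⟩ := by
  have hf := h.ne_zero
  have hg := h.swap.ne_zero
  have hc := fun i => cst_ne_zero (ha.1 i)
  have c0 := hc 0
  have c1 := hc 1
  have c2 := hc 2
  have hr : cst (a 0) * cst (a 1) * cst (a 2) = cst (a 3) * cst (a 4) := by
    rw [← cst_mul, ← cst_mul, ← cst_mul, ha.2]
  ext
  · rename_i i
    fin_cases i <;> simp [birGen]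
  · simp [birGen, cst_inv]
    field_simp
  · simp [birGen, cst_inv]
    field_simp
    linear_combination (-1) * hr

theorem link_σ₀ {a a' : Fin 5 → ℂ} (ha : IsRootVars a) {f g f' g' : KK}
    (h : IsChart f g) (hp : birGen .σ₀ ⟨a, f, g⟩ = ⟨a', f', g'⟩) :
    Link f g (locB a f g) f' g' (locB a' f' g') permσ₀ (fun i => i = 1 ∨ i = 5) := by
  have hf := h.ne_zero
  have hg := h.swap.ne_zero
  have n0 := ha.1 0
  have n1 := ha.1 1
  have n2 := ha.1 2
  have n3 := ha.1 3
  have n4 := ha.1 4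
  have hr := ha.2
  have k0 := cst_ne_zero n0
  have k1 := cst_ne_zero n1
  have k4 := cst_ne_zero n4
  have ea : a' = _ := (congrArg Pt.a hp).symm
  have ef : f' = f / cst (a 1) := (congrArg Pt.f hp).symm
  have eg : g' = -(cst (a 0) * f) / (cst (a 4) * g) := (congrArg Pt.g hp).symm
  have a0 : a' 0 = 1 / a 2 := by rw [ea]; rfl
  have a1 : a' 1 = 1 / a 1 := by rw [ea]; rfl
  have a2 : a' 2 = 1 / a 0 := by rw [ea]; rfl
  have a4 : a' 4 = 1 / a 3 := by rw [ea]; rfl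
  have ef' : f' = f * cst (1 / a 1) := by rw [ef, cst_div, cst_one]; field_simp
  have efi : f'⁻¹ = f⁻¹ * cst (a 1) := by rw [ef]; field_simp
  have eg' : g' = f / g * cst (-(a 0 / a 4)) := by rw [eg, cst_neg, cst_div]; field_simp
  have egi : g'⁻¹ = g / f * cst (-(a 4 / a 0)) := by
    rw [eg, cst_neg, cst_div]; field_simp
  have efg : f' / g' = g * cst (-(a 4 / (a 0 * a 1))) := by
    rw [ef, eg, cst_neg, cst_div, cst_mul]; field_simp
  have egf : g' / f' = g⁻¹ * cst (-(a 0 * a 1 / a 4)) := by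
    rw [ef, eg, cst_neg, cst_div, cst_mul]; field_simp
  constructor
  · intro i hi B hB h1 h2
    fin_cases i
    · have h3 : Tends B g 1 := tends_of_vanishes_sub_one h2
      refine ⟨(show Vanishes B f⁻¹ from h1).of_mul (tends_cst (a 1)) hB efi,
        ((h3.mul (tends_cst _) hB).add (tends_cst (a' 4 / a' 0)) hB).vanishes
          (congrArg (· + cst (a' 4 / a' 0)) efg) ?_⟩
      rw [a0, a4]; field_simp; linear_combination hr
    · exact absurd (Or.inl rfl) hi
    · have h3 : Tends B (f / g) (-(a 4 / a 0)) := tends_of_vanishes_add h2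
      refine ⟨(show Vanishes B f⁻¹ from h1).of_mul (tends_cst (a 1)) hB efi,
        ((h3.mul (tends_cst (-(a 0 / a 4))) hB).sub tends_one hB).vanishes
          (congrArg (· - 1) eg') ?_⟩
      field_simp; ring
    · replace h1 : Vanishes B g⁻¹ := h1
      have h3 : Tends B f 1 := tends_of_vanishes_sub_one h2
      refine ⟨h1.of_mul (h3.mul (tends_cst (-(a 0 / a 4))) hB) hB ?_,
        ((h3.mul (tends_cst (1 / a 1)) hB).sub (tends_cst (a' 1)) hB).vanishes
          (congrArg (· - cst (a' 1)) ef') ?_⟩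
      · change g' = _
        rw [eg']; ring
      · rw [a1]; ring
    · replace h1 : Vanishes B f := h1
      have h3 : Tends B g (1 / a 2) := h2
      refine ⟨h1.of_mul (tends_cst _) hB ef', (((h3.inv (one_div_ne_zero n2) hB).mul (tends_cst _)
        hB).add (tends_cst (1 / a' 4)) hB).vanishes (congrArg (· + cst (1 / a' 4)) egf) ?_⟩
      rw [a4]; field_simp; linear_combination (-1) * hr
    · exact absurd (Or.inr rfl) hi
    · replace h1 : Vanishes B f := h1
      have h3 : Tends B (g / f) (-(1 / a 4)) := tends_of_vanishes_add h2
      refine ⟨h1.of_mul (tends_cst _) hB ef', (((h3.inv (neg_ne_zero.2 (one_div_ne_zero n4)) hB).mul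
        (tends_cst (-(a 0 / a 4))) hB).sub (tends_cst (1 / a' 2)) hB).vanishes ?_ ?_⟩
      · change g' - cst (1 / a' 2) = _
        rw [inv_div, eg']
      · rw [a2]; field_simp; ring
    · replace h1 : Vanishes B g := h1
      have h3 : Tends B f (a 1) := h2
      refine ⟨h1.of_mul ((h3.inv n1 hB).mul (tends_cst (-(a 4 / a 0))) hB) hB ?_,
        ((h3.mul (tends_cst (1 / a 1)) hB).sub tends_one hB).vanishes (congrArg (· - 1) ef') ?_⟩
      · change g'⁻¹ = _
        rw [egi]; ring
      · field_simp; ring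
  · rintro B hP ⟨hvf, hvg, hc⟩
    have hB := hP.1
    have c1 : Vanishes B f⁻¹ → Vanishes B g⁻¹ → HasValue B (g⁻¹ / f⁻¹) := hc 1
    have c5 : Vanishes B f → Vanishes B g → HasValue B (g / f) := hc 5
    refine ⟨hvf.of_mul (tends_cst _) (one_div_ne_zero n1) hB ef', ?_, ?_⟩
    · refine HasValue.of_mul (x := f / g) ?_ (tends_cst _) (neg_ne_zero.2 (div_ne_zero n0 n4)) hB eg'
      rcases hP.unit_or hvg with ⟨d, hd, hgd⟩ | hg0 | hgi
      · exact hvf.of_mul (hgd.inv hd hB) (inv_ne_zero hd) hB (div_eq_mul_inv _ _)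
      · rcases hP.unit_or hvf with ⟨d, hd, hfd⟩ | hf0 | hfi
        · exact hvg.inv.of_mul hfd hd hB (by field_simp)
        · rw [← inv_div]; exact (c5 hf0 hg0).inv
        · right
          rw [inv_div, div_eq_mul_inv]
          exact mul_mem hg0.1 hfi.1
      · rcases hP.unit_or hvf with ⟨d, hd, hfd⟩ | hf0 | hfi
        · exact hvg.inv.of_mul hfd hd hB (by field_simp)
        · left
          rw [div_eq_mul_inv]
          exact mul_mem hf0.1 hgi.1
        · have := c1 hfi hgi
          rwa [inv_div_inv] at this
    · rintro i (rfl | rfl) - -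
      · refine hvg.of_mul (tends_cst _) (neg_ne_zero.2 (div_ne_zero n4 (mul_ne_zero n0 n1))) hB
          (Eq.trans ?_ efg)
        exact inv_div_inv _ _
      · exact hvg.inv.of_mul (tends_cst _) (neg_ne_zero.2 (div_ne_zero (mul_ne_zero n0 n1) n4)) hB egf

theorem lat_σ₀ : (∀ i : Fin 8, ¬ (i = 1 ∨ i = 5) →
      latGen .σ₀ (excClasses nextB i) = excClasses nextB (permσ₀ i)) ∧
    latGen .σ₀ (basicClasses nextB poleB 0) = excClasses nextB 1 ∧
    latGen .σ₀ (excClasses nextB 1) = basicClasses nextB poleB 0 ∧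
    latGen .σ₀ (basicClasses nextB poleB 1) = basicClasses nextB poleB 1 -
      ∑ i, (![0, -1, -1, -1, 0, 1, 1, 1] : Fin 8 → ℤ) i • excClasses nextB i ∧
    latGen .σ₀ (excClasses nextB 5) = basicClasses nextB poleB 0 -
      ∑ i, (![-1, -1, -1, 0, 1, 1, 1, 0] : Fin 8 → ℤ) i • excClasses nextB i := by
  decide +kernel

theorem curves_σ₀ {a a' : Fin 5 → ℂ} (ha : ∀ i, a i ≠ 0) {f g f' g' : KK}
    (h : IsChart f g) (h' : IsChart f' g') (hp : birGen .σ₀ ⟨a, f, g⟩ = ⟨a', f', g'⟩) :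
    crv f'⁻¹ (g'⁻¹ / f'⁻¹) = crv f⁻¹ g ∧ crv f'⁻¹ g' = crv f⁻¹ (g⁻¹ / f⁻¹) ∧
    crv (g' - cst 0) f' = crv g⁻¹ f ∧ crv (f' - cst 0) g' = crv f (g / f) := by
  have hf := h.ne_zero
  have hg := h.swap.ne_zero
  have n0 := ha 0
  have n1 := ha 1
  have n4 := ha 4
  have k0 := cst_ne_zero n0
  have k1 := cst_ne_zero n1
  have k4 := cst_ne_zero n4
  have ef : f' = f / cst (a 1) := (congrArg Pt.f hp).symm
  have eg : g' = -(cst (a 0) * f) / (cst (a 4) * g) := (congrArg Pt.g hp).symm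
  have ef' : f' = f * cst (1 / a 1) := by rw [ef, cst_div, cst_one]; field_simp
  have efi : f'⁻¹ = f⁻¹ * cst (a 1) := by rw [ef]; field_simp
  have eg' : g' = f / g * cst (-(a 0 / a 4)) := by rw [eg, cst_neg, cst_div]; field_simp
  have efg : f' / g' = g * cst (-(a 4 / (a 0 * a 1))) := by
    rw [ef, eg, cst_neg, cst_div, cst_mul]; field_simp
  refine ⟨?_, ?_, ?_, ?_⟩
  · refine (h.swap.inv.swap.crv_eq_of h'.swap.inv.swap.inv.div fun V hV hu hw =>
      ⟨hu.of_mul (tends_cst _) hV.isLoc efi, _, _, ?_, tends_cst (-(a 4 / (a 0 * a 1))), ?_⟩).symm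
    · exact neg_ne_zero.2 (div_ne_zero n4 (mul_ne_zero n0 n1))
    · rw [← efg, inv_div_inv]
  · refine (h.swap.inv.swap.inv.exc_eq_of h'.swap.inv.swap fun V hV hu hw =>
      ⟨hu.of_mul (tends_cst _) hV efi, _, _, ?_, tends_cst (-(a 0 / a 4)), ?_⟩).symm
    · exact neg_ne_zero.2 (div_ne_zero n0 n4)
    · rw [eg', inv_div_inv]
  · rw [cst_zero, sub_zero]
    refine (h.inv.swap.crv_eq_of h'.swap fun V hV hu hw =>
      ⟨?_, _, _, one_div_ne_zero n1, tends_cst _, ef'⟩).symm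
    have hm : f ∈ V := by
      have := (hV.hasOrder_zero_iff.1 (hw 0)).1
      rwa [cst_zero, sub_zero] at this
    refine (hu.mul_mem hm hV.isLoc).of_mul (tends_cst (-(a 0 / a 4))) hV.isLoc ?_
    rw [eg']; ring
  · rw [cst_zero, sub_zero]
    exact (h.exc_eq_of_inv h' fun V hV hu hw =>
      ⟨hu.of_mul (tends_cst _) hV ef', _, _, neg_ne_zero.2 (div_ne_zero n0 n4), tends_cst _, eg'⟩).symm

theorem isRootVars_σ₀ {a : Fin 5 → ℂ} (ha : IsRootVars a) :
    IsRootVars (birGen .σ₀ (genPt a)).a := by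
  refine ⟨fun i => ?_, ?_⟩
  · fin_cases i <;> simp [birGen, genPt, ha.1]
  · have hr := ha.2
    have h := ha.1
    have h0 := h 0
    have h1 := h 1
    have h2 := h 2
    have h3 := h 3
    have h4 := h 4
    change 1 / a 2 * (1 / a 1) * (1 / a 0) = 1 / a 4 * (1 / a 3)
    field_simp
    linear_combination (-1) * hr

theorem isRootVars_σ₁ {a : Fin 5 → ℂ} (ha : IsRootVars a) :
    IsRootVars (birGen .σ₁ (genPt a)).a := by
  refine ⟨fun i => ?_, ?_⟩
  · fin_cases i <;> simp [birGen, genPt, ha.1]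
  · have hr := ha.2
    have h := ha.1
    have h0 := h 0
    have h1 := h 1
    have h2 := h 2
    have h3 := h 3
    have h4 := h 4
    change 1 / a 0 * (1 / a 2) * (1 / a 1) = 1 / a 3 * (1 / a 4)
    field_simp
    linear_combination (-1) * hr

theorem iso_σ₀ {a : Fin 5 → ℂ} (ha : IsRootVars a) : ∃ Φ : KK ≃ₐ[ℂ] KK,
    Φ (coord 0) = (birGen .σ₀ (genPt a)).f ∧ Φ (coord 1) = (birGen .σ₀ (genPt a)).g ∧
    IsMarkedIso Φ (confB a) (confB (birGen .σ₀ (genPt a)).a) (latGen .σ₀).toLinearMap := by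
  have hra' := isRootVars_σ₀ ha
  obtain ⟨⟨a', f', g'⟩, hp⟩ : ∃ p, birGen .σ₀ (genPt a) = p := ⟨_, rfl⟩
  have hp' : birGen .σ₀ ⟨a', f', g'⟩ = genPt a := by
    rw [← hp]; exact birGen_σ₀_birGen ha isChart_coord
  have hch : IsChart f' g' := isChart_of_birGen (p' := ⟨a', f', g'⟩) isChart_coord hp'
  rw [hp] at hra' ⊢
  obtain ⟨Φ, hf, hg⟩ := hch
  have hch : IsChart f' g' := ⟨Φ, hf, hg⟩
  refine ⟨Φ, hf, hg, ?_⟩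
  replace hra' : IsRootVars a' := hra'
  have ha' := hra'.1
  have n1 := ha' 1
  have n2 := ha' 2
  obtain ⟨c0, c3, c1, c7⟩ := curves_σ₀ ha.1 isChart_coord hch hp
  obtain ⟨l, l0, l3, l1, l7⟩ := lat_σ₀
  refine IsMarkedIso.of_link (markB ha.1) (markB ha') hf hg (loc' := locB a' f' g')
    (fun i => by rw [confB_loc, map_locB, hf, hg]) (link_σ₀ ha isChart_coord hp)
    ?_ permσ₀_permσ₀ permσ₀_permσ₀ l ?_ ?_ ?_
  · have := link_σ₀ hra' hch hp'
    have e : (fun i : Fin 8 => i = 1 ∨ i = 5) ∘ permσ₀ = fun i => i = 1 ∨ i = 5 := by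
      funext i; fin_cases i <;> simp [permσ₀]
    rwa [e]
  · refine Or.inl ⟨3, ?_, l0⟩
    change mapRing Φ ((confB a').exc 1) = lineInf 0
    rw [mapRing_exc (loc := locB a' f' g') (by rw [confB_loc, map_locB, hf, hg]), lineInf_zero, ← c0]
    rfl
  · refine Or.inr ⟨1, 0, _, fun i => ?_, ?_, l1⟩
    · refine orderB ha' ?_
      fin_cases i <;> simp [baseB, n2.symm, n2]
    · change crv (Φ (coord 1) - cst 0) (Φ (coord 0)) = lineInf 1
      rw [hf, hg, c1, lineInf_one]
  · rintro i (rfl | rfl)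
    · refine Or.inl ⟨0, ?_, l3⟩
      change mapRing Φ (lineInf 0) = _
      rw [mapRing_lineInf_zero, hf, hg, c3]; rfl
    · refine Or.inr ⟨0, 0, _, fun i => ?_, ?_, l7⟩
      · refine orderB ha' ?_
        fin_cases i <;> simp [baseB, n1.symm]
      · change crv (Φ (coord 0) - cst 0) (Φ (coord 1)) = _
        rw [hf, hg, c7]; rfl

/-! ### From the (b)-model to the (a)-model -/

theorem link_BA {a : Fin 5 → ℂ} (ha : ∀ i, a i ≠ 0) {f g F G : KK}
    (h : IsChart f g) (hF : F = f * (g - 1) / g) (hG : G = cst (a 4 / a 0) * g) :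
    Link f g (locB a f g) F G (locA a F G) id (fun i => i = 0 ∨ i = 5) := by
  have hf := h.ne_zero
  have hg := h.swap.ne_zero
  have n0 := ha 0
  have n1 := ha 1
  have n2 := ha 2
  have n4 := ha 4
  have hg1 : g - 1 ≠ 0 := h.swap.sub_one_ne_zero
  have hc : a 4 / a 0 ≠ 0 := div_ne_zero n4 n0
  have e4 : a 4 / (a 0 * a 2) = a 4 / a 0 * (1 / a 2) := by field_simp
  have e7 : a 1 * a 4 / a 0 = a 4 / a 0 * a 1 := by field_simp
  have hk := cst_ne_zero hc
  constructor
  · intro i hi B hB h1 h2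
    fin_cases i
    · exact absurd (Or.inl rfl) hi
    · replace h1 : Vanishes B f⁻¹ := h1
      replace h2 : Vanishes B g⁻¹ := h2
      have hT := tends_one.sub h2.tends hB
      refine ⟨h1.of_mul (hT.inv (by norm_num) hB) hB ?_, h2.of_mul ((tends_cst _).inv hc hB) hB ?_⟩
      · change F⁻¹ = _
        rw [hF]; field_simp
      · change G⁻¹ = _
        rw [hG, mul_inv, mul_comm]
    · replace h1 : Vanishes B f⁻¹ := h1
      replace h2 : Vanishes B (f / g + cst (a 4 / a 0)) := h2
      have h3 := tends_of_vanishes_add h2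
      have h4 : Vanishes B g⁻¹ := h1.of_mul h3 hB (by field_simp)
      have hT := tends_one.sub h4.tends hB
      refine ⟨h1.of_mul (hT.inv (by norm_num) hB) hB ?_,
        (((h3.mul hT hB).div (tends_cst _) hc hB).add tends_one hB).vanishes ?_ ?_⟩
      · change F⁻¹ = _
        rw [hF]; field_simp
      · change F / G + 1 = _
        rw [hF, hG]; field_simp
      · field_simp; ring
    · replace h1 : Vanishes B g⁻¹ := h1
      replace h2 : Vanishes B (f - 1) := h2
      have hT := tends_one.sub h1.tends hB
      refine ⟨h1.of_mul ((tends_cst _).inv hc hB) hB ?_,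
        (((tends_of_vanishes_sub_one h2).mul hT hB).sub tends_one hB).vanishes ?_ (by ring)⟩
      · change G⁻¹ = _
        rw [hG, mul_inv, mul_comm]
      · change F - 1 = _
        rw [hF]; field_simp
    · replace h1 : Vanishes B f := h1
      have h3 : Tends B g (1 / a 2) := h2
      refine ⟨h1.of_mul ((h3.sub tends_one hB).div h3 (one_div_ne_zero n2) hB) hB ?_,
        (((tends_cst (a 4 / a 0)).mul h3 hB).sub (tends_cst (a 4 / (a 0 * a 2))) hB).vanishes ?_ ?_⟩
      · change F = _
        rw [hF]; field_simp
      · change G - cst (a 4 / (a 0 * a 2)) = _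
        rw [hG]
      · rw [e4]; ring
    · exact absurd (Or.inr rfl) hi
    · replace h1 : Vanishes B f := h1
      have h3 : Tends B (g / f) (-(1 / a 4)) := tends_of_vanishes_add h2
      have h4 : Vanishes B g := h1.of_mul h3 hB (by field_simp)
      refine ⟨h4.of_mul (tends_cst (a 4 / a 0)) hB ?_,
        (((h4.tends.sub tends_one hB).div h3 (neg_ne_zero.2 (one_div_ne_zero n4)) hB).sub
          (tends_cst (a 4)) hB).vanishes ?_ ?_⟩
      · change G = _
        rw [hG, mul_comm]
      · change F - cst (a 4) = _
        rw [hF]; field_simp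
      · field_simp; ring
    · replace h1 : Vanishes B g := h1
      have h3 : Tends B f (a 1) := h2
      have h4 := h1.tends.sub tends_one hB
      refine ⟨h1.of_mul ((h3.mul h4 hB).inv (by simpa using n1) hB) hB ?_,
        (((tends_cst (a 4 / a 0)).mul (h3.mul h4 hB) hB).add (tends_cst (a 1 * a 4 / a 0)) hB).vanishes
          ?_ ?_⟩
      · change F⁻¹ = _
        rw [hF]; field_simp
      · change F * G + cst (a 1 * a 4 / a 0) = _
        rw [hF, hG]; field_simp
      · rw [e7]; ring
  · rintro B hP ⟨hvf, hvg, hcd⟩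
    have hB := hP.1
    have c0 : Vanishes B f⁻¹ → Vanishes B (g - 1) → HasValue B ((g - 1) / f⁻¹) := hcd 0
    have c5 : Vanishes B f → Vanishes B g → HasValue B (g / f) := hcd 5
    refine ⟨?_, ?_, ?_⟩
    · rcases hP.tends_or hvg with ⟨d, hgd⟩ | hgi
      · by_cases hd0 : d = 0
        · subst hd0
          have hg0 := tends_zero_iff.1 hgd
          have h3 : HasValue B (f / g) := by
            rcases hP.unit_or hvf with ⟨d, hd, hfd⟩ | hf0 | hfi
            · exact hvg.inv.of_mul hfd hd hB (by field_simp)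
            · rw [← inv_div]; exact (c5 hf0 hg0).inv
            · rw [← inv_div, hasValue_inv_iff, div_eq_mul_inv]
              exact Or.inl (mul_mem hg0.1 hfi.1)
          refine h3.of_mul (hgd.sub tends_one hB) (by norm_num) hB ?_
          rw [hF]; field_simp
        · by_cases hd1 : d = 1
          · subst hd1
            have hg1v : Vanishes B (g - 1) := by simpa [Tends, cst_one] using hgd
            have h3 : HasValue B (f * (g - 1)) := by
              rcases hP.tends_or hvf with ⟨d, hfd⟩ | hfi
              · exact Or.inl (mul_mem (hfd.mem hB) hg1v.1)
              · have := c0 hfi hg1v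
                rwa [div_inv_eq_mul, mul_comm] at this
            exact h3.of_mul (hgd.inv one_ne_zero hB) (by norm_num) hB (by rw [hF, div_eq_mul_inv])
          · exact hvf.of_mul ((hgd.sub tends_one hB).div hgd hd0 hB)
              (div_ne_zero (sub_ne_zero.2 hd1) hd0) hB (by rw [hF, mul_div_assoc])
      · exact hvf.of_mul (tends_one.sub hgi.tends hB) (by norm_num) hB (by rw [hF]; field_simp)
    · exact hvg.of_mul (tends_cst _) hc hB (by rw [hG, mul_comm])
    · rintro i (rfl | rfl) h1 h2
      · have h4 : Tends B g 0 := by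
          have h2 : Vanishes B G := h2
          refine (h2.tends.div (tends_cst _) hc hB).congr ?_ (zero_div _).symm
          rw [hG]; field_simp
        refine hvf.of_mul ((tends_cst (a 4 / a 0)).mul (h4.sub tends_one hB) hB)
          (mul_ne_zero hc (by norm_num)) hB ?_
        change G / F⁻¹ = _
        rw [hF, hG]; field_simp
      · have h4 : Tends B g 1 := by
          have h2 : Tends B G (a 4 / a 0) := h2
          refine (h2.div (tends_cst _) hc hB).congr ?_ (div_self hc).symm
          rw [hG]; field_simp
        refine hvf.inv.of_mul ((tends_cst (a 4 / a 0)).mul h4 hB)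
          (mul_ne_zero hc (by norm_num)) hB ?_
        change (G - cst (a 4 / a 0)) / F = _
        rw [hF, hG]; field_simp

theorem link_AB {a : Fin 5 → ℂ} (ha : ∀ i, a i ≠ 0) (ha2 : a 2 ≠ 1) {f g F G : KK}
    (h : IsChart F G) (hf : f = F * G / (G - cst (a 4 / a 0))) (hg : g = G / cst (a 4 / a 0)) :
    Link F G (locA a F G) f g (locB a f g) id (fun i => i = 0 ∨ i = 5) := by
  have hF0 := h.ne_zero
  have hG0 := h.swap.ne_zero
  have n0 := ha 0
  have n1 := ha 1
  have n2 := ha 2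
  have n4 := ha 4
  have hc : a 4 / a 0 ≠ 0 := div_ne_zero n4 n0
  have e4 : a 4 / (a 0 * a 2) = a 4 / a 0 * (1 / a 2) := by field_simp
  have e7 : a 1 * a 4 / a 0 = a 4 / a 0 * a 1 := by field_simp
  have hGc : G - cst (a 4 / a 0) ≠ 0 := h.swap.sub_cst_ne_zero _
  have hk := cst_ne_zero hc
  generalize hcc : a 4 / a 0 = c at *
  constructor
  · intro i hi B hB h1 h2
    fin_cases i
    · exact absurd (Or.inl rfl) hi
    · replace h1 : Vanishes B F⁻¹ := h1
      replace h2 : Vanishes B G⁻¹ := h2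
      have hT := tends_one.sub ((tends_cst c).mul h2.tends hB) hB
      refine ⟨h1.of_mul hT hB ?_, h2.of_mul (tends_cst c) hB ?_⟩
      · change f⁻¹ = _
        rw [hf]; field_simp
      · change g⁻¹ = _
        rw [hg]; field_simp
    · replace h1 : Vanishes B F⁻¹ := h1
      replace h2 : Vanishes B (F / G + 1) := h2
      have h3 := tends_of_vanishes_add_one h2
      have h4 : Vanishes B G⁻¹ := h1.of_mul h3 hB (by field_simp)
      have hT := tends_one.sub ((tends_cst c).mul h4.tends hB) hB
      refine ⟨h1.of_mul hT hB ?_, (((h3.mul (tends_cst c) hB).div hT (by simp) hB).add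
        (tends_cst c) hB).vanishes ?_ ?_⟩
      · change f⁻¹ = _
        rw [hf]; field_simp
      · change f / g + cst (a 4 / a 0) = _
        rw [hf, hg, hcc]; field_simp
      · simp
    · replace h1 : Vanishes B G⁻¹ := h1
      replace h2 : Vanishes B (F - 1) := h2
      have hT := tends_one.sub ((tends_cst c).mul h1.tends hB) hB
      refine ⟨h1.of_mul (tends_cst c) hB ?_,
        (((tends_of_vanishes_sub_one h2).div hT (by simp) hB).sub tends_one hB).vanishes ?_ (by simp)⟩
      · change g⁻¹ = _
        rw [hg]; field_simp
      · change f - 1 = _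
        rw [hf]; field_simp
    · replace h1 : Vanishes B F := h1
      have h3 : Tends B G (a 4 / (a 0 * a 2)) := h2
      rw [e4] at h3
      refine ⟨h1.of_mul (h3.div (h3.sub (tends_cst c) hB) ?_ hB) hB ?_,
        ((h3.div (tends_cst c) hc hB).sub (tends_cst (1 / a 2)) hB).vanishes ?_ ?_⟩
      · have : c * (1 / a 2) - c = c * (1 - a 2) / a 2 := by field_simp
        rw [this]
        exact div_ne_zero (mul_ne_zero hc (sub_ne_zero.2 ha2.symm)) n2
      · change f = _
        rw [hf, mul_div_assoc]
      · change g - cst (1 / a 2) = _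
        rw [hg]
      · field_simp; ring
    · exact absurd (Or.inr rfl) hi
    · replace h1 : Vanishes B G := h1
      have h3 : Tends B F (a 4) := h2
      have h4 := h1.tends.sub (tends_cst c) hB
      refine ⟨h1.of_mul (h3.div h4 (by simpa using hc) hB) hB ?_,
        ((h4.div (h3.mul (tends_cst c) hB) (mul_ne_zero n4 hc) hB).add
          (tends_cst (1 / a 4)) hB).vanishes ?_ ?_⟩
      · change f = _
        rw [hf]; field_simp
      · change g / f + cst (1 / a 4) = _
        rw [hf, hg]; field_simp
      · field_simp; ring
    · replace h1 : Vanishes B F⁻¹ := h1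
      have h3 : Tends B (F * G) (-(a 1 * a 4 / a 0)) := tends_of_vanishes_add h2
      rw [e7] at h3
      have h4 : Vanishes B G := h1.of_mul h3 hB (by field_simp)
      refine ⟨h4.of_mul ((tends_cst c).inv hc hB) hB ?_,
        ((h3.div (h4.tends.sub (tends_cst c) hB) (by simpa using hc) hB).sub
          (tends_cst (a 1)) hB).vanishes ?_ ?_⟩
      · change g = _
        rw [hg, div_eq_mul_inv]
      · change f - cst (a 1) = _
        rw [hf]
      · field_simp; ring
  · rintro B hP ⟨hvF, hvG, hcd⟩
    have hB := hP.1
    have c0 : Vanishes B F⁻¹ → Vanishes B G → HasValue B (G / F⁻¹) := hcd 0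
    have c5 : Vanishes B F → Vanishes B (G - cst c) → HasValue B ((G - cst c) / F) := by
      have := hcd 5
      rw [← hcc]; exact this
    refine ⟨?_, ?_, ?_⟩
    · rcases hP.tends_or hvG with ⟨d, hGd⟩ | hGi
      · by_cases hdc : d = c
        · subst hdc
          have h3 : HasValue B (F / (G - cst d)) := by
            rw [← inv_div, hasValue_inv_iff]
            rcases hP.unit_or hvF with ⟨e, he, hFe⟩ | hF0 | hFi
            · exact (hGd.tends.div hFe he hB).hasValue hB
            · exact c5 hF0 hGd
            · rw [div_eq_mul_inv]
              exact Or.inl (mul_mem hGd.1 hFi.1)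
          refine h3.of_mul hGd hc hB ?_
          rw [hf]; field_simp
        · by_cases hd0 : d = 0
          · subst hd0
            have hG0v := tends_zero_iff.1 hGd
            have h3 : HasValue B (F * G) := by
              rcases hP.tends_or hvF with ⟨e, hFe⟩ | hFi
              · exact Or.inl (mul_mem (hFe.mem hB) hG0v.1)
              · have := c0 hFi hG0v
                rwa [div_inv_eq_mul, mul_comm] at this
            exact h3.of_mul ((hGd.sub (tends_cst c) hB).inv (sub_ne_zero.2 hdc) hB)
              (inv_ne_zero (sub_ne_zero.2 hdc)) hB (by rw [hf, div_eq_mul_inv])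
          · exact hvF.of_mul (hGd.div (hGd.sub (tends_cst c) hB) (sub_ne_zero.2 hdc) hB)
              (div_ne_zero hd0 (sub_ne_zero.2 hdc)) hB (by rw [hf, mul_div_assoc])
      · exact hvF.of_mul ((tends_one.sub ((tends_cst c).mul hGi.tends hB) hB).inv (by simp) hB)
          (by simp) hB (by rw [hf]; field_simp)
    · exact hvG.of_mul ((tends_cst c).inv hc hB) (inv_ne_zero hc) hB (by rw [hg, div_eq_mul_inv])
    · rintro i (rfl | rfl) h1 h2
      · have h2 : Vanishes B (g - 1) := h2
        have h4 : Tends B G c := by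
          refine ((tends_of_vanishes_sub_one h2).mul (tends_cst c) hB).congr ?_ (one_mul c).symm
          rw [hg]; field_simp
        refine hvF.of_mul (h4.div (tends_cst c) hc hB) (by rw [div_self hc]; norm_num) hB ?_
        change (g - 1) / f⁻¹ = _
        rw [hf, hg]; field_simp
      · have h2 : Vanishes B g := h2
        have h4 : Tends B G 0 := by
          refine (h2.tends.mul (tends_cst c) hB).congr ?_ (zero_mul c).symm
          rw [hg]; field_simp
        refine hvF.inv.of_mul ((h4.sub (tends_cst c) hB).div (tends_cst c) hc hB) ?_ hB ?_
        · rw [zero_sub]; exact div_ne_zero (neg_ne_zero.2 hc) hc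
        · change g / f = _
          rw [hf, hg]; field_simp

theorem lat_BtoA : (∀ i : Fin 8, ¬ (i = 0 ∨ i = 5) →
      BtoA (excClasses nextB i) = excClasses nextA i) ∧
    BtoA (basicClasses nextB poleB 0) = basicClasses nextA poleA 0 ∧
    BtoA (basicClasses nextB poleB 1) = basicClasses nextA poleA 1 ∧
    BtoA (excClasses nextB 0) = basicClasses nextA poleA 1 -
      ∑ i, (![0, -1, -1, -1, 0, 1, 0, 0] : Fin 8 → ℤ) i • excClasses nextA i ∧
    BtoA (excClasses nextB 5) = basicClasses nextA poleA 1 -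
      ∑ i, (![1, -1, -1, -1, 0, 0, 1, 1] : Fin 8 → ℤ) i • excClasses nextA i := by
  decide +kernel

theorem curves_BA {a : Fin 5 → ℂ} (ha : ∀ i, a i ≠ 0) {f g F G : KK}
    (h : IsChart f g) (h' : IsChart F G) (hF : F = f * (g - 1) / g)
    (hG : G = cst (a 4 / a 0) * g) :
    crv F⁻¹ G = crv f⁻¹ g ∧ crv G⁻¹ F = crv g⁻¹ f ∧
    crv (G - cst (a 4 / a 0)) F = crv f⁻¹ ((g - 1) / f⁻¹) ∧ crv (G - cst 0) F = crv f (g / f) := by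
  have hf := h.ne_zero
  have hg := h.swap.ne_zero
  have hg1 : g - 1 ≠ 0 := h.swap.sub_one_ne_zero
  have hc : a 4 / a 0 ≠ 0 := div_ne_zero (ha 4) (ha 0)
  refine ⟨?_, ?_, ?_, ?_⟩
  · refine (h.swap.inv.swap.crv_eq_of h'.swap.inv.swap fun V hV hu hw => ⟨?_, ?_⟩).symm
    · have h1 := hV.hasOrder_zero_iff.1 (hV.hasOrder_div (hw 0) (hw 1))
      refine (hu.mul_mem h1.1 hV.isLoc).of_mul (tends_cst 1) hV.isLoc ?_
      rw [hF, cst_zero, sub_zero, cst_one]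
      field_simp
    · exact ⟨_, _, hc, tends_cst _, by rw [hG, mul_comm]⟩
  · refine (h.inv.swap.crv_eq_of h'.inv.swap fun V hV hu hw => ⟨?_, ?_⟩).symm
    · exact hu.of_mul ((tends_cst _).inv hc hV.isLoc) hV.isLoc (by rw [hG, mul_inv, mul_comm])
    · exact ⟨_, _, by norm_num, tends_one.sub hu.tends hV.isLoc, by rw [hF]; field_simp⟩
  · have hch : IsChart f⁻¹ (g - 1) := by simpa [cst_one] using (h.sub_cst 1).swap.inv.swap
    refine (hch.exc_eq_of (h'.sub_cst _).swap fun V hB hu hv => ⟨?_, ?_⟩).symm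
    · exact hv.of_mul (tends_cst (a 4 / a 0)) hB (by rw [hG]; ring)
    · exact ⟨_, _, by norm_num, (tends_of_vanishes_sub_one hv).inv one_ne_zero hB,
        by rw [hF]; field_simp⟩
  · rw [cst_zero, sub_zero]
    refine (h.exc_eq_of_inv h'.swap fun V hB hu hv => ⟨?_, ?_⟩).symm
    · exact hv.of_mul (tends_cst (a 4 / a 0)) hB (by rw [hG]; ring)
    · exact ⟨_, _, by norm_num, hv.tends.sub tends_one hB, by rw [hF]; field_simp⟩

theorem isChart_BA {a : Fin 5 → ℂ} (ha : ∀ i, a i ≠ 0) {f g : KK} (h : IsChart f g) :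
    IsChart (changeBA ⟨a, f, g⟩).f (changeBA ⟨a, f, g⟩).g := by
  have hk := cst_ne_zero (div_ne_zero (ha 4) (ha 0))
  have hg := h.swap.ne_zero
  have hg1 : g - 1 ≠ 0 := h.swap.sub_one_ne_zero
  refine h.of_forall_mem fun K h0 h1 => ?_
  have hg' : g ∈ K := by
    have := K.mul_mem (K.inv_mem (cst_mem K (a 4 / a 0))) h1
    simpa [changeBA, hk] using this
  refine ⟨?_, hg'⟩
  have := K.mul_mem h0 (K.div_mem hg' (K.sub_mem hg' K.one_mem))
  convert this using 1
  simp only [changeBA]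
  field_simp

theorem iso_BA {a : Fin 5 → ℂ} (ha : ∀ i, a i ≠ 0) (ha2 : a 2 ≠ 1) : ∃ τ : KK ≃ₐ[ℂ] KK,
    τ (coord 0) = (changeBA (genPt a)).f ∧ τ (coord 1) = (changeBA (genPt a)).g ∧
    IsMarkedIso τ (confB a) (confA a) BtoA := by
  have hch := isChart_BA ha isChart_coord
  obtain ⟨F, hF⟩ : ∃ F, F = (changeBA (genPt a)).f := ⟨_, rfl⟩
  obtain ⟨G, hG⟩ : ∃ G, G = (changeBA (genPt a)).g := ⟨_, rfl⟩
  change IsChart (changeBA (genPt a)).f (changeBA (genPt a)).g at hch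
  rw [← hF, ← hG] at hch ⊢
  obtain ⟨Φ, hf, hg⟩ := hch
  have hch : IsChart F G := ⟨Φ, hf, hg⟩
  refine ⟨Φ, hf, hg, ?_⟩
  replace hF : F = coord 0 * (coord 1 - 1) / coord 1 := hF
  replace hG : G = cst (a 4 / a 0) * coord 1 := hG
  have hc : a 4 / a 0 ≠ 0 := div_ne_zero (ha 4) (ha 0)
  have hk := cst_ne_zero hc
  have hy := coord_ne_zero 1
  have hg1 : coord 1 - 1 ≠ 0 := isChart_coord.swap.sub_one_ne_zero
  have n4 := ha 4
  have n0 := ha 0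
  have n2 := ha 2
  have e4 : a 4 / a 0 ≠ a 4 / (a 0 * a 2) := by
    intro h; apply ha2; field_simp at h; exact h
  have e4' : a 4 / (a 0 * a 2) ≠ 0 := div_ne_zero n4 (mul_ne_zero n0 n2)
  obtain ⟨c0, c1, c2, c7⟩ := curves_BA ha isChart_coord hch hF hG
  obtain ⟨l, l0, l1, l2, l7⟩ := lat_BtoA
  refine IsMarkedIso.of_link (markB ha) (markA ha ha2) hf hg (loc' := locA a F G)
    (fun i => by rw [confA_loc, map_locA, hf, hg]) (link_BA ha isChart_coord hF hG)
    (link_AB ha ha2 hch ?_ ?_) (fun _ => rfl) (fun _ => rfl) l ?_ ?_ ?_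
  · have : cst (a 4 / a 0) * coord 1 - cst (a 4 / a 0) = cst (a 4 / a 0) * (coord 1 - 1) := by ring
    rw [hF, hG, this]; field_simp
  · rw [hG]; field_simp
  · refine Or.inl ⟨0, ?_, l0⟩
    change mapRing Φ (lineInf 0) = lineInf 0
    rw [mapRing_lineInf_zero, hf, hg, c0, lineInf_zero]
  · refine Or.inl ⟨1, ?_, l1⟩
    change mapRing Φ (lineInf 1) = lineInf 1
    rw [mapRing_lineInf_one, hf, hg, c1, lineInf_one]
  · rintro i (rfl | rfl)
    · refine Or.inr ⟨1, a 4 / a 0, _, fun i => ?_, ?_, l2⟩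
      · refine orderA ha ha2 ?_
        unfold baseA
        generalize a 4 / a 0 = x, a 4 / (a 0 * a 2) = y at *
        fin_cases i <;> simp [e4, hc]
      · change crv (Φ (coord 1) - cst (a 4 / a 0)) (Φ (coord 0)) = _
        rw [hf, hg, c2]; rfl
    · refine Or.inr ⟨1, 0, _, fun i => ?_, ?_, l7⟩
      · refine orderA ha ha2 ?_
        unfold baseA
        generalize a 4 / a 0 = x, a 4 / (a 0 * a 2) = y at *
        fin_cases i <;> simp [e4'.symm, hc.symm]
      · change crv (Φ (coord 1) - cst 0) (Φ (coord 0)) = _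
        rw [hf, hg, c7]; rfl

/-! ### The reflection `w₄`, in the coordinates of the (a)-model -/

/-- The reflection `w₄` in the coordinates of the (a)-model. -/
def reflA : Pt → Pt
  | ⟨a, f, g⟩ => ⟨![a 0, a 1, a 2, a 3 * a 4 ^ 2, 1 / a 4],
      f / cst (a 4), g * (f - 1) / (cst (a 4) * (f - cst (a 4)))⟩

theorem reflA_reflA {a : Fin 5 → ℂ} (ha : ∀ i, a i ≠ 0) {f g : KK} (h : IsChart f g) :
    reflA (reflA ⟨a, f, g⟩) = ⟨a, f, g⟩ := by
  have n4 := ha 4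
  have hA := cst_ne_zero n4
  have h1 : f - 1 ≠ 0 := h.sub_one_ne_zero
  have h4 : f - cst (a 4) ≠ 0 := h.sub_cst_ne_zero _
  ext
  · rename_i i
    fin_cases i <;> simp [reflA] <;> field_simp
  · simp [reflA, cst_inv]
    field_simp
  · have e1 : f / cst (a 4) - 1 = (f - cst (a 4)) / cst (a 4) := by field_simp
    have e2 : f / cst (a 4) - (cst (a 4))⁻¹ = (f - 1) / cst (a 4) := by field_simp
    simp [reflA, cst_inv, e1, e2]
    field_simp

theorem isChart_reflA {a : Fin 5 → ℂ} (ha : ∀ i, a i ≠ 0) {f g : KK} (h : IsChart f g) :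
    IsChart (reflA ⟨a, f, g⟩).f (reflA ⟨a, f, g⟩).g := by
  have hh := reflA_reflA ha h
  obtain ⟨⟨a', f', g'⟩, hp⟩ : ∃ p, reflA ⟨a, f, g⟩ = p := ⟨_, rfl⟩
  rw [hp] at hh ⊢
  refine h.of_forall_mem fun F h0 h1 => ?_
  rw [show f = _ from (congrArg Pt.f hh).symm, show g = _ from (congrArg Pt.g hh).symm]
  have hc := cst_mem F
  exact ⟨F.div_mem h0 (hc _), F.div_mem (F.mul_mem h1 (F.sub_mem h0 F.one_mem))
    (F.mul_mem (hc _) (F.sub_mem h0 (hc _)))⟩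

theorem link_reflA {a a' : Fin 5 → ℂ} (ha : ∀ i, a i ≠ 0) (ha4 : a 4 ≠ 1) {f g f' g' : KK}
    (h : IsChart f g) (hp : reflA ⟨a, f, g⟩ = ⟨a', f', g'⟩) :
    Link f g (locA a f g) f' g' (locA a' f' g') id (fun i => i = 3 ∨ i = 6) := by
  have hf := h.ne_zero
  have hg := h.swap.ne_zero
  have n4 := ha 4
  have hA := cst_ne_zero n4
  have hf1 : f - 1 ≠ 0 := h.sub_one_ne_zero
  have hf4 : f - cst (a 4) ≠ 0 := h.sub_cst_ne_zero _
  have ea : a' = _ := (congrArg Pt.a hp).symm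
  have ef : f' = f / cst (a 4) := (congrArg Pt.f hp).symm
  have eg : g' = g * (f - 1) / (cst (a 4) * (f - cst (a 4))) := (congrArg Pt.g hp).symm
  have a0 : a' 0 = a 0 := by rw [ea]; rfl
  have a1 : a' 1 = a 1 := by rw [ea]; rfl
  have a2 : a' 2 = a 2 := by rw [ea]; rfl
  have a4 : a' 4 = 1 / a 4 := by rw [ea]; rfl
  have n0 := ha 0
  have n2 := ha 2
  obtain ⟨U, hU⟩ : ∃ U : KK, U = (f - 1) / (cst (a 4) * (f - cst (a 4))) := ⟨_, rfl⟩
  have hU0 : U ≠ 0 := by rw [hU]; exact div_ne_zero hf1 (mul_ne_zero hA hf4)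
  have hg' : g' = g * U := by rw [eg, hU]; ring
  have hgi' : g'⁻¹ = g⁻¹ * U⁻¹ := by rw [hg', mul_inv]
  have hf' : f' = f * (cst (a 4))⁻¹ := by rw [ef, div_eq_mul_inv]
  have hfi' : f'⁻¹ = f⁻¹ * cst (a 4) := by rw [hf', mul_inv, inv_inv]
  have hUinf : ∀ B, IsLoc B → Vanishes B f⁻¹ → Tends B U (1 / a 4) := by
    intro B hB hv
    refine ((tends_one.sub hv.tends hB).div
      ((tends_cst (a 4)).mul (tends_one.sub ((tends_cst (a 4)).mul hv.tends hB) hB) hB)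
        (by simpa using n4) hB).congr ?_ ?_
    · rw [hU]; field_simp
    · simp
  have hUc : ∀ B, IsLoc B → ∀ c, c - a 4 ≠ 0 → Tends B f c →
      Tends B U ((c - 1) / (a 4 * (c - a 4))) := by
    intro B hB c hc hv
    rw [hU]
    exact (hv.sub tends_one hB).div ((tends_cst (a 4)).mul (hv.sub (tends_cst _) hB) hB)
      (mul_ne_zero n4 hc) hB
  have hUzero : ∀ B, IsLoc B → Vanishes B f → Tends B U (1 / a 4 ^ 2) := by
    intro B hB hv
    refine (hUc B hB 0 (by simpa using n4) hv.tends).congr rfl ?_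
    field_simp; ring
  have i4 : (1 / a 4) ≠ 0 := one_div_ne_zero n4
  constructor
  · intro i hi B hB h1 h2
    fin_cases i
    · replace h1 : Vanishes B f⁻¹ := h1
      replace h2 : Vanishes B g := h2
      exact ⟨h1.of_mul (tends_cst _) hB hfi', h2.of_mul (hUinf B hB h1) hB hg'⟩
    · replace h1 : Vanishes B f⁻¹ := h1
      replace h2 : Vanishes B g⁻¹ := h2
      exact ⟨h1.of_mul (tends_cst _) hB hfi', h2.of_mul ((hUinf B hB h1).inv i4 hB) hB hgi'⟩
    · replace h1 : Vanishes B f⁻¹ := h1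
      have h3 : Tends B (f / g) (-1) := tends_of_vanishes_add_one h2
      refine ⟨h1.of_mul (tends_cst _) hB hfi',
        ((h3.div ((tends_cst (a 4)).mul (hUinf B hB h1) hB) (mul_ne_zero n4 i4) hB).add
          tends_one hB).vanishes ?_ ?_⟩
      · change f' / g' + 1 = _
        rw [hf', hg']; field_simp
      · field_simp; ring
    · exact absurd (Or.inl rfl) hi
    · replace h1 : Vanishes B f := h1
      have h3 : Tends B g (a 4 / (a 0 * a 2)) := h2
      refine ⟨h1.of_mul ((tends_cst (a 4)).inv n4 hB) hB hf', ?_⟩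
      change Tends B g' (a' 4 / (a' 0 * a' 2))
      rw [hg', a4, a0, a2]
      refine (h3.mul (hUzero B hB h1) hB).congr rfl ?_
      field_simp
    · replace h1 : Vanishes B f := h1
      have h3 : Tends B g (a 4 / a 0) := h2
      refine ⟨h1.of_mul ((tends_cst (a 4)).inv n4 hB) hB hf', ?_⟩
      change Tends B g' (a' 4 / a' 0)
      rw [hg', a4, a0]
      refine (h3.mul (hUzero B hB h1) hB).congr rfl ?_
      field_simp
    · exact absurd (Or.inr rfl) hi
    · replace h1 : Vanishes B f⁻¹ := h1
      have h3 : Tends B (f * g) (-(a 1 * a 4 / a 0)) := tends_of_vanishes_add h2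
      refine ⟨h1.of_mul (tends_cst _) hB hfi',
        (((h3.mul (hUinf B hB h1) hB).div (tends_cst (a 4)) n4 hB).add
          (tends_cst (a' 1 * a' 4 / a' 0)) hB).vanishes ?_ ?_⟩
      · change f' * g' + _ = _
        rw [hf', hg']; field_simp
      · rw [a1, a4, a0]; field_simp; ring
  · rintro B hP ⟨hvf, hvg, hc⟩
    have hB := hP.1
    have c3 : Vanishes B g⁻¹ → Vanishes B (f - 1) → HasValue B ((f - 1) / g⁻¹) := hc 3
    have c6 : Vanishes B g → Vanishes B (f - cst (a 4)) → HasValue B ((f - cst (a 4)) / g) := hc 6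
    refine ⟨hvf.of_mul ((tends_cst (a 4)).inv n4 hB) (inv_ne_zero n4) hB hf', ?_, ?_⟩
    · rcases hP.tends_or hvf with ⟨c, hfc⟩ | hfi
      · by_cases hc4 : c = a 4
        · subst hc4
          have h3 : HasValue B (g / (f - cst (a 4))) := by
            rw [← inv_div, hasValue_inv_iff]
            rcases hP.unit_or hvg with ⟨d, hd, hgd⟩ | hg0 | hgi
            · exact (hfc.tends.div hgd hd hB).hasValue hB
            · exact c6 hg0 hfc
            · rw [div_eq_mul_inv]
              exact Or.inl (mul_mem hfc.1 hgi.1)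
          refine h3.of_mul ((hfc.sub tends_one hB).div (tends_cst (a 4)) n4 hB)
            (div_ne_zero (sub_ne_zero.2 ha4) n4) hB ?_
          rw [eg]; field_simp
        · by_cases hc1 : c = 1
          · subst hc1
            have hf1v : Vanishes B (f - 1) := by simpa [Tends, cst_one] using hfc
            have h3 : HasValue B (g * (f - 1)) := by
              rcases hP.tends_or hvg with ⟨d, hgd⟩ | hgi
              · exact Or.inl (mul_mem (hgd.mem hB) hf1v.1)
              · have := c3 hgi hf1v
                rwa [div_inv_eq_mul, mul_comm] at this
            refine h3.of_mul (((tends_cst (a 4)).mul (hfc.sub (tends_cst (a 4)) hB) hB).inv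
              (mul_ne_zero n4 (sub_ne_zero.2 hc4)) hB)
              (inv_ne_zero (mul_ne_zero n4 (sub_ne_zero.2 hc4))) hB ?_
            rw [eg, div_eq_mul_inv]
          · exact hvg.of_mul (hUc B hB c (sub_ne_zero.2 hc4) hfc)
              (div_ne_zero (sub_ne_zero.2 hc1) (mul_ne_zero n4 (sub_ne_zero.2 hc4))) hB hg'
      · exact hvg.of_mul (hUinf B hB hfi) i4 hB hg'
    · rintro i (rfl | rfl)
      · intro h1 h2
        replace h2 : Vanishes B (f' - 1) := h2
        have h3 : Tends B f (a 4) := by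
          refine ((tends_of_vanishes_sub_one h2).mul (tends_cst (a 4)) hB).congr ?_ (one_mul _).symm
          rw [ef]; field_simp
        refine hvg.of_mul ((h3.sub tends_one hB).div (tends_cst (a 4 ^ 2)) (pow_ne_zero 2 n4) hB)
          (div_ne_zero (sub_ne_zero.2 ha4) (pow_ne_zero 2 n4)) hB ?_
        change (f' - 1) / g'⁻¹ = _
        rw [div_inv_eq_mul, ef, eg, cst_pow]; field_simp
      · intro h1 h2
        replace h2 : Tends B f' (a' 4) := h2
        rw [a4] at h2
        have h3 : Tends B f 1 := by
          refine (h2.mul (tends_cst (a 4)) hB).congr ?_ (one_div_mul_cancel n4).symm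
          rw [ef]; field_simp
        refine hvg.inv.of_mul (h3.sub (tends_cst (a 4)) hB) (sub_ne_zero.2 ha4.symm) hB ?_
        change (f' - cst (a' 4)) / g' = _
        rw [a4, ef, eg, cst_div, cst_one]; field_simp

theorem lat_reflA : ∃ L : PicLat ≃ₗ[ℤ] PicLat, (∀ i : Fin 8, ¬ (i = 3 ∨ i = 6) →
      L (excClasses nextA i) = excClasses nextA i) ∧
    L (basicClasses nextA poleA 0) = basicClasses nextA poleA 0 ∧
    L (basicClasses nextA poleA 1) = basicClasses nextA poleA 1 ∧
    L (excClasses nextA 3) = basicClasses nextA poleA 0 -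
      ∑ i, (![-1, -1, -1, 0, 0, 0, 1, -1] : Fin 8 → ℤ) i • excClasses nextA i ∧
    L (excClasses nextA 6) = basicClasses nextA poleA 0 -
      ∑ i, (![-1, -1, -1, 1, 0, 0, 0, -1] : Fin 8 → ℤ) i • excClasses nextA i ∧
    ∀ i, BtoA (latGen (.w 4) (Pi.single i 1)) = L (BtoA (Pi.single i 1)) :=
  ⟨refl (alphaA 4) (by decide), by decide +kernel⟩

theorem curves_reflA {a a' : Fin 5 → ℂ} (ha : ∀ i, a i ≠ 0) (ha4 : a 4 ≠ 1) {f g f' g' : KK}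
    (h : IsChart f g) (h' : IsChart f' g') (hp : reflA ⟨a, f, g⟩ = ⟨a', f', g'⟩) :
    crv f'⁻¹ g' = crv f⁻¹ g ∧ crv g'⁻¹ f' = crv g⁻¹ f ∧
    crv (f' - cst (a' 4)) g' = crv g⁻¹ ((f - 1) / g⁻¹) ∧
    crv (f' - cst 1) g' = crv g ((f - cst (a 4)) / g) := by
  have hf := h.ne_zero
  have hg := h.swap.ne_zero
  have n4 := ha 4
  have hA := cst_ne_zero n4
  have hf1 : f - 1 ≠ 0 := h.sub_one_ne_zero
  have hf4 : f - cst (a 4) ≠ 0 := h.sub_cst_ne_zero _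
  have ea : a' = _ := (congrArg Pt.a hp).symm
  have ef : f' = f / cst (a 4) := (congrArg Pt.f hp).symm
  have eg : g' = g * (f - 1) / (cst (a 4) * (f - cst (a 4))) := (congrArg Pt.g hp).symm
  have e4 : a' 4 = 1 / a 4 := by rw [ea]; rfl
  refine ⟨?_, ?_, ?_, ?_⟩
  · refine (h.swap.inv.swap.crv_eq_of h'.swap.inv.swap fun V hV hu hw => ?_).symm
    have hB := hV.isLoc
    refine ⟨hu.of_mul (tends_cst (a 4)) hB (by rw [ef]; field_simp), _, _, ?_,
      (tends_one.sub hu.tends hB).div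
        ((tends_cst (a 4)).mul (tends_one.sub ((tends_cst (a 4)).mul hu.tends hB) hB) hB) ?_ hB, ?_⟩
    · simpa using n4
    · simpa using n4
    · rw [eg]; field_simp
  · refine (h.inv.swap.crv_eq_of h'.inv.swap fun V hV hu hw => ⟨?_, ?_⟩).symm
    · have hB := hV.isLoc
      have h1 := hV.hasOrder_zero_iff.1 (hV.hasOrder_div (hw (a 4)) (hw 1))
      refine (hu.mul_mem h1.1 hB).of_mul (tends_cst (a 4)) hB ?_
      rw [eg, cst_one]; field_simp
    · exact ⟨_, _, inv_ne_zero n4, (tends_cst _).inv n4 hV.isLoc, by rw [ef, div_eq_mul_inv]⟩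
  · have hc : IsChart g⁻¹ (f - 1) := by simpa [cst_one] using (h.swap.sub_cst 1).swap.inv.swap
    refine (hc.exc_eq_of (h'.swap.sub_cst _).swap fun V hB hu hv => ⟨?_, ?_⟩).symm
    · exact hv.of_mul ((tends_cst (a 4)).inv n4 hB) hB
        (by rw [ef, e4, cst_div, cst_one]; field_simp)
    · have hv1 := tends_of_vanishes_sub_one hv
      refine ⟨_, _, inv_ne_zero (mul_ne_zero n4 (sub_ne_zero.2 ha4.symm)),
        ((tends_cst (a 4)).mul (hv1.sub (tends_cst (a 4)) hB) hB).inv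
          (mul_ne_zero n4 (sub_ne_zero.2 ha4.symm)) hB, ?_⟩
      rw [eg]; field_simp
  · refine ((h.swap.sub_cst _).exc_eq_of_inv (h'.swap.sub_cst _).swap fun V hB hu hv => ⟨?_, ?_⟩).symm
    · exact hv.of_mul ((tends_cst (a 4)).inv n4 hB) hB (by rw [ef, cst_one]; field_simp)
    · have hv1 : Tends V f (a 4) := hv
      exact ⟨_, _, div_ne_zero (sub_ne_zero.2 ha4) n4,
        (hv1.sub tends_one hB).div (tends_cst (a 4)) n4 hB, by rw [eg]; field_simp⟩

theorem iso_reflA {a : Fin 5 → ℂ} (ha : ∀ i, a i ≠ 0) (ha2 : a 2 ≠ 1) (ha4 : a 4 ≠ 1) :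
    ∃ (Φ : KK ≃ₐ[ℂ] KK) (L : PicLat ≃ₗ[ℤ] PicLat),
    Φ (coord 0) = (reflA (genPt a)).f ∧ Φ (coord 1) = (reflA (genPt a)).g ∧
    IsMarkedIso Φ (confA a) (confA (reflA (genPt a)).a) L.toLinearMap ∧
    ∀ c, BtoA (latGen (.w 4) c) = L (BtoA c) := by
  have hch := isChart_reflA ha isChart_coord
  have hp' := reflA_reflA ha isChart_coord
  change IsChart (reflA (genPt a)).f (reflA (genPt a)).g at hch
  change reflA (reflA (genPt a)) = genPt a at hp'
  obtain ⟨⟨a', f', g'⟩, hp⟩ : ∃ p, reflA (genPt a) = p := ⟨_, rfl⟩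
  rw [hp] at hch hp' ⊢
  change IsChart f' g' at hch
  obtain ⟨Φ, hf, hg⟩ := hch
  have hch : IsChart f' g' := ⟨Φ, hf, hg⟩
  obtain ⟨L, l, l0, l1, l3, l6, hL⟩ := lat_reflA
  refine ⟨Φ, L, hf, hg, ?_, ?_⟩
  swap
  · have : (BtoA ∘ₗ (latGen (.w 4)).toLinearMap) = L.toLinearMap ∘ₗ BtoA := by
      ext i : 1
      ext1
      exact hL i
    exact fun c => LinearMap.congr_fun this c
  have ea : a' = _ := (congrArg Pt.a hp).symm
  have e4 : a' 4 = 1 / a 4 := by rw [ea]; rfl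
  have ha' : ∀ i, a' i ≠ 0 := by
    intro i
    rw [ea]
    fin_cases i <;> simp [reflA, genPt, ha]
  have ha2' : a' 2 ≠ 1 := by
    rw [ea]; exact ha2
  have ha4' : a' 4 ≠ 1 := by
    rw [e4, one_div]; simpa using ha4
  have n4' := ha' 4
  obtain ⟨c0, c1, c3, c6⟩ := curves_reflA ha ha4 isChart_coord hch hp
  refine IsMarkedIso.of_link (markA ha ha2) (markA ha' ha2') hf hg (loc' := locA a' f' g')
    (fun i => by rw [confA_loc, map_locA, hf, hg]) (link_reflA ha ha4 isChart_coord hp)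
    (link_reflA ha' ha4' hch hp') (fun _ => rfl) (fun _ => rfl) l ?_ ?_ ?_
  · refine Or.inl ⟨0, ?_, l0⟩
    change mapRing Φ (lineInf 0) = lineInf 0
    rw [mapRing_lineInf_zero, hf, hg, c0, lineInf_zero]
  · refine Or.inl ⟨1, ?_, l1⟩
    change mapRing Φ (lineInf 1) = lineInf 1
    rw [mapRing_lineInf_one, hf, hg, c1, lineInf_one]
  · rintro i (rfl | rfl)
    · refine Or.inr ⟨0, a' 4, _, fun i => ?_, ?_, l3⟩
      · refine orderA ha' ha2' ?_
        fin_cases i <;> simp [baseA, ha4', n4']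
      · change crv (Φ (coord 0) - cst (a' 4)) (Φ (coord 1)) = _
        rw [hf, hg, c3]; rfl
    · refine Or.inr ⟨0, 1, _, fun i => ?_, ?_, l6⟩
      · refine orderA ha' ha2' ?_
        fin_cases i <;> simp [baseA, ha4'.symm]
      · change crv (Φ (coord 0) - cst 1) (Φ (coord 1)) = _
        rw [hf, hg, c6]; rfl

theorem isRootVars_w4 {a : Fin 5 → ℂ} (ha : IsRootVars a) (f g : KK) :
    IsRootVars (birGen (.w 4) ⟨a, f, g⟩).a := by
  refine ⟨fun i => ?_, ?_⟩
  · have := ha.1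
    fin_cases i <;> simp [birGen, this]
  · have := ha.2
    simp [birGen]
    field_simp
    exact this

/-! ### Relations between the birational generators -/

theorem IsChart.bilinear_ne_zero {u v x : KK} (h : IsChart u v) (a b c d : ℂ)
    (he : x = cst a + cst b * u + cst c * v + cst d * (u * v))
    (H : a ≠ 0 ∨ b ≠ 0 ∨ c ≠ 0 ∨ d ≠ 0) : x ≠ 0 := by
  rintro rfl
  have h0 : aeval ![u, v] (C a + C b * X 0 + C c * X 1 + C d * (X 0 * X 1) : Poly) =
      aeval ![u, v] (0 : Poly) := by
    simp only [map_add, map_mul, aeval_X, map_zero, MvPolynomial.algHom_C]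
    exact he.symm
  rw [h.aeval_inj] at h0
  have h1 := congrArg (eval ![0, 0]) h0
  have h2 := congrArg (eval ![1, 0]) h0
  have h3 := congrArg (eval ![0, 1]) h0
  have h4 := congrArg (eval ![1, 1]) h0
  simp at h1 h2 h3 h4
  subst h1
  simp at h2 h3
  subst h2 h3
  simp at h4
  simp [h4] at H

/-- Transport of a point along an automorphism of the function field. -/
def Pt.map (Φ : KK ≃ₐ[ℂ] KK) (p : Pt) : Pt := ⟨p.a, Φ p.f, Φ p.g⟩

theorem birGen_map (Φ : KK ≃ₐ[ℂ] KK) (s : Gen) (p : Pt) :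
    birGen s (p.map Φ) = (birGen s p).map Φ := by
  obtain ⟨a, f, g⟩ := p
  rcases s with i | _ | _
  · fin_cases i <;> simp [birGen, Pt.map, map_cst]
  · simp [birGen, Pt.map, map_cst]
  · simp [birGen, Pt.map]

theorem bir_map (Φ : KK ≃ₐ[ℂ] KK) (l : List Gen) (p : Pt) :
    bir l (p.map Φ) = (bir l p).map Φ := by
  induction l with
  | nil => rfl
  | cons s l ih =>
    change birGen s (bir l (p.map Φ)) = _
    rw [ih, birGen_map]; rfl

theorem bir_cons (s : Gen) (l : List Gen) (p : Pt) : bir (s :: l) p = birGen s (bir l p) := rfl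

theorem bir_nil (p : Pt) : bir [] p = p := rfl

theorem bir_append (l l' : List Gen) (p : Pt) : bir (l ++ l') p = bir l (bir l' p) :=
  List.foldr_append

theorem map_genPt (Φ : KK ≃ₐ[ℂ] KK) (a : Fin 5 → ℂ) :
    (genPt a).map Φ = ⟨a, Φ (coord 0), Φ (coord 1)⟩ := rfl

/-- Root variables together with affine coordinates of the plane. -/
structure Pt.Good (p : Pt) : Prop where
  root : IsRootVars p.a
  chart : IsChart p.f p.g

theorem good_mk {a : Fin 5 → ℂ} {f g : KK} :
    Pt.Good ⟨a, f, g⟩ ↔ IsRootVars a ∧ IsChart f g := ⟨fun h => ⟨h.1, h.2⟩, fun h => ⟨h.1, h.2⟩⟩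

theorem good_genPt {a : Fin 5 → ℂ} (ha : IsRootVars a) : (genPt a).Good := ⟨ha, isChart_coord⟩

theorem isChart_of_changeBA {a : Fin 5 → ℂ} {f g : KK}
    (h : IsChart (changeBA ⟨a, f, g⟩).f (changeBA ⟨a, f, g⟩).g) : IsChart f g := by
  refine h.of_forall_mem fun K h0 h1 => ⟨?_, K.mul_mem (cst_mem K _) h1⟩
  exact K.div_mem (K.mul_mem h0 (K.sub_mem h1 K.one_mem)) h1

theorem changeBA_w4 {p : Pt} (hp : p.Good) : changeBA (birGen (.w 4) p) = reflA (changeBA p) := by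
  obtain ⟨a, f, g⟩ := p
  obtain ⟨⟨ha, -⟩, h⟩ := good_mk.1 hp
  have hf := h.ne_zero
  have hg := h.swap.ne_zero
  have n0 := cst_ne_zero (ha 0)
  have n4 := cst_ne_zero (ha 4)
  have h1 : f - cst (a 4) * (f - 1) * g ≠ 0 :=
    h.bilinear_ne_zero 0 1 (a 4) (-a 4) (by simp [cst_neg]; ring) (by simp)
  have h2 : f * (g - 1) - cst (a 4) * g ≠ 0 :=
    h.bilinear_ne_zero 0 (-1) (-a 4) 1 (by simp [cst_neg]; ring) (by simp)
  have h3 : f * g - f - g ≠ 0 :=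
    h.bilinear_ne_zero 0 (-1) (-1) 1 (by simp [cst_neg]; ring) (by simp)
  have e1 : f * (g - 1) / g - cst (a 4) = (f * (g - 1) - cst (a 4) * g) / g := by field_simp
  have e2 : f * (g - 1) / g - 1 = (f * g - f - g) / g := by field_simp
  ext
  · rfl
  · have e3 : cst (a 4) * g * (f * g - f - g) / (f * (g - 1) - cst (a 4) * g) - 1 =
        (f - cst (a 4) * (f - 1) * g) * (1 - g) / (f * (g - 1) - cst (a 4) * g) := by
      rw [div_sub_one h2]; congr 1; ring
    have e4 : f + g - f * g = -(f * g - f - g) := by ring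
    simp only [changeBA, birGen, reflA]
    rw [e3, e4]
    generalize f * g - f - g = A, f - cst (a 4) * (f - 1) * g = B,
      f * (g - 1) - cst (a 4) * g = D at *
    field_simp
    ring
  · simp only [changeBA, birGen, reflA]
    rw [e1, e2]
    generalize f * g - f - g = A, f * (g - 1) - cst (a 4) * g = D at *
    simp [cst_div, cst_inv]
    field_simp

theorem good_w4 {p : Pt} (hp : p.Good) : (birGen (.w 4) p).Good := by
  have hr : IsRootVars (birGen (.w 4) p).a := isRootVars_w4 hp.root p.f p.g
  refine ⟨hr, isChart_of_changeBA (a := (birGen (.w 4) p).a) ?_⟩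
  change IsChart (changeBA (birGen (.w 4) p)).f (changeBA (birGen (.w 4) p)).g
  rw [changeBA_w4 hp]
  exact isChart_reflA hp.root.1 (isChart_BA hp.root.1 hp.chart)

theorem changeBA_injective {p p' : Pt} (hp : p.Good) (ha : p.a = p'.a)
    (h : changeBA p = changeBA p') : p = p' := by
  have hk := cst_ne_zero (div_ne_zero (hp.root.1 4) (hp.root.1 0))
  have hg := hp.chart.swap.ne_zero
  have hg1 : p.g - 1 ≠ 0 := hp.chart.swap.sub_one_ne_zero
  have h1 : cst (p.a 4 / p.a 0) * p.g = cst (p'.a 4 / p'.a 0) * p'.g := congrArg Pt.g h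
  have h2 : p.f * (p.g - 1) / p.g = p'.f * (p'.g - 1) / p'.g := congrArg Pt.f h
  rw [← ha] at h1
  have h3 := mul_left_cancel₀ hk h1
  rw [← h3] at h2
  field_simp at h2
  exact Pt.ext ha h2 h3

theorem good_σ₀ {p : Pt} (hp : p.Good) : (birGen .σ₀ p).Good := by
  have hr : IsRootVars (birGen .σ₀ p).a := isRootVars_σ₀ hp.root
  refine ⟨hr, isChart_of_birGen (s := .σ₀) (p := p) hp.chart ?_⟩
  exact birGen_σ₀_birGen hp.root hp.chart

theorem good_σ₁ {p : Pt} (hp : p.Good) : (birGen .σ₁ p).Good :=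
  ⟨isRootVars_σ₁ hp.root, hp.chart.swap⟩

theorem good_w2 {p : Pt} (hp : p.Good) : (birGen (.w 2) p).Good := by
  obtain ⟨a, f, g⟩ := p
  obtain ⟨⟨ha, hr⟩, h⟩ := good_mk.1 hp
  refine ⟨⟨fun i => ?_, ?_⟩, isChart_of_birGen (s := .w 2) h (birGen_w2_birGen ha h)⟩
  · fin_cases i <;> simp [birGen, ha]
  · have n2 : a 2 ≠ 0 := ha 2
    simp [birGen]
    field_simp
    linear_combination hr

theorem w0_eq {p : Pt} (hp : p.Good) : birGen (.w 0) p = bir [.σ₀, .w 2, .σ₀] p := by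
  obtain ⟨a, f, g⟩ := p
  obtain ⟨⟨ha, hr⟩, h⟩ := good_mk.1 hp
  have hf := h.ne_zero
  have hg := h.swap.ne_zero
  have n0 := ha 0
  have n1 := ha 1
  have n2 := ha 2
  have n4 := ha 4
  have hrr : cst (a 0) * cst (a 1) * cst (a 2) = cst (a 3) * cst (a 4) := by
    rw [← cst_mul, ← cst_mul, ← cst_mul, hr]
  have m0 := cst_ne_zero n0
  have m1 := cst_ne_zero n1
  have m2 := cst_ne_zero n2
  have m4 := cst_ne_zero n4
  have h1 : cst (a 0) * f + cst (a 4) * g ≠ 0 :=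
    h.bilinear_ne_zero 0 (a 0) (a 4) 0 (by simp) (by simp [n0])
  have h2 : f + cst (a 4) * g ≠ 0 :=
    h.bilinear_ne_zero 0 1 (a 4) 0 (by simp) (by simp)
  have e1 : -(cst (a 0) * f) / (cst (a 4) * g) - 1 =
      -(cst (a 0) * f + cst (a 4) * g) / (cst (a 4) * g) := by field_simp; ring
  have e2 : (cst (a 0))⁻¹ * (-(cst (a 0) * f) / (cst (a 4) * g)) - 1 =
      -(f + cst (a 4) * g) / (cst (a 4) * g) := by field_simp; ring
  ext
  · rename_i i
    fin_cases i <;> simp [birGen, bir]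
  · simp [birGen, bir, cst_inv, cst_mul]
    rw [e1, e2]
    field_simp
  · simp [birGen, bir, cst_inv, cst_mul]
    rw [e1, e2]
    generalize cst (a 0) * f + cst (a 4) * g = A, f + cst (a 4) * g = B at *
    field_simp
    linear_combination hrr

theorem good_w0 {p : Pt} (hp : p.Good) : (birGen (.w 0) p).Good := by
  rw [w0_eq hp, bir_cons, bir_cons, bir_cons, bir_nil]
  exact good_σ₀ (good_w2 (good_σ₀ hp))

theorem sigma₂_eq (p : Pt) : bir sigma₂ p = ⟨![p.a 2, p.a 0, p.a 1, p.a 4, p.a 3],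
    -(cst (p.a 0) * p.f) / (cst (p.a 4) * p.g), p.f / cst (p.a 1)⟩ := by
  obtain ⟨a, f, g⟩ := p
  ext
  · rename_i i
    fin_cases i <;> simp [sigma₂, bir, birGen]
  · rfl
  · rfl

theorem good_sigma₂ {p : Pt} (hp : p.Good) : (bir sigma₂ p).Good := by
  rw [sigma₂, bir_cons, bir_cons, bir_nil]
  exact good_σ₁ (good_σ₀ hp)

theorem sigma₂_two {p : Pt} (hp : p.Good) : bir (sigma₂ ++ sigma₂) p =
    ⟨![p.a 1, p.a 2, p.a 0, p.a 3, p.a 4], 1 / p.g, -p.f / (cst (p.a 4) * p.g)⟩ := by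
  obtain ⟨a, f, g⟩ := p
  obtain ⟨⟨ha, hr⟩, h⟩ := good_mk.1 hp
  have hf := h.ne_zero
  have hg := h.swap.ne_zero
  have hrr : cst (a 0) * cst (a 1) * cst (a 2) = cst (a 3) * cst (a 4) := by
    rw [← cst_mul, ← cst_mul, ← cst_mul, hr]
  have m0 := cst_ne_zero (ha 0)
  have m3 := cst_ne_zero (ha 3)
  have m4 := cst_ne_zero (ha 4)
  rw [bir_append, sigma₂_eq, sigma₂_eq]
  ext
  · rename_i i
    fin_cases i <;> simp
  · simp
    field_simp
    linear_combination hrr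
  · simp
    field_simp

theorem sigma₂_three {p : Pt} (hp : p.Good) : bir (sigma₂ ++ sigma₂ ++ sigma₂) p =
    ⟨![p.a 0, p.a 1, p.a 2, p.a 4, p.a 3], cst (p.a 1) / p.f, 1 / (cst (p.a 2) * p.g)⟩ := by
  rw [List.append_assoc, bir_append, sigma₂_two hp, sigma₂_eq]
  obtain ⟨a, f, g⟩ := p
  obtain ⟨⟨ha, hr⟩, h⟩ := good_mk.1 hp
  have hf := h.ne_zero
  have hg := h.swap.ne_zero
  have m2 := cst_ne_zero (ha 2)
  have m4 := cst_ne_zero (ha 4)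
  ext
  · rename_i i
    fin_cases i <;> simp
  · simp
    field_simp
  · simp
    field_simp

theorem good_sigma₂_three {p : Pt} (hp : p.Good) : (bir (sigma₂ ++ sigma₂ ++ sigma₂) p).Good := by
  rw [bir_append, bir_append]
  exact good_sigma₂ (good_sigma₂ (good_sigma₂ hp))

theorem sigma₂_six {p : Pt} (hp : p.Good) :
    bir (sigma₂ ++ sigma₂ ++ sigma₂) (bir (sigma₂ ++ sigma₂ ++ sigma₂) p) = p := by
  rw [sigma₂_three (good_sigma₂_three hp), sigma₂_three hp]
  obtain ⟨a, f, g⟩ := p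
  obtain ⟨⟨ha, hr⟩, h⟩ := good_mk.1 hp
  have m1 := cst_ne_zero (ha 1)
  have m2 := cst_ne_zero (ha 2)
  ext
  · rename_i i
    fin_cases i <;> simp
  · change cst (a 1) / (cst (a 1) / f) = f
    field_simp
  · change 1 / (cst (a 2) * (1 / (cst (a 2) * g))) = g
    field_simp

theorem w2_sigma₂_three {p : Pt} (hp : p.Good) :
    birGen (.w 2) (bir (sigma₂ ++ sigma₂ ++ sigma₂) p) =
      bir (sigma₂ ++ sigma₂ ++ sigma₂) (birGen (.w 2) p) := by
  rw [sigma₂_three (good_w2 hp), sigma₂_three hp]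
  obtain ⟨a, f, g⟩ := p
  obtain ⟨⟨ha, hr⟩, h⟩ := good_mk.1 hp
  have hf := h.ne_zero
  have hg := h.swap.ne_zero
  have m1 := cst_ne_zero (ha 1)
  have m2 := cst_ne_zero (ha 2)
  have hg1 : g - 1 ≠ 0 := h.swap.sub_one_ne_zero
  ext
  · rename_i i
    fin_cases i <;> simp [birGen]
  · have e1 : g⁻¹ - 1 = -(g - 1) / g := by field_simp; ring
    simp [birGen, cst_mul]
    rw [show cst (a 2) * (g⁻¹ * (cst (a 2))⁻¹) - 1 = -(g - 1) / g by field_simp; ring]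
    field_simp
    ring
  · simp [birGen, cst_inv]
    field_simp

theorem w0_sigma₂_three {p : Pt} (hp : p.Good) :
    birGen (.w 0) (bir (sigma₂ ++ sigma₂ ++ sigma₂) p) =
      bir (sigma₂ ++ sigma₂ ++ sigma₂) (birGen (.w 0) p) := by
  rw [sigma₂_three (good_w0 hp), sigma₂_three hp]
  obtain ⟨a, f, g⟩ := p
  obtain ⟨⟨ha, hr⟩, h⟩ := good_mk.1 hp
  have hf := h.ne_zero
  have hg := h.swap.ne_zero
  have n0 := ha 0
  have n1 := ha 1
  have n2 := ha 2
  have n4 := ha 4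
  have m0 := cst_ne_zero n0
  have m1 := cst_ne_zero n1
  have m2 := cst_ne_zero n2
  have m4 := cst_ne_zero n4
  have h2 : f + cst (a 4) * g ≠ 0 :=
    h.bilinear_ne_zero 0 1 (a 4) 0 (by simp) (by simp)
  have e4 : a 3 = a 0 * a 1 * a 2 / a 4 := by field_simp; exact hr.symm
  have e1 : cst (a 0) * (cst (a 1) / f) + cst (a 3) * ((cst (a 2))⁻¹ * g⁻¹) =
      cst (a 0) * cst (a 1) * (f + cst (a 4) * g) / (cst (a 4) * f * g) := by
    simp only [e4, cst_mul, cst_div]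
    field_simp; ring
  have e2 : cst (a 1) / f + cst (a 3) * ((cst (a 2))⁻¹ * g⁻¹) =
      cst (a 1) * (cst (a 0) * f + cst (a 4) * g) / (cst (a 4) * f * g) := by
    simp only [e4, cst_mul, cst_div]
    field_simp; ring
  ext
  · rename_i i
    fin_cases i <;> simp [birGen]
  · simp [birGen, cst_mul, mul_comm g⁻¹]
    rw [e1, e2]
    field_simp
  · simp [birGen, cst_mul, mul_comm g⁻¹]
    rw [e1, e2]
    field_simp

theorem w4_sigma₂_two {p : Pt} (hp : p.Good) :
    birGen (.w 4) (bir (sigma₂ ++ sigma₂) p) = bir (sigma₂ ++ sigma₂) (birGen (.w 4) p) := by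
  rw [sigma₂_two (good_w4 hp), sigma₂_two hp]
  obtain ⟨a, f, g⟩ := p
  obtain ⟨⟨ha, hr⟩, h⟩ := good_mk.1 hp
  have hf := h.ne_zero
  have hg := h.swap.ne_zero
  have m4 := cst_ne_zero (ha 4)
  have h1 : f - cst (a 4) * (f - 1) * g ≠ 0 :=
    h.bilinear_ne_zero 0 1 (a 4) (-a 4) (by simp [cst_neg]; ring) (by simp)
  have h2 : f * (g - 1) - cst (a 4) * g ≠ 0 :=
    h.bilinear_ne_zero 0 (-1) (-a 4) 1 (by simp [cst_neg]; ring) (by simp)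
  have h3 : f * g - f - g ≠ 0 :=
    h.bilinear_ne_zero 0 (-1) (-1) 1 (by simp [cst_neg]; ring) (by simp)
  have e1 : 1 / g - cst (a 4) * (1 / g - 1) * (-f / (cst (a 4) * g)) =
      -(f * g - f - g) / g ^ 2 := by
    field_simp; ring
  have e2 : 1 / g + -f / (cst (a 4) * g) - 1 / g * (-f / (cst (a 4) * g)) =
      -(f * (g - 1) - cst (a 4) * g) / (cst (a 4) * g ^ 2) := by
    field_simp; ring
  have e3 : 1 / g * (-f / (cst (a 4) * g) - 1) - cst (a 4) * (-f / (cst (a 4) * g)) =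
      -(f - cst (a 4) * (f - 1) * g) / (cst (a 4) * g ^ 2) := by
    field_simp; ring
  have e4 : 1 / g * (-f / (cst (a 4) * g)) - 1 / g - -f / (cst (a 4) * g) =
      (f * (g - 1) - cst (a 4) * g) / (cst (a 4) * g ^ 2) := by
    field_simp; ring
  have e5 : f + g - f * g = -(f * g - f - g) := by ring
  ext
  · rename_i i
    fin_cases i <;> simp [birGen]
  · simp only [birGen, Matrix.cons_val]
    rw [e1, e2]
    generalize f * g - f - g = A, f * (g - 1) - cst (a 4) * g = D at *
    field_simp
  · simp only [birGen, Matrix.cons_val]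
    rw [e3, e4, e5]
    generalize f * g - f - g = A, f - cst (a 4) * (f - 1) * g = B,
      f * (g - 1) - cst (a 4) * g = D at *
    simp [cst_inv]
    field_simp

/-- The reflection `w₀` in the coordinates of the (a)-model. -/
def reflA₀ : Pt → Pt
  | ⟨a, f, g⟩ => ⟨![1 / a 0, a 0 * a 1, a 0 * a 2, a 3, a 4],
      cst (a 0) * f * (f + g - cst (a 4)) / (f + cst (a 0) * g - cst (a 4)),
      cst (a 0) * g * (cst (a 0) * f + cst (a 0) * g - cst (a 4)) /
        (f + cst (a 0) * g - cst (a 4))⟩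

theorem changeBA_w0 {p : Pt} (hp : p.Good) : changeBA (birGen (.w 0) p) = reflA₀ (changeBA p) := by
  obtain ⟨a, f, g⟩ := p
  obtain ⟨⟨ha, -⟩, h⟩ := good_mk.1 hp
  have hf := h.ne_zero
  have hg := h.swap.ne_zero
  have n0 := cst_ne_zero (ha 0)
  have n4 := cst_ne_zero (ha 4)
  have hg1 : g - 1 ≠ 0 := h.swap.sub_one_ne_zero
  have hX : cst (a 0) * f + cst (a 4) * g ≠ 0 :=
    h.bilinear_ne_zero 0 (a 0) (a 4) 0 (by simp) (by simp [ha])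
  have hY : f + cst (a 4) * g ≠ 0 :=
    h.bilinear_ne_zero 0 1 (a 4) 0 (by simp) (by simp)
  have e1 : f * (g - 1) / g + cst (a 0) * (cst (a 4) / cst (a 0) * g) - cst (a 4) =
      (g - 1) * (f + cst (a 4) * g) / g := by field_simp; ring
  have e2 : g * (cst (a 0) * f + cst (a 4) * g) / (cst (a 0) * (f + cst (a 4) * g)) - 1 =
      (g * (cst (a 0) * f + cst (a 4) * g) - cst (a 0) * (f + cst (a 4) * g)) /
        (cst (a 0) * (f + cst (a 4) * g)) := div_sub_one (mul_ne_zero n0 hY)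
  have e3 : cst (a 0) * (f * (g - 1) / g) + cst (a 0) * (cst (a 4) / cst (a 0) * g) - cst (a 4) =
      (g - 1) * (cst (a 0) * f + cst (a 4) * g) / g := by field_simp; ring
  have e4 : f * (g - 1) / g + cst (a 4) / cst (a 0) * g - cst (a 4) =
      (g * (cst (a 0) * f + cst (a 4) * g) - cst (a 0) * (f + cst (a 4) * g)) /
        (cst (a 0) * g) := by field_simp; ring
  ext
  · rfl
  · simp only [changeBA, birGen, reflA₀, cst_div]
    rw [e1, e2, e4]
    generalize g * (cst (a 0) * f + cst (a 4) * g) - cst (a 0) * (f + cst (a 4) * g) = Z at *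
    generalize cst (a 0) * f + cst (a 4) * g = X, f + cst (a 4) * g = Y at *
    field_simp
  · simp only [changeBA, birGen, reflA₀, cst_div]
    rw [e1, e3]
    generalize cst (a 0) * f + cst (a 4) * g = X, f + cst (a 4) * g = Y at *
    simp [cst_inv]
    field_simp

theorem reflA_reflA₀ {a : Fin 5 → ℂ} (ha : ∀ i, a i ≠ 0) {f g : KK} (h : IsChart f g) :
    reflA (reflA₀ ⟨a, f, g⟩) = reflA₀ (reflA ⟨a, f, g⟩) := by
  have n0 := cst_ne_zero (ha 0)
  have n4 := cst_ne_zero (ha 4)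
  have hf1 : f - 1 ≠ 0 := h.sub_one_ne_zero
  have hf4 : f - cst (a 4) ≠ 0 := h.sub_cst_ne_zero _
  have hD : f + cst (a 0) * g - cst (a 4) ≠ 0 :=
    h.bilinear_ne_zero (-a 4) 1 (a 0) 0 (by simp [cst_neg]; ring) (by simp)
  have hE : cst (a 0) * f + cst (a 0) * g - cst (a 4) ≠ 0 :=
    h.bilinear_ne_zero (-a 4) (a 0) (a 0) 0 (by simp [cst_neg]; ring) (by simp [ha])
  have e1 : cst (a 0) * f * (f + g - cst (a 4)) / (f + cst (a 0) * g - cst (a 4)) - 1 =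
      (cst (a 0) * f * (f + g - cst (a 4)) - (f + cst (a 0) * g - cst (a 4))) /
        (f + cst (a 0) * g - cst (a 4)) := div_sub_one hD
  have e2 : cst (a 0) * f * (f + g - cst (a 4)) / (f + cst (a 0) * g - cst (a 4)) - cst (a 4) =
      (f - cst (a 4)) * (cst (a 0) * f + cst (a 0) * g - cst (a 4)) /
        (f + cst (a 0) * g - cst (a 4)) := by
    rw [div_sub' hD]; congr 1; ring
  have e3 : f / cst (a 4) + cst (a 0) * (g * (f - 1) / (cst (a 4) * (f - cst (a 4)))) -
      (cst (a 4))⁻¹ = (f - 1) * (f + cst (a 0) * g - cst (a 4)) / (cst (a 4) * (f - cst (a 4))) := by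
    field_simp; ring
  have e4 : f / cst (a 4) + g * (f - 1) / (cst (a 4) * (f - cst (a 4))) -
      (cst (a 4))⁻¹ = (f - 1) * (f + g - cst (a 4)) / (cst (a 4) * (f - cst (a 4))) := by
    field_simp; ring
  have e5 : cst (a 0) * (f / cst (a 4)) + cst (a 0) * (g * (f - 1) / (cst (a 4) * (f - cst (a 4)))) -
      (cst (a 4))⁻¹ = (cst (a 0) * f * (f + g - cst (a 4)) - (f + cst (a 0) * g - cst (a 4))) /
        (cst (a 4) * (f - cst (a 4))) := by
    field_simp; ring
  ext
  · rfl
  · simp only [reflA, reflA₀, Matrix.cons_val, one_div, cst_inv]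
    rw [e3, e4]
    generalize f + cst (a 0) * g - cst (a 4) = D, f + g - cst (a 4) = N at *
    field_simp
  · simp only [reflA, reflA₀, Matrix.cons_val, one_div, cst_inv]
    rw [e1, e2, e3, e5]
    generalize cst (a 0) * f * (f + g - cst (a 4)) - (f + cst (a 0) * g - cst (a 4)) = Q at *
    generalize f + cst (a 0) * g - cst (a 4) = D,
      cst (a 0) * f + cst (a 0) * g - cst (a 4) = E at *
    field_simp

theorem changeBA_w2 {p : Pt} (hp : p.Good) : changeBA (birGen (.w 2) p) =
    ⟨![p.a 0 * p.a 2, p.a 1 * p.a 2, 1 / p.a 2, p.a 3, p.a 4], (changeBA p).f, (changeBA p).g⟩ := by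
  obtain ⟨a, f, g⟩ := p
  obtain ⟨⟨ha, -⟩, h⟩ := good_mk.1 hp
  have hg := h.swap.ne_zero
  have m2 := cst_ne_zero (ha 2)
  have m0 := cst_ne_zero (ha 0)
  have hgA : cst (a 2) * g - 1 ≠ 0 := h.swap.linear_sub_one_ne_zero (ha 2)
  ext
  · rfl
  · simp only [changeBA, birGen]
    field_simp
  · simp only [changeBA, birGen, Matrix.cons_val, cst_div, cst_mul]
    field_simp

theorem w4_w0 {p : Pt} (hp : p.Good) :
    birGen (.w 4) (birGen (.w 0) p) = birGen (.w 0) (birGen (.w 4) p) := by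
  refine changeBA_injective (good_w4 (good_w0 hp)) ?_ ?_
  · obtain ⟨a, f, g⟩ := p
    simp [birGen]
  · rw [changeBA_w4 (good_w0 hp), changeBA_w0 hp, changeBA_w0 (good_w4 hp), changeBA_w4 hp]
    exact reflA_reflA₀ hp.root.1 (isChart_BA hp.root.1 hp.chart)

theorem w4_w2 {p : Pt} (hp : p.Good) :
    birGen (.w 4) (birGen (.w 2) p) = birGen (.w 2) (birGen (.w 4) p) := by
  refine changeBA_injective (good_w4 (good_w2 hp)) ?_ ?_
  · obtain ⟨a, f, g⟩ := p
    simp [birGen]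
  · rw [changeBA_w4 (good_w2 hp), changeBA_w2 hp, changeBA_w2 (good_w4 hp), changeBA_w4 hp]
    obtain ⟨a, f, g⟩ := p
    rfl

theorem w3_eq {p : Pt} (hp : p.Good) : birGen (.w 3) p =
    bir (sigma₂ ++ sigma₂ ++ sigma₂) (birGen (.w 4) (bir (sigma₂ ++ sigma₂ ++ sigma₂) p)) := by
  rw [sigma₂_three (good_w4 (good_sigma₂_three hp)), sigma₂_three hp]
  obtain ⟨a, f, g⟩ := p
  obtain ⟨⟨ha, hr⟩, h⟩ := good_mk.1 hp
  have hf := h.ne_zero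
  have hg := h.swap.ne_zero
  have n0 := ha 0
  have n1 := ha 1
  have n2 := ha 2
  have n4 := ha 4
  have m0 := cst_ne_zero n0
  have m1 := cst_ne_zero n1
  have m2 := cst_ne_zero n2
  have m4 := cst_ne_zero n4
  have e3 : cst (a 3) = cst (a 0) * cst (a 1) * cst (a 2) / cst (a 4) := by
    rw [← cst_mul, ← cst_mul, ← cst_div, hr, mul_div_cancel_right₀ _ n4]
  have h1 : f + cst (a 1) * (cst (a 2) * g - 1) ≠ 0 :=
    h.bilinear_ne_zero (-a 1) 1 (a 1 * a 2) 0 (by simp [cst_neg, cst_mul]; ring) (by simp)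
  have h2 : cst (a 0) * (f - cst (a 1)) + cst (a 4) * g ≠ 0 :=
    h.bilinear_ne_zero (-(a 0 * a 1)) (a 0) (a 4) 0 (by simp [cst_neg, cst_mul]; ring) (by simp [ha])
  have h3 : cst (a 0) * cst (a 2) * f + cst (a 4) * (cst (a 2) * g - 1) ≠ 0 :=
    h.bilinear_ne_zero (-a 4) (a 0 * a 2) (a 4 * a 2) 0 (by simp [cst_neg, cst_mul]; ring)
      (by simp [ha])
  have e1 : cst (a 1) / f + 1 / (cst (a 2) * g) - cst (a 1) / f * (1 / (cst (a 2) * g)) =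
      (f + cst (a 1) * (cst (a 2) * g - 1)) / (cst (a 2) * f * g) := by field_simp; ring
  have e1' : cst (a 1) / f * (1 / (cst (a 2) * g)) - cst (a 1) / f - 1 / (cst (a 2) * g) =
      -(f + cst (a 1) * (cst (a 2) * g - 1)) / (cst (a 2) * f * g) := by field_simp; ring
  have e2 : cst (a 1) / f - cst (a 3) * (cst (a 1) / f - 1) * (1 / (cst (a 2) * g)) =
      cst (a 1) * (cst (a 0) * (f - cst (a 1)) + cst (a 4) * g) / (cst (a 4) * f * g) := by
    rw [e3]; field_simp; ring
  have e4 : cst (a 1) / f * (1 / (cst (a 2) * g) - 1) - cst (a 3) * (1 / (cst (a 2) * g)) =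
      -cst (a 1) * (cst (a 0) * cst (a 2) * f + cst (a 4) * (cst (a 2) * g - 1)) /
        (cst (a 4) * cst (a 2) * f * g) := by
    rw [e3]; field_simp; ring
  ext
  · rename_i i
    fin_cases i <;> simp [birGen]
    ring
  · simp only [birGen, Matrix.cons_val]
    rw [e1, e2]
    generalize f + cst (a 1) * (cst (a 2) * g - 1) = A,
      cst (a 0) * (f - cst (a 1)) + cst (a 4) * g = B at *
    field_simp
  · simp only [birGen, Matrix.cons_val]
    rw [e1', e4, e3]
    generalize f + cst (a 1) * (cst (a 2) * g - 1) = A,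
      cst (a 0) * cst (a 2) * f + cst (a 4) * (cst (a 2) * g - 1) = B at *
    field_simp

theorem phiW_eq (p : Pt) : bir phiW p =
    bir sigma₂ (bir (sigma₂ ++ sigma₂ ++ sigma₂) (birGen (.w 0) (birGen (.w 2) p))) := by
  rw [phiW, bir_append]
  rfl

theorem psiW_eq (p : Pt) : bir psiW p = birGen (.w 4) (bir (sigma₂ ++ sigma₂ ++ sigma₂) p) := by
  rw [psiW, List.append_assoc, List.append_assoc, bir_append, ← List.append_assoc]
  rfl

theorem sigma₂_four {p : Pt} :
    bir sigma₂ (bir (sigma₂ ++ sigma₂ ++ sigma₂) p) = bir (sigma₂ ++ sigma₂)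
      (bir (sigma₂ ++ sigma₂) p) := by
  simp only [bir_append]

theorem sigma₂_comm {p : Pt} : bir sigma₂ (bir (sigma₂ ++ sigma₂ ++ sigma₂) p) =
    bir (sigma₂ ++ sigma₂ ++ sigma₂) (bir sigma₂ p) := by
  simp only [bir_append]

theorem good_sigma₂_two {p : Pt} (hp : p.Good) : (bir (sigma₂ ++ sigma₂) p).Good := by
  rw [bir_append]
  exact good_sigma₂ (good_sigma₂ hp)

theorem psiW_phiW {p : Pt} (hp : p.Good) : bir (psiW ++ phiW) p =
    birGen (.w 4) (bir sigma₂ (birGen (.w 0) (birGen (.w 2) p))) := by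
  have h := good_w0 (good_w2 hp)
  rw [bir_append, psiW_eq, phiW_eq, sigma₂_comm, sigma₂_six (good_sigma₂ h)]

theorem phiW_psiW {p : Pt} (hp : p.Good) : bir (phiW ++ psiW) p = bir (psiW ++ phiW) p := by
  have h3 := good_sigma₂_three hp
  have h := good_w0 (good_w2 hp)
  rw [psiW_phiW hp, bir_append, psiW_eq, phiW_eq, ← w4_w2 h3, ← w4_w0 (good_w2 h3), sigma₂_four,
    ← w4_sigma₂_two (good_w0 (good_w2 h3)),
    ← w4_sigma₂_two (good_sigma₂_two (good_w0 (good_w2 h3))), ← sigma₂_four, w2_sigma₂_three hp,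
    w0_sigma₂_three (good_w2 hp), sigma₂_six h]

theorem lagW_eq {p : Pt} (hp : p.Good) : bir lagW p = bir (psiW ++ phiW) p := by
  have h := good_w0 (good_w2 hp)
  have h3 := good_sigma₂_three h
  rw [psiW_phiW hp]
  have : bir lagW p = bir sigma₂ (birGen (.w 3) (birGen (.w 0) (birGen (.w 2) p))) := rfl
  rw [this, w3_eq h, sigma₂_four, ← w4_sigma₂_two h3,
    ← w4_sigma₂_two (good_sigma₂_two h3), ← sigma₂_four, sigma₂_six h]

/-! ### The standard mappings -/

theorem qPIII_phiW {p : Pt} (hp : p.Good) : QPIII p (bir phiW p) := by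
  have h2 := good_w2 hp
  have h0 := good_w0 h2
  rw [phiW_eq, sigma₂_three h0, sigma₂_eq]
  obtain ⟨a, f, g⟩ := p
  obtain ⟨⟨ha, hr⟩, h⟩ := good_mk.1 hp
  have n0 := ha 0
  have n1 := ha 1
  have n2 := ha 2
  have n3 := ha 3
  have n4 := ha 4
  have e3 : a 3 = a 0 * a 1 * a 2 / a 4 := by rw [hr]; field_simp
  have m0 := cst_ne_zero n0
  have m1 := cst_ne_zero n1
  have m2 := cst_ne_zero n2
  have m4 := cst_ne_zero n4
  have hf := h.ne_zero
  have hg := h.swap.ne_zero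
  have hg1 : g - 1 ≠ 0 := h.swap.sub_one_ne_zero
  have hgA : cst (a 2) * g - 1 ≠ 0 := h.swap.linear_sub_one_ne_zero n2
  obtain ⟨u, hu⟩ : ∃ u, u = cst (a 2) * f * (g - 1) / (cst (a 2) * g - 1) := ⟨_, rfl⟩
  obtain ⟨v, hv⟩ : ∃ v, v = cst (a 2) * g := ⟨_, rfl⟩
  have e : birGen (.w 2) ⟨a, f, g⟩ = ⟨![a 0 * a 2, a 1 * a 2, 1 / a 2, a 3, a 4], u, v⟩ := by
    rw [hu, hv]; rfl
  rw [e] at h2 h0 ⊢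
  have hc : IsChart u v := h2.chart
  have hu0 := hc.ne_zero
  have hv0 := hc.swap.ne_zero
  have hX : cst (a 0) * cst (a 2) * u + cst (a 4) * v ≠ 0 :=
    hc.bilinear_ne_zero 0 (a 0 * a 2) (a 4) 0 (by simp [cst_mul]) (by simp [ha])
  have hY : u + cst (a 4) * v ≠ 0 :=
    hc.bilinear_ne_zero 0 1 (a 4) 0 (by simp) (by simp)
  have hf' : f = u * (cst (a 2) * g - 1) / (cst (a 2) * (g - 1)) := by
    rw [hu]; field_simp
  have hb : -(cst (1 / (a 0 * a 2)) * (cst (a 0 * a 2 * (a 1 * a 2)) /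
      (u * (cst (a 0 * a 2) * u + cst (a 4) * v) / (u + cst (a 4) * v)))) /
      (cst (a 3) * (1 / (cst (a 0 * a 2 * (1 / a 2)) * (v * (cst (a 0 * a 2) * u + cst (a 4) * v) /
        (cst (a 0 * a 2) * (u + cst (a 4) * v)))))) =
      -(cst (a 4) * v) / (cst (a 0) * cst (a 2) * u) := by
    simp only [e3, cst_mul, cst_div, cst_one]
    generalize cst (a 0) * cst (a 2) * u + cst (a 4) * v = X, u + cst (a 4) * v = Y at *
    field_simp
  have hb1 : -(cst (a 4) * v) / (cst (a 0) * cst (a 2) * u) - 1 =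
      -(cst (a 0) * cst (a 2) * u + cst (a 4) * v) / (cst (a 0) * cst (a 2) * u) := by
    field_simp; ring
  have hb2 : -(cst (a 4) * v) / (cst (a 0) * cst (a 2) * u) - cst (1 / (a 0 * a 2)) =
      -(u + cst (a 4) * v) / (cst (a 0) * cst (a 2) * u) := by
    simp only [cst_div, cst_mul, cst_one]
    field_simp; ring
  refine ⟨?_, ?_, ?_⟩
  · ext i
    fin_cases i <;> simp [birGen] <;> field_simp
  · simp only [birGen, Matrix.cons_val]
    rw [hb, hf', hv]
    simp only [cst_div, cst_one]
    field_simp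
  · simp only [birGen, Matrix.cons_val]
    rw [hb, hb1, hb2]
    have : g = v / cst (a 2) := by rw [hv]; field_simp
    rw [this]
    simp only [cst_div, cst_mul, cst_one]
    generalize cst (a 0) * cst (a 2) * u + cst (a 4) * v = X, u + cst (a 4) * v = Y at *
    field_simp

theorem qPIV_psiW {p : Pt} (hp : p.Good) : QPIV (changeBA p) (changeBA (bir psiW p)) := by
  have h3 := good_sigma₂_three hp
  have hch := isChart_BA h3.root.1 h3.chart
  rw [psiW_eq, changeBA_w4 h3]
  rw [sigma₂_three hp] at hch ⊢
  obtain ⟨a, f, g⟩ := p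
  obtain ⟨⟨ha, hr⟩, h⟩ := good_mk.1 hp
  have n0 := ha 0
  have n1 := ha 1
  have n2 := ha 2
  have n3 := ha 3
  have n4 := ha 4
  have e4 : a 4 = a 0 * a 1 * a 2 / a 3 := by rw [hr]; field_simp
  have m0 := cst_ne_zero n0
  have m1 := cst_ne_zero n1
  have m2 := cst_ne_zero n2
  have m3 := cst_ne_zero n3
  have hf := h.ne_zero
  have hg := h.swap.ne_zero
  obtain ⟨u, hu⟩ : ∃ u, u = cst (a 1) / f * (1 / (cst (a 2) * g) - 1) / (1 / (cst (a 2) * g)) :=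
    ⟨_, rfl⟩
  have hch : IsChart u (cst (a 3 / a 0) * (1 / (cst (a 2) * g))) := by rw [hu]; exact hch
  have hu3 : u - cst (a 3) ≠ 0 := hch.sub_cst_ne_zero _
  have hu1 : u - 1 ≠ 0 := by simpa using hch.sub_cst_ne_zero 1
  have b1 : u / cst (a 3) - cst (1 / a 3) = (u - 1) / cst (a 3) := by
    rw [cst_div, cst_one]; field_simp
  have b2 : u / cst (a 3) - 1 = (u - cst (a 3)) / cst (a 3) := by field_simp
  refine ⟨?_, ?_, ?_⟩
  · ext i
    fin_cases i <;> simp [changeBA, reflA]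
    · linear_combination -(a 3) * hr
    · rw [hr]; field_simp
  · simp only [changeBA, reflA, Matrix.cons_val]
    simp only [e4, cst_mul, cst_div]
    field_simp
    ring
  · simp only [changeBA, reflA, Matrix.cons_val]
    rw [← hu, b1, b2]
    simp only [e4, cst_mul, cst_div, cst_one]
    field_simp

/-! ### Words as isomorphisms -/

/-- The word `l` is realized by an isomorphism from the (b)-model with root variables `a`. -/
def Realizable (l : List Gen) (a : Fin 5 → ℂ) : Prop :=
  ∃ Ψ : KK ≃ₐ[ℂ] KK, Ψ (coord 0) = (bir l (genPt a)).f ∧ Ψ (coord 1) = (bir l (genPt a)).g ∧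
    IsMarkedIso Ψ (confB a) (confB (bir l (genPt a)).a) (lat l).toLinearMap

theorem lat_append (l l' : List Gen) : lat (l ++ l') = lat l * lat l' := by
  rw [lat, List.map_append, List.prod_append]; rfl

theorem lat_singleton (s : Gen) : lat [s] = latGen s := by simp [lat]

theorem realizable_singleton {s : Gen} {a : Fin 5 → ℂ} : Realizable [s] a ↔ ∃ Ψ : KK ≃ₐ[ℂ] KK,
    Ψ (coord 0) = (birGen s (genPt a)).f ∧ Ψ (coord 1) = (birGen s (genPt a)).g ∧
    IsMarkedIso Ψ (confB a) (confB (birGen s (genPt a)).a) (latGen s).toLinearMap := by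
  rw [← lat_singleton]; rfl

theorem Realizable.append {l l' : List Gen} {a : Fin 5 → ℂ} (h' : Realizable l' a)
    (ha : ∀ i, (bir l' (genPt a)).a i ≠ 0) (h : Realizable l (bir l' (genPt a)).a) :
    Realizable (l ++ l') a := by
  obtain ⟨Ψ', hf', hg', hΨ'⟩ := h'
  obtain ⟨Ψ, hf, hg, hΨ⟩ := h
  have e : bir (l ++ l') (genPt a) = (bir l (genPt (bir l' (genPt a)).a)).map Ψ' := by
    rw [bir_append, ← bir_map, map_genPt, hf', hg']
  refine ⟨Ψ.trans Ψ', ?_, ?_, ?_⟩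
  · rw [e, AlgEquiv.trans_apply, hf]; rfl
  · rw [e, AlgEquiv.trans_apply, hg]; rfl
  · rw [e, lat_append]
    exact hΨ'.trans (markB ha) hΨ

theorem Realizable.congr {l l' : List Gen} {a : Fin 5 → ℂ} (h : Realizable l a)
    (hb : bir l (genPt a) = bir l' (genPt a)) (hl : lat l = lat l') : Realizable l' a := by
  rwa [Realizable, ← hb, ← hl]

theorem lat_ext {L L' : PicLat ≃ₗ[ℤ] PicLat}
    (h : ∀ i, L (Pi.single i 1) = L' (Pi.single i 1)) : L = L' := by
  apply LinearEquiv.toLinearMap_injective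
  ext i : 1
  ext1
  exact h i

theorem lat_w0 : lat [.σ₀, .w 2, .σ₀] = lat [.w 0] := lat_ext (by decide +kernel)

theorem reflA_map (Φ : KK ≃ₐ[ℂ] KK) (p : Pt) : reflA (p.map Φ) = (reflA p).map Φ := by
  simp [reflA, Pt.map, map_cst]

theorem changeBA_map (Φ : KK ≃ₐ[ℂ] KK) (p : Pt) : changeBA (p.map Φ) = (changeBA p).map Φ := by
  simp [changeBA, Pt.map, map_cst]

theorem map_eq_changeBA (Φ : KK ≃ₐ[ℂ] KK) {a : Fin 5 → ℂ}
    (hf : Φ (coord 0) = (changeBA (genPt a)).f) (hg : Φ (coord 1) = (changeBA (genPt a)).g) :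
    (genPt a).map Φ = changeBA (genPt a) := Pt.ext rfl hf hg

theorem BtoA_comp_BtoA : BtoA ∘ₗ BtoA = LinearMap.id := by
  have : ∀ i, BtoA (BtoA (Pi.single i 1)) = Pi.single i 1 := by decide +kernel
  ext i : 1
  ext1
  exact this i

theorem realizable_w4 {a : Fin 5 → ℂ} (ha : IsRootVars a) (ha2 : a 2 ≠ 1) (ha4 : a 4 ≠ 1) :
    Realizable [.w 4] a := by
  rw [realizable_singleton]
  have hgood := good_w4 (good_genPt ha)
  obtain ⟨τ, hτ0, hτ1, hτ⟩ := iso_BA ha.1 ha2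
  obtain ⟨ω, L, hω0, hω1, hω, hL⟩ := iso_reflA ha.1 ha2 ha4
  have ha' : IsRootVars (birGen (.w 4) (genPt a)).a := hgood.root
  obtain ⟨a', ha'e⟩ : ∃ a', a' = (birGen (.w 4) (genPt a)).a := ⟨_, rfl⟩
  have ha2' : a' 2 ≠ 1 := by rw [ha'e]; exact ha2
  rw [← ha'e] at ha' ⊢
  obtain ⟨τ', hτ0', hτ1', hτ'⟩ := iso_BA ha'.1 ha2'
  have hω' : IsMarkedIso ω (confA a) (confA a') L.toLinearMap := by rw [ha'e]; exact hω
  obtain ⟨Φ, h0, h1⟩ := hgood.chart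
  refine ⟨Φ, h0, h1, ?_⟩
  have hkey : τ'.trans Φ = ω.trans τ := by
    have e1 : ((genPt a').map τ').map Φ = ((reflA (genPt a)).map τ) := by
      rw [map_eq_changeBA τ' hτ0' hτ1', ← changeBA_map, map_genPt, h0, h1, ha'e, ← reflA_map,
        map_eq_changeBA τ hτ0 hτ1, ← changeBA_w4 (good_genPt ha)]
    refine algEquiv_ext ?_ ?_
    · have := congrArg Pt.f e1
      rw [AlgEquiv.trans_apply, AlgEquiv.trans_apply, hω0]
      exact this
    · have := congrArg Pt.g e1
      rw [AlgEquiv.trans_apply, AlgEquiv.trans_apply, hω1]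
      exact this
  have hΦ : Φ = τ'.symm.trans (ω.trans τ) := by
    rw [← hkey]
    ext x
    simp
  rw [hΦ]
  have hs := (hτ.trans (markA ha.1 ha2) hω').trans (markA ha'.1 ha2') (hτ'.symm BtoA_comp_BtoA)
  have hLL : BtoA ∘ₗ L.toLinearMap ∘ₗ BtoA = (latGen (.w 4)).toLinearMap := by
    ext c : 2
    change BtoA (L (BtoA _)) = latGen (.w 4) _
    rw [← hL]
    exact LinearMap.congr_fun BtoA_comp_BtoA _
  rwa [hLL] at hs

theorem realizable_w2 {a : Fin 5 → ℂ} (ha : IsRootVars a) (ha2 : a 2 ≠ 1) : Realizable [.w 2] a :=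
  realizable_singleton.2 (iso_w2 ha.1 ha2)

theorem realizable_σ₀ {a : Fin 5 → ℂ} (ha : IsRootVars a) : Realizable [.σ₀] a :=
  realizable_singleton.2 (iso_σ₀ ha)

theorem realizable_σ₁ {a : Fin 5 → ℂ} (ha : IsRootVars a) : Realizable [.σ₁] a :=
  realizable_singleton.2 (iso_σ₁ ha.1)

theorem realizable_w0 {a : Fin 5 → ℂ} (ha : IsRootVars a) (ha0 : a 0 ≠ 1) :
    Realizable [.w 0] a := by
  have h1 := good_σ₀ (good_genPt ha)
  have h2 := good_w2 h1
  refine Realizable.congr (l := [.σ₀] ++ ([.w 2] ++ [.σ₀])) ?_ (w0_eq (good_genPt ha)).symm lat_w0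
  refine Realizable.append (Realizable.append (realizable_σ₀ ha) h1.root.1
    (realizable_w2 h1.root ?_)) h2.root.1 (realizable_σ₀ h2.root)
  change 1 / a 0 ≠ 1
  rw [one_div]
  simpa using ha0

theorem realizable_sigma₂ {a : Fin 5 → ℂ} (ha : IsRootVars a) : Realizable sigma₂ a := by
  have h1 := good_σ₀ (good_genPt ha)
  exact Realizable.append (l := [.σ₁]) (realizable_σ₀ ha) h1.root.1 (realizable_σ₁ h1.root)

theorem realizable_sigma₂_three {a : Fin 5 → ℂ} (ha : IsRootVars a) :
    Realizable (sigma₂ ++ sigma₂ ++ sigma₂) a := by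
  have h1 := good_sigma₂ (good_genPt ha)
  have h2 := good_sigma₂ h1
  rw [List.append_assoc]
  refine Realizable.append (Realizable.append (realizable_sigma₂ ha) h1.root.1
    (realizable_sigma₂ h1.root)) ?_ (realizable_sigma₂ ?_)
  · rw [bir_append]; exact h2.root.1
  · rw [bir_append]; exact h2.root

theorem realizable_psiW {a : Fin 5 → ℂ} (ha : IsRootVars a) (ha2 : a 2 ≠ 1) (ha3 : a 3 ≠ 1) :
    Realizable psiW a := by
  have h3 := good_sigma₂_three (good_genPt ha)
  rw [psiW, List.append_assoc, List.append_assoc, ← List.append_assoc sigma₂]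
  refine Realizable.append (realizable_sigma₂_three ha) h3.root.1 (realizable_w4 h3.root ?_ ?_)
  · rw [sigma₂_three (good_genPt ha)]; exact ha2
  · rw [sigma₂_three (good_genPt ha)]; exact ha3

theorem realizable_phiW {a : Fin 5 → ℂ} (ha : IsRootVars a) (ha2 : a 2 ≠ 1)
    (ha02 : a 0 * a 2 ≠ 1) : Realizable phiW a := by
  have h2 := good_w2 (good_genPt ha)
  have h0 := good_w0 h2
  have h3 := good_sigma₂_three h0
  have hw : Realizable [.w 0, .w 2] a := Realizable.append (l := [.w 0]) (realizable_w2 ha ha2)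
    h2.root.1 (realizable_w0 h2.root ha02)
  have e : phiW = sigma₂ ++ ((sigma₂ ++ sigma₂ ++ sigma₂) ++ [.w 0, .w 2]) := rfl
  rw [e]
  have h0' : (bir [.w 0, .w 2] (genPt a)).Good := h0
  have h3' : (bir ((sigma₂ ++ sigma₂ ++ sigma₂) ++ [.w 0, .w 2]) (genPt a)).Good := by
    rw [bir_append]; exact h3
  exact Realizable.append (Realizable.append hw h0'.root.1 (realizable_sigma₂_three h0'.root))
    h3'.root.1 (realizable_sigma₂ h3'.root)

/-! ### From the `q`-Laguerre surface to the (b)-model -/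

theorem IsPoint.hasValue_div {B : Subring KK} (hP : IsPoint B) {p r : KK} {a b : ℂ}
    (hp : Tends B p a) (hr : Tends B r b) (h : a ≠ 0 ∨ b ≠ 0) : HasValue B (p / r) := by
  by_cases hb : b = 0
  · rw [← inv_div]
    exact ((hr.div hp (h.resolve_right (not_not.2 hb)) hP.1).hasValue hP.1).inv
  · exact (hp.div hr hb hP.1).hasValue hP.1

variable {q Q T : ℂ} {n : ℕ}

/-- The root variables of the (b)-model surface `σ₀`-conjugate to the one of the `q`-Laguerre
surface. -/
def rootX₀ (q Q T : ℂ) (n : ℕ) : Fin 5 → ℂ :=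
  ![1 / q ^ (n + 1), q ^ n * T, 1 / T, q ^ n * Q, 1 / (q ^ (n + 1) * Q)]

/-- Matching of the points of the `q`-Laguerre surface and of the (b)-model. -/
def permX : Fin 8 → Fin 8 := ![0, 4, 7, 5, 6, 1, 2, 3]

/-- The inverse matching. -/
def permX' : Fin 8 → Fin 8 := ![0, 5, 6, 7, 1, 3, 4, 2]

theorem rootX₀_ratio (hq : q ≠ 0) (hQ : Q ≠ 0) :
    rootX₀ q Q T n 4 / rootX₀ q Q T n 0 = 1 / Q := by
  have : q ^ (n + 1) ≠ 0 := pow_ne_zero _ hq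
  simp only [rootX₀, Matrix.cons_val]
  field_simp

theorem one_div_rootX₀_two : 1 / rootX₀ q Q T n 2 = T := one_div_one_div T

theorem one_div_rootX₀_four : 1 / rootX₀ q Q T n 4 = q ^ (n + 1) * Q := one_div_one_div _

theorem rootX₀_ne_zero (hq : q ≠ 0) (hQ : Q ≠ 0) (hT : T ≠ 0) (i : Fin 5) :
    rootX₀ q Q T n i ≠ 0 := by
  have : q ^ (n + 1) ≠ 0 := pow_ne_zero _ hq
  fin_cases i <;> simp [rootX₀, hq, hQ, hT]

theorem link_XB (hq : q ≠ 0) (hQ : Q ≠ 0) (hT : T ≠ 0) (hT1 : T ≠ 1) {x y f g : KK}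
    (h : IsChart x y) (hf : f = cst (q ^ n) * (x - cst T) / (x * y - 1)) (hg : g = x) :
    Link x y (locX q Q T n x y) f g (locB (rootX₀ q Q T n) f g) permX (fun i => i = 1 ∨ i = 2) := by
  subst hg
  have hx := h.ne_zero
  have hy := h.swap.ne_zero
  have hr := rootX₀_ratio (n := n) (T := T) hq hQ
  have h2 := one_div_rootX₀_two (q := q) (Q := Q) (T := T) (n := n)
  have h4 := one_div_rootX₀_four (q := q) (Q := Q) (T := T) (n := n)
  have h1 : rootX₀ q Q T n 1 = q ^ n * T := rfl
  have hN : q ^ n ≠ 0 := pow_ne_zero n hq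
  have ec : q ^ (2 * n + 1) = q ^ n * q ^ n * q := by ring
  have ec' : q ^ (n + 1) = q ^ n * q := pow_succ q n
  have hxT : g - cst T ≠ 0 := h.sub_cst_ne_zero T
  have hxy : g * y - 1 ≠ 0 := h.bilinear_ne_zero (-1) 0 0 1 (by simp [cst_neg]; ring) (by simp)
  have hNc := cst_ne_zero hN
  generalize rootX₀ q Q T n = b at *
  obtain ⟨N, hNd⟩ : ∃ N, N = q ^ n := ⟨_, rfl⟩
  rw [← hNd] at hf hN hNc h1 ec ec'
  have hfi : f⁻¹ = (g * y - 1) / (cst N * (g - cst T)) := by rw [hf, inv_div]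
  constructor
  · intro i hi B hB v1 v2
    fin_cases i
    · replace v1 : Tends B g 1 := tends_of_vanishes_sub_one v1
      replace v2 : Tends B y 1 := tends_of_vanishes_sub_one v2
      refine ⟨(((v1.mul v2 hB).sub tends_one hB).div
        ((tends_cst N).mul (v1.sub (tends_cst T) hB) hB)
        (mul_ne_zero hN (sub_ne_zero.2 hT1.symm)) hB).vanishes hfi (by simp), ?_⟩
      exact (v1.sub tends_one hB).vanishes rfl (by simp)
    · exact absurd (Or.inl rfl) hi
    · exact absurd (Or.inr rfl) hi
    · replace v1 : Vanishes B g := v1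
      replace v2 : Vanishes B (1 / (g * y)) := v2
      refine ⟨v2.of_mul (((tends_cst N).mul (v1.tends.sub (tends_cst T) hB) hB).div
        (tends_one.sub v2.tends hB) (by simp) hB) hB ?_, v1⟩
      change f = _
      rw [hf]; field_simp
    · replace v1 : Vanishes B g := v1
      have v3 : Tends B (1 / (g ^ 2 * y)) (1 / (q ^ (2 * n + 1) * Q * T)) := v2
      have v4 : Vanishes B (1 / (g * y)) := v1.of_mul v3 hB (by field_simp)
      refine ⟨v4.of_mul (((tends_cst N).mul (v1.tends.sub (tends_cst T) hB) hB).div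
        (tends_one.sub v4.tends hB) (by simp) hB) hB ?_,
        (((tends_one.sub v4.tends hB).div (((tends_cst N).mul (v1.tends.sub (tends_cst T) hB) hB).mul
          v3 hB) ?_ hB).add (tends_cst (1 / b 4)) hB).vanishes ?_ ?_⟩
      · change f = _
        rw [hf]; field_simp
      · rw [ec]; simp [hN, hT, hQ, hq]
      · change g / f + cst (1 / b 4) = _
        rw [hf]; field_simp
      · rw [h4, ec, ec']; field_simp; ring
    · replace v1 : Vanishes B g⁻¹ := v1
      replace v2 : Vanishes B y := v2
      refine ⟨((v2.tends.sub v1.tends hB).div ((tends_cst N).mul (tends_one.sub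
        ((tends_cst T).mul v1.tends hB) hB) hB) (by simpa using hN) hB).vanishes ?_ (by simp), v1⟩
      change f⁻¹ = _
      rw [hfi]; field_simp
    · replace v1 : Vanishes B g⁻¹ := v1
      have v3 : Tends B (g * y) (1 - N * Q) := by rw [hNd]; exact v2
      have v4 := (tends_cst N).mul (tends_one.sub ((tends_cst T).mul v1.tends hB) hB) hB
      refine ⟨v1.of_mul ((v3.sub tends_one hB).div v4 (by simpa using hN) hB) hB ?_,
        ((v4.div (v3.sub tends_one hB) (by simp [hN, hQ]) hB).add (tends_cst (b 4 / b 0))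
          hB).vanishes ?_ ?_⟩
      · change f⁻¹ = _
        rw [hfi]; field_simp
      · change f / g + cst (b 4 / b 0) = _
        rw [hf]; field_simp
      · rw [hr]; simp; field_simp; ring
    · replace v1 : Vanishes B g⁻¹ := v1
      have v3 : Tends B y N := by rw [hNd]; exact v2
      refine ⟨v1, ((((tends_cst N).mul (tends_one.sub ((tends_cst T).mul v1.tends hB) hB) hB).div
        (v3.sub v1.tends hB) (by simpa using hN) hB).sub tends_one hB).vanishes ?_ ?_⟩
      · change f - 1 = _
        rw [hf]; field_simp
      · simp [hN]
  · rintro B hP ⟨hvx, hvy, hc⟩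
    have hB := hP.1
    have c1 : Vanishes B (g - cst T) → Vanishes B (y - cst (1 / T)) →
      HasValue B ((y - cst (1 / T)) / (g - cst T)) := hc 1
    have c2 : Vanishes B g → Vanishes B y⁻¹ → HasValue B (y⁻¹ / g) := hc 2
    have hNt := tends_cst (B := B) N
    have hTt := tends_cst (B := B) T
    refine ⟨?_, hvx, ?_⟩
    · rcases hP.tends_or hvx with ⟨c, hxc⟩ | hxi
      · have hnum := hNt.mul (hxc.sub hTt hB) hB
        rcases hP.tends_or hvy with ⟨d, hyd⟩ | hyi
        · have hden := (hxc.mul hyd hB).sub tends_one hB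
          by_cases hcT : c = T
          · by_cases hd : c * d - 1 = 0
            · subst hcT
              have hd : d = 1 / c := by field_simp; linear_combination hd
              subst hd
              have h3 := (c1 hxc hyd).of_affine (tends_cst c) hT (hyd.mem hB) hB
                (y := (g * y - 1) / (g - cst c)) (by
                  have := cst_ne_zero hT
                  rw [cst_div, cst_one]; field_simp; ring)
              refine h3.inv.of_mul hNt hN hB ?_
              rw [hf, inv_div]; ring
            · rw [hf]
              exact hP.hasValue_div hnum hden (Or.inr hd)
          · rw [hf]
            exact hP.hasValue_div hnum hden (Or.inl (mul_ne_zero hN (sub_ne_zero.2 hcT)))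
        · by_cases hc0 : c = 0
          · subst hc0
            have h3 := c2 (tends_zero_iff.1 hxc) hyi
            have h3 := h3.inv.of_affine (tends_one (B := B)) one_ne_zero
              (B.neg_mem B.one_mem) hB (y := g * y - 1) (by field_simp; ring)
            refine h3.inv.of_mul hnum (mul_ne_zero hN (by simpa using hT)) hB ?_
            rw [hf]; field_simp
          · have e : f = cst N * (g - cst T) * y⁻¹ / (g - y⁻¹) := by rw [hf]; field_simp
            rw [e]
            exact hP.hasValue_div (hnum.mul hyi.tends hB) (hxc.sub hyi.tends hB)
              (Or.inr (by simpa using hc0))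
      · have hnum := hNt.mul (tends_one.sub (hTt.mul hxi.tends hB) hB) hB
        have hn0 : N * (1 - T * 0) ≠ 0 := by simpa using hN
        rcases hP.tends_or hvy with ⟨d, hyd⟩ | hyi
        · have e : f = cst N * (1 - cst T * g⁻¹) / (y - g⁻¹) := by rw [hf]; field_simp
          rw [e]
          exact hP.hasValue_div hnum (hyd.sub hxi.tends hB) (Or.inl hn0)
        · have e : f = cst N * (1 - cst T * g⁻¹) * y⁻¹ / (1 - g⁻¹ * y⁻¹) := by rw [hf]; field_simp
          rw [e]
          exact hP.hasValue_div (hnum.mul hyi.tends hB)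
            (tends_one.sub (hxi.tends.mul hyi.tends hB) hB) (Or.inr (by simp))
    · rintro i (rfl | rfl) v1 v2
      · have v3 : Tends B g (1 / b 2) := v2
        rw [h2] at v3
        have h3 : HasValue B (g * y - 1) := (hvy.of_mul v3 hT hB (mul_comm g y)).of_affine
          (tends_one (B := B)) one_ne_zero (B.neg_mem B.one_mem) hB (by ring)
        refine h3.of_mul (hNt.inv hN hB) (inv_ne_zero hN) hB ?_
        change (g - cst (1 / b 2)) / f = _
        rw [h2, hf]; field_simp
      · have v3 : Tends B f (b 1) := v2
        have v4 : Vanishes B g := v1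
        rw [h1] at v3
        have hNT : N * T ≠ 0 := mul_ne_zero hN hT
        have hden : Tends B (g * y - 1) (-1) := by
          refine ((hNt.mul (v4.tends.sub hTt hB) hB).div v3 hNT hB).congr ?_ ?_
          · rw [hf]; field_simp
          · field_simp; ring
        refine hvy.of_affine ((((tends_cst (-(N * T))).div hden (by norm_num)) hB)) ?_
          (β := cst N / (g * y - 1)) ((hNt.div hden (by norm_num) hB).mem hB) hB ?_
        · simpa using ⟨hN, hT⟩
        · change (f - cst (b 1)) / g = _
          rw [h1, hf, cst_neg, cst_mul]; field_simp; ring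

theorem link_BX (hq : q ≠ 0) (hQ : Q ≠ 0) (hT : T ≠ 0) (hT1 : T ≠ 1) {x y f g : KK}
    (h : IsChart f g) (hx : x = g) (hy : y = (f + cst (q ^ n) * (g - cst T)) / (f * g))
    (hch : IsChart x y) :
    Link f g (locB (rootX₀ q Q T n) f g) x y (locX q Q T n x y) permX'
      (fun i => i = 4 ∨ i = 7) := by
  subst hx
  have hf := h.ne_zero
  have hg := h.swap.ne_zero
  have hr := rootX₀_ratio (n := n) (T := T) hq hQ
  have h2 := one_div_rootX₀_two (q := q) (Q := Q) (T := T) (n := n)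
  have h4 := one_div_rootX₀_four (q := q) (Q := Q) (T := T) (n := n)
  have h1 : rootX₀ q Q T n 1 = q ^ n * T := rfl
  have hN : q ^ n ≠ 0 := pow_ne_zero n hq
  have ec : q ^ (2 * n + 1) = q ^ n * q ^ n * q := by ring
  have ec' : q ^ (n + 1) = q ^ n * q := pow_succ q n
  have hxT : x - cst T ≠ 0 := hch.sub_cst_ne_zero T
  have hTc := cst_ne_zero hT
  have hD : f + cst (q ^ n) * (x - cst T) ≠ 0 :=
    h.bilinear_ne_zero (-(q ^ n * T)) 1 (q ^ n) 0 (by simp [cst_neg, cst_mul]; ring) (by simp)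
  generalize rootX₀ q Q T n = b at *
  obtain ⟨N, hNd⟩ : ∃ N, N = q ^ n := ⟨_, rfl⟩
  rw [← hNd] at hy hN hD h1 ec ec'
  have ey1 : y = (1 + cst N * (x - cst T) * f⁻¹) / x := by rw [hy]; field_simp
  have ey2 : y = x⁻¹ + cst N * (1 - cst T * x⁻¹) * f⁻¹ := by rw [hy]; field_simp
  have ey3 : y = (f * x⁻¹ + cst N * (1 - cst T * x⁻¹)) / f := by rw [hy]; field_simp
  constructor
  · intro i hi B hB v1 v2
    have hNt := tends_cst (B := B) N
    have hTt := tends_cst (B := B) T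
    fin_cases i
    · replace v1 : Vanishes B f⁻¹ := v1
      replace v2 : Tends B x 1 := tends_of_vanishes_sub_one v2
      refine ⟨(v2.sub tends_one hB).vanishes rfl (by simp),
        (((tends_one.add ((hNt.mul (v2.sub hTt hB) hB).mul v1.tends hB) hB).div v2 one_ne_zero
          hB).sub tends_one hB).vanishes ?_ (by simp)⟩
      change y - 1 = _
      rw [ey1]
    · replace v1 : Vanishes B f⁻¹ := v1
      replace v2 : Vanishes B x⁻¹ := v2
      exact ⟨v2, (v2.tends.add ((hNt.mul (tends_one.sub (hTt.mul v2.tends hB) hB) hB).mul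
        v1.tends hB) hB).vanishes ey2 (by simp)⟩
    · replace v1 : Vanishes B f⁻¹ := v1
      have v3 : Tends B (f / x) (-(b 4 / b 0)) := tends_of_vanishes_add v2
      rw [hr] at v3
      have v4 : Vanishes B x⁻¹ := v1.of_mul v3 hB (by field_simp)
      refine ⟨v4, ((tends_one.add ((hNt.mul (tends_one.sub (hTt.mul v4.tends hB) hB) hB).div v3
        (by simpa using hQ) hB) hB).sub (tends_cst (1 - N * Q)) hB).vanishes ?_ ?_⟩
      · change x * y - cst (1 - q ^ n * Q) = _
        rw [← hNd, hy]; field_simp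
      · field_simp; ring
    · replace v1 : Vanishes B x⁻¹ := v1
      have v3 : Tends B f 1 := tends_of_vanishes_sub_one v2
      refine ⟨v1, ((v1.tends.add ((hNt.mul (tends_one.sub (hTt.mul v1.tends hB) hB) hB).mul
        (v3.inv one_ne_zero hB) hB) hB).sub hNt hB).vanishes ?_ (by simp)⟩
      change y - cst (q ^ n) = _
      rw [← hNd, ey2]
    · exact absurd (Or.inl rfl) hi
    · replace v1 : Vanishes B f := v1
      replace v2 : Vanishes B x := v2
      refine ⟨v2, v1.of_mul ((v1.tends.add (hNt.mul (v2.tends.sub hTt hB) hB) hB).inv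
        (by simp [hN, hT]) hB) hB ?_⟩
      change 1 / (x * y) = _
      rw [hy]; field_simp
    · replace v1 : Vanishes B f := v1
      have v3 : Tends B (x / f) (-(1 / b 4)) := tends_of_vanishes_add v2
      rw [h4, ec'] at v3
      have v4 : Vanishes B x := v1.of_mul v3 hB (by field_simp)
      refine ⟨v4, ((((v1.tends.add (hNt.mul (v4.tends.sub hTt hB) hB) hB).mul v3 hB).inv
        ?_ hB).sub (tends_cst (1 / (q ^ (2 * n + 1) * Q * T))) hB).vanishes ?_ ?_⟩
      · simp [hN, hT, hq, hQ]
      · change 1 / (x ^ 2 * y) - cst (1 / (q ^ (2 * n + 1) * Q * T)) = _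
        rw [hy]; field_simp
      · rw [ec]; field_simp; ring
    · exact absurd (Or.inr rfl) hi
  · rintro B hP ⟨hvf, hvx, hc⟩
    have hB := hP.1
    have c4 : Vanishes B f → Vanishes B (x - cst T) → HasValue B ((x - cst T) / f) := by
      rw [← h2]; exact hc 4
    have c7 : Vanishes B x → Vanishes B (f - cst (N * T)) → HasValue B ((f - cst (N * T)) / x) := by
      rw [← h1]; exact hc 7
    have hNt := tends_cst (B := B) N
    have hTt := tends_cst (B := B) T
    refine ⟨hvx, ?_, ?_⟩
    · rcases hP.tends_or hvx with ⟨c, hxc⟩ | hxi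
      · rcases hP.tends_or hvf with ⟨d, hfd⟩ | hfi
        · have hnum := hfd.add (hNt.mul (hxc.sub hTt hB) hB) hB
          have hden := hfd.mul hxc hB
          by_cases hd : d = 0
          · subst hd
            by_cases hcT : c = T
            · subst hcT
              refine (c4 (tends_zero_iff.1 hfd) hxc).of_affine (hNt.div hxc hT hB)
                (div_ne_zero hN hT) ((hxc.inv hT hB).mem hB) hB ?_
              rw [hy]; field_simp; ring
            · rw [hy]
              exact hP.hasValue_div hnum hden (Or.inl (by
                simpa using ⟨hN, sub_ne_zero.2 hcT⟩))
          · by_cases hc0 : c = 0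
            · subst hc0
              by_cases hdT : d = N * T
              · subst hdT
                refine (c7 (tends_zero_iff.1 hxc) hfd).of_affine (hfd.inv hd hB)
                  (inv_ne_zero hd) ((hNt.div hfd hd hB).mem hB) hB ?_
                rw [hy, cst_mul]; field_simp; ring
              · rw [hy]
                exact hP.hasValue_div hnum hden (Or.inl (by
                  rw [zero_sub, mul_neg, ← sub_eq_add_neg]; exact sub_ne_zero.2 hdT))
            · rw [hy]
              exact hP.hasValue_div hnum hden (Or.inr (mul_ne_zero hd hc0))
        · rw [ey1]
          exact hP.hasValue_div (tends_one.add ((hNt.mul (hxc.sub hTt hB) hB).mul hfi.tends hB) hB)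
            hxc (Or.inl (by simp))
      · have hn := hNt.mul (tends_one.sub (hTt.mul hxi.tends hB) hB) hB
        rcases hP.tends_or hvf with ⟨d, hfd⟩ | hfi
        · rw [ey3]
          exact hP.hasValue_div ((hfd.mul hxi.tends hB).add hn hB) hfd (Or.inl (by simpa using hN))
        · rw [ey2]
          exact (hxi.tends.add (hn.mul hfi.tends hB) hB).hasValue hB
    · rintro i (rfl | rfl) v1 v2
      · have v3 : Tends B x T := v1
        refine hvf.inv.of_affine (hNt.div v3 hT hB) (div_ne_zero hN hT)
          (β := -(1 / (cst T * x))) ?_ hB ?_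
        · exact ((tends_one.div (hTt.mul v3 hB) (mul_ne_zero hT hT) hB).neg hB).mem hB
        · change (y - cst (1 / T)) / (x - cst T) = _
          rw [hy, cst_div, cst_one]; field_simp; ring
      · have v3 : Vanishes B x := v1
        have h3 := hvf.inv.of_affine (hNt.mul (v3.tends.sub hTt hB) hB)
          (mul_ne_zero hN (by simpa using hT)) B.one_mem hB
          (y := (f + cst N * (x - cst T)) / f) (by field_simp; ring)
        change HasValue B (y⁻¹ / x)
        have e : y⁻¹ / x = ((f + cst N * (x - cst T)) / f)⁻¹ := by rw [hy]; field_simp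
        rw [e]
        exact h3.inv

theorem lat_X : (∀ i : Fin 8, ¬ (i = 1 ∨ i = 2) →
      latGen .σ₀ (toB (excClasses nextX i)) = excClasses nextB (permX i)) ∧
    latGen .σ₀ (toB (basicClasses nextX poleX 0)) = basicClasses nextB poleB 1 ∧
    latGen .σ₀ (toB (basicClasses nextX poleX 1)) = basicClasses nextB poleB 0 -
      ∑ i, (![-1, -1, -1, 0, 1, 1, 1, 0] : Fin 8 → ℤ) i • excClasses nextB i ∧
    latGen .σ₀ (toB (excClasses nextX 1)) = basicClasses nextB poleB 1 -
      ∑ i, (![0, -1, -1, -1, 1, 0, 0, 0] : Fin 8 → ℤ) i • excClasses nextB i ∧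
    latGen .σ₀ (toB (excClasses nextX 2)) = basicClasses nextB poleB 1 -
      ∑ i, (![0, -1, -1, -1, 0, 1, 1, 1] : Fin 8 → ℤ) i • excClasses nextB i := by
  decide +kernel

theorem curves_X (hq : q ≠ 0) (hT : T ≠ 0) {x y f g : KK}
    (h : IsChart x y) (h' : IsChart f g) (hf : f = cst (q ^ n) * (x - cst T) / (x * y - 1))
    (hg : g = x) :
    crv g⁻¹ f = crv x⁻¹ y ∧ crv (f - cst 0) g = crv y⁻¹ x ∧
    crv (g - cst T) f = crv (x - cst T) ((y - cst (1 / T)) / (x - cst T)) ∧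
    crv (g - cst 0) f = crv x (y⁻¹ / x) := by
  subst hg
  have hx := h.ne_zero
  have hy := h.swap.ne_zero
  have hN : q ^ n ≠ 0 := pow_ne_zero n hq
  have hxT : g - cst T ≠ 0 := h.sub_cst_ne_zero T
  have hxy : g * y - 1 ≠ 0 := h.bilinear_ne_zero (-1) 0 0 1 (by simp [cst_neg]; ring) (by simp)
  have hNc := cst_ne_zero hN
  have hTc := cst_ne_zero hT
  generalize q ^ n = N at *
  refine ⟨?_, ?_, ?_, ?_⟩
  · have hc : IsChart g⁻¹ y := h.swap.inv.swap
    rw [← hc.crv_inv]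
    refine (hc.inv.crv_eq_of h'.inv.swap fun V hV hu hw => ⟨hu, ?_⟩).symm
    have hB := hV.isLoc
    have h0 : HasOrder V y⁻¹ 0 := by simpa using hw 0
    have h1 := hu.mul_mem (hV.hasOrder_zero_iff.1 h0).1 hB
    refine ⟨_, _, ?_, ((tends_cst N).mul (tends_one.sub ((tends_cst T).mul hu.tends hB) hB) hB).div
      (tends_one.sub h1.tends hB) (by simp) hB, ?_⟩
    · simpa using hN
    · rw [hf]; field_simp
  · rw [cst_zero, sub_zero]
    refine (h.inv.swap.crv_eq_of h' fun V hV hu hw => ⟨?_, 1, 1, one_ne_zero, tends_one, by simp⟩).symm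
    have hB := hV.isLoc
    have h0 : HasOrder V g 0 := by simpa using hw 0
    have h1 := (hV.hasOrder_zero_iff.1 (by simpa using hV.hasOrder_inv h0) :
      g⁻¹ ∈ V ∧ ¬ Vanishes V g⁻¹).1
    have h2 := (hV.hasOrder_zero_iff.1 (hw T)).1
    have h3 := hu.mul_mem h1 hB
    refine (hu.mul_mem (V.mul_mem (V.mul_mem (hB.cst_mem N) h2) h1) hB).of_mul
      ((tends_one.sub h3.tends hB).inv (by simp) hB) hB ?_
    rw [hf]; field_simp
  · have hc : IsChart (g - cst T) (y - cst (1 / T)) := (h.sub_cst _).swap.sub_cst _ |>.swap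
    rw [← (h'.sub_cst T).swap.crv_inv]
    have hv := hc.exc_dominates hc.vanishes_right
    have hB := hc.div.isCurve.isLoc
    have hy' : Tends (crv (g - cst T) ((y - cst (1 / T)) / (g - cst T))) y (1 / T) := hv
    refine (hc.div.crv_eq (h'.sub_cst T).swap.inv hc.div.crv_vanishes_left
      ((tends_cst T).div (tends_cst N) hN hB) (div_ne_zero hT hN)
      (hy'.div (tends_cst N) hN hB) ?_).symm
    rw [hf, cst_div, cst_one]; field_simp; ring
  · rw [cst_zero, sub_zero]
    have hc : IsChart g y⁻¹ := h.inv
    rw [← h'.swap.crv_inv, ← hc.div.crv_inv]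
    have hi := hc.div.inv
    have hB := hi.isCurve.isLoc
    have hα := ((tends_cst N).mul ((hi.crv_vanishes_left.tends).sub (tends_cst T) hB) hB).inv
      (by simp [hN, hT]) hB
    refine (hi.crv_eq h'.swap.inv hi.crv_vanishes_left hα
      (by simp [hN, hT]) (hα.neg hB) ?_).symm
    rw [hf]; field_simp; ring

theorem isChart_XB (hq : q ≠ 0) {x y : KK} (h : IsChart x y) :
    IsChart (cst (q ^ n) * (x - cst T) / (x * y - 1)) x := by
  have hN := cst_ne_zero (pow_ne_zero n hq)
  have hx := h.ne_zero
  have hxT : x - cst T ≠ 0 := h.sub_cst_ne_zero T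
  refine h.of_forall_mem fun K h0 h1 => ⟨h1, ?_⟩
  have h2 := K.div_mem (K.add_mem (K.div_mem (K.mul_mem (cst_mem K (q ^ n))
    (K.sub_mem h1 (cst_mem K T))) h0) K.one_mem) h1
  convert h2 using 1
  field_simp
  ring

theorem iso_XB (hq : q ≠ 0) (hQ : Q ≠ 0) (hT : T ≠ 0) (hT1 : T ≠ 1) : ∃ Φ : KK ≃ₐ[ℂ] KK,
    Φ (coord 0) = cst (q ^ n) * (coord 0 - cst T) / (coord 0 * coord 1 - 1) ∧
    Φ (coord 1) = coord 0 ∧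
    IsMarkedIso Φ (confX q Q T n) (confB (rootX₀ q Q T n))
      ((latGen .σ₀).toLinearMap ∘ₗ toB) := by
  have hch := isChart_XB (T := T) (n := n) hq isChart_coord
  obtain ⟨f, hF⟩ : ∃ f, f = cst (q ^ n) * (coord 0 - cst T) / (coord 0 * coord 1 - 1) := ⟨_, rfl⟩
  obtain ⟨g, hG⟩ : ∃ g, g = coord 0 := ⟨_, rfl⟩
  have hch : IsChart f g := by rw [hF, hG]; exact hch
  rw [← hF]
  obtain ⟨Φ, hf, hg⟩ := hch
  have hch : IsChart f g := ⟨Φ, hf, hg⟩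
  refine ⟨Φ, hf, hg.trans hG, ?_⟩
  have hb := rootX₀_ne_zero (n := n) hq hQ hT
  have h2 := one_div_rootX₀_two (q := q) (Q := Q) (T := T) (n := n)
  have hN : q ^ n ≠ 0 := pow_ne_zero n hq
  have hx := coord_ne_zero 0
  have hxT : coord 0 - cst T ≠ 0 := isChart_coord.sub_cst_ne_zero T
  have hxy : coord 0 * coord 1 - 1 ≠ 0 :=
    isChart_coord.bilinear_ne_zero (-1) 0 0 1 (by simp [cst_neg]; ring) (by simp)
  have hNc := cst_ne_zero hN
  obtain ⟨c0, c1, c2, c3⟩ := curves_X hq hT isChart_coord hch hF hG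
  obtain ⟨l, l0, l1, l2, l3⟩ := lat_X
  refine IsMarkedIso.of_link (markX hq hQ hT hT1) (markB hb) hf hg
    (loc' := locB (rootX₀ q Q T n) f g)
    (fun i => by rw [confB_loc, map_locB, hf, hg]) (link_XB hq hQ hT hT1 isChart_coord hF hG)
    (ρ := permX') ?_ (by decide) (by decide) l ?_ ?_ ?_
  · have hun : ((fun i : Fin 8 => i = 1 ∨ i = 2) ∘ permX') = fun i => i = 4 ∨ i = 7 := by
      funext i
      fin_cases i <;> simp [permX']
    rw [hun]
    refine link_BX hq hQ hT hT1 hch hG.symm ?_ isChart_coord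
    have e : coord 1 = (coord 0 * coord 1 - 1 + 1) / coord 0 := by field_simp; ring
    rw [hF, hG]
    generalize coord 0 - cst T = A, coord 0 * coord 1 - 1 = D at *
    rw [e]
    field_simp
    ring
  · refine Or.inl ⟨1, ?_, l0⟩
    change mapRing Φ (lineInf 1) = lineInf 0
    rw [mapRing_lineInf_one, hf, hg, c0, lineInf_zero]
  · refine Or.inr ⟨0, 0, _, fun i => ?_, ?_, l1⟩
    · refine orderB hb ?_
      have h1' := (hb 1).symm
      fin_cases i <;> simp [baseB, h1']
    · change crv (Φ (coord 0) - cst 0) (Φ (coord 1)) = lineInf 1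
      rw [hf, hg, c1, lineInf_one]
  · rintro i (rfl | rfl)
    · refine Or.inr ⟨1, T, _, fun i => ?_, ?_, l2⟩
      · refine orderB hb ?_
        unfold baseB
        rw [h2]
        fin_cases i <;> simp [hT1, hT]
      · change crv (Φ (coord 1) - cst T) (Φ (coord 0)) = _
        rw [hf, hg, c2]; rfl
    · refine Or.inr ⟨1, 0, _, fun i => ?_, ?_, l3⟩
      · refine orderB hb ?_
        unfold baseB
        rw [h2]
        fin_cases i <;> simp [hT.symm]
      · change crv (Φ (coord 1) - cst 0) (Φ (coord 0)) = _
        rw [hf, hg, c3]; rfl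

theorem isRootVars_rootX (hq : q ≠ 0) (hQ : Q ≠ 0) (hT : T ≠ 0) : IsRootVars (rootX q Q T n) := by
  have : q ^ (n + 1) ≠ 0 := pow_ne_zero _ hq
  refine ⟨fun i => ?_, ?_⟩
  · fin_cases i <;> simp [rootX, hq, hQ, hT]
  · simp only [rootX, Matrix.cons_val]
    field_simp

theorem isRootVars_rootX₀ (hq : q ≠ 0) (hQ : Q ≠ 0) (hT : T ≠ 0) : IsRootVars (rootX₀ q Q T n) := by
  refine ⟨rootX₀_ne_zero hq hQ hT, ?_⟩
  simp only [rootX₀, Matrix.cons_val]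
  field_simp

theorem iso_X (hq : q ≠ 0) (hQ : Q ≠ 0) (hT : T ≠ 0) (hT1 : T ≠ 1) : ∃ χ : KK ≃ₐ[ℂ] KK,
    χ (coord 0) = fX T ∧ χ (coord 1) = gX q Q T n ∧
    IsMarkedIso χ (confX q Q T n) (confB (rootX q Q T n)) toB := by
  have hb := isRootVars_rootX₀ (n := n) hq hQ hT
  obtain ⟨Φ, h0, h1, hΦ⟩ := iso_XB (n := n) hq hQ hT hT1
  obtain ⟨Ψ, k0, k1, hΨ⟩ := iso_σ₀ hb
  have ha : (birGen .σ₀ (genPt (rootX₀ q Q T n))).a = rootX q Q T n := by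
    funext i
    fin_cases i <;> simp [birGen, genPt, rootX₀, rootX]
  rw [ha] at hΨ
  have hN : cst (q ^ n) ≠ 0 := cst_ne_zero (pow_ne_zero n hq)
  have hq' : cst q ≠ 0 := cst_ne_zero hq
  have hQ' : cst Q ≠ 0 := cst_ne_zero hQ
  have hT' : cst T ≠ 0 := cst_ne_zero hT
  have hxy : coord 0 * coord 1 - 1 ≠ 0 :=
    isChart_coord.bilinear_ne_zero (-1) 0 0 1 (by simp [cst_neg]; ring) (by simp)
  have hx := coord_ne_zero 0
  refine ⟨Ψ.trans Φ, ?_, ?_, ?_⟩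
  · rw [AlgEquiv.trans_apply, k0]
    simp only [birGen, genPt, rootX₀, Matrix.cons_val, map_div₀, map_cst, h0, fX]
    rw [cst_mul]
    field_simp
  · rw [AlgEquiv.trans_apply, k1]
    simp only [birGen, genPt, rootX₀, Matrix.cons_val, map_div₀, map_neg, map_mul, map_cst, h0, h1, gX,
      cst_mul, cst_div, pow_succ, cst_one]
    field_simp
  · have hL : (latGen .σ₀).toLinearMap ∘ₗ (latGen .σ₀).toLinearMap ∘ₗ toB = toB := by
      have : ∀ i, latGen .σ₀ (latGen .σ₀ (toB (Pi.single i 1))) = toB (Pi.single i 1) := by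
        decide +kernel
      ext i : 1
      ext1
      exact this i
    have := hΦ.trans (markB hb.1) hΨ
    rwa [hL] at this

/-! ### Polynomials with bounded poles at infinity -/

/-- The bidegree `(a, b)`. -/
def bideg (a b : ℕ) : Fin 2 →₀ ℕ := Finsupp.single 0 a + Finsupp.single 1 b

theorem bideg_zero (a b : ℕ) : bideg a b 0 = a := by simp [bideg]

theorem bideg_one (a b : ℕ) : bideg a b 1 = b := by simp [bideg]

theorem eq_bideg_iff {m : Fin 2 →₀ ℕ} {a b : ℕ} : bideg a b = m ↔ a = m 0 ∧ b = m 1 := by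
  rw [Finsupp.ext_iff, Fin.forall_fin_two, bideg_zero, bideg_one]

theorem aeval_monomial_bideg (u w : KK) (a b : ℕ) (c : ℂ) :
    aeval ![u, w] (monomial (bideg a b) c) = cst c * (u ^ a * w ^ b) := by
  rw [aeval_monomial, Finsupp.prod_fintype _ _ (by simp), Fin.prod_univ_two, bideg_zero, bideg_one]
  rfl

theorem degreeOf_le_of_mem_lineInf {j : Fin 2} {P : Poly} {k : ℕ}
    (h : algebraMap Poly KK P * (coord j)⁻¹ ^ k ∈ lineInf j) : degreeOf j P ≤ k := by
  by_contra! hlt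
  have hj : j ≠ 1 - j := by fin_cases j <;> decide
  have hP0 : P ≠ 0 := by rintro rfl; simp at hlt
  set n := degreeOf j P with hn
  let R : Poly := ∑ m ∈ P.support, monomial (bideg (n - m j) (m (1 - j))) (coeff m P)
  have hch := isChart_lineInf j
  have hR : aeval ![(coord j)⁻¹, coord (1 - j)] R = algebraMap Poly KK P * (coord j)⁻¹ ^ n := by
    rw [← aeval_coord]
    conv_rhs => rw [P.as_sum]
    rw [map_sum, map_sum, Finset.sum_mul]
    refine Finset.sum_congr rfl fun m hm => ?_
    have hmn : m j ≤ n := monomial_le_degreeOf j hm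
    have hm2 : m = bideg (m 0) (m 1) := (eq_bideg_iff.2 ⟨rfl, rfl⟩).symm
    have hx := coord_ne_zero j
    have hpow : (coord j)⁻¹ ^ (n - m j) = coord j ^ m j * (coord j)⁻¹ ^ n := by
      obtain ⟨e, he⟩ := Nat.exists_eq_add_of_le hmn
      rw [he, Nat.add_sub_cancel_left, pow_add, ← mul_assoc, ← mul_pow, mul_inv_cancel₀ hx, one_pow,
        one_mul]
    rw [aeval_monomial_bideg, hpow]
    conv_rhs => rw [hm2, aeval_monomial_bideg, ← hm2]
    clear_value n R
    fin_cases j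
    · change _ * (coord 0 ^ m 0 * _ * coord 1 ^ m 1) = _ * (coord 0 ^ m 0 * coord 1 ^ m 1) * _
      ring
    · change _ * (coord 1 ^ m 1 * _ * coord 0 ^ m 0) = _ * (coord 0 ^ m 0 * coord 1 ^ m 1) * _
      ring
  have hvan : Vanishes (crv (coord j)⁻¹ (coord (1 - j))) (aeval ![(coord j)⁻¹, coord (1 - j)] R) := by
    obtain ⟨e, he⟩ := Nat.exists_eq_add_of_lt hlt
    have hB := hch.isCurve.isLoc
    rw [hR, he, add_assoc, pow_add, ← mul_assoc, pow_succ, mul_comm, mul_comm _ (coord j)⁻¹,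
      mul_assoc]
    exact hch.crv_vanishes_left.mul_mem
      (mul_mem (pow_mem hch.crv_vanishes_left.1 e) h) hB
  have hdvd : (X 0 : Poly) ∣ R := by
    obtain ⟨θ, h0, h1⟩ := hch
    rw [← h0, ← h1, crv_eq, ← map_aeval, aeval_coord, vanishes_mapRing, IrrPoly.vanishes_ring] at hvan
    exact hvan
  obtain ⟨m, hm, hmn⟩ : ∃ m ∈ P.support, m j = n := by
    rw [hn, degreeOf_eq_sup]
    obtain ⟨m, hm, h⟩ := Finset.exists_mem_eq_sup _ (support_nonempty.2 hP0) fun m => m j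
    exact ⟨m, hm, h.symm⟩
  have hc : coeff (bideg 0 (m (1 - j))) R = coeff m P := by
    rw [coeff_sum, Finset.sum_eq_single_of_mem m hm, coeff_monomial, if_pos]
    · rw [hmn, Nat.sub_self]
    · intro l hl hne
      have hln : l j ≤ n := monomial_le_degreeOf j hl
      rw [coeff_monomial, if_neg]
      rw [eq_bideg_iff, bideg_zero, bideg_one]
      rintro ⟨h1, h2⟩
      refine hne (Finsupp.ext fun i => ?_)
      have : i = j ∨ i = 1 - j := by
        fin_cases i <;> fin_cases j <;> decide
      rcases this with rfl | rfl
      · omega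
      · exact h2
  obtain ⟨S, hS⟩ := hdvd
  rw [hS, coeff_X_mul', if_neg] at hc
  · exact mem_support_iff.1 hm hc.symm
  · rw [Finsupp.mem_support_iff, bideg_zero]; simp

theorem algebraMap_eq_sum {P : Poly} {k : ℕ} (h : ∀ j, degreeOf j P ≤ k) :
    algebraMap Poly KK P = ∑ a : Fin (k + 1), ∑ b : Fin (k + 1),
      cst (coeff (bideg a b) P) * (coord 0 ^ (a : ℕ) * coord 1 ^ (b : ℕ)) := by
  have key : P = ∑ a : Fin (k + 1), ∑ b : Fin (k + 1), monomial (bideg a b) (coeff (bideg a b) P) := by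
    ext m
    simp only [coeff_sum, coeff_monomial, eq_bideg_iff]
    by_cases hm : m 0 < k + 1 ∧ m 1 < k + 1
    · rw [Finset.sum_eq_single ⟨m 0, hm.1⟩, Finset.sum_eq_single ⟨m 1, hm.2⟩, if_pos ⟨rfl, rfl⟩]
      · congr 1
        exact (eq_bideg_iff.2 ⟨rfl, rfl⟩).symm
      · intro b _ hb
        exact if_neg fun H => hb (Fin.ext H.2)
      · simp
      · intro a _ ha
        exact Finset.sum_eq_zero fun b _ => if_neg fun H => ha (Fin.ext H.1)
      · simp
    · rw [Finset.sum_eq_zero]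
      · by_contra hne
        have hs := mem_support_iff.2 hne
        exact hm ⟨Nat.lt_succ_of_le ((monomial_le_degreeOf 0 hs).trans (h 0)),
          Nat.lt_succ_of_le ((monomial_le_degreeOf 1 hs).trans (h 1))⟩
      · intro a _
        refine Finset.sum_eq_zero fun b _ => if_neg ?_
        rintro ⟨h1, h2⟩
        exact hm ⟨h1 ▸ a.2, h2 ▸ b.2⟩
  conv_lhs => rw [key, ← aeval_coord]
  simp only [map_sum, aeval_monomial_bideg]

theorem Tends.pow_fin_three {B : Subring KK} (hB : IsLoc B) {x : KK} {a : ℂ} (h : Tends B x a)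
    (i : Fin 3) : Tends B (1 * x ^ (i : ℕ)) (![1, a, a ^ 2] i) := by
  fin_cases i
  · exact tends_one.congr (by simp) rfl
  · exact h.congr (by simp) rfl
  · exact (h.mul h hB).congr (by simp [sq]) (by simp [sq])

theorem Vanishes.pow_fin_three {B : Subring KK} (hB : IsLoc B) {x : KK} (hx : x ≠ 0)
    (h : Vanishes B x⁻¹) (i : Fin 3) : Tends B (x⁻¹ ^ 2 * x ^ (i : ℕ)) (![0, 0, 1] i) := by
  fin_cases i
  · exact (h.tends.mul h.tends hB).congr (by simp [sq]) (by simp)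
  · exact h.tends.congr (by simp [sq, hx]) rfl
  · exact tends_one.congr (by simp [hx]) rfl

theorem sum_eq_zero_of_vanishes {B : Subring KK} (hB : IsLoc B) {x y p r P : KK} {c : Fin 3 → Fin 3 → ℂ}
    (hP : P = ∑ a : Fin 3, ∑ b : Fin 3, cst (c a b) * (x ^ (a : ℕ) * y ^ (b : ℕ))) {α β : Fin 3 → ℂ}
    (hα : ∀ i : Fin 3, Tends B (p * x ^ (i : ℕ)) (α i))
    (hβ : ∀ i : Fin 3, Tends B (r * y ^ (i : ℕ)) (β i)) (hv : Vanishes B (p * r * P)) :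
    ∑ a, ∑ b, c a b * (α a * β b) = 0 := by
  refine Tends.unique ?_ hv.tends hB
  have h1 : ∀ a b : Fin 3, Tends B (cst (c a b) * ((p * x ^ (a : ℕ)) * (r * y ^ (b : ℕ))))
    (c a b * (α a * β b)) := fun a b => (tends_cst _).mul ((hα a).mul (hβ b) hB) hB
  simp only [Fin.sum_univ_three] at hP ⊢
  refine Tends.congr (((((h1 0 0).add (h1 0 1) hB).add (h1 0 2) hB).add
    ((((h1 1 0).add (h1 1 1) hB).add (h1 1 2) hB)) hB).add
    ((((h1 2 0).add (h1 2 1) hB).add (h1 2 2) hB)) hB) ?_ rfl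
  rw [hP]
  ring

/-- A linear combination of tending functions, up to a vanishing remainder. -/
theorem linear_eq_zero_of_vanishes {B : Subring KK} (hB : IsLoc B) {s u R P : KK} {a b k : ℂ}
    (hs : Tends B s k) (hu : Vanishes B u) (hR : R ∈ B) (hv : Vanishes B P)
    (hP : P = cst a + cst b * s + u * R) : a + b * k = 0 := by
  refine Tends.unique ?_ hv.tends hB
  exact (((tends_cst a).add ((tends_cst b).mul hs hB) hB).add (hu.mul_mem hR hB).tends hB).congr hP
    (by ring)

theorem sum_single_apply {S : Set (Subring KK)} {d : Fin 6 → PrimeDiv S} (hd : Function.Injective d)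
    (V : PrimeDiv S) : ((∃ i, V = d i) ∧ (∑ i, Finsupp.single (d i) (1 : ℤ)) V = 1) ∨
      ((∀ i, V ≠ d i) ∧ (∑ i, Finsupp.single (d i) (1 : ℤ)) V = 0) := by
  classical
  rw [Finsupp.finsetSum_apply]
  by_cases h : ∃ i, V = d i
  · left
    obtain ⟨i, rfl⟩ := h
    refine ⟨⟨i, rfl⟩, ?_⟩
    rw [Finset.sum_eq_single i (fun j _ hj => Finsupp.single_eq_of_ne (hd.ne hj.symm)) (by simp)]
    simp
  · right
    push Not at h
    exact ⟨h, Finset.sum_eq_zero fun i _ => Finsupp.single_eq_of_ne (h i)⟩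

/-- The components of the anticanonical divisor of the (b)-model. -/
def compB {a : Fin 5 → ℂ} (ha : ∀ i, a i ≠ 0) : Fin 6 → PrimeDiv (confB a).surface :=
  ![(markB ha).valid.basicDiv 0, (markB ha).valid.basicDiv 3, (markB ha).valid.basicDiv 1,
    (markB ha).valid.planeDiv (irrXC 0 0), (markB ha).valid.basicDiv 7,
    (markB ha).valid.planeDiv (irrXC 1 0)]

theorem deltaB_eq : deltaB = ![basicClasses nextB poleB 0, basicClasses nextB poleB 3,
    basicClasses nextB poleB 1,
    basicClasses nextB poleB 0 - ∑ i, (![-1, -1, -1, 0, 1, 1, 1, 0] i : ℤ) • excClasses nextB i,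
    basicClasses nextB poleB 7,
    basicClasses nextB poleB 1 - ∑ i, (![0, -1, -1, -1, 0, 1, 1, 1] i : ℤ) • excClasses nextB i] := by
  decide +kernel

theorem cls_compB {a : Fin 5 → ℂ} (ha : ∀ i, a i ≠ 0) (m : Marking (confB a)) (i : Fin 6) :
    m.equiv (deltaB i) = cls (Finsupp.single (compB ha i) 1) := by
  rw [deltaB_eq]
  have h1 := ha 1
  have h2 := ha 2
  fin_cases i
  · exact (markB ha).equiv_basicClass m 0
  · exact (markB ha).equiv_basicClass m 3
  · exact (markB ha).equiv_basicClass m 1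
  · refine (markB ha).equiv_linear m (j := 0) (c := 0) (o := ![-1, -1, -1, 0, 1, 1, 1, 0])
      fun i => orderB ha ?_
    fin_cases i <;> simp [baseB, h1.symm]
  · exact (markB ha).equiv_basicClass m 7
  · refine (markB ha).equiv_linear m (j := 1) (c := 0) (o := ![0, -1, -1, -1, 0, 1, 1, 1])
      fun i => orderB ha ?_
    fin_cases i <;> simp [baseB, h2.symm]

theorem inter_deltaB (i j : Fin 6) : inter (deltaB i) (deltaB j) =
    if i = j then -2 else if j = i + 1 ∨ i = j + 1 then 1 else 0 := by
  revert i j; decide +kernel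

theorem sum_deltaB : ∑ i, deltaB i = antiK := by decide +kernel

theorem compB_injective {a : Fin 5 → ℂ} (ha : ∀ i, a i ≠ 0) : Function.Injective (compB ha) := by
  intro i j hij
  have h1 := cls_compB ha (markB ha).marking i
  rw [hij, ← cls_compB ha (markB ha).marking] at h1
  have : ∀ i j, deltaB i = deltaB j → i = j := by decide +kernel
  exact this i j ((markB ha).marking.equiv.injective h1)

theorem compB_cases {a : Fin 5 → ℂ} (ha : ∀ i, a i ≠ 0) (i : Fin 6) :
    (∃ k, (k = 0 ∨ k = 1 ∨ k = 3 ∨ k = 7) ∧ compB ha i = (markB ha).valid.basicDiv k) ∨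
      ∃ j, compB ha i = (markB ha).valid.planeDiv (irrXC j 0) := by
  fin_cases i
  · exact Or.inl ⟨0, by decide, rfl⟩
  · exact Or.inl ⟨3, by decide, rfl⟩
  · exact Or.inl ⟨1, by decide, rfl⟩
  · exact Or.inr ⟨0, rfl⟩
  · exact Or.inl ⟨7, by decide, rfl⟩
  · exact Or.inr ⟨1, rfl⟩

theorem exists_polynomial {a : Fin 5 → ℂ} (ha : ∀ i, a i ≠ 0) {h : KK}
    (hne : h ≠ 0) {D : PrimeDiv (confB a).surface →₀ ℤ} (hD : ∀ V, 0 ≤ D V)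
    (hh : ∀ V : PrimeDiv (confB a).surface,
      HasOrder V.1 h (D V - (∑ i, Finsupp.single (compB ha i) (1 : ℤ)) V)) :
    ∃ c : Fin 3 → Fin 3 → ℂ, h * coord 0 * coord 1 = ∑ i : Fin 3, ∑ j : Fin 3,
      cst (c i j) * (coord 0 ^ (i : ℕ) * coord 1 ^ (j : ℕ)) := by
  have hC := (markB ha).valid
  have horder : ∀ (V : PrimeDiv (confB a).surface) (x : KK), HasOrder V.1 x 1 → h * x ∈ V.1 := by
    intro V x hx
    have hV := hC.isCurve V
    refine (hV.mem_iff (hV.hasOrder_mul (hh V) hx)).2 ?_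
    have := hD V
    rcases sum_single_apply (compB_injective ha) V with ⟨-, h⟩ | ⟨-, h⟩ <;> rw [h] <;> omega
  have hmem : ∀ V : PrimeDiv (confB a).surface, (∀ i, V ≠ compB ha i) → h ∈ V.1 := by
    intro V hV
    refine ((hC.isCurve V).mem_iff (hh V)).2 ?_
    rcases sum_single_apply (compB_injective ha) V with ⟨⟨i, hi⟩, -⟩ | ⟨-, h⟩
    · exact absurd hi (hV i)
    · rw [h, sub_zero]; exact hD V
  obtain ⟨P, hP⟩ : ∃ P : Poly, h * coord 0 * coord 1 = algebraMap Poly KK P := by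
    refine exists_poly_of_forall_mem fun π => ?_
    have m0 : coord 0 ∈ π.ring := algebraMap_mem_ring π (X 0)
    have m1 : coord 1 ∈ π.ring := algebraMap_mem_ring π (X 1)
    have hirr : ∀ j, algebraMap Poly KK (irrXC j 0).1 = coord j := fun j => by simp [irrXC, coord]
    by_cases h0 : π.ring = (irrXC 0 0).ring
    · have := horder (hC.planeDiv (irrXC 0 0)) (coord 0)
        (by rw [← hirr]; exact IrrPoly.hasOrder_self _)
      rw [h0] at m1 ⊢
      exact mul_mem this m1
    by_cases h1 : π.ring = (irrXC 1 0).ring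
    · have := horder (hC.planeDiv (irrXC 1 0)) (coord 1)
        (by rw [← hirr]; exact IrrPoly.hasOrder_self _)
      rw [h1] at m0 ⊢
      rw [mul_right_comm]
      exact mul_mem this m0
    refine mul_mem (mul_mem (hmem (hC.planeDiv π) fun i hi => ?_) m0) m1
    rcases compB_cases ha i with ⟨k, -, hk⟩ | ⟨j, hj⟩
    · exact hC.basic_ne_ring k π (congrArg Subtype.val (hi.trans hk)).symm
    · have hj' : π.ring = (irrXC j 0).ring := congrArg Subtype.val (hi.trans hj)
      fin_cases j
      · exact h0 hj'
      · exact h1 hj'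
  have hinf : ∀ j, HasOrder (lineInf j) (coord j)⁻¹ 1 ∧ coord (1 - j) ∈ lineInf j := fun j =>
    ⟨(isChart_lineInf j).hasOrder_left, (isChart_lineInf j).crv_mem_right⟩
  have hdeg : ∀ j, degreeOf j P ≤ 2 := by
    refine fun j => degreeOf_le_of_mem_lineInf ?_
    rw [← hP]
    have h1 := horder (hC.basicDiv (fst j)) (coord j)⁻¹
    change (HasOrder ((confB a).basic (fst j)) _ _ → _ ∈ (confB a).basic (fst j)) at h1
    rw [basic_fst] at h1
    have h2 := mul_mem (h1 (hinf j).1) (hinf j).2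
    have hj := coord_ne_zero j
    have he : h * coord 0 * coord 1 * (coord j)⁻¹ ^ 2 = h * (coord j)⁻¹ * coord (1 - j) := by
      fin_cases j
      · change h * coord 0 * coord 1 * (coord 0)⁻¹ ^ 2 = h * (coord 0)⁻¹ * coord 1
        replace hj : coord 0 ≠ 0 := hj
        field_simp
      · change h * coord 0 * coord 1 * (coord 1)⁻¹ ^ 2 = h * (coord 1)⁻¹ * coord 0
        replace hj : coord 1 ≠ 0 := hj
        field_simp
    rwa [he]
  exact ⟨fun i j => coeff (bideg i j) P, hP.trans (algebraMap_eq_sum hdeg)⟩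

/-- The only function whose poles are bounded by the anticanonical divisor are the constants. -/
theorem eq_cst_of_pole_le {a : Fin 5 → ℂ} (ha : IsRootVars a) (hq : a 0 * a 1 * a 2 ≠ 1) {h : KK}
    (hne : h ≠ 0) {D : PrimeDiv (confB a).surface →₀ ℤ} (hD : ∀ V, 0 ≤ D V)
    (hh : ∀ V : PrimeDiv (confB a).surface,
      HasOrder V.1 h (D V - (∑ i, Finsupp.single (compB ha.1 i) (1 : ℤ)) V)) :
    ∃ c, c ≠ 0 ∧ h = cst c := by
  obtain ⟨ha, hrel⟩ := ha
  have hC := (markB ha).valid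
  obtain ⟨c, hP⟩ := exists_polynomial ha hne hD hh
  have hx := coord_ne_zero 0
  have hy := coord_ne_zero 1
  have hloc : ∀ i, IsLoc ((confB a).exc i) := fun i => (hC.isCurve_exc i).isLoc
  have hbase : ∀ i k, Vanishes ((confB a).exc i) (param (coord k) (baseB a i k)) :=
    (treeB ha).vanishes_exc
  have hmem : ∀ i : Fin 8, i ≠ 1 → i ≠ 5 → h ∈ (confB a).exc i := by
    intro i h1 h5
    refine ((hC.isCurve (hC.basicDiv i.succ.succ)).mem_iff (hh _)).2 ?_
    rcases sum_single_apply (compB_injective ha) (hC.basicDiv i.succ.succ) with ⟨⟨k, hk⟩, -⟩ | ⟨-, h⟩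
    · exfalso
      rcases compB_cases ha k with ⟨l, hl, hl'⟩ | ⟨j, hj⟩
      · have := hC.basicDiv_injective (hk.trans hl')
        clear hk hl' hloc hbase
        revert i l
        decide
      · exact hC.basic_ne_ring i.succ.succ (irrXC j 0) (congrArg Subtype.val (hk.trans hj))
    · rw [h, sub_zero]; exact hD _
  have hmem' : ∀ (i : Fin 8) (x : KK), HasOrder ((confB a).exc i) x 1 → h * x ∈ (confB a).exc i := by
    intro i x hx
    have hV := hC.isCurve_exc i
    refine (hV.mem_iff (hV.hasOrder_mul (hh (hC.basicDiv i.succ.succ)) hx)).2 ?_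
    have := hD (hC.basicDiv i.succ.succ)
    rcases sum_single_apply (compB_injective ha) (hC.basicDiv i.succ.succ) with ⟨-, h⟩ | ⟨-, h⟩ <;>
      rw [h] <;> omega
  have t0 : Tends ((confB a).exc 0) (coord 1) 1 := hbase 0 1
  have t3 : Tends ((confB a).exc 3) (coord 0) 1 := hbase 3 0
  have t4 : Tends ((confB a).exc 4) (coord 0) 0 := hbase 4 0
  have t4' : Tends ((confB a).exc 4) (coord 1) (1 / a 2) := hbase 4 1
  have t5 : Tends ((confB a).exc 5) (coord 0) 0 := hbase 5 0
  have t5' : Tends ((confB a).exc 5) (coord 1) 0 := hbase 5 1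
  have t7 : Tends ((confB a).exc 7) (coord 0) (a 1) := hbase 7 0
  have t7' : Tends ((confB a).exc 7) (coord 1) 0 := hbase 7 1
  have v0 : Vanishes ((confB a).exc 0) (coord 0)⁻¹ := hbase 0 0
  have v1 : Vanishes ((confB a).exc 1) (coord 0)⁻¹ := hbase 1 0
  have v1' : Vanishes ((confB a).exc 1) (coord 1)⁻¹ := hbase 1 1
  have v2 : Vanishes ((confB a).exc 2) (coord 0)⁻¹ := hbase 2 0
  have v3 : Vanishes ((confB a).exc 3) (coord 1)⁻¹ := hbase 3 1
  have v6 : Tends ((confB a).exc 6) (coord 0) 0 := hbase 6 0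
  have o1 : HasOrder ((confB a).exc 1) (coord 0)⁻¹ 1 := by
    have := (hC.isCurve_exc 1).hasOrder_inv (orderB ha (i := 1) (j := 0) (c := 0) (o := -1)
      (Or.inl ⟨rfl, rfl⟩))
    rwa [cst_zero, sub_zero] at this
  have o5 : HasOrder ((confB a).exc 5) (coord 0) 1 := by
    have := orderB ha (i := 5) (j := 0) (c := 0) (o := 1) (Or.inr (Or.inl ⟨rfl, rfl⟩))
    rwa [cst_zero, sub_zero] at this
  have e0 := sum_eq_zero_of_vanishes (hloc 0) hP (v0.pow_fin_three (hloc 0) hx)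
    (t0.pow_fin_three (hloc 0)) ((v0.mul_mem (mul_mem (hmem 0 (by decide) (by decide))
      (t0.mem (hloc 0))) (hloc 0)).tends.vanishes (by field_simp) rfl)
  have e3 := sum_eq_zero_of_vanishes (hloc 3) hP (t3.pow_fin_three (hloc 3))
    (v3.pow_fin_three (hloc 3) hy) ((v3.mul_mem (mul_mem (hmem 3 (by decide) (by decide))
      (t3.mem (hloc 3))) (hloc 3)).tends.vanishes (by field_simp) rfl)
  have e4 := sum_eq_zero_of_vanishes (hloc 4) hP (t4.pow_fin_three (hloc 4))
    (t4'.pow_fin_three (hloc 4)) (((tends_zero_iff.1 t4).mul_mem (mul_mem (hmem 4 (by decide) (by decide))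
      (t4'.mem (hloc 4))) (hloc 4)).tends.vanishes (by ring) rfl)
  have e7 := sum_eq_zero_of_vanishes (hloc 7) hP (t7.pow_fin_three (hloc 7))
    (t7'.pow_fin_three (hloc 7)) (((tends_zero_iff.1 t7').mul_mem (mul_mem (hmem 7 (by decide) (by decide))
      (t7.mem (hloc 7))) (hloc 7)).tends.vanishes (by ring) rfl)
  have e1 := sum_eq_zero_of_vanishes (hloc 1) hP (v1.pow_fin_three (hloc 1) hx)
    (v1'.pow_fin_three (hloc 1) hy) ((v1'.mul_mem (hmem' 1 _ o1) (hloc 1)).tends.vanishes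
      (by field_simp) rfl)
  have e5 := sum_eq_zero_of_vanishes (hloc 5) hP (t5.pow_fin_three (hloc 5))
    (t5'.pow_fin_three (hloc 5)) (((tends_zero_iff.1 t5').mul_mem (hmem' 5 _ o5) (hloc 5)).tends.vanishes
      (by ring) rfl)
  simp only [Fin.sum_univ_three, Matrix.cons_val, mul_one, mul_zero, one_mul, add_zero, zero_add,
    Fin.isValue, ne_eq, OfNat.ofNat_ne_zero, not_false_eq_true, zero_pow, zero_mul] at e0 e1 e3 e4 e5 e7
  simp only [Fin.sum_univ_three, Fin.isValue, Fin.coe_ofNat_eq_mod, Nat.reduceMod, Nat.zero_mod,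
    Nat.one_mod, pow_zero, pow_one, one_mul, mul_one] at hP
  rw [e1, e5, cst_zero] at hP
  have s2 : Tends ((confB a).exc 2) (coord 0 / coord 1) (-(a 4 / a 0)) :=
    tends_of_vanishes_add ((treeB ha).valid.chart 2 |>.exc_dominates (((treeB ha).chart 2).vanishes_right))
  have s6 : Tends ((confB a).exc 6) (coord 1 / coord 0) (-(1 / a 4)) :=
    tends_of_vanishes_add ((treeB ha).valid.chart 6 |>.exc_dominates (((treeB ha).chart 6).vanishes_right))
  have e2 : c 1 2 + c 2 1 * (-(a 4 / a 0)) = 0 := by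
    have hs := s2.mem (hloc 2)
    have hu := v2.1
    have hc := (hloc 2).cst_mem
    refine linear_eq_zero_of_vanishes (hloc 2) s2 v2 (R := cst (c 2 0) * (coord 0 / coord 1) ^ 2 +
      cst (c 1 1) * (coord 0 / coord 1) + cst (c 0 2) + (coord 0)⁻¹ * (cst (c 1 0) * (coord 0 / coord 1) ^ 2
        + cst (c 0 1) * (coord 0 / coord 1))) ?_
      (v2.mul_mem (mul_mem (hmem 2 (by decide) (by decide)) hs) (hloc 2)) ?_
    · exact add_mem (add_mem (add_mem (mul_mem (hc _) (pow_mem hs 2)) (mul_mem (hc _) hs)) (hc _))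
        (mul_mem hu (add_mem (mul_mem (hc _) (pow_mem hs 2)) (mul_mem (hc _) hs)))
    · field_simp
      linear_combination hP
  have e6 : c 1 0 + c 0 1 * (-(1 / a 4)) = 0 := by
    have hs := s6.mem (hloc 6)
    have hu := v6.mem (hloc 6)
    have hc := (hloc 6).cst_mem
    refine linear_eq_zero_of_vanishes (hloc 6) s6 (tends_zero_iff.1 v6) (R := cst (c 2 0) +
      cst (c 1 1) * (coord 1 / coord 0) + cst (c 0 2) * (coord 1 / coord 0) ^ 2 +
        coord 0 * (cst (c 2 1) * (coord 1 / coord 0) + cst (c 1 2) * (coord 1 / coord 0) ^ 2)) ?_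
      ((tends_zero_iff.1 v6).mul_mem (mul_mem (hmem 6 (by decide) (by decide)) hs) (hloc 6)) ?_
    · exact add_mem (add_mem (add_mem (hc _) (mul_mem (hc _) hs)) (mul_mem (hc _) (pow_mem hs 2)))
        (mul_mem hu (add_mem (mul_mem (hc _) hs) (mul_mem (hc _) (pow_mem hs 2))))
    · field_simp
      linear_combination hP
  rw [e5, zero_add] at e4 e7
  have h0 := ha 0
  have h1 := ha 1
  have h2 := ha 2
  have h4 := ha 4
  have f4 : c 0 1 = -c 0 2 / a 2 := by
    field_simp at e4 ⊢
    linear_combination e4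
  have f7 : c 1 0 = -c 2 0 * a 1 := mul_right_cancel₀ h1 (by linear_combination e7)
  have f0 : c 2 0 = -c 2 1 := by linear_combination e0 - e1
  have f3 : c 0 2 = -c 1 2 := by linear_combination e3 - e1
  have f2 : c 1 2 = c 2 1 * a 4 / a 0 := by linear_combination e2
  rw [f4, f7, f0, f3, f2] at e6
  have z21 : c 2 1 = 0 := by
    have : c 2 1 * (a 0 * a 1 * a 2 - 1) = 0 := by
      field_simp at e6
      linear_combination e6
    exact (mul_eq_zero.1 this).resolve_right (sub_ne_zero.2 hq)
  have hh' : h = cst (c 1 1) := by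
    simp only [f4, f7, f0, f3, f2, z21, neg_zero, zero_mul, zero_div, cst_zero, zero_add, add_zero] at hP
    refine mul_right_cancel₀ (mul_ne_zero hx hy) ?_
    rw [← mul_assoc, hP]
  refine ⟨c 1 1, ?_, hh'⟩
  rintro h0
  exact hne (by rw [hh', h0, cst_zero])

theorem isSakaiSurfaceA5_confB {a : Fin 5 → ℂ} (ha : IsRootVars a) (hq : a 0 * a 1 * a 2 ≠ 1) :
    IsSakaiSurfaceA5 (confB a) deltaB := by
  refine ⟨inter_deltaB, sum_deltaB, (markB ha.1).marking, compB ha.1, cls_compB ha.1 _,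
    fun D hD hcls => ?_⟩
  have hC := (markB ha.1).valid
  have hE : cls (∑ i, Finsupp.single (compB ha.1 i) (1 : ℤ)) = (markB ha.1).marking.equiv antiK := by
    rw [← sum_deltaB, map_sum]
    simp only [cls_compB ha.1]
    exact map_sum (QuotientAddGroup.mk' _) _ _
  rw [← hE] at hcls
  obtain ⟨h, hne, hh⟩ := (cls_eq_cls hC.isCurve).1 hcls.symm
  obtain ⟨c, hc, rfl⟩ := eq_cst_of_pole_le ha hq hne hD hh
  ext V
  have hV := hC.isCurve V
  exact sub_eq_zero.1 (hV.hasOrder_unique (hh V) (hV.hasOrder_cst hc))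

theorem isSakaiSurfaceA5_confA {a : Fin 5 → ℂ} (ha : IsRootVars a) (hq : a 0 * a 1 * a 2 ≠ 1)
    (ha2 : a 2 ≠ 1) : IsSakaiSurfaceA5 (confA a) deltaA := by
  obtain ⟨τ, -, -, hτ⟩ := iso_BA ha.1 ha2
  have hinv := BtoA_comp_BtoA
  refine IsSakaiSurfaceA5.of_iso (markB ha.1) (hτ.symm hinv) ?_
    (Function.LeftInverse.injective (g := BtoA) fun x => LinearMap.congr_fun hinv x) ?_ ?_
    (isSakaiSurfaceA5_confB ha hq)
  · decide +kernel
  · decide +kernel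
  · decide +kernel

/-! ### The recurrence in terms of the standard mappings -/

/-- The composition of the two standard mappings in the coordinates `x, y`. -/
theorem laguerre_of_standard {K : Type*} [Field K] {q a Q T x g f₁ g₁ u F G x' y' : K} (hq : q ≠ 0)
    (ha : a ≠ 0) (hQ : Q ≠ 0) (hT : T ≠ 0) (hx : x ≠ 0) (hg : g ≠ 0) (hg1 : g - 1 ≠ 0)
    (hf₁ : f₁ ≠ 0) (hf₁1 : f₁ - 1 ≠ 0) (hg₁ : g₁ ≠ 0) (hg₁1 : g₁ - 1 ≠ 0) (hu : u - 1 ≠ 0)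
    (hF : F ≠ 0) (hG : G ≠ 0) (hG1 : G - 1 ≠ 0) (hx' : x' ≠ 0) (hs' : x' * y' - 1 ≠ 0)
    (hu' : u = F * (G - 1) / G)
    (e1 : -(q / (a * Q * T)) * x * g * f₁ = -(q / (a * Q * T)) * (g * (g - 1 / a) / (g - 1)))
    (e2 : g₁ * g = -(a * Q * T / q) * (f₁ * (f₁ - 1 / (a * T)) / (f₁ - 1)))
    (e3 : f₁ * (g₁ - 1) / g₁ * u = -((q / (a * Q * T) * g₁ - 1 / (a * a * Q * T)) *
      (q / (a * Q * T) * g₁ - q / (a * Q * T)) / (q / (a * Q * T) * g₁)))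
    (e4 : 1 / (a * Q * T) * G * (q / (a * Q * T) * g₁) =
      1 / (a * T) * (1 / (a * Q * T)) * ((u - 1 / (a * Q)) / (u - 1)))
    (hF' : F = (x' - T) / (T * (x' * y' - 1)))
    (hG' : G = -(a * Q) * ((x' - T) / (x' * (x' * y' - 1)))) :
    x * y' - 1 = a * (x - 1) * g ∧
    (x' * y' - 1) * (a * (x - 1) * g) = a ^ 2 * Q * T * ((y' - 1) * (y' - 1 / T) / (a - y')) := by
  obtain ⟨p, hp⟩ : ∃ p, p = a * g - 1 := ⟨_, rfl⟩
  obtain ⟨r, hr⟩ : ∃ r, r = (g - 1) * x := ⟨_, rfl⟩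
  obtain ⟨V, hV⟩ : ∃ V, V = g * (p - a * r) := ⟨_, rfl⟩
  have hr0 : r ≠ 0 := hr ▸ mul_ne_zero hg1 hx
  have k1 : f₁ = p / (a * r) := by
    rw [hp, hr]
    field_simp at e1 ⊢
    linear_combination -e1
  have hp0 : p ≠ 0 := by
    rintro h
    exact hf₁ (by rw [k1, h, zero_div])
  have hpr : p - a * r ≠ 0 := by
    intro h
    refine hf₁1 ?_
    rw [k1]
    field_simp
    rw [h, mul_zero]
  have hV0 : V ≠ 0 := hV ▸ mul_ne_zero hg hpr
  have k2 : g₁ = -(a * Q / (q * a)) * (p * (T * p - r) / (r * V)) := by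
    refine mul_right_cancel₀ hg ?_
    rw [e2, hV, k1]
    have : p / (a * r) - 1 = (p - a * r) / (a * r) := by field_simp
    rw [this]
    field_simp
  have hU : T * p - r ≠ 0 := by
    intro h
    exact hg₁ (by rw [k2, h]; simp)
  have k3 : u = (a * Q * (T * p - r) * p + r * V) / (a * Q * T * V * p) := by
    have e3' : f₁ * u = -(q / (a * Q * T)) * (g₁ - 1 / (q * a)) := by
      field_simp at e3 ⊢
      linear_combination e3
    rw [k1, k2] at e3'
    field_simp at e3' ⊢
    linear_combination e3'
  obtain ⟨S, hS⟩ : ∃ S, S = a * Q * (T * p - r) * p + r * V := ⟨_, rfl⟩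
  obtain ⟨B, hB⟩ : ∃ B, B = S - a * Q * T * V * p := ⟨_, rfl⟩
  rw [← hS] at k3
  have hu1 : u - 1 = B / (a * Q * T * V * p) := by
    rw [k3, hB]
    field_simp
  have hB0 : B ≠ 0 := by
    rintro h
    exact hu (by rw [hu1, h, zero_div])
  have k4 : G = -((a * Q * p - V) * (r * V)) / (p * B) := by
    have : u - 1 / (a * Q) = (T * p - r) * (a * Q * p - V) / (a * Q * T * V * p) := by
      rw [k3, hS]
      field_simp
      ring
    rw [hu1, this, k2] at e4
    field_simp at e4 ⊢
    linear_combination -e4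
  have k5 : G - 1 = -((p - V) * S) / (p * B) := by
    rw [k4]
    field_simp
    rw [hB, hS]
    ring
  have hpV : p - V ≠ 0 := by
    intro h
    exact hG1 (by rw [k5, h]; simp)
  have hS0 : S ≠ 0 := by
    intro h
    exact hG1 (by rw [k5, h]; simp)
  have hcV : a * Q * p - V ≠ 0 := by
    intro h
    exact hG (by rw [k4, h]; simp)
  have k6 : F = (a * Q * p - V) * r / (a * Q * T * p * (p - V)) := by
    have : F = u * G / (G - 1) := by
      rw [hu']
      field_simp
    rw [this, k3, k5, k4]
    field_simp
  have k7 : x' = B / (V * (p - V)) := by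
    have hF0 : x' - T ≠ 0 := by
      intro h
      exact hF (by rw [hF', h, zero_div])
    have : x' * G = -(a * Q * T) * F := by
      rw [hF', hG']
      field_simp
    rw [k4, k6] at this
    field_simp at this ⊢
    linear_combination -this
  have k8 : y' = (p - V) / r := by
    rw [k6, eq_div_iff (mul_ne_zero hT hs')] at hF'
    have h1 : x' - T = (a * Q * p - V) * (T * p - r - T * V) / (V * (p - V)) := by
      rw [k7, hB, hS]
      field_simp
      ring
    rw [h1] at hF'
    have h2 : x' * y' - 1 = a * Q * p * (T * p - r - T * V) / (r * V) := by
      field_simp at hF' ⊢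
      linear_combination hF'
    have h3 : x' * y' = x' * ((p - V) / r) := by
      rw [← sub_left_inj (a := (1 : K)), h2, k7, hB, hS]
      field_simp
      ring
    exact mul_left_cancel₀ hx' h3
  have hpV' : p - V = (g - 1) * (1 + a * (x - 1) * g) := by
    rw [hV, hr, hp]
    ring
  have k9 : y' = (1 + a * (x - 1) * g) / x := by
    rw [k8, hpV', hr]
    field_simp
  have h1 : x * y' - 1 = a * (x - 1) * g := by
    rw [k9]
    field_simp
    ring
  refine ⟨h1, ?_⟩
  have h2 : a - y' = (p - a * r) / x := by
    rw [k9, hr, hp]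
    field_simp
    ring
  have h3 : y' - 1 = (x - 1) * p / x := by
    rw [k9, hp]
    field_simp
    ring
  have h4 : x' * y' - 1 = a * Q * p * (T * y' - 1) / V := by
    rw [k7, k8, hB, hS]
    field_simp
    ring
  rw [h4, h3, h2, hV]
  field_simp

/-- The change of basis from the (b)-model to the `q`-Laguerre surface. -/
def toX : PicLat →ₗ[ℤ] PicLat :=
  ofImages ![dv 1 1 [2, 3], dv 2 1 [2, 3, 4, 6], ex 7, dv 1 1 [2, 3, 6], ex 1, dv 1 0 [3], ex 5, dv 1 1 [2, 3, 4], dv 1 0 [2], ex 8]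

theorem toX_comp_toB : toX ∘ₗ toB = LinearMap.id := by
  have : ∀ i, toX (toB (Pi.single i 1)) = Pi.single i 1 := by decide +kernel
  ext i : 1
  ext1
  exact this i

theorem toB_comp_toX : toB ∘ₗ toX = LinearMap.id := by
  have : ∀ i, toB (toX (Pi.single i 1)) = Pi.single i 1 := by decide +kernel
  ext i : 1
  ext1
  exact this i

theorem toX_toB (c : PicLat) : toX (toB c) = c := LinearMap.congr_fun toX_comp_toB c

theorem toB_toX (c : PicLat) : toB (toX c) = c := LinearMap.congr_fun toB_comp_toX c

/-- The change of basis as an equivalence. -/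
def equivB : PicLat ≃ₗ[ℤ] PicLat := LinearEquiv.ofLinearMap toB toX toB_comp_toX toX_comp_toB

/-- An isometry of the Picard lattice of the (b)-model, on the `q`-Laguerre surface. -/
def conjB (L : PicLat ≃ₗ[ℤ] PicLat) : PicLat ≃ₗ[ℤ] PicLat := (equivB.trans L).trans equivB.symm

theorem toB_conjB (L : PicLat ≃ₗ[ℤ] PicLat) (c : PicLat) : toB (conjB L c) = L (toB c) := toB_toX _

theorem toB_alphaX (i : Fin 5) : toB (alphaX i) = alphaB i := by revert i; decide +kernel

theorem lat_psiW_phiW_alphaB (i : Fin 5) :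
    lat (psiW ++ phiW) (alphaB i) = alphaB i + (![0, 1, -1, -1, 1] i : ℤ) • antiK := by
  revert i; decide +kernel

theorem conjB_alphaX (i : Fin 5) :
    conjB (lat (psiW ++ phiW)) (alphaX i) = alphaX i + (![0, 1, -1, -1, 1] i : ℤ) • antiK := by
  have h : toB antiK = antiK := by decide +kernel
  refine equivB.injective ((toB_conjB _ _).trans ?_)
  change _ = toB _
  rw [map_add, map_smul, h, toB_alphaX, lat_psiW_phiW_alphaB]

theorem toB_deltaX (i : Fin 6) : toB (deltaX i) = deltaB i := by revert i; decide +kernel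

theorem isSakaiSurfaceA5_confX {q Q T : ℂ} {n : ℕ} (hq : q ≠ 0) (hQ : Q ≠ 0) (hT : T ≠ 0) (hT1 : T ≠ 1)
    (hq1 : q ≠ 1) : IsSakaiSurfaceA5 (confX q Q T n) deltaX := by
  obtain ⟨χ, -, -, hχ⟩ := iso_X (n := n) hq hQ hT hT1
  have hr := isRootVars_rootX (n := n) hq hQ hT
  refine IsSakaiSurfaceA5.of_iso (markB hr.1) hχ toB_deltaX
    (Function.LeftInverse.injective toX_toB) ?_ ?_ (isSakaiSurfaceA5_confB hr ?_)
  · decide +kernel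
  · decide +kernel
  · simp only [rootX, Matrix.cons_val, pow_succ]
    field_simp
    exact hq1

/-! ### The Picard lattice -/

theorem latGen_mem (l : List Gen) : lat l ∈ extWeyl :=
  Subgroup.list_prod_mem _ fun _ hx => by
    obtain ⟨s, -, rfl⟩ := List.mem_map.1 hx
    exact Subgroup.subset_closure ⟨s, rfl⟩

theorem lat_phiW_alphaB (i : Fin 5) :
    lat phiW (alphaB i) = alphaB i + (![0, 1, -1, 0, 0] i : ℤ) • antiK := by
  revert i; decide +kernel

theorem lat_psiW_alphaB (i : Fin 5) :
    lat psiW (alphaB i) = alphaB i + (![0, 0, 0, -1, 1] i : ℤ) • antiK := by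
  revert i; decide +kernel

theorem lat_psiW_phiW : lat (psiW ++ phiW) = lat (phiW ++ psiW) :=
  lat_ext (by decide +kernel)

theorem lat_lagW : lat (psiW ++ phiW) = lat lagW :=
  lat_ext (by decide +kernel)

/-- The integral matrix of the action of a word. -/
def intMatrix (l : List Gen) : Matrix (Fin 10) (Fin 10) ℤ := LinearMap.toMatrix' (lat l).toLinearMap

theorem trace_pow_eq {P : Matrix (Fin 10) (Fin 10) ℂ} (hP : IsUnit P) {l l' : List Gen}
    (h : P * latMatrix l = latMatrix l' * P) (k : ℕ) :
    (intMatrix l ^ k).trace = (intMatrix l' ^ k).trace := by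
  have hk : P * latMatrix l ^ k = latMatrix l' ^ k * P := (SemiconjBy.pow_right h k)
  obtain ⟨u, rfl⟩ := hP
  have h1 : latMatrix l' ^ k = u * latMatrix l ^ k * (u⁻¹ : (Matrix (Fin 10) (Fin 10) ℂ)ˣ) := by
    rw [hk, mul_assoc, Units.mul_inv, mul_one]
  have h2 : (latMatrix l ^ k).trace = (latMatrix l' ^ k).trace := by
    rw [h1, Matrix.trace_mul_comm, ← mul_assoc, Units.inv_mul, one_mul]
  have h3 : ∀ l, latMatrix l ^ k = (Int.castRingHom ℂ).mapMatrix (intMatrix l ^ k) := fun l => by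
    rw [map_pow]; rfl
  have h4 : ∀ l, (latMatrix l ^ k).trace = ((intMatrix l ^ k).trace : ℂ) := fun l => by
    rw [h3]
    exact (AddMonoidHom.map_trace (Int.castRingHom ℂ).toAddMonoidHom _).symm
  rw [h4, h4] at h2
  exact_mod_cast h2

theorem intMatrix_eq {l : List Gen} {R : Fin 10 → PicLat}
    (h : ∀ i, lat l (Pi.single i 1) = R i) : intMatrix l = (Matrix.of R).transpose := by
  ext i j
  rw [intMatrix, LinearMap.toMatrix'_apply, Matrix.transpose_apply, Matrix.of_apply, ← h]
  rfl

/-- The images of the basis vectors under `φ`. -/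
def rowsPhi : Fin 10 → PicLat :=
  ![![3, 2, 0, -1, -1, -2, 0, -1, -1, -2],
    ![2, 1, 0, -1, 0, -1, 0, -1, 0, -1],
    ![2, 1, 0, -1, -1, -1, 0, -1, 0, -1],
    ![1, 1, 0, 0, 0, -1, 0, -1, 0, -1],
    ![1, 0, 0, 0, 0, -1, 0, 0, 0, 0],
    ![0, 0, 1, 0, 0, 0, 0, 0, 0, 0],
    ![2, 1, 0, -1, 0, -1, 0, -1, -1, -1],
    ![1, 1, 0, -1, 0, -1, 0, 0, 0, -1],
    ![1, 0, 0, 0, 0, 0, 0, 0, 0, -1],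
    ![0, 0, 0, 0, 0, 0, 1, 0, 0, 0]]

/-- The images of the basis vectors under `ψ`. -/
def rowsPsi : Fin 10 → PicLat :=
  ![![2, 1, -1, 0, 0, -1, 0, -1, -1, 0],
    ![1, 2, -1, 0, 0, -1, 0, -1, -1, 0],
    ![0, 0, 0, 0, 0, 0, 1, 0, 0, 0],
    ![1, 1, -1, 0, 0, -1, 0, 0, -1, 0],
    ![1, 1, -1, 0, 0, -1, 0, -1, 0, 0],
    ![0, 0, 0, 0, 0, 0, 0, 0, 0, 1],
    ![1, 1, 0, 0, 0, -1, 0, -1, -1, 0],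
    ![0, 0, 0, 1, 0, 0, 0, 0, 0, 0],
    ![0, 0, 0, 0, 1, 0, 0, 0, 0, 0],
    ![1, 1, -1, 0, 0, 0, 0, -1, -1, 0]]

/-- The images of the basis vectors under `ψ ∘ φ`. -/
def rowsLag : Fin 10 → PicLat :=
  ![![4, 3, -1, -1, -1, -3, 0, -2, -2, -2],
    ![3, 2, -1, -1, 0, -2, 0, -2, -1, -1],
    ![2, 1, 0, -1, 0, -1, 0, -1, -1, -1],
    ![2, 2, -1, -1, 0, -2, 0, -1, -1, -1],
    ![2, 1, -1, 0, 0, -1, 0, -1, -1, -1],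
    ![0, 0, 0, 0, 0, 0, 1, 0, 0, 0],
    ![3, 2, -1, -1, -1, -2, 0, -2, -1, -1],
    ![1, 1, 0, 0, 0, -1, 0, -1, 0, -1],
    ![1, 0, 0, 0, 0, -1, 0, 0, 0, 0],
    ![1, 1, 0, 0, 0, -1, 0, -1, -1, 0]]

theorem intMatrix_phiW : intMatrix phiW = (Matrix.of rowsPhi).transpose := intMatrix_eq (by decide +kernel)

theorem intMatrix_psiW : intMatrix psiW = (Matrix.of rowsPsi).transpose := intMatrix_eq (by decide +kernel)

theorem intMatrix_lagW : intMatrix lagW = (Matrix.of rowsLag).transpose := intMatrix_eq (by decide +kernel)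

theorem not_conjugate {P : Matrix (Fin 10) (Fin 10) ℂ} (hP : IsUnit P) :
    P * latMatrix (psiW ++ phiW) ≠ latMatrix phiW * P ∧
      P * latMatrix (psiW ++ phiW) ≠ latMatrix psiW * P := by
  rw [latMatrix, lat_lagW, ← latMatrix]
  constructor <;> intro h
  · have := trace_pow_eq hP h 3
    rw [intMatrix_lagW, intMatrix_phiW, ← Matrix.transpose_pow, ← Matrix.transpose_pow,
      Matrix.trace_transpose, Matrix.trace_transpose, pow_succ, pow_two, pow_succ, pow_two] at this
    exact absurd this (by decide +kernel)
  · have := trace_pow_eq hP h 2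
    rw [intMatrix_lagW, intMatrix_psiW, ← Matrix.transpose_pow, ← Matrix.transpose_pow,
      Matrix.trace_transpose, Matrix.trace_transpose, pow_two, pow_two] at this
    exact absurd this (by decide +kernel)

theorem good_phiW {p : Pt} (hp : p.Good) : (bir phiW p).Good := by
  rw [phiW_eq]
  exact good_sigma₂ (good_sigma₂_three (good_w0 (good_w2 hp)))

theorem good_psiW {p : Pt} (hp : p.Good) : (bir psiW p).Good := by
  rw [psiW_eq]
  exact good_w4 (good_sigma₂_three hp)

variable {q Q T : ℂ} {n : ℕ}

theorem mk_a (a : Fin 5 → ℂ) (f g : KK) : (Pt.mk a f g).a = a := rfl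

theorem changeBA_a (p : Pt) : (changeBA p).a = p.a := mk_a p.a _ _

theorem phiW_rootX {p : Pt} (hp : p.Good) (ha : p.a = rootX q Q T n) (hq : q ≠ 0) (hT : T ≠ 0) :
    (bir phiW p).a = ![T, 1 / (q ^ (n + 1) * T), q ^ (n + 1 + 1), q ^ (n + 1) * Q, 1 / (q ^ n * Q)] := by
  obtain ⟨h1, -, -⟩ := qPIII_phiW hp
  generalize bir phiW p = p' at *
  rw [h1, ha]
  have h : q ^ n ≠ 0 := pow_ne_zero n hq
  have e1 : 1 / (q ^ n * T) / (T * (1 / (q ^ n * T)) * q ^ (n + 1)) = 1 / (q ^ (n + 1) * T) := by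
    rw [pow_succ]; field_simp
  have e2 : T * (1 / (q ^ n * T)) * q ^ (n + 1) * q ^ (n + 1) = q ^ (n + 1 + 1) := by
    rw [pow_succ _ (n + 1), pow_succ]; field_simp
  simp only [rootX, Matrix.cons_val]
  rw [e1, e2]

theorem psiW_phiW_rootX {p : Pt} (hp : p.Good) (ha : p.a = rootX q Q T n) (hq : q ≠ 0) (hT : T ≠ 0)
    (hQ : Q ≠ 0) : (bir (psiW ++ phiW) p).a = rootX q Q T (n + 1) := by
  have hp' := good_phiW hp
  have e := phiW_rootX hp ha hq hT
  rw [bir_append]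
  generalize bir phiW p = p' at *
  obtain ⟨h1, -, -⟩ := qPIV_psiW hp'
  generalize bir psiW p' = p'' at *
  rw [changeBA_a, changeBA_a] at h1
  rw [h1, e]
  have h : q ^ n ≠ 0 := pow_ne_zero n hq
  have e3 : T * (1 / (q ^ (n + 1) * T)) * q ^ (n + 1 + 1) * (q ^ (n + 1) * Q) = q ^ (n + 1 + 1) * Q := by
    rw [pow_succ _ (n + 1), pow_succ]; field_simp
  have e4 : 1 / (q ^ n * Q) / (T * (1 / (q ^ (n + 1) * T)) * q ^ (n + 1 + 1)) = 1 / (q ^ (n + 1) * Q) := by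
    rw [pow_succ _ (n + 1), pow_succ]; field_simp
  simp only [rootX, Matrix.cons_val]
  rw [e3, e4]

theorem realizable_psiW_phiW {a : Fin 5 → ℂ} (ha : IsRootVars a) (ha2 : a 2 ≠ 1) (ha3 : a 3 ≠ 1)
    (ha02 : a 0 * a 2 ≠ 1) (hq : a 0 * a 1 * a 2 * a 2 ≠ 1) : Realizable (psiW ++ phiW) a := by
  have h := good_phiW (good_genPt ha)
  have hφ := realizable_phiW ha ha2 ha02
  obtain ⟨e, -, -⟩ := qPIII_phiW (good_genPt ha)
  refine Realizable.append hφ h.root.1 (realizable_psiW h.root ?_ ?_)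
  · rw [e]; exact hq
  · rw [e]; exact ha3

theorem IsLaguerreStep.unique {Φ Ψ : KK ≃ₐ[ℂ] KK} (h : IsLaguerreStep q Q T n Φ)
    (h' : IsLaguerreStep q Q T n Ψ) (hq : q ≠ 0) (hQ : Q ≠ 0) : Φ = Ψ := by
  have hx := coord_ne_zero 0
  have hs : coord 0 * coord 1 - 1 ≠ 0 :=
    isChart_coord.bilinear_ne_zero (-1) 0 0 1 (by simp [cst_neg]; ring) (by simp)
  obtain ⟨h1, h2⟩ := h
  obtain ⟨k1, k2⟩ := h'
  have hy : Φ (coord 1) = Ψ (coord 1) := by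
    have := mul_left_cancel₀ hs (h1.trans k1.symm)
    exact mul_left_cancel₀ hx (sub_left_injective this)
  have hy0 : Ψ (coord 1) ≠ 0 := (map_ne_zero Ψ).2 (coord_ne_zero 1)
  have ht : coord 0 * Ψ (coord 1) - 1 ≠ 0 := by
    intro h
    rw [h, mul_zero] at k1
    have hx1 : coord 0 - 1 ≠ 0 := isChart_coord.sub_one_ne_zero
    refine mul_ne_zero (neg_ne_zero.2 (cst_ne_zero (mul_ne_zero (pow_ne_zero _ hq) hQ)))
      (div_ne_zero (mul_ne_zero hx1 (isChart_coord.sub_cst_ne_zero T)) hx) k1.symm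
  rw [hy] at h2
  have := mul_right_cancel₀ ht (h2.trans k2.symm)
  exact algEquiv_ext (mul_right_cancel₀ hy0 (sub_left_injective this)) hy

theorem Pt.Good.sub_one_ne_zero {p : Pt} (hp : p.Good) : p.f - 1 ≠ 0 ∧ p.g - 1 ≠ 0 := by
  constructor
  · exact hp.chart.sub_one_ne_zero
  · exact hp.chart.swap.sub_one_ne_zero

theorem isLaguerreStep_of_standard (hq : q ≠ 0) (hQ : Q ≠ 0) (hT : T ≠ 0) {Φ χ : KK ≃ₐ[ℂ] KK}
    (h0 : χ (coord 0) = fX T) (h1 : χ (coord 1) = gX q Q T n)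
    (hf : Φ (fX T) = (bir (psiW ++ phiW) ⟨rootX q Q T n, fX T, gX q Q T n⟩).f)
    (hg : Φ (gX q Q T (n + 1)) = (bir (psiW ++ phiW) ⟨rootX q Q T n, fX T, gX q Q T n⟩).g) :
    IsLaguerreStep q Q T n Φ := by
  have hx := coord_ne_zero 0
  have hs : coord 0 * coord 1 - 1 ≠ 0 :=
    isChart_coord.bilinear_ne_zero (-1) 0 0 1 (by simp [cst_neg]; ring) (by simp)
  have hch : IsChart (fX T) (gX q Q T n) := ⟨χ, h0, h1⟩
  have hp : Pt.Good ⟨rootX q Q T n, fX T, gX q Q T n⟩ := ⟨isRootVars_rootX hq hQ hT, hch⟩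
  have hg1 := hp.sub_one_ne_zero.2
  have ha₁ := phiW_rootX hp rfl hq hT
  have ha₂ := psiW_phiW_rootX hp rfl hq hT hQ
  have hp₁ := good_phiW hp
  have hIII := qPIII_phiW hp
  have hIV := qPIV_psiW hp₁
  have hp₂ := good_psiW hp₁
  rw [bir_append] at hf hg ha₂
  generalize bir phiW ⟨rootX q Q T n, fX T, gX q Q T n⟩ = p₁ at *
  generalize bir psiW p₁ = p₂ at *
  have hu : p₂.f * (p₂.g - 1) / p₂.g - 1 ≠ 0 := by
    have := (isChart_BA hp₂.root.1 hp₂.chart).sub_cst_ne_zero 1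
    rwa [cst_one] at this
  obtain ⟨-, e1, e2⟩ := hIII
  obtain ⟨-, e3, e4⟩ := hIV
  obtain ⟨a₁, f₁, g₁⟩ := p₁
  obtain ⟨a₂, f₂, g₂⟩ := p₂
  replace ha₁ : a₁ = _ := ha₁
  replace ha₂ : a₂ = _ := ha₂
  subst ha₁ ha₂
  have hN : cst (q ^ n) ≠ 0 := cst_ne_zero (pow_ne_zero n hq)
  have hq' := cst_ne_zero hq
  have hQ' := cst_ne_zero hQ
  have hT' := cst_ne_zero hT
  have ha' : cst (q ^ (n + 1)) ≠ 0 := cst_ne_zero (pow_ne_zero _ hq)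
  have hpow : cst (q ^ (n + 1)) = cst (q ^ n) * cst q := by rw [pow_succ, cst_mul]
  have hκ : ∀ m : ℕ, cst (1 / (q ^ m * Q) / T) = cst q / (cst (q ^ (m + 1)) * cst Q * cst T) := fun m => by
    have := cst_ne_zero (pow_ne_zero m hq)
    rw [pow_succ, cst_div, cst_div, cst_mul, cst_mul, cst_one]
    field_simp
  have hfx : fX T = -(cst q / (cst (q ^ (n + 1)) * cst Q * cst T)) * coord 0 * gX q Q T n := by
    rw [fX, gX, hpow, cst_mul]
    field_simp
  rw [hfx] at e1
  simp only [changeBA, rootX, Matrix.cons_val, hκ, cst_div, cst_mul, cst_one] at e1 e2 e3 e4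
  have hx' : Φ (coord 0) ≠ 0 := (map_ne_zero Φ).2 hx
  have hs' : Φ (coord 0) * Φ (coord 1) - 1 ≠ 0 := by
    rw [← map_mul, ← map_one Φ, ← map_sub]
    exact (map_ne_zero Φ).2 hs
  have hf' : f₂ = (Φ (coord 0) - cst T) / (cst T * (Φ (coord 0) * Φ (coord 1) - 1)) := by
    rw [← show Φ (fX T) = f₂ from hf, fX]
    simp only [map_div₀, map_sub, map_mul, map_cst, map_one]
  have hg' : g₂ = -(cst (q ^ (n + 1)) * cst Q) * ((Φ (coord 0) - cst T) /
      (Φ (coord 0) * (Φ (coord 0) * Φ (coord 1) - 1))) := by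
    rw [← show Φ (gX q Q T (n + 1)) = g₂ from hg, gX]
    simp only [map_div₀, map_sub, map_mul, map_cst, map_one, map_neg, cst_mul]
  have hpow2 : cst (q ^ (n + 1 + 1)) = cst (q ^ (n + 1)) * cst q := by rw [pow_succ, cst_mul]
  have d2 : cst T / (1 / (cst (q ^ n) * cst Q)) = cst (q ^ (n + 1)) * cst Q * cst T / cst q := by
    rw [hpow]; field_simp
  have d3 : 1 / (cst (q ^ n) * cst Q) / (cst T * cst (q ^ (n + 1 + 1))) =
      1 / (cst (q ^ (n + 1)) * cst (q ^ (n + 1)) * cst Q * cst T) := by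
    rw [hpow2, hpow]; field_simp
  have d4 : cst q / (cst (q ^ (n + 1 + 1)) * cst Q * cst T) = 1 / (cst (q ^ (n + 1)) * cst Q * cst T) := by
    rw [hpow2]; field_simp
  have d5 : 1 / (cst (q ^ (n + 1)) * cst T) * (1 / (cst (q ^ (n + 1)) * cst Q)) / cst T =
      1 / (cst (q ^ (n + 1)) * cst T) * (1 / (cst (q ^ (n + 1)) * cst Q * cst T)) := by
    field_simp
  rw [d2] at e2
  rw [d3] at e3
  rw [d4, d5] at e4
  obtain ⟨k1, k2⟩ := laguerre_of_standard hq' ha' hQ' hT' hx hch.swap.ne_zero hg1 hp₁.chart.ne_zero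
    hp₁.sub_one_ne_zero.1 hp₁.chart.swap.ne_zero hp₁.sub_one_ne_zero.2 hu hp₂.chart.ne_zero
    hp₂.chart.swap.ne_zero hp₂.sub_one_ne_zero.2 hx' hs' rfl e1 e2 e3 e4 hf' hg'
  have hd : q ^ (2 * n + 1) * Q = q ^ n * q ^ (n + 1) * Q := by ring
  have hd' : q ^ (2 * (n + 1)) * Q * T = (q ^ (n + 1)) ^ 2 * Q * T := by ring
  refine ⟨?_, ?_⟩
  · rw [k1, hd, gX, cst_mul, cst_mul, cst_mul]
    field_simp
  · rw [k1, k2, hd', cst_mul, cst_mul, cst_pow (q ^ (n + 1)) 2, cst_div, cst_one]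

theorem exists_laguerreStep (hq : q ≠ 0) (hq1 : ∀ m : ℕ, 0 < m → q ^ m ≠ 1) (hQ : Q ≠ 0)
    (hQ1 : ∀ m : ℕ, 0 < m → Q * q ^ m ≠ 1) (hT : T ≠ 0) (hT1 : ∀ m : ℕ, T * q ^ m ≠ 1)
    {χ χ' : KK ≃ₐ[ℂ] KK} (h0 : χ (coord 0) = fX T) (h1 : χ (coord 1) = gX q Q T n)
    (hχ : IsMarkedIso χ (confX q Q T n) (confB (rootX q Q T n)) toB)
    (h0' : χ' (coord 0) = fX T) (h1' : χ' (coord 1) = gX q Q T (n + 1))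
    (hχ' : IsMarkedIso χ' (confX q Q T (n + 1)) (confB (rootX q Q T (n + 1))) toB) :
    ∃ Φ : KK ≃ₐ[ℂ] KK, (∀ Ψ, IsLaguerreStep q Q T n Ψ ↔ Ψ = Φ) ∧
      IsMarkedIso Φ (confX q Q T n) (confX q Q T (n + 1)) (conjB (lat (psiW ++ phiW))).toLinearMap ∧
      bir (psiW ++ phiW) ⟨rootX q Q T n, fX T, gX q Q T n⟩ =
        ⟨rootX q Q T (n + 1), Φ (fX T), Φ (gX q Q T (n + 1))⟩ := by
  have hr := isRootVars_rootX (n := n) hq hQ hT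
  have hr' := isRootVars_rootX (n := n + 1) hq hQ hT
  have hreal : Realizable (psiW ++ phiW) (rootX q Q T n) := by
    refine realizable_psiW_phiW hr (hq1 _ n.succ_pos) ?_ (hT1 (n + 1)) ?_
    · change q ^ (n + 1) * Q ≠ 1
      rw [mul_comm]
      exact hQ1 _ n.succ_pos
    · have : T * (1 / (q ^ n * T)) * q ^ (n + 1) * q ^ (n + 1) = q ^ (n + 1 + 1) := by
        rw [pow_succ _ (n + 1), pow_succ]; field_simp
      change T * (1 / (q ^ n * T)) * q ^ (n + 1) * q ^ (n + 1) ≠ 1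
      rw [this]
      exact hq1 _ (Nat.succ_pos _)
  obtain ⟨Ψ, hΨ0, hΨ1, hΨ⟩ := hreal
  have ha := psiW_phiW_rootX (good_genPt hr) rfl hq hT hQ
  have hmap : bir (psiW ++ phiW) ⟨rootX q Q T n, fX T, gX q Q T n⟩ =
      (bir (psiW ++ phiW) (genPt (rootX q Q T n))).map χ := by
    rw [← bir_map, map_genPt, h0, h1]
  rw [ha] at hΨ
  have key : bir (psiW ++ phiW) ⟨rootX q Q T n, fX T, gX q Q T n⟩ =
      ⟨rootX q Q T (n + 1), (χ'.symm.trans (Ψ.trans χ)) (fX T),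
        (χ'.symm.trans (Ψ.trans χ)) (gX q Q T (n + 1))⟩ := by
    rw [hmap, ← h0', ← h1']
    simp only [AlgEquiv.trans_apply, AlgEquiv.symm_apply_apply]
    rw [hΨ0, hΨ1, ← ha]
    rfl
  have hstep : IsLaguerreStep q Q T n (χ'.symm.trans (Ψ.trans χ)) :=
    isLaguerreStep_of_standard hq hQ hT h0 h1 (congrArg Pt.f key).symm (congrArg Pt.g key).symm
  refine ⟨_, fun Ψ' => ⟨fun h => h.unique hstep hq hQ, fun h => h ▸ hstep⟩, ?_, key⟩
  generalize lat (psiW ++ phiW) = L at hΨ ⊢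
  exact (hχ.trans (markB hr.1) hΨ).trans (markB hr'.1) (hχ'.symm toX_comp_toB)

end SakaiA5

end

theorem theorem2 :
    -- The symmetry roots are simple roots of the affine root system (A₂ + A₁)⁽¹⁾,
    -- orthogonal to the surface roots.
    (Matrix.of fun i j => inter (alphaB i) (alphaB j)) =
      !![-2, 1, 1, 0, 0; 1, -2, 1, 0, 0; 1, 1, -2, 0, 0; 0, 0, 0, -2, 2; 0, 0, 0, 2, -2] ∧
    (∀ i j, inter (alphaB i) (deltaB j) = 0) ∧
    alphaB 0 + alphaB 1 + alphaB 2 = antiK ∧ alphaB 3 + alphaB 4 = antiK ∧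
    -- The translations [01-100], [000-11] and [01-1-11] in the extended affine Weyl group.
    lat phiW ∈ extWeyl ∧ lat psiW ∈ extWeyl ∧
    (∀ i, lat phiW (alphaB i) = alphaB i + (![0, 1, -1, 0, 0] i : ℤ) • antiK) ∧
    (∀ i, lat psiW (alphaB i) = alphaB i + (![0, 0, 0, -1, 1] i : ℤ) • antiK) ∧
    (∀ i, lat (psiW ++ phiW) (alphaB i) = alphaB i + (![0, 1, -1, -1, 1] i : ℤ) • antiK) ∧
    lat (psiW ++ phiW) = lat (phiW ++ psiW) ∧ lat (psiW ++ phiW) = lat lagW ∧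
    -- The composition is conjugate to neither factor, not even over ℂ.
    (∀ P : Matrix (Fin 10) (Fin 10) ℂ, IsUnit P →
      P * latMatrix (psiW ++ phiW) ≠ latMatrix phiW * P ∧
      P * latMatrix (psiW ++ phiW) ≠ latMatrix psiW * P) ∧
    -- The standard models and the standard mappings.
    (∀ i, BtoA (alphaB i) = alphaA i) ∧ (∀ i, BtoA (deltaB i) = deltaA i) ∧
    (∀ a : Fin 5 → ℂ, IsRootVars a →
      (a 0 * a 1 * a 2 ≠ 1 → IsSakaiSurfaceA5 (confB a) deltaB) ∧
      (a 0 * a 1 * a 2 ≠ 1 → a 2 ≠ 1 → IsSakaiSurfaceA5 (confA a) deltaA) ∧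
      (a 2 ≠ 1 → ∃ τ : KK ≃ₐ[ℂ] KK,
        τ (coord 0) = (changeBA (genPt a)).f ∧ τ (coord 1) = (changeBA (genPt a)).g ∧
        IsMarkedIso τ (confB a) (confA a) BtoA) ∧
      QPIII (genPt a) (bir phiW (genPt a)) ∧
      QPIV (changeBA (genPt a)) (changeBA (bir psiW (genPt a))) ∧
      bir (psiW ++ phiW) (genPt a) = bir (phiW ++ psiW) (genPt a) ∧
      bir (psiW ++ phiW) (genPt a) = bir lagW (genPt a) ∧
      (a 2 ≠ 1 → a 0 * a 2 ≠ 1 → a 3 ≠ 1 → ∀ l ∈ [phiW, psiW], ∃ Ψ : KK ≃ₐ[ℂ] KK,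
        Ψ (coord 0) = (bir l (genPt a)).f ∧ Ψ (coord 1) = (bir l (genPt a)).g ∧
        IsMarkedIso Ψ (confB a) (confB (bir l (genPt a)).a) (lat l).toLinearMap)) ∧
    -- The q-Laguerre recurrence.
    (∀ i, toB (alphaX i) = alphaB i) ∧ (∀ i, toB (deltaX i) = deltaB i) ∧
    ∃ M : PicLat ≃ₗ[ℤ] PicLat,
      (∀ i, M (alphaX i) = alphaX i + (![0, 1, -1, -1, 1] i : ℤ) • antiK) ∧
      (∀ c, toB (M c) = lat (psiW ++ phiW) (toB c)) ∧
      ∀ q Q T : ℂ, q ≠ 0 → (∀ m : ℕ, 0 < m → q ^ m ≠ 1) → Q ≠ 0 →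
        (∀ m : ℕ, 0 < m → Q * q ^ m ≠ 1) → T ≠ 0 → (∀ m : ℕ, T * q ^ m ≠ 1) →
        ∃ Φ χ : ℕ → (KK ≃ₐ[ℂ] KK), ∀ n : ℕ,
          -- the recurrence defines a birational map
          (∀ Ψ : KK ≃ₐ[ℂ] KK, IsLaguerreStep q Q T n Ψ ↔ Ψ = Φ n) ∧
          -- it is an isomorphism between Sakai surfaces, inducing the translation
          IsSakaiSurfaceA5 (confX q Q T n) deltaX ∧
          IsMarkedIso (Φ n) (confX q Q T n) (confX q Q T (n + 1)) M.toLinearMap ∧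
          -- the change of coordinates to the (b)-model
          IsRootVars (rootX q Q T n) ∧
          χ n (coord 0) = fX T ∧ χ n (coord 1) = gX q Q T n ∧
          IsMarkedIso (χ n) (confX q Q T n) (confB (rootX q Q T n)) toB ∧
          -- it transforms the recurrence into the composition of the standard mappings
          bir (psiW ++ phiW) ⟨rootX q Q T n, fX T, gX q Q T n⟩ =
            ⟨rootX q Q T (n + 1), Φ n (fX T), Φ n (gX q Q T (n + 1))⟩ := by
  refine ⟨by decide +kernel, by decide +kernel, by decide +kernel, by decide +kernel,
    latGen_mem _, latGen_mem _, lat_phiW_alphaB, lat_psiW_alphaB, lat_psiW_phiW_alphaB, lat_psiW_phiW,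
    lat_lagW, fun P hP => not_conjugate hP, by decide +kernel, by decide +kernel, fun a ha => ?_,
    toB_alphaX, toB_deltaX, conjB (lat (psiW ++ phiW)), conjB_alphaX, toB_conjB _, ?_⟩
  · refine ⟨isSakaiSurfaceA5_confB ha, isSakaiSurfaceA5_confA ha, iso_BA ha.1, qPIII_phiW (good_genPt ha),
      qPIV_psiW (good_genPt ha), (phiW_psiW (good_genPt ha)).symm, (lagW_eq (good_genPt ha)).symm, ?_⟩
    intro ha2 ha02 ha3 l hl
    simp only [List.mem_cons, List.not_mem_nil, or_false] at hl
    rcases hl with rfl | rfl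
    · exact realizable_phiW ha ha2 ha02
    · exact realizable_psiW ha ha2 ha3
  · intro q Q T hq hq1 hQ hQ1 hT hT1
    have hT1' : T ≠ 1 := by simpa using hT1 0
    choose χ h0 h1 hχ using fun n => iso_X (n := n) hq hQ hT hT1'
    choose Φ hΦ using fun n => exists_laguerreStep hq hq1 hQ hQ1 hT hT1 (h0 n) (h1 n) (hχ n)
      (h0 (n + 1)) (h1 (n + 1)) (hχ (n + 1))
    refine ⟨Φ, χ, fun n => ⟨(hΦ n).1, ?_, (hΦ n).2.1, isRootVars_rootX hq hQ hT, h0 n, h1 n, hχ n,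
      (hΦ n).2.2⟩⟩
    exact isSakaiSurfaceA5_confX hq hQ hT hT1' (by simpa using hq1 1 one_pos)
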